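/- **Setting.** Letters are positive integers with fixed ranks; trees are rooted, ordered, and every node labelled $a$ has exactly $\mathrm{rank}(a)$ children; $|T|$ is the number of nodes of $T$. A node is *unary* if it has exactly one child. For a unary letter $a$, an $a$-maximal chain is a maximal sequence of unary nodes labelled $a$, each the child of the previous one. A 2-chain $ab$ is a unary node labelled $a$ whose child is a unary node labelled $b$. The algorithm TtoG keeps a current tree $T$ (initially the input tree) and a set of grammar productions (initially empty). While $|T|>1$ it performs a *phase*, consisting of three steps, in which all new letters are fresh and pairwise different: 1. *Chain compression.* In parallel for all unary letters $a$ and all $\ell>1$, every $a$-maximal chain with $\ell$ nodes is replaced by one node labelled $a_\ell$. If $\ell_1<\dots<\ell_k$ are the lengths $>1$ of $a$-maximal chains and $\ell_0=0$, the productions are $a_{2^j}\to a_{2^{j-1}}a_{2^{j-1}}$ for $1\le j\le\lfloor\log_2\max_i(\ell_i-\ell_{i-1})\rfloor$, where $a_{2^0}=a$ (auxiliary letters for the powers of two); for each $i$ a production that writes an auxiliary letter $d_i$ as the chain of the letters $a_{2^j}$ given by the binary expansion of $\ell_i-\ell_{i-1}$; and $a_{\ell_i}\to d_i\,a_{\ell_{i-1}}$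 (just $a_{\ell_1}\to d_1$ for $i=1$). 2. *Unary pair compression.* The set $F_1$ of unary letters of the current tree is partitioned into $F^{\rm up}\uplus F^{\rm down}$ greedily: the letters are considered one after the other, in some order, and $a$ is put into $F^{\rm up}$ if the number of 2-chains formed by $a$ and a letter already in $F^{\rm down}$ (in either order) is at least the number of those formed by $a$ and a letter already in $F^{\rm up}$, and into $F^{\rm down}$ otherwise; finally the two sets are switched if there are more 2-chains in $F^{\rm down}F^{\rm up}$ than in $F^{\rm up}F^{\rm down}$. Then every 2-chain $ab$ with $a\in F^{\rm up}$, $b\in F^{\rm down}$ is replaced by one node labelled with a new letter $c=c_{ab}$, with the production $c\to ab$. 3. *Leaf compression.* For every node with at least one leaf child, if $f$ is its label and its leaf children are at positions $i_1<\dots<i_\ell$ and labelled $a_1,\dots,a_\ell$, these leaves are removed and the node is relabelled by a new letter $f'$ that depends only on $(f,i_1,a_1,\dots,i_\ell,a_\ell)$; the production is $f'\to f(t_1,\dots,t_{\mathrm{rank}(f)})$ with $t_{i_j}=a_j$ and distinct parameters, from left to right, at the other positions. When $|T|=1$ the algorithm returns the set of productions, with the label of the remaining node as start symbol. The computational model is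 a word RAM with a fixed program, registers and finitely many arrays of cells, which are $0$ initially except for the input; an elementary operation (reading or writing a cell, $+$, truncated $-$, $\times$, integer division, remainder, comparison) on words costs one step, and every value that occurs must fit into a word. For a tree of size $n$ the words have $d(\lfloor\log_2 n\rfloor+1)$ bits, with a constant $d$. Trees are stored in pointer representation (label, parent, first child, next sibling of each node; the nodes of the input tree have addresses $1,\dots,n$, in any order). A set of productions is stored as a list of its members in any order, each written down by its non-parameter nodes (with positions in the case of leaf compression). **Theorem.** TtoG runs in linear time. In detail: (a) In each phase the current tree shrinks by a constant factor: if $|T|>1$ and a phase of TtoG (with any greedy order and any fresh letters) transforms $T$ into $T'$, then $|T'|\le\frac34|T|$. (b) There is a word RAM program for TtoG of the form "preprocessing; while $|T|>1$ do (chain compression; unary pair compression; leaf compression)" such that for every $c\in\mathbb N$ there are constants $K,d$ with the following property. On every input tree of size $n$ with labels in $\{1,\dots,n^c\}$, on words of $d(\lfloor\log_2 n\rfloor+1)$ bits, the preprocessing takes at most $Kn$ steps, each phase that starts with the current tree $T$ takes at most $K|T|$ steps, and the whole run stops after at most $Kn$ steps. After the preprocessing and after each of the three compressions in each phase, the memory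 stores the current tree and the current set of productions of a run of TtoG on the input tree; at the end the tree has size $1$ and the memory stores the grammar returned by that run. -/

import Mathlib

namespace TtoG

/-! ### Trees -/

/-- Rooted ordered trees with node labels in `α`. -/
inductive RTree (α : Type) : Type where
  | node (label : α) (children : List (RTree α)) : RTree α

namespace RTree

mutual
/-- The labels of all nodes, in preorder. -/
def labels {α : Type} : RTree α → List α
  | node a ts => a :: labelsL ts
/-- The labels of all nodes of a list of trees. -/
def labelsL {α : Type} : List (RTree α) → List α
  | [] => []
  | t :: ts => labels t ++ labelsL ts
end

/-- The size of a tree is its number of nodes. -/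
def size {α : Type} (t : RTree α) : ℕ := t.labels.length

mutual
/-- Relabel all nodes by `f`. -/
def map {α β : Type} (f : α → β) : RTree α → RTree β
  | node a ts => node (f a) (mapL f ts)
/-- Relabel all nodes of a list of trees by `f`. -/
def mapL {α β : Type} (f : α → β) : List (RTree α) → List (RTree β)
  | [] => []
  | t :: ts => map f t :: mapL f ts
end

mutual
/-- Every node labelled `a` has exactly `rk a` children. -/
def WellRanked (rk : ℕ → ℕ) : RTree ℕ → Prop
  | node a ts => ts.length = rk a ∧ WellRankedL rk ts
/-- `WellRanked` for all trees of a list. -/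
def WellRankedL (rk : ℕ → ℕ) : List (RTree ℕ) → Prop
  | [] => True
  | t :: ts => WellRanked rk t ∧ WellRankedL rk ts
end

end RTree

open RTree

/-! ### Grammars

A letter is a natural number.  A right-hand side is either a chain pattern or a pattern of depth
one, and is written down by its non-parameter nodes. -/

/-- Right-hand sides of productions.
* `word [b₁, …, b_k]` is the chain pattern `b₁(b₂(⋯ b_k(y)⋯))`;
* `absorb f [(i₁, a₁), …, (i_ℓ, a_ℓ)]` is `f(t₁, …, t_m)` with `m` the rank of `f`, where `t_{i_j}`
  is the constant `a_j` and the other `t_i` are the parameters, from left to right. -/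
inductive Rhs : Type where
  | word (w : List ℕ) : Rhs
  | absorb (f : ℕ) (abs : List (ℕ × ℕ)) : Rhs

/-- A production `lhs → rhs`. -/
structure Production : Type where
  lhs : ℕ
  rhs : Rhs

/-- The letters occurring in a right-hand side. -/
def Rhs.letters : Rhs → List ℕ
  | word w => w
  | absorb f abs => f :: abs.map Prod.snd

/-- What the compressor keeps: the current tree and the productions constructed so far. -/
structure Config : Type where
  tree : RTree ℕ
  prods : Set Production

/-- The letters that are not fresh any more. -/
def Config.used (X : Config) : Set ℕ :=
  {a | a ∈ X.tree.labels ∨ ∃ p ∈ X.prods, a = p.lhs ∨ a ∈ p.rhs.letters}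

/-- What a letter introduced by a compression step stands for:
* `pow a j` is the auxiliary letter `a_{2^j}` representing the chain pattern `a^(2^j)`;
* `diff a ℓ` is the auxiliary letter representing `a^(ℓ - ℓ')`, where `ℓ'` is the length preceding
  `ℓ` in the sorted list of the lengths of `a`-maximal chains (and `0` if `ℓ` is the first one);
* `chain a ℓ` is the letter `a_ℓ` that replaces the `a`-maximal chains of length `ℓ`;
* `pair a b` replaces the chain pattern `ab`;
* `leaf f abs` replaces `f` together with the constants at the positions listed in `abs`. -/
inductive Desc : Type where
  | pow (a j : ℕ) : Desc
  | diff (a l : ℕ) : Desc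
  | chain (a l : ℕ) : Desc
  | pair (a b : ℕ) : Desc
  | leaf (f : ℕ) (abs : List (ℕ × ℕ)) : Desc

/-- The naming `nm` gives pairwise different fresh letters to the left-hand sides in `D`. -/
def Fresh (X : Config) (nm : Desc → ℕ) (D : Set (Desc × Rhs)) : Prop :=
  Set.InjOn nm (Prod.fst '' D) ∧ ∀ p ∈ D, nm p.1 ∉ X.used

/-- Add the productions `nm d → r`, for `(d, r) ∈ D`. -/
def addProds (G : Set Production) (nm : Desc → ℕ) (D : Set (Desc × Rhs)) : Set Production :=
  G ∪ (fun p : Desc × Rhs => (⟨nm p.1, p.2⟩ : Production)) '' D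

/-! ### Chain compression -/

/-- The number of nodes of the longest chain that starts at the root and has all nodes labelled by
the unary letter `a` (`0` if the root is not a unary node labelled `a`). -/
def topRun (a : ℕ) : RTree ℕ → ℕ
  | node b [u] => if b = a then topRun a u + 1 else 0
  | node _ _ => 0

mutual
/-- The list of all pairs `(a, ℓ)`, one for each `a`-maximal chain with `ℓ` nodes.  The argument
`prev` is the label of the parent of the root if that parent is unary. -/
def chainOcc : Option ℕ → RTree ℕ → List (ℕ × ℕ)
  | prev, node a [u] =>
      if prev = some a then chainOcc (some a) u
      else (a, topRun a u + 1) :: chainOcc (some a) u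
  | _, node _ ts => chainOccL ts
/-- `chainOcc` for a list of trees below a node that is not unary. -/
def chainOccL : List (RTree ℕ) → List (ℕ × ℕ)
  | [] => []
  | t :: ts => chainOcc none t ++ chainOccL ts
end

mutual
/-- Replace every `a`-maximal chain with `ℓ > 1` nodes by one node labelled `nm (chain a ℓ)`. -/
def chainTree (nm : Desc → ℕ) : RTree ℕ → RTree ℕ
  | node a [u] =>
      if topRun a u = 0 then node a [chainTree nm u]
      else
        match chainTree nm u with
        | node _ us => node (nm (.chain a (topRun a u + 1))) us
  | node a ts => node a (chainTreeL nm ts)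
/-- `chainTree` for a list of trees. -/
def chainTreeL (nm : Desc → ℕ) : List (RTree ℕ) → List (RTree ℕ)
  | [] => []
  | t :: ts => chainTree nm t :: chainTreeL nm ts
end

/-- The increasing list `ℓ₁ < ⋯ < ℓ_k` of the lengths `> 1` of `a`-maximal chains in `t`. -/
def chainLengths (t : RTree ℕ) (a : ℕ) : List ℕ :=
  (((chainOcc none t).filter (fun p => p.1 = a ∧ 2 ≤ p.2)).map Prod.snd).toFinset.sort (· ≤ ·)

/-- The maximum of the differences of consecutive elements of `prev, ℓ₁, …, ℓ_k`. -/
def maxDiff : ℕ → List ℕ → ℕ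
  | _, [] => 0
  | prev, l :: ls => max (l - prev) (maxDiff l ls)

/-- The letter that represents `a^(2^j)`; for `j = 0` this is `a` itself. -/
def powLetter (nm : Desc → ℕ) (a : ℕ) : ℕ → ℕ
  | 0 => a
  | j + 1 => nm (.pow a (j + 1))

/-- The productions for the powers: `a_{2^j} → a_{2^(j-1)} a_{2^(j-1)}` for
`1 ≤ j ≤ ⌊log₂ (max difference)⌋`. -/
def powProds (nm : Desc → ℕ) (a : ℕ) (ls : List ℕ) : List (Desc × Rhs) :=
  (List.range (Nat.log 2 (maxDiff 0 ls))).map fun j =>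
    (.pow a (j + 1), .word [powLetter nm a j, powLetter nm a j])

/-- For each length `ℓ`, preceded by the length `prev`: the letter for the difference `ℓ - prev` is
written as a chain of power letters according to the binary expansion of `ℓ - prev`, and
`a_ℓ → a_{ℓ - prev} a_prev`, where `a_prev` is omitted if `prev = 0`. -/
def lengthProds (nm : Desc → ℕ) (a : ℕ) : ℕ → List ℕ → List (Desc × Rhs)
  | _, [] => []
  | prev, l :: ls =>
      (.diff a l, .word ((l - prev).bitIndices.map (powLetter nm a))) ::
      (.chain a l,
        .word (nm (.diff a l) :: (if prev = 0 then [] else [nm (.chain a prev)]))) ::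
      lengthProds nm a l ls

/-- All productions of a chain compression of `t`. -/
def chainProds (nm : Desc → ℕ) (t : RTree ℕ) : Set (Desc × Rhs) :=
  {p | ∃ a, p ∈ powProds nm a (chainLengths t a) ∨ p ∈ lengthProds nm a 0 (chainLengths t a)}

/-- Chain compression, for all unary letters of the current tree in parallel. -/
def ChainComp (X Y : Config) : Prop :=
  ∃ nm : Desc → ℕ,
    Fresh X nm (chainProds nm X.tree) ∧
    Y.tree = chainTree nm X.tree ∧
    Y.prods = addProds X.prods nm (chainProds nm X.tree)

/-! ### Unary pair compression -/

mutual
/-- The labels of the unary nodes. -/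
def unaryLabels : RTree ℕ → List ℕ
  | node a [u] => a :: unaryLabels u
  | node _ ts => unaryLabelsL ts
/-- `unaryLabels` for a list of trees. -/
def unaryLabelsL : List (RTree ℕ) → List ℕ
  | [] => []
  | t :: ts => unaryLabels t ++ unaryLabelsL ts
end

mutual
/-- The list of the label pairs of all 2-chains: one entry `(a, b)` for each unary node labelled
`a` whose child is a unary node labelled `b`. -/
def pairOcc : RTree ℕ → List (ℕ × ℕ)
  | node a [node b [u]] => (a, b) :: pairOcc (node b [u])
  | node _ ts => pairOccL ts
/-- `pairOcc` for a list of trees. -/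
def pairOccL : List (RTree ℕ) → List (ℕ × ℕ)
  | [] => []
  | t :: ts => pairOcc t ++ pairOccL ts
end

/-- The number of occurrences of patterns from `aS ∪ Sa` in the list `occ` of 2-chains. -/
def touching (occ : List (ℕ × ℕ)) (a : ℕ) (S : List ℕ) : ℕ :=
  occ.countP fun p => (p.1 = a ∧ p.2 ∈ S) ∨ (p.2 = a ∧ p.1 ∈ S)

/-- The number of occurrences of patterns from `SR` in the list `occ` of 2-chains. -/
def covered (occ : List (ℕ × ℕ)) (S R : List ℕ) : ℕ :=
  occ.countP fun p => p.1 ∈ S ∧ p.2 ∈ R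

/-- The main loop of the greedy choice: the letters of the list are put one after the other into
`up` (the first component) or `down` (the second one). -/
def greedyLoop (occ : List (ℕ × ℕ)) : List ℕ → List ℕ × List ℕ → List ℕ × List ℕ
  | [], P => P
  | a :: as, P =>
      if touching occ a P.1 ≤ touching occ a P.2 then greedyLoop occ as (a :: P.1, P.2)
      else greedyLoop occ as (P.1, a :: P.2)

/-- The greedy partition `(up, down)` of the letters in `order`, considered in that order. -/
def greedy (occ : List (ℕ × ℕ)) (order : List ℕ) : List ℕ × List ℕ :=
  let P := greedyLoop occ order ([], [])
  if covered occ P.1 P.2 < covered occ P.2 P.1 then (P.2, P.1) else P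

/-- `up` and `down` partition the unary letters of `t` as the greedy algorithm does, for some order
in which it lists these letters. -/
def GreedyPartition (t : RTree ℕ) (up down : List ℕ) : Prop :=
  ∃ order : List ℕ, order.Nodup ∧ (∀ a, a ∈ order ↔ a ∈ unaryLabels t) ∧
    (up, down) = greedy (pairOcc t) order

mutual
/-- Replace every 2-chain `ab` with `a ∈ up`, `b ∈ down` by one node labelled `nm (pair a b)`. -/
def pairTree (nm : Desc → ℕ) (up down : List ℕ) : RTree ℕ → RTree ℕ
  | node a [node b [u]] =>
      if a ∈ up ∧ b ∈ down then node (nm (.pair a b)) [pairTree nm up down u]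
      else node a [pairTree nm up down (node b [u])]
  | node a ts => node a (pairTreeL nm up down ts)
/-- `pairTree` for a list of trees. -/
def pairTreeL (nm : Desc → ℕ) (up down : List ℕ) : List (RTree ℕ) → List (RTree ℕ)
  | [] => []
  | t :: ts => pairTree nm up down t :: pairTreeL nm up down ts
end

/-- The productions `c → ab` of a unary pair compression of `t`. -/
def pairProds (up down : List ℕ) (t : RTree ℕ) : Set (Desc × Rhs) :=
  {p | ∃ a ∈ up, ∃ b ∈ down, (a, b) ∈ pairOcc t ∧ p = (.pair a b, .word [a, b])}

/-- Unary pair compression for a greedy partition of the unary letters of the current tree. -/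
def PairComp (X Y : Config) : Prop :=
  ∃ (up down : List ℕ) (nm : Desc → ℕ),
    GreedyPartition X.tree up down ∧
    Fresh X nm (pairProds up down X.tree) ∧
    Y.tree = pairTree nm up down X.tree ∧
    Y.prods = addProds X.prods nm (pairProds up down X.tree)

/-! ### Leaf compression -/

/-- The positions (starting with `i`) and labels of those trees of a list that are leaves. -/
def leafList : ℕ → List (RTree ℕ) → List (ℕ × ℕ)
  | _, [] => []
  | i, node a [] :: ts => (i, a) :: leafList (i + 1) ts
  | i, node _ (_ :: _) :: ts => leafList (i + 1) ts

mutual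
/-- The list of all `(f, [(i₁, a₁), …, (i_ℓ, a_ℓ)])`, one for each node with a leaf child: its
label, and the positions and labels of all its leaf children. -/
def leafOcc : RTree ℕ → List (ℕ × List (ℕ × ℕ))
  | node f ts =>
      (if leafList 1 ts = [] then [] else [(f, leafList 1 ts)]) ++ leafOccL ts
/-- `leafOcc` for a list of trees. -/
def leafOccL : List (RTree ℕ) → List (ℕ × List (ℕ × ℕ))
  | [] => []
  | t :: ts => leafOcc t ++ leafOccL ts
end

mutual
/-- Remove the leaf children of every node that has some, and relabel that node. -/
def leafTree (nm : Desc → ℕ) : RTree ℕ → RTree ℕ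
  | node f ts =>
      node (if leafList 1 ts = [] then f else nm (.leaf f (leafList 1 ts))) (leafTreeL nm ts)
/-- The list of trees without its leaves, with `leafTree` applied to the others. -/
def leafTreeL (nm : Desc → ℕ) : List (RTree ℕ) → List (RTree ℕ)
  | [] => []
  | node _ [] :: ts => leafTreeL nm ts
  | node f (u :: us) :: ts => leafTree nm (node f (u :: us)) :: leafTreeL nm ts
end

/-- The productions of a leaf compression of `t`. -/
def leafProds (t : RTree ℕ) : Set (Desc × Rhs) :=
  {p | ∃ q ∈ leafOcc t, p = (.leaf q.1 q.2, .absorb q.1 q.2)}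

/-- Leaf compression. -/
def LeafComp (X Y : Config) : Prop :=
  ∃ nm : Desc → ℕ,
    Fresh X nm (leafProds X.tree) ∧
    Y.tree = leafTree nm X.tree ∧
    Y.prods = addProds X.prods nm (leafProds X.tree)

/-- One phase of TtoG. -/
def Phase (X Y : Config) : Prop :=
  ∃ X' X'' : Config, ChainComp X X' ∧ PairComp X' X'' ∧ LeafComp X'' Y

/-! ### A word RAM

A program has registers and arrays, numbered by `ℕ`, all of whose cells contain words of `w` bits.
Every operation costs one step; a computation in which some value does not fit into a word is stuck,
that is, it has no result. -/

/-- The contents of the registers and of the arrays. -/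
structure State : Type where
  reg : ℕ → ℕ
  arr : ℕ → ℕ → ℕ

/-- Arithmetic operations and comparisons. -/
inductive Op : Type where
  | add | sub | mul | div | mod | lt | eq

/-- Subtraction is truncated at `0`; a comparison returns `1` (true) or `0` (false). -/
def Op.eval : Op → ℕ → ℕ → ℕ
  | add, x, y => x + y
  | sub, x, y => x - y
  | mul, x, y => x * y
  | div, x, y => x / y
  | mod, x, y => x % y
  | lt, x, y => if x < y then 1 else 0
  | eq, x, y => if x = y then 1 else 0

/-- Expressions: constants, registers, array cells `A[e]`, and operations. -/
inductive Expr : Type where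
  | const (k : ℕ) : Expr
  | reg (x : ℕ) : Expr
  | read (A : ℕ) (e : Expr) : Expr
  | op (o : Op) (e₁ e₂ : Expr) : Expr

/-- The value of an expression. -/
def Expr.eval (s : State) : Expr → ℕ
  | const k => k
  | reg x => s.reg x
  | read A e => s.arr A (e.eval s)
  | op o e₁ e₂ => o.eval (e₁.eval s) (e₂.eval s)

/-- All values that occur in the evaluation of an expression fit into words of `w` bits. -/
def Expr.Fits (w : ℕ) (s : State) : Expr → Prop
  | const k => k < 2 ^ w
  | reg x => s.reg x < 2 ^ w
  | read A e => e.Fits w s ∧ s.arr A (e.eval s) < 2 ^ w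
  | op o e₁ e₂ => e₁.Fits w s ∧ e₂.Fits w s ∧ o.eval (e₁.eval s) (e₂.eval s) < 2 ^ w

/-- The number of steps needed to evaluate an expression. -/
def Expr.cost : Expr → ℕ
  | const _ => 1
  | reg _ => 1
  | read _ e => e.cost + 1
  | op _ e₁ e₂ => e₁.cost + e₂.cost + 1

/-- Programs. A condition is true if its value is not `0`. -/
inductive Cmd : Type where
  | skip : Cmd
  | set (x : ℕ) (e : Expr) : Cmd
  | write (A : ℕ) (i e : Expr) : Cmd
  | seq (p q : Cmd) : Cmd
  | ite (e : Expr) (p q : Cmd) : Cmd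
  | while (e : Expr) (p : Cmd) : Cmd

/-- `Exec w p s k s'`: on words of `w` bits, the program `p` started in the state `s` stops after
`k` steps in the state `s'`. -/
inductive Exec (w : ℕ) : Cmd → State → ℕ → State → Prop where
  | skip (s : State) : Exec w .skip s 1 s
  | set (x : ℕ) (e : Expr) (s : State) (he : e.Fits w s) :
      Exec w (.set x e) s (e.cost + 1) ⟨Function.update s.reg x (e.eval s), s.arr⟩
  | write (A : ℕ) (i e : Expr) (s : State) (hi : i.Fits w s) (he : e.Fits w s) :
      Exec w (.write A i e) s (i.cost + e.cost + 1)
        ⟨s.reg, Function.update s.arr A (Function.update (s.arr A) (i.eval s) (e.eval s))⟩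
  | seq {p q : Cmd} {s s' s'' : State} {k l : ℕ} :
      Exec w p s k s' → Exec w q s' l s'' → Exec w (.seq p q) s (k + l) s''
  | iteTrue {e : Expr} {p q : Cmd} {s s' : State} {k : ℕ} :
      e.Fits w s → e.eval s ≠ 0 → Exec w p s k s' → Exec w (.ite e p q) s (e.cost + 1 + k) s'
  | iteFalse {e : Expr} {p q : Cmd} {s s' : State} {k : ℕ} :
      e.Fits w s → e.eval s = 0 → Exec w q s k s' → Exec w (.ite e p q) s (e.cost + 1 + k) s'
  | whileTrue {e : Expr} {p : Cmd} {s s' s'' : State} {k l : ℕ} :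
      e.Fits w s → e.eval s ≠ 0 → Exec w p s k s' → Exec w (.while e p) s' l s'' →
      Exec w (.while e p) s (e.cost + 1 + k + l) s''
  | whileFalse {e : Expr} {p : Cmd} {s : State} :
      e.Fits w s → e.eval s = 0 → Exec w (.while e p) s (e.cost + 1) s

/-! ### How trees and grammars are stored -/

/-- Array of the node labels. -/
def LABEL : ℕ := 0
/-- Array of the pointers to the parent (`0` at the root). -/
def PARENT : ℕ := 1
/-- Array of the pointers to the first child (`0` at a leaf). -/
def CHILD : ℕ := 2
/-- Array of the pointers to the next sibling (`0` at a last child and at the root). -/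
def NEXT : ℕ := 3
/-- Array of the productions. -/
def PRODS : ℕ := 4
/-- Register with the pointer to the root of the current tree. -/
def ROOT : ℕ := 0
/-- Register with the size of the current tree. -/
def SIZE : ℕ := 1
/-- Register with the number of used cells of the array `PRODS`. -/
def LEN : ℕ := 2

mutual
/-- The pointers in memory are those of the tree `t` of node addresses, whose root has the parent
`par`. -/
def Linked (s : State) (par : ℕ) : RTree ℕ → Prop
  | node v us => s.arr PARENT v = par ∧ LinkedL s v (s.arr CHILD v) us
/-- The sibling list that starts at address `p` consists of the roots of the given trees of node
addresses; their parent is `par`. -/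
def LinkedL (s : State) (par : ℕ) : ℕ → List (RTree ℕ) → Prop
  | p, [] => p = 0
  | p, node v us :: ts =>
      p = v ∧ Linked s par (node v us) ∧ LinkedL s par (s.arr NEXT v) ts
end

/-- The tree `T` is stored in pointer representation, and `t` is the tree of the addresses of its
nodes: these are positive and pairwise different. -/
def StoresAt (s : State) (T t : RTree ℕ) : Prop :=
  t.labels.Nodup ∧ (∀ v ∈ t.labels, 0 < v) ∧ LinkedL s 0 (s.reg ROOT) [t] ∧
    t.map (s.arr LABEL) = T

/-- A production as a list of numbers. -/
def Production.encode : Production → List ℕ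
  | ⟨a, .word w⟩ => a :: 0 :: w.length :: w
  | ⟨a, .absorb f abs⟩ => a :: 1 :: f :: abs.length :: abs.flatMap fun q => [q.1, q.2]

/-- The set `G` of productions is stored, each one once, one after the other in any order. -/
def StoresProds (s : State) (G : Set Production) : Prop :=
  ∃ L : List Production, L.Nodup ∧ (∀ p, p ∈ L ↔ p ∈ G) ∧
    s.reg LEN = (L.flatMap Production.encode).length ∧
    ∀ (i : ℕ) (h : i < (L.flatMap Production.encode).length),
      s.arr PRODS i = (L.flatMap Production.encode)[i]

/-- The current tree, its size and the current set of productions are stored. -/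
def Stores (s : State) (X : Config) : Prop :=
  (∃ t, StoresAt s X.tree t) ∧ s.reg SIZE = X.tree.size ∧ StoresProds s X.prods

/-- `s` is an initial state for the input tree `T`: the tree is stored with node addresses in
`{1, …, |T|}`, and all registers and cells that are not used for this contain `0`. -/
def IsInput (s : State) (T : RTree ℕ) : Prop :=
  ∃ t, StoresAt s T t ∧ (∀ v ∈ t.labels, v ≤ T.size) ∧
    (∀ x, x ≠ ROOT → s.reg x = 0) ∧
    ∀ A v, (A ∈ [LABEL, PARENT, CHILD, NEXT] → v ∉ t.labels) → s.arr A v = 0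

/-- The program TtoG, composed of a preprocessing and of programs for the three compressions:
`init; while |T| > 1 do (chainP; pairP; leafP)`. -/
def main (init chainP pairP leafP : Cmd) : Cmd :=
  .seq init (.while (.op .lt (.const 1) (.reg SIZE)) (.seq chainP (.seq pairP leafP)))

end TtoG

-- Shrinking. Let `P` be the number of 2-chains and `L` the number of leaves of the tree `T₁` after
-- chain compression. A count by induction (`size_le_pairs_add_leaves`) gives `|T₁| ≤ P + 4L`:
-- branching nodes are paid for by leaves, and a unary node is paid for by the 2-chain that it forms
-- with a unary child, or by a unit of surplus if its child is not unary. Chain compression leaves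
-- no 2-chain `aa` (`ChainComp.pairOcc_ne`), so each greedy decision cuts at least half of the
-- 2-chains that it settles (`greedyLoop_half`), and the final choice of the direction keeps at
-- least half of the cut ones. Replaced 2-chains do not overlap, hence pair compression removes at
-- least `P/4` nodes, and it changes no leaf (`pairTree_size_leaves`). Leaf compression then removes
-- all `L` leaves. Together at least `(P + 4L)/4 ≥ |T₁|/4` nodes disappear (`Phase.size`).
--
-- Linear time. Preprocessing and all compressions keep the node addresses equal to `1, …, N` in
-- preorder (`Canon`), so a loop over addresses meets parents before children or, backwards,
-- children before parents. Each compression is a relabelling followed by a contraction of marked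
-- nodes (`chainTree_eq`, `pairTree_eq`, `leafTree_eq`). A contraction computes new parent pointers
-- in one pass; with preorder addresses these determine all other pointers (`linkedL_of_first`).
--
-- Letters are found through one directly addressed table `TAB`, whose keys are polynomially bounded
-- numbers encoding tuples. Letters are handed out from a counter `FR`, and a compression stores its
-- initial value in `ST`. An entry below `ST` counts as absent, so the table is never cleared
-- (`Dict`).
--
-- Sorting is avoided in each compression. In chain compression, run lengths are computed bottom-up;
-- a run of length `r > 1` sits on an already visited run of length `r - 1` of the same letter.
-- Hence the longest run known for a letter increases by one at a time, and the lengths of a letter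
-- are met in increasing order. A power of two is emitted when the gap to the last occurring length
-- reaches it (`maxExp_succ`), and writing the binary expansions is paid for by the gaps, which sum
-- up to the longest run (`chainStep_spec`). In pair compression, the occurrences of each letter are
-- linked into a list, which is walked only once, when the letter is put on a side
-- (`greedyStep_spec`). In leaf compression, the variable-length list of leaf children is read
-- through a trie stored in `TAB`; its states encode the label and the list read so far (`wk_inj`).
--
-- Each phase costs at most 5000 steps per node and the sizes decrease geometrically, so the total
-- is linear (`loop_exec`).
--
-- Word length. Running times are first proved on unbounded words (`Run`, `Tri`). All programs are
-- slow: a stored value exceeds the values already in memory by at most 8. After linearly many steps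
-- the memory is therefore still polynomially bounded, and expressions of degree at most 10 evaluate
-- to polynomially bounded numbers, which fit into `d(⌊log₂ n⌋ + 1)` bits (`Run.exec`,
-- `word_bound`).

namespace TtoG

/-! ### Running programs on unbounded words -/

/-- Set a register. -/
def State.setR (s : State) (x v : ℕ) : State := ⟨Function.update s.reg x v, s.arr⟩

/-- Set an array cell. -/
def State.setA (s : State) (A i v : ℕ) : State :=
  ⟨s.reg, Function.update s.arr A (Function.update (s.arr A) i v)⟩

@[simp] theorem State.setR_reg (s : State) (x v y : ℕ) :
    (s.setR x v).reg y = if y = x then v else s.reg y := by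
  simp [State.setR, Function.update_apply]

@[simp] theorem State.setR_arr (s : State) (x v : ℕ) : (s.setR x v).arr = s.arr := rfl

@[simp] theorem State.setA_reg (s : State) (A i v : ℕ) : (s.setA A i v).reg = s.reg := rfl

@[simp] theorem State.setA_arr (s : State) (A i v B j : ℕ) :
    (s.setA A i v).arr B j = if B = A ∧ j = i then v else s.arr B j := by
  by_cases h : B = A
  · subst h; simp [State.setA, Function.update_apply]
  · simp [State.setA, h]

/-- `Run p s k s'`: the program `p`, started in `s`, stops after `k` steps in `s'`, on words that
are long enough. -/
inductive Run : Cmd → State → ℕ → State → Prop where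
  | skip (s : State) : Run .skip s 1 s
  | set (x : ℕ) (e : Expr) (s : State) : Run (.set x e) s (e.cost + 1) (s.setR x (e.eval s))
  | write (A : ℕ) (i e : Expr) (s : State) :
      Run (.write A i e) s (i.cost + e.cost + 1) (s.setA A (i.eval s) (e.eval s))
  | seq {p q : Cmd} {s s' s'' : State} {k l : ℕ} :
      Run p s k s' → Run q s' l s'' → Run (.seq p q) s (k + l) s''
  | iteTrue {e : Expr} {p q : Cmd} {s s' : State} {k : ℕ} :
      e.eval s ≠ 0 → Run p s k s' → Run (.ite e p q) s (e.cost + 1 + k) s'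
  | iteFalse {e : Expr} {p q : Cmd} {s s' : State} {k : ℕ} :
      e.eval s = 0 → Run q s k s' → Run (.ite e p q) s (e.cost + 1 + k) s'
  | whileTrue {e : Expr} {p : Cmd} {s s' s'' : State} {k l : ℕ} :
      e.eval s ≠ 0 → Run p s k s' → Run (.while e p) s' l s'' →
      Run (.while e p) s (e.cost + 1 + k + l) s''
  | whileFalse {e : Expr} {p : Cmd} {s : State} :
      e.eval s = 0 → Run (.while e p) s (e.cost + 1) s

/-! ### Programs whose values grow slowly -/

/-- Upper bound for the constants of an expression. -/
def Expr.cmax : Expr → ℕ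
  | const k => k
  | reg _ => 0
  | read _ e => e.cmax
  | op _ e₁ e₂ => max e₁.cmax e₂.cmax

/-- The values of an expression are at most `b ^ deg`, if everything is at most `b`. -/
def Expr.deg : Expr → ℕ
  | const _ => 1
  | reg _ => 1
  | read _ e => e.deg
  | op _ e₁ e₂ => e₁.deg + e₂.deg

/-- The expression exceeds the values in memory by at most a constant. -/
def Expr.slow : Expr → Bool
  | const _ => true
  | reg _ => true
  | read _ _ => true
  | op .add e (.const _) => e.slow
  | op .sub e _ => e.slow
  | op .div e _ => e.slow
  | op .mod e _ => e.slow
  | op .lt _ _ => true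
  | op .eq _ _ => true
  | _ => false

/-- The constant by which a slow expression may exceed the values in memory. -/
def Expr.inc : Expr → ℕ
  | const k => k
  | op .add e (.const k) => e.inc + k
  | op .sub e _ => e.inc
  | op .div e _ => e.inc
  | op .mod e _ => e.inc
  | op .lt _ _ => 1
  | op .eq _ _ => 1
  | _ => 0

/-- All assigned values exceed the values in memory by at most `G`. -/
def Cmd.slow (G : ℕ) : Cmd → Bool
  | skip => true
  | set _ e => e.slow && decide (e.inc ≤ G)
  | write _ _ e => e.slow && decide (e.inc ≤ G)
  | seq p q => p.slow G && q.slow G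
  | ite _ p q => p.slow G && q.slow G
  | .while _ p => p.slow G

/-- All constants are at most `C` and all expressions have degree at most `D`. -/
def Cmd.small (C D : ℕ) : Cmd → Bool
  | skip => true
  | set _ e => decide (e.cmax ≤ C ∧ e.deg ≤ D)
  | write _ i e => decide ((i.cmax ≤ C ∧ i.deg ≤ D) ∧ e.cmax ≤ C ∧ e.deg ≤ D)
  | seq p q => p.small C D && q.small C D
  | ite e p q => decide (e.cmax ≤ C ∧ e.deg ≤ D) && (p.small C D && q.small C D)
  | .while e p => decide (e.cmax ≤ C ∧ e.deg ≤ D) && p.small C D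

/-- All registers and cells contain values `≤ b`. -/
def Bd (s : State) (b : ℕ) : Prop := (∀ x, s.reg x ≤ b) ∧ ∀ A i, s.arr A i ≤ b

theorem Bd.mono {s : State} {b c : ℕ} (h : Bd s b) (hbc : b ≤ c) : Bd s c :=
  ⟨fun x => (h.1 x).trans hbc, fun A i => (h.2 A i).trans hbc⟩

theorem Expr.one_le_deg (e : Expr) : 1 ≤ e.deg := by
  induction e with
  | const k => simp [deg]
  | reg x => simp [deg]
  | read A e ih => simpa [deg] using ih
  | op o e₁ e₂ ih₁ ih₂ => simp only [deg]; omega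

/-- A sum of two numbers bounded by `x, y ≥ 2` is at most `x * y`, so degrees may be added for sums
as well as for products; this is what `2 ≤ b` is for. Subtraction, division and remainder do not
exceed their first operand, and comparisons return at most 1. -/
theorem Expr.eval_le {s : State} {b : ℕ} (hb : Bd s b) (h2 : 2 ≤ b) (e : Expr)
    (hc : e.cmax ≤ b) : e.eval s ≤ b ^ e.deg := by
  induction e with
  | const k => simpa [eval, deg, cmax] using hc
  | reg x => simpa [eval, deg] using hb.1 x
  | read A e ih => exact (hb.2 _ _).trans (Nat.le_self_pow (by have := e.one_le_deg; simp only [deg]; omega) b)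
  | op o e₁ e₂ ih₁ ih₂ =>
    simp only [cmax] at hc
    have h₁ := ih₁ (le_trans (le_max_left _ _) hc)
    have h₂ := ih₂ (le_trans (le_max_right _ _) hc)
    have d₁ : 2 ≤ b ^ e₁.deg := h2.trans (Nat.le_self_pow (by have := e₁.one_le_deg; omega) b)
    have d₂ : 2 ≤ b ^ e₂.deg := h2.trans (Nat.le_self_pow (by have := e₂.one_le_deg; omega) b)
    have hm : b ^ e₁.deg ≤ b ^ e₁.deg * b ^ e₂.deg := Nat.le_mul_of_pos_right _ (by omega)
    simp only [eval, deg, pow_add]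
    cases o with
    | add => simp only [Op.eval]; nlinarith
    | sub => simp only [Op.eval]; omega
    | mul => exact Nat.mul_le_mul h₁ h₂
    | div => exact (Nat.div_le_self _ _).trans (h₁.trans hm)
    | mod => exact (Nat.mod_le _ _).trans (h₁.trans hm)
    | lt => simp only [Op.eval]; split_ifs <;> omega
    | eq => simp only [Op.eval]; split_ifs <;> omega

theorem Expr.fits {s : State} {b w D : ℕ} (hb : Bd s b) (h2 : 2 ≤ b) (hw : b ^ D < 2 ^ w)
    (e : Expr) (hc : e.cmax ≤ b) (hd : e.deg ≤ D) : e.Fits w s := by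
  have key := (e.eval_le hb h2 hc).trans_lt
    ((Nat.pow_le_pow_right (by omega) hd).trans_lt hw)
  induction e with
  | const k => exact key
  | reg x => exact key
  | read A e ih =>
    refine ⟨ih hc hd ((e.eval_le hb h2 hc).trans_lt
      ((Nat.pow_le_pow_right (by omega) hd).trans_lt hw)), key⟩
  | op o e₁ e₂ ih₁ ih₂ =>
    simp only [cmax, deg] at hc hd
    have c₁ : e₁.cmax ≤ b := le_trans (le_max_left _ _) hc
    have c₂ : e₂.cmax ≤ b := le_trans (le_max_right _ _) hc
    refine ⟨ih₁ c₁ (by omega) ?_, ih₂ c₂ (by omega) ?_, key⟩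
    · exact (e₁.eval_le hb h2 c₁).trans_lt
        ((Nat.pow_le_pow_right (by omega) (by omega)).trans_lt hw)
    · exact (e₂.eval_le hb h2 c₂).trans_lt
        ((Nat.pow_le_pow_right (by omega) (by omega)).trans_lt hw)

/-- The value read from a cell is bounded by `b` whatever the address is. Products may therefore be
used in addresses, as in table keys, without any growth of the stored values. -/
theorem Expr.eval_slow {s : State} {b : ℕ} (hb : Bd s b) (e : Expr) (he : e.slow = true) :
    e.eval s ≤ b + e.inc := by
  induction e with
  | const k => simp [eval, inc]
  | reg x => simpa [eval, inc] using hb.1 x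
  | read A e ih => simpa [eval, inc] using hb.2 A _
  | op o e₁ e₂ ih₁ ih₂ =>
    cases o with
    | add =>
      cases e₂ with
      | const k => simp only [slow] at he; have := ih₁ he; simp only [eval, Op.eval, inc]; omega
      | _ => simp [slow] at he
    | sub => have := ih₁ (by simpa [slow] using he); simp only [eval, Op.eval, inc]; omega
    | mul => simp [slow] at he
    | div =>
      have := ih₁ (by simpa [slow] using he)
      exact (Nat.div_le_self _ _).trans this
    | mod =>
      have := ih₁ (by simpa [slow] using he)
      exact (Nat.mod_le _ _).trans this
    | lt => simp only [eval, Op.eval, inc]; split_ifs <;> omega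
    | eq => simp only [eval, Op.eval, inc]; split_ifs <;> omega

/-- A run of a slowly growing program is a run on words that are polynomially longer. -/
theorem Run.exec {p : Cmd} {s s' : State} {k : ℕ} (h : Run p s k s') {G C D B w : ℕ}
    (hs : p.slow G = true) (hp : p.small C D = true) (hC : C ≤ B) (hB : 2 ≤ B)
    (hw : B ^ D < 2 ^ w) :
    ∀ b, Bd s b → b + G * k ≤ B → Exec w p s k s' ∧ Bd s' (b + G * k) := by
  have fit : ∀ {s : State} {b : ℕ} {e : Expr}, Bd s b → b ≤ B → e.cmax ≤ C → e.deg ≤ D →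
      e.Fits w s := fun hb hbB hc hd =>
    Expr.fits (hb.mono hbB) hB hw _ (hc.trans hC) hd
  -- Every assignment costs at least one step and raises the maximum of the memory by at most `G`,
  -- so `b + G * k` is a bound after `k` steps. As this stays below `B`, all expressions evaluated
  -- on the way fit.
  induction h with
  | skip s => exact fun b hb _ => ⟨.skip s, hb.mono (by omega)⟩
  | set x e s =>
    intro b hb hbB
    simp only [Cmd.slow, Cmd.small, Bool.and_eq_true, decide_eq_true_eq] at hs hp
    have hv := e.eval_slow hb hs.1
    have hg : G ≤ G * (e.cost + 1) := Nat.le_mul_of_pos_right _ (by omega)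
    refine ⟨.set x e s (fit hb (by omega) hp.1 hp.2), ?_, fun A i => ?_⟩
    · intro y
      rw [State.setR_reg]
      split_ifs
      · omega
      · exact (hb.1 y).trans (by omega)
    · exact (hb.2 A i).trans (by omega)
  | write A i e s =>
    intro b hb hbB
    simp only [Cmd.slow, Cmd.small, Bool.and_eq_true, decide_eq_true_eq] at hs hp
    have hv := e.eval_slow hb hs.1
    have hg : G ≤ G * (i.cost + e.cost + 1) := Nat.le_mul_of_pos_right _ (by omega)
    refine ⟨.write A i e s (fit hb (by omega) hp.1.1 hp.1.2) (fit hb (by omega) hp.2.1 hp.2.2),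
      fun y => (hb.1 y).trans (by omega), fun A' j => ?_⟩
    rw [State.setA_arr]
    split_ifs
    · omega
    · exact (hb.2 _ _).trans (by omega)
  | @seq p q s s' s'' k l _ _ ih₁ ih₂ =>
    intro b hb hbB
    simp only [Cmd.slow, Cmd.small, Bool.and_eq_true] at hs hp
    rw [mul_add] at hbB
    obtain ⟨e₁, b₁⟩ := ih₁ hs.1 hp.1 b hb (by omega)
    obtain ⟨e₂, b₂⟩ := ih₂ hs.2 hp.2 _ b₁ (by omega)
    exact ⟨.seq e₁ e₂, b₂.mono (by rw [mul_add]; omega)⟩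
  | @iteTrue e p q s s' k he _ ih =>
    intro b hb hbB
    simp only [Cmd.slow, Cmd.small, Bool.and_eq_true, decide_eq_true_eq] at hs hp
    rw [mul_add] at hbB
    obtain ⟨e₁, b₁⟩ := ih hs.1 hp.2.1 b hb (by omega)
    exact ⟨.iteTrue (fit hb (by omega) hp.1.1 hp.1.2) he e₁, b₁.mono (by rw [mul_add]; omega)⟩
  | @iteFalse e p q s s' k he _ ih =>
    intro b hb hbB
    simp only [Cmd.slow, Cmd.small, Bool.and_eq_true, decide_eq_true_eq] at hs hp
    rw [mul_add] at hbB
    obtain ⟨e₁, b₁⟩ := ih hs.2 hp.2.2 b hb (by omega)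
    exact ⟨.iteFalse (fit hb (by omega) hp.1.1 hp.1.2) he e₁, b₁.mono (by rw [mul_add]; omega)⟩
  | @whileTrue e p s s' s'' k l he _ _ ih₁ ih₂ =>
    intro b hb hbB
    have hs' := hs
    have hp' := hp
    simp only [Cmd.slow, Cmd.small, Bool.and_eq_true, decide_eq_true_eq] at hs hp
    rw [mul_add, mul_add] at hbB
    obtain ⟨e₁, b₁⟩ := ih₁ hs hp.2 b hb (by omega)
    obtain ⟨e₂, b₂⟩ := ih₂ hs' hp' _ b₁ (by omega)
    exact ⟨.whileTrue (fit hb (by omega) hp.1.1 hp.1.2) he e₁ e₂,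
      b₂.mono (by rw [mul_add, mul_add]; omega)⟩
  | whileFalse he =>
    intro b hb hbB
    simp only [Cmd.small, Bool.and_eq_true, decide_eq_true_eq] at hp
    exact ⟨.whileFalse (fit hb (by omega) hp.1.1 hp.1.2) he, hb.mono (by omega)⟩

/-! ### Program logic -/

/-- The program stops after at most `b` steps, in a state that satisfies `Q`. -/
def Tri (p : Cmd) (s : State) (b : ℕ) (Q : State → Prop) : Prop :=
  ∃ k s', Run p s k s' ∧ k ≤ b ∧ Q s'

theorem Tri.mono {p : Cmd} {s : State} {b b' : ℕ} {Q Q' : State → Prop} (h : Tri p s b Q)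
    (hb : b ≤ b') (hQ : ∀ s', Q s' → Q' s') : Tri p s b' Q' :=
  let ⟨k, s', h₁, h₂, h₃⟩ := h
  ⟨k, s', h₁, h₂.trans hb, hQ s' h₃⟩

theorem Tri.seq {p q : Cmd} {s : State} {b c : ℕ} {Q R : State → Prop} (h : Tri p s b R)
    (h' : ∀ s', R s' → Tri q s' c Q) : Tri (.seq p q) s (b + c) Q := by
  obtain ⟨k, s', h₁, h₂, h₃⟩ := h
  obtain ⟨l, s'', h₄, h₅, h₆⟩ := h' s' h₃
  exact ⟨_, _, .seq h₁ h₄, by omega, h₆⟩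

theorem Tri.ite {e : Expr} {p q : Cmd} {s : State} {b : ℕ} {Q : State → Prop}
    (h₁ : e.eval s ≠ 0 → Tri p s b Q) (h₂ : e.eval s = 0 → Tri q s b Q) :
    Tri (.ite e p q) s (e.cost + 1 + b) Q := by
  by_cases h : e.eval s = 0
  · obtain ⟨k, s', h₃, h₄, h₅⟩ := h₂ h
    exact ⟨_, _, .iteFalse h h₃, by omega, h₅⟩
  · obtain ⟨k, s', h₃, h₄, h₅⟩ := h₁ h
    exact ⟨_, _, .iteTrue h h₃, by omega, h₅⟩

/-- The loop rule; `I b` is the invariant together with the remaining time budget `b`. -/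
theorem Tri.while {e : Expr} {p : Cmd} (I : ℕ → State → Prop)
    (h : ∀ b s, I b s → e.eval s ≠ 0 →
      ∃ c b', c + b' + e.cost + 1 ≤ b ∧ Tri p s c (I b')) {b : ℕ} {s : State} (hI : I b s) :
    Tri (.while e p) s (b + e.cost + 1) (fun s' => e.eval s' = 0 ∧ ∃ b', I b' s') := by
  induction b using Nat.strong_induction_on generalizing s with
  | _ b ih =>
    by_cases he : e.eval s = 0
    · exact ⟨_, s, .whileFalse he, by omega, he, b, hI⟩
    -- The test of the condition costs at least one step, so `b' < b`: the time budget is also the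
    -- measure that proves termination.
    · obtain ⟨c, b', hb, k, s', h₁, h₂, h₃⟩ := h b s hI he
      obtain ⟨l, s'', h₄, h₅, h₆⟩ := ih b' (by omega) h₃
      exact ⟨_, _, .whileTrue he h₁ h₄, by omega, h₆⟩

/-- The effect of a program without loops. -/
def Cmd.run : Cmd → State → State
  | skip, s => s
  | set x e, s => s.setR x (e.eval s)
  | write A i e, s => s.setA A (i.eval s) (e.eval s)
  | seq p q, s => q.run (p.run s)
  | ite e p q, s => if e.eval s = 0 then q.run s else p.run s
  | .while _ _, s => s

/-- The program has no loops. -/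
def Cmd.flat : Cmd → Bool
  | seq p q => p.flat && q.flat
  | ite _ p q => p.flat && q.flat
  | .while _ _ => false
  | _ => true

/-- A bound for the cost of a program without loops. -/
def Cmd.cst : Cmd → ℕ
  | skip => 1
  | set _ e => e.cost + 1
  | write _ i e => i.cost + e.cost + 1
  | seq p q => p.cst + q.cst
  | ite e p q => e.cost + 1 + max p.cst q.cst
  | .while _ _ => 0

theorem Tri.flat {p : Cmd} {s : State} {b : ℕ} {Q : State → Prop} (hp : p.flat = true)
    (hb : p.cst ≤ b) (hQ : Q (p.run s)) : Tri p s b Q := by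
  suffices h : ∃ k, Run p s k (p.run s) ∧ k ≤ p.cst from
    let ⟨k, h₁, h₂⟩ := h; ⟨k, _, h₁, h₂.trans hb, hQ⟩
  clear hQ hb
  induction p generalizing s with
  | skip => exact ⟨1, .skip s, le_rfl⟩
  | set x e => exact ⟨_, .set x e s, le_rfl⟩
  | write A i e => exact ⟨_, .write A i e s, le_rfl⟩
  | seq p q ih₁ ih₂ =>
    simp only [Cmd.flat, Bool.and_eq_true] at hp
    obtain ⟨k, h₁, h₂⟩ := ih₁ (s := s) hp.1
    obtain ⟨l, h₃, h₄⟩ := ih₂ (s := p.run s) hp.2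
    exact ⟨_, .seq h₁ h₃, by simp only [Cmd.cst]; omega⟩
  | ite e p q ih₁ ih₂ =>
    simp only [Cmd.flat, Bool.and_eq_true] at hp
    obtain ⟨k, h₁, h₂⟩ := ih₁ (s := s) hp.1
    obtain ⟨l, h₃, h₄⟩ := ih₂ (s := s) hp.2
    by_cases he : e.eval s = 0
    · exact ⟨_, by rw [Cmd.run, if_pos he]; exact .iteFalse he h₃, by simp only [Cmd.cst]; omega⟩
    · exact ⟨_, by rw [Cmd.run, if_neg he]; exact .iteTrue he h₁, by simp only [Cmd.cst]; omega⟩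
  | _ e p => simp [Cmd.flat] at hp

/-- The registers that a program may modify. -/
def Cmd.modR (y : ℕ) : Cmd → Bool
  | set x _ => x == y
  | seq p q => p.modR y || q.modR y
  | ite _ p q => p.modR y || q.modR y
  | .while _ p => p.modR y
  | _ => false

/-- The arrays that a program may modify. -/
def Cmd.modA (B : ℕ) : Cmd → Bool
  | write A _ _ => A == B
  | seq p q => p.modA B || q.modA B
  | ite _ p q => p.modA B || q.modA B
  | .while _ p => p.modA B
  | _ => false

/-- A program changes at most the registers and arrays that occur in its assignments. -/
def Frame (p : Cmd) (s s' : State) : Prop :=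
  (∀ x, p.modR x = false → s'.reg x = s.reg x) ∧ ∀ A, p.modA A = false → s'.arr A = s.arr A

theorem Run.frame {p : Cmd} {s s' : State} {k : ℕ} (h : Run p s k s') : Frame p s s' := by
  induction h with
  | skip s => exact ⟨fun _ _ => rfl, fun _ _ => rfl⟩
  | set x e s =>
    refine ⟨fun y hy => ?_, fun _ _ => rfl⟩
    simp only [Cmd.modR, beq_eq_false_iff_ne] at hy
    simp [Ne.symm hy]
  | write A i e s =>
    refine ⟨fun y hy => rfl, fun B hB => ?_⟩
    simp only [Cmd.modA, beq_eq_false_iff_ne] at hB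
    funext j
    simp [Ne.symm hB]
  | seq _ _ ih₁ ih₂ =>
    refine ⟨fun y hy => ?_, fun B hB => ?_⟩
    · simp only [Cmd.modR, Bool.or_eq_false_iff] at hy
      rw [ih₂.1 y hy.2, ih₁.1 y hy.1]
    · simp only [Cmd.modA, Bool.or_eq_false_iff] at hB
      rw [ih₂.2 B hB.2, ih₁.2 B hB.1]
  | iteTrue _ _ ih =>
    refine ⟨fun y hy => ?_, fun B hB => ?_⟩
    · simp only [Cmd.modR, Bool.or_eq_false_iff] at hy
      exact ih.1 y hy.1
    · simp only [Cmd.modA, Bool.or_eq_false_iff] at hB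
      exact ih.2 B hB.1
  | iteFalse _ _ ih =>
    refine ⟨fun y hy => ?_, fun B hB => ?_⟩
    · simp only [Cmd.modR, Bool.or_eq_false_iff] at hy
      exact ih.1 y hy.2
    · simp only [Cmd.modA, Bool.or_eq_false_iff] at hB
      exact ih.2 B hB.2
  | whileTrue _ _ _ ih₁ ih₂ =>
    refine ⟨fun y hy => ?_, fun B hB => ?_⟩
    · rw [ih₂.1 y hy, ih₁.1 y (by simpa [Cmd.modR] using hy)]
    · rw [ih₂.2 B hB, ih₁.2 B (by simpa [Cmd.modA] using hB)]
  | whileFalse _ => exact ⟨fun _ _ => rfl, fun _ _ => rfl⟩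

theorem Tri.frame {p : Cmd} {s : State} {b : ℕ} {Q : State → Prop} (h : Tri p s b Q) :
    Tri p s b (fun s' => Q s' ∧ Frame p s s') :=
  let ⟨k, s', h₁, h₂, h₃⟩ := h
  ⟨k, s', h₁, h₂, h₃, h₁.frame⟩

/-- Two programs in a row, with the frame of the first one. -/
theorem Tri.seqF {p q : Cmd} {s : State} {b c : ℕ} {Q R : State → Prop} (h : Tri p s b R)
    (h' : ∀ s', R s' → Frame p s s' → Tri q s' c Q) : Tri (.seq p q) s (b + c) Q :=
  h.frame.seq fun s' hs' => h' s' hs'.1 hs'.2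


/-! ### Notation for programs -/

instance (n : ℕ) [n.AtLeastTwo] : OfNat Expr n := ⟨.const n⟩
instance : Zero Expr := ⟨.const 0⟩
instance : One Expr := ⟨.const 1⟩
instance : Add Expr := ⟨.op .add⟩
instance : Sub Expr := ⟨.op .sub⟩
instance : Mul Expr := ⟨.op .mul⟩
instance : Div Expr := ⟨.op .div⟩
instance : Mod Expr := ⟨.op .mod⟩

infixr:60 " ;; " => Cmd.seq

section eval
variable (s : State) (a b : Expr)

@[simp] theorem Expr.eval_zero : (0 : Expr).eval s = 0 := rfl
@[simp] theorem Expr.eval_one : (1 : Expr).eval s = 1 := rfl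
@[simp] theorem Expr.eval_ofNat (n : ℕ) [n.AtLeastTwo] :
    (ofNat(n) : Expr).eval s = OfNat.ofNat n := rfl
@[simp] theorem Expr.eval_add : (a + b).eval s = a.eval s + b.eval s := rfl
@[simp] theorem Expr.eval_sub : (a - b).eval s = a.eval s - b.eval s := rfl
@[simp] theorem Expr.eval_mul : (a * b).eval s = a.eval s * b.eval s := rfl
@[simp] theorem Expr.eval_div : (a / b).eval s = a.eval s / b.eval s := rfl
@[simp] theorem Expr.eval_mod : (a % b).eval s = a.eval s % b.eval s := rfl
@[simp] theorem Expr.eval_reg (x : ℕ) : (Expr.reg x).eval s = s.reg x := rfl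
@[simp] theorem Expr.eval_read (A : ℕ) : (Expr.read A a).eval s = s.arr A (a.eval s) := rfl
@[simp] theorem Expr.eval_lt :
    (Expr.op .lt a b).eval s = if a.eval s < b.eval s then 1 else 0 := rfl
@[simp] theorem Expr.eval_eq :
    (Expr.op .eq a b).eval s = if a.eval s = b.eval s then 1 else 0 := rfl

end eval

attribute [simp] Cmd.run

@[simp] theorem State.ite_reg (c : Prop) [Decidable c] (s s' : State) (x : ℕ) :
    (if c then s else s').reg x = if c then s.reg x else s'.reg x := by split_ifs <;> rfl

@[simp] theorem State.ite_arr (c : Prop) [Decidable c] (s s' : State) (A i : ℕ) :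
    (if c then s else s').arr A i = if c then s.arr A i else s'.arr A i := by split_ifs <;> rfl

/-! ### Registers and arrays -/

/-- Register: the least letter that has not been used. -/
def FR : ℕ := 3
/-- Register: the value of `FR` at the beginning of the current compression. -/
def ST : ℕ := 4
/-- Register: the loop variable. -/
def I : ℕ := 5
/-- Registers for intermediate values. -/
def R1 : ℕ := 6
/-- Registers for intermediate values. -/
def R2 : ℕ := 7
/-- Registers for intermediate values. -/
def R3 : ℕ := 8
/-- Registers for intermediate values. -/
def R4 : ℕ := 9
/-- Registers for intermediate values. -/
def R5 : ℕ := 10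
/-- Registers for intermediate values. -/
def R6 : ℕ := 11

/-- Array: the dictionary that assigns letters to keys. -/
def TAB : ℕ := 5
/-- Array: the nodes to be deleted. -/
def DEL : ℕ := 6
/-- Array: the new labels of the nodes. -/
def NL : ℕ := 7
/-- Array: the new address of a node, or of its lowest ancestor that is not deleted. -/
def REP : ℕ := 8
/-- Array: the labels of the new tree. -/
def NLAB : ℕ := 9
/-- Array: the parent pointers of the new tree. -/
def NPAR : ℕ := 10
/-- Array: a stack. -/
def STK : ℕ := 11
/-- Array: the number of nodes of the longest chain below a unary node with the same label. -/
def RUN : ℕ := 12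
/-- Array: the longest chain of a letter found so far. -/
def CUR : ℕ := 13
/-- Array: the longest chain of a letter treated so far. -/
def LAST : ℕ := 14
/-- Array: the largest power of two for a letter. -/
def PW : ℕ := 15
/-- Array: the exponent of that power. -/
def PE : ℕ := 16
/-- Array: the letter for that power. -/
def PL : ℕ := 17
/-- Array: the first unary node with a given label. -/
def HEAD : ℕ := 18
/-- Array: the next unary node with the same label. -/
def LNX : ℕ := 19
/-- Array: the side of a letter in the greedy partition. -/
def SIDE : ℕ := 20
/-- Array: whether a node is unary. -/
def UN : ℕ := 21

/-! ### Loops over all nodes -/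

/-- For `I = 1, …, SIZE` (the body increments `I`). -/
def forUp (body : Cmd) : Cmd :=
  .set I 1 ;; .while (.op .lt (.reg I) (.reg SIZE + 1)) (body ;; .set I (.reg I + 1))

/-- For `I = SIZE, …, 1` (the body decrements `I`). -/
def forDown (body : Cmd) : Cmd :=
  .set I (.reg SIZE) ;; .while (.reg I) (body ;; .set I (.reg I - 1))

theorem Cmd.frame_run {p : Cmd} (hp : p.flat = true) (s : State) : Frame p s (p.run s) :=
  let ⟨_, _, _, _, h, hf⟩ := (Tri.flat (s := s) (Q := fun s' => s' = p.run s) hp le_rfl rfl).frame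
  h ▸ hf

theorem Frame.refl (p : Cmd) (s : State) : Frame p s s := ⟨fun _ _ => rfl, fun _ _ => rfl⟩

theorem Frame.trans {p q : Cmd} {s s' s'' : State} (h : Frame p s s') (h' : Frame q s' s'')
    (hR : ∀ x, p.modR x = false → q.modR x = false)
    (hA : ∀ A, p.modA A = false → q.modA A = false) : Frame p s s'' :=
  ⟨fun x hx => (h'.1 x (hR x hx)).trans (h.1 x hx),
    fun A hx => (h'.2 A (hA A hx)).trans (h.2 A hx)⟩

/-- The parameter `p` of the invariant is a potential: an iteration may cost more than `C` if it
lowers the potential accordingly. The test and the increment of `I` take 10 steps per iteration. The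
body also receives the frame relative to the state before the loop, so an invariant need only
mention what the loop changes. -/
theorem Tri.forUpP {body : Cmd} {s : State} {N C p : ℕ} (J : ℕ → ℕ → State → Prop)
    (hI : body.modR I = false) (hS : body.modR SIZE = false)
    (hJ : ∀ i p s x, J i p s → J i p (s.setR I x))
    (h0 : J 1 p s) (hN : s.reg SIZE = N)
    (hb : ∀ i p s', Frame (forUp body) s s' → 1 ≤ i → i ≤ N → s'.reg I = i → J i p s' →
      ∃ c p', c + p' ≤ C + p ∧ Tri body s' c (J (i + 1) p')) :
    Tri (forUp body) s (N * (C + 10) + p + 8) (fun s' => ∃ p', J (N + 1) p' s') := by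
  have h1 : Tri (.set I 1) s 2 (fun s' => s'.reg I = 1 ∧ s'.reg SIZE = N ∧ J 1 p s') :=
    .flat rfl (by decide) ⟨by simp, by simpa +decide using hN, hJ _ _ _ _ h0⟩
  have cst : (Expr.op .lt (.reg I) (.reg SIZE + 1)).cost = 5 := by decide
  refine (h1.seqF fun s' hs' hf => (Tri.while (b := N * (C + 10) + p)
    (fun b s' => ∃ i p, s'.reg I = i ∧ s'.reg SIZE = N ∧ 1 ≤ i ∧ i ≤ N + 1 ∧ J i p s' ∧
      Frame (forUp body) s s' ∧ b = (N + 1 - i) * (C + 10) + p) ?_ ?_)).mono ?_ ?_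
  rotate_left
  · exact ⟨1, p, hs'.1, hs'.2.1, le_rfl, by omega, hs'.2.2,
      (Frame.refl _ s).trans hf (fun x hx => by simp_all [forUp, Cmd.modR])
        (fun A hA => by simp [Cmd.modA]), by simp⟩
  · omega
  · rintro s' ⟨he, b', i, p, h₁, h₂, h₃, h₄, h₅, -⟩
    simp [h₁, h₂] at he
    obtain rfl : i = N + 1 := by omega
    exact ⟨p, h₅⟩
  · rintro b s₁ ⟨i, p, h₁, h₂, h₃, h₄, h₅, hf, rfl⟩ he
    simp [h₁, h₂] at he
    obtain ⟨c, p', hc, hT⟩ := hb i p s₁ hf h₃ (by omega) h₁ h₅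
    refine ⟨c + 4, (N + 1 - (i + 1)) * (C + 10) + p', ?_, ?_⟩
    · obtain ⟨m, hm⟩ : ∃ m, N + 1 - i = m + 1 := ⟨N - i, by omega⟩
      have hm' : N + 1 - (i + 1) = m := by omega
      rw [hm, hm', cst]
      linarith
    · have hq : Tri (body ;; .set I (.reg I + 1)) s₁ (c + 4)
          (fun s' => s'.reg I = i + 1 ∧ s'.reg SIZE = N ∧ J (i + 1) p' s') :=
        hT.seqF fun s' hs' hf => .flat rfl (by decide) ⟨by simp [hf.1 I hI, h₁],
          by simpa +decide [h₂] using hf.1 SIZE hS, hJ _ _ _ _ hs'⟩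
      exact hq.frame.mono le_rfl fun s' hs' => ⟨i + 1, p', hs'.1.1, hs'.1.2.1, by omega, by omega,
        hs'.1.2.2, hf.trans hs'.2 (fun x hx => by simp_all [forUp, Cmd.modR])
          (fun A hA => by simp_all [forUp, Cmd.modA]), rfl⟩

theorem Tri.forDownP {body : Cmd} {s : State} {N C p : ℕ} (J : ℕ → ℕ → State → Prop)
    (hI : body.modR I = false)
    (hJ : ∀ i p s x, J i p s → J i p (s.setR I x))
    (h0 : J N p s) (hN : s.reg SIZE = N)
    (hb : ∀ i p s', Frame (forDown body) s s' → 1 ≤ i → i ≤ N → s'.reg I = i → J i p s' →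
      ∃ c p', c + p' ≤ C + p ∧ Tri body s' c (J (i - 1) p')) :
    Tri (forDown body) s (N * (C + 10) + p + 8) (fun s' => ∃ p', J 0 p' s') := by
  have h1 : Tri (.set I (.reg SIZE)) s 2 (fun s' => s'.reg I = N ∧ J N p s') :=
    .flat rfl (by decide) ⟨by simp [hN], hJ _ _ _ _ h0⟩
  refine (h1.seqF fun s' hs' hf => (Tri.while (b := N * (C + 10) + p)
    (fun b s' => ∃ i p, s'.reg I = i ∧ i ≤ N ∧ J i p s' ∧ Frame (forDown body) s s' ∧
      b = i * (C + 10) + p) ?_ ?_)).mono ?_ ?_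
  rotate_left
  · exact ⟨N, p, hs'.1, le_rfl, hs'.2,
      (Frame.refl _ s).trans hf (fun x hx => by simp_all [forDown, Cmd.modR])
        (fun A hA => by simp [Cmd.modA]), rfl⟩
  · simp [Expr.cost]; omega
  · rintro s' ⟨he, b', i, p, h₁, h₂, h₃, -⟩
    simp [h₁] at he
    subst he
    exact ⟨p, h₃⟩
  · rintro b s₁ ⟨i, p, h₁, h₂, h₃, hf, rfl⟩ he
    simp [h₁] at he
    obtain ⟨c, p', hc, hT⟩ := hb i p s₁ hf (by omega) h₂ h₁ h₃
    refine ⟨c + 4, (i - 1) * (C + 10) + p', ?_, ?_⟩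
    · obtain ⟨m, rfl⟩ : ∃ m, i = m + 1 := ⟨i - 1, by omega⟩
      simp [Expr.cost]
      linarith
    · have hq : Tri (body ;; .set I (.reg I - 1)) s₁ (c + 4)
          (fun s' => s'.reg I = i - 1 ∧ J (i - 1) p' s') :=
        hT.seqF fun s' hs' hf => .flat rfl (by decide) ⟨by simp [hf.1 I hI, h₁], hJ _ _ _ _ hs'⟩
      exact hq.frame.mono le_rfl fun s' hs' => ⟨i - 1, p', hs'.1.1, by omega,
        hs'.1.2, hf.trans hs'.2 (fun x hx => by simp_all [forDown, Cmd.modR])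
          (fun A hA => by simp_all [forDown, Cmd.modA]), rfl⟩

theorem Tri.forUp {body : Cmd} {s : State} {N C : ℕ} (J : ℕ → State → Prop)
    (hI : body.modR I = false) (hS : body.modR SIZE = false)
    (hJ : ∀ i s x, J i s → J i (s.setR I x))
    (h0 : J 1 s) (hN : s.reg SIZE = N)
    (hb : ∀ i s', Frame (forUp body) s s' → 1 ≤ i → i ≤ N → s'.reg I = i → J i s' →
      Tri body s' C (J (i + 1))) :
    Tri (forUp body) s (N * (C + 10) + 8) (J (N + 1)) :=
  (Tri.forUpP (p := 0) (fun i _ => J i) hI hS (fun i _ => hJ i) h0 hN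
    fun i _ s h₁ h₂ h₃ h₄ h₅ => ⟨C, 0, by omega, hb i s h₁ h₂ h₃ h₄ h₅⟩).mono le_rfl
    fun _ ⟨_, h⟩ => h

theorem Tri.forDown {body : Cmd} {s : State} {N C : ℕ} (J : ℕ → State → Prop)
    (hI : body.modR I = false)
    (hJ : ∀ i s x, J i s → J i (s.setR I x))
    (h0 : J N s) (hN : s.reg SIZE = N)
    (hb : ∀ i s', Frame (forDown body) s s' → 1 ≤ i → i ≤ N → s'.reg I = i → J i s' →
      Tri body s' C (J (i - 1))) :
    Tri (forDown body) s (N * (C + 10) + 8) (J 0) :=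
  (Tri.forDownP (p := 0) (fun i _ => J i) hI (fun i _ => hJ i) h0 hN
    fun i _ s h₁ h₂ h₃ h₄ h₅ => ⟨C, 0, by omega, hb i s h₁ h₂ h₃ h₄ h₅⟩).mono le_rfl
    fun _ ⟨_, h⟩ => h

open RTree

/-! ### Forests -/

/-- Forests rather than trees are the objects of induction: the forest below the first root and the
forest of the remaining trees are both smaller, and a single predicate replaces a mutual induction.
-/
theorem forest_induction {α : Type} {P : List (RTree α) → Prop} (nil : P [])
    (cons : ∀ a us ts, P us → P ts → P (node a us :: ts)) : ∀ ts, P ts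
  | [] => nil
  | node a us :: ts => cons a us ts (forest_induction nil cons us) (forest_induction nil cons ts)

@[simp] theorem mapL_nil {α β : Type} (f : α → β) : mapL f [] = [] := by simp [mapL]

@[simp] theorem mapL_cons {α β : Type} (f : α → β) (a : α) (us ts : List (RTree α)) :
    mapL f (node a us :: ts) = node (f a) (mapL f us) :: mapL f ts := by simp [mapL, map]

@[simp] theorem labelsL_nil {α : Type} : labelsL ([] : List (RTree α)) = [] := by simp [labelsL]

@[simp] theorem labelsL_cons {α : Type} (a : α) (us ts : List (RTree α)) :
    labelsL (node a us :: ts) = a :: (labelsL us ++ labelsL ts) := by simp [labelsL, labels]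

theorem labelsL_append {α : Type} (ts us : List (RTree α)) :
    labelsL (ts ++ us) = labelsL ts ++ labelsL us := by
  induction ts with
  | nil => simp
  | cons t ts ih => simp [labelsL, ih]

theorem mapL_append {α β : Type} (f : α → β) (ts us : List (RTree α)) :
    mapL f (ts ++ us) = mapL f ts ++ mapL f us := by
  induction ts with
  | nil => simp
  | cons t ts ih => simp [mapL, ih]

theorem labelsL_mapL {α β : Type} (f : α → β) (ts : List (RTree α)) :
    labelsL (mapL f ts) = (labelsL ts).map f := by
  induction ts using forest_induction with
  | nil => simp
  | cons a us ts ih₁ ih₂ => simp [ih₁, ih₂]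

theorem mapL_mapL {α β γ : Type} (f : α → β) (g : β → γ) (ts : List (RTree α)) :
    mapL g (mapL f ts) = mapL (fun x => g (f x)) ts := by
  induction ts using forest_induction with
  | nil => simp
  | cons a us ts ih₁ ih₂ => simp [ih₁, ih₂]

theorem mapL_congr {α β : Type} {f g : α → β} {ts : List (RTree α)}
    (h : ∀ a ∈ labelsL ts, f a = g a) : mapL f ts = mapL g ts := by
  induction ts using forest_induction with
  | nil => simp
  | cons a us ts ih₁ ih₂ =>
    simp only [labelsL_cons, List.mem_cons, List.mem_append] at h
    rw [mapL_cons, mapL_cons, h a (.inl rfl), ih₁ fun x hx => h x (.inr (.inl hx)),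
      ih₂ fun x hx => h x (.inr (.inr hx))]

@[simp] theorem length_mapL {α β : Type} (f : α → β) (ts : List (RTree α)) :
    (mapL f ts).length = ts.length := by
  induction ts with
  | nil => simp
  | cons t ts ih => simp [mapL, ih]

theorem linkedL_cons {s : State} {p q v : ℕ} {us ts : List (RTree ℕ)} :
    LinkedL s p q (node v us :: ts) ↔
      q = v ∧ s.arr PARENT v = p ∧ LinkedL s v (s.arr CHILD v) us ∧
        LinkedL s p (s.arr NEXT v) ts := by
  rw [LinkedL, Linked]; tauto

theorem linkedL_nil {s : State} {p q : ℕ} : LinkedL s p q [] ↔ q = 0 := by rw [LinkedL]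

/-- The nodes of a forest in preorder, with the forests below them. -/
def nodesL {α : Type} : List (RTree α) → List (α × List (RTree α))
  | [] => []
  | node a us :: ts => (a, us) :: (nodesL us ++ nodesL ts)

theorem nodesL_fst {α : Type} (ts : List (RTree α)) : (nodesL ts).map Prod.fst = labelsL ts := by
  induction ts using forest_induction with
  | nil => simp [nodesL]
  | cons a us ts ih₁ ih₂ => simp [nodesL, ih₁, ih₂]

theorem exists_of_mem_labelsL {α : Type} {ts : List (RTree α)} {a : α} (h : a ∈ labelsL ts) :
    ∃ us, (a, us) ∈ nodesL ts := by
  rw [← nodesL_fst] at h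
  simpa using h

theorem linkedL_of_mem {s : State} {p q : ℕ} {ts : List (RTree ℕ)} (h : LinkedL s p q ts)
    {v : ℕ} {us : List (RTree ℕ)} (hv : (v, us) ∈ nodesL ts) :
    LinkedL s v (s.arr CHILD v) us := by
  induction ts using forest_induction generalizing p q with
  | nil => simp [nodesL] at hv
  | cons a ws ts ih₁ ih₂ =>
    rw [linkedL_cons] at h
    simp only [nodesL, List.mem_cons, Prod.mk.injEq, List.mem_append] at hv
    rcases hv with ⟨rfl, rfl⟩ | hv | hv
    · exact h.2.2.1
    · exact ih₁ h.2.2.1 hv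
    · exact ih₂ h.2.2.2 hv

/-- In preorder the first root, the nodes below it and the nodes of the remaining trees occupy
consecutive intervals of addresses. -/
theorem range'_cons_append {q m v : ℕ} {l₁ l₂ : List ℕ}
    (h : v :: (l₁ ++ l₂) = List.range' q m) :
    v = q ∧ l₁ = List.range' (q + 1) l₁.length ∧
      l₂ = List.range' (q + 1 + l₁.length) l₂.length ∧ m = 1 + l₁.length + l₂.length := by
  have hm : m = 1 + l₁.length + l₂.length := by
    have := congrArg List.length h
    simp at this; omega
  have h' : List.range' q m = q :: (List.range' (q + 1) l₁.length ++
      List.range' (q + 1 + l₁.length) l₂.length) := by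
    rw [List.range'_append_1, hm, show 1 + l₁.length + l₂.length = (l₁.length + l₂.length) + 1 by omega,
      List.range'_succ]
  rw [h'] at h
  obtain ⟨h₁, h₂⟩ := List.cons.inj h
  obtain ⟨h₃, h₄⟩ := List.append_inj h₂ (by simp)
  exact ⟨h₁, h₃, h₄, hm⟩

theorem labelsL_of_mem {q m : ℕ} {ts : List (RTree ℕ)} (h : labelsL ts = List.range' q m)
    {v : ℕ} {us : List (RTree ℕ)} (hv : (v, us) ∈ nodesL ts) :
    q ≤ v ∧ ∃ m', labelsL us = List.range' (v + 1) m' ∧ v + 1 + m' ≤ q + m := by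
  induction ts using forest_induction generalizing q m with
  | nil => simp [nodesL] at hv
  | cons a ws ts ih₁ ih₂ =>
    rw [labelsL_cons] at h
    obtain ⟨rfl, h₁, h₂, h₃⟩ := range'_cons_append h
    simp only [nodesL, List.mem_cons, Prod.mk.injEq, List.mem_append] at hv
    rcases hv with ⟨rfl, rfl⟩ | hv | hv
    · exact ⟨le_rfl, _, h₁, by omega⟩
    · obtain ⟨h₄, m', h₅, h₆⟩ := ih₁ h₁ hv
      exact ⟨by omega, m', h₅, by omega⟩
    · obtain ⟨h₄, m', h₅, h₆⟩ := ih₂ h₂ hv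
      exact ⟨by omega, m', h₅, by omega⟩

/-- The roots of the trees of a forest. -/
def roots {α : Type} (ts : List (RTree α)) : List α := ts.map fun | node a _ => a

@[simp] theorem roots_nil {α : Type} : roots ([] : List (RTree α)) = [] := rfl

@[simp] theorem roots_cons {α : Type} (a : α) (us ts : List (RTree α)) :
    roots (node a us :: ts) = a :: roots ts := rfl

theorem roots_subset {α : Type} (ts : List (RTree α)) : roots ts ⊆ labelsL ts := by
  induction ts with
  | nil => simp
  | cons t ts ih =>
    obtain ⟨a, us⟩ := t
    simp only [roots_cons, labelsL_cons, List.cons_subset, List.mem_cons, true_or, true_and]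
    exact fun x hx => by simp [ih hx]

theorem parent_of_root {s : State} {p q : ℕ} {ts : List (RTree ℕ)} (h : LinkedL s p q ts)
    {v : ℕ} (hv : v ∈ roots ts) : s.arr PARENT v = p := by
  induction ts generalizing q with
  | nil => simp at hv
  | cons t ts ih =>
    obtain ⟨a, us⟩ := t
    rw [linkedL_cons] at h
    rw [roots_cons, List.mem_cons] at hv
    rcases hv with rfl | hv
    · exact h.2.1
    · exact ih h.2.2.2 hv

theorem root_or_child {α : Type} {ts : List (RTree α)} {v : α} (hv : v ∈ labelsL ts) :
    v ∈ roots ts ∨ ∃ p us, (p, us) ∈ nodesL ts ∧ v ∈ roots us := by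
  induction ts using forest_induction with
  | nil => simp at hv
  | cons a us ts ih₁ ih₂ =>
    simp only [labelsL_cons, List.mem_cons, List.mem_append] at hv
    simp only [roots_cons, nodesL, List.mem_cons, List.mem_append, Prod.mk.injEq]
    rcases hv with rfl | hv | hv
    · exact .inl (.inl rfl)
    · rcases ih₁ hv with h | ⟨p, ws, h₁, h₂⟩
      · exact .inr ⟨a, us, .inl ⟨rfl, rfl⟩, h⟩
      · exact .inr ⟨p, ws, .inr (.inl h₁), h₂⟩
    · rcases ih₂ hv with h | ⟨p, ws, h₁, h₂⟩
      · exact .inl (.inr h)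
      · exact .inr ⟨p, ws, .inr (.inr h₁), h₂⟩

/-! ### Trees whose addresses are `1, …, N` in preorder -/

/-- The pointers in memory are those of a tree with root `1`, the forest `us` below the root, and
addresses `1, …, N` in preorder. -/
structure Canon (s : State) (us : List (RTree ℕ)) (N : ℕ) : Prop where
  labels : labelsL [node 1 us] = List.range' 1 N
  linked : LinkedL s 0 1 [node 1 us]
  root : s.reg ROOT = 1
  size : s.reg SIZE = N

namespace Canon
variable {s : State} {us : List (RTree ℕ)} {N : ℕ}

theorem mem_iff (h : Canon s us N) {v : ℕ} : v ∈ labelsL [node 1 us] ↔ 1 ≤ v ∧ v ≤ N := by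
  rw [h.labels, List.mem_range'_1]; omega

theorem pos (h : Canon s us N) : 1 ≤ N := (h.mem_iff.1 (by simp : 1 ∈ _)).2

theorem kids (h : Canon s us N) {v : ℕ} (h₁ : 1 ≤ v) (h₂ : v ≤ N) :
    ∃ ws, (v, ws) ∈ nodesL [node 1 us] := exists_of_mem_labelsL (h.mem_iff.2 ⟨h₁, h₂⟩)

theorem of_mem (h : Canon s us N) {v : ℕ} {ws : List (RTree ℕ)}
    (hv : (v, ws) ∈ nodesL [node 1 us]) :
    1 ≤ v ∧ v ≤ N ∧ LinkedL s v (s.arr CHILD v) ws ∧ ∀ u ∈ labelsL ws, v < u ∧ u ≤ N := by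
  obtain ⟨h₁, m', h₂, h₃⟩ := labelsL_of_mem h.labels hv
  refine ⟨h₁, by omega, linkedL_of_mem h.linked hv, fun u hu => ?_⟩
  rw [h₂, List.mem_range'_1] at hu
  omega

theorem child_eq_zero (h : Canon s us N) {v : ℕ} {ws : List (RTree ℕ)}
    (hv : (v, ws) ∈ nodesL [node 1 us]) : s.arr CHILD v = 0 ↔ ws = [] := by
  obtain ⟨h₁, h₂, h₃, h₄⟩ := h.of_mem hv
  cases ws with
  | nil => rw [linkedL_nil] at h₃; simpa using h₃
  | cons t ts =>
    obtain ⟨a, xs⟩ := t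
    rw [linkedL_cons] at h₃
    have := h₄ a (by simp)
    simp; omega

theorem child (h : Canon s us N) {v : ℕ} (h₁ : 1 ≤ v) (h₂ : v ≤ N) (hc : s.arr CHILD v ≠ 0) :
    v < s.arr CHILD v ∧ s.arr CHILD v ≤ N ∧ s.arr PARENT (s.arr CHILD v) = v := by
  obtain ⟨ws, hws⟩ := h.kids h₁ h₂
  obtain ⟨-, -, h₃, h₄⟩ := h.of_mem hws
  cases ws with
  | nil => rw [linkedL_nil] at h₃; exact absurd h₃ hc
  | cons t ts =>
    obtain ⟨a, xs⟩ := t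
    rw [linkedL_cons] at h₃
    rw [h₃.1]
    have := h₄ a (by simp)
    exact ⟨this.1, this.2, h₃.2.1⟩

theorem parent_one (h : Canon s us N) : s.arr PARENT 1 = 0 := (linkedL_cons.1 h.linked).2.1

theorem parent (h : Canon s us N) {v : ℕ} (h₁ : 2 ≤ v) (h₂ : v ≤ N) :
    1 ≤ s.arr PARENT v ∧ s.arr PARENT v < v ∧ s.arr CHILD (s.arr PARENT v) ≠ 0 ∧
      ∃ ws, (s.arr PARENT v, ws) ∈ nodesL [node 1 us] ∧ v ∈ roots ws := by
  rcases root_or_child (h.mem_iff.2 ⟨by omega, h₂⟩) with h₃ | ⟨p, ws, h₃, h₄⟩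
  · simp at h₃; omega
  · obtain ⟨h₅, h₆, h₇, h₈⟩ := h.of_mem h₃
    rw [parent_of_root h₇ h₄]
    refine ⟨h₅, (h₈ v (roots_subset _ h₄)).1, ?_, ws, h₃, h₄⟩
    rw [Ne, h.child_eq_zero h₃]
    rintro rfl
    simp at h₄

theorem parent_lt (h : Canon s us N) {v : ℕ} (h₁ : 1 ≤ v) (h₂ : v ≤ N) : s.arr PARENT v < v := by
  rcases Nat.lt_or_ge 1 v with h₃ | h₃
  · exact (h.parent h₃ h₂).2.1
  · obtain rfl : v = 1 := by omega
    simp [h.parent_one]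

theorem only_child (h : Canon s us N) {v : ℕ} (h₁ : 1 ≤ v) (h₂ : v ≤ N)
    (hp : s.arr PARENT v ≠ 0) (hn : s.arr NEXT (s.arr CHILD (s.arr PARENT v)) = 0) :
    s.arr CHILD (s.arr PARENT v) = v := by
  have : v ≠ 1 := by rintro rfl; exact hp h.parent_one
  obtain ⟨h₃, h₄, h₅, ws, h₆, h₇⟩ := h.parent (by omega) h₂
  obtain ⟨-, -, h₈, h₉⟩ := h.of_mem h₆
  cases ws with
  | nil => simp at h₇
  | cons t ts =>
    obtain ⟨a, xs⟩ := t
    rw [linkedL_cons] at h₈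
    rw [h₈.1] at hn ⊢
    rw [hn] at h₈
    cases ts with
    | nil => exact (by simpa using h₇ : v = a).symm
    | cons t ts =>
      obtain ⟨b, ys⟩ := t
      have := (linkedL_cons.1 h₈.2.2.2).1
      have := h₉ b (by simp)
      omega

end Canon

theorem linkedL_congr {s s' : State} (h₁ : s'.arr PARENT = s.arr PARENT)
    (h₂ : s'.arr CHILD = s.arr CHILD) (h₃ : s'.arr NEXT = s.arr NEXT) {p q : ℕ}
    {ts : List (RTree ℕ)} (h : LinkedL s p q ts) : LinkedL s' p q ts := by
  induction ts using forest_induction generalizing p q with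
  | nil => simpa [linkedL_nil] using h
  | cons a us ts ih₁ ih₂ =>
    rw [linkedL_cons] at h ⊢
    rw [h₁, h₂, h₃]
    exact ⟨h.1, h.2.1, ih₁ h.2.2.1, ih₂ h.2.2.2⟩

/-- A program that does not touch the tree preserves `Canon`. -/
theorem Canon.frame {p : Cmd} {s s' : State} {us : List (RTree ℕ)} {N : ℕ} (h : Canon s us N)
    (hf : Frame p s s')
    (hp : (p.modA PARENT || p.modA CHILD || p.modA NEXT || p.modR ROOT || p.modR SIZE) = false) :
    Canon s' us N := by
  simp only [Bool.or_eq_false_iff] at hp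
  obtain ⟨⟨⟨⟨h₁, h₂⟩, h₃⟩, h₄⟩, h₅⟩ := hp
  exact ⟨h.labels, linkedL_congr (hf.2 _ h₁) (hf.2 _ h₂) (hf.2 _ h₃) h.linked,
    (hf.1 _ h₄).trans h.root, (hf.1 _ h₅).trans h.size⟩

/-! ### Parent pointers determine the tree -/

/-- `P` assigns to each node of the forest its parent; the parent of the roots is `p`. -/
def ParL (P : ℕ → ℕ) : ℕ → List (RTree ℕ) → Prop
  | _, [] => True
  | p, node v us :: ts => P v = p ∧ ParL P v us ∧ ParL P p ts

theorem LinkedL.parL {s : State} {p q : ℕ} {ts : List (RTree ℕ)} (h : LinkedL s p q ts) :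
    ParL (s.arr PARENT) p ts := by
  induction ts using forest_induction generalizing p q with
  | nil => simp [ParL]
  | cons a us ts ih₁ ih₂ =>
    rw [linkedL_cons] at h
    rw [ParL]
    exact ⟨h.2.1, ih₁ h.2.2.1, ih₂ h.2.2.2⟩

theorem ParL.mem {P : ℕ → ℕ} {p : ℕ} {ts : List (RTree ℕ)} (h : ParL P p ts) {u : ℕ}
    (hu : u ∈ labelsL ts) : P u = p ∨ P u ∈ labelsL ts := by
  induction ts using forest_induction generalizing p with
  | nil => simp at hu
  | cons a us ts ih₁ ih₂ =>
    rw [ParL] at h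
    simp only [labelsL_cons, List.mem_cons, List.mem_append] at hu ⊢
    rcases hu with rfl | hu | hu
    · exact .inl h.1
    · rcases ih₁ h.2.1 hu with h' | h' <;> tauto
    · rcases ih₂ h.2.2 hu with h' | h' <;> tauto

/-- `x` is the first of the nodes `q, …, N` with parent `p` (`0` if there is none). -/
def IsFirst (P : ℕ → ℕ) (N q p x : ℕ) : Prop :=
  (x = 0 ∧ ∀ u, q ≤ u → u ≤ N → P u ≠ p) ∨
    (q ≤ x ∧ x ≤ N ∧ P x = p ∧ ∀ u, q ≤ u → u < x → P u ≠ p)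

theorem IsFirst.mono {P : ℕ → ℕ} {N q q' p x : ℕ} (h : IsFirst P N q p x) (hq : q ≤ q')
    (hu : ∀ u, q ≤ u → u < q' → P u ≠ p) : IsFirst P N q' p x := by
  rcases h with ⟨h₁, h₂⟩ | ⟨h₁, h₂, h₃, h₄⟩
  · exact .inl ⟨h₁, fun u h₃ h₄ => h₂ u (hq.trans h₃) h₄⟩
  · refine .inr ⟨?_, h₂, h₃, fun u h₅ h₆ => h₄ u (hq.trans h₅) h₆⟩
    by_contra h
    exact hu x h₁ (by omega) h₃

/-- In preorder the first child of `v` is the first later node with parent `v`, and the next sibling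
of `v` is the first later node with the same parent. Hence parent pointers determine the rest. By
`hlate`, a node behind the interval `[q, q + m)` of the forest neither is one of its roots nor has a
parent in it, so the search for a further child or sibling cannot wrongly succeed behind the
interval. -/
theorem linkedL_of_first {s : State} {P : ℕ → ℕ} {N : ℕ}
    (hP : ∀ v, 1 ≤ v → v ≤ N → s.arr PARENT v = P v)
    (hC : ∀ v, 1 ≤ v → v ≤ N → IsFirst P N (v + 1) v (s.arr CHILD v))
    (hX : ∀ v, 1 ≤ v → v ≤ N → IsFirst P N (v + 1) (P v) (s.arr NEXT v))
    {ts : List (RTree ℕ)} {p q m x : ℕ} (hl : labelsL ts = List.range' q m) (hp : ParL P p ts)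
    (hx : IsFirst P N q p x) (hpq : p < q) (hm : q + m ≤ N + 1)
    (hlate : ∀ u, q + m ≤ u → u ≤ N → P u ≠ p ∧ (P u < q ∨ q + m ≤ P u)) :
    LinkedL s p x ts := by
  induction ts using forest_induction generalizing p q m x with
  | nil =>
    rw [linkedL_nil]
    have : m = 0 := by simpa using (congrArg List.length hl).symm
    subst this
    rcases hx with h | ⟨h₁, h₂, h₃, h₄⟩
    · exact h.1
    · exact absurd h₃ (hlate x (by omega) h₂).1
  | cons v us ts ih₁ ih₂ =>
    rw [labelsL_cons] at hl
    obtain ⟨rfl, h₁, h₂, h₃⟩ := range'_cons_append hl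
    rw [ParL] at hp
    obtain ⟨p₁, p₂, p₃⟩ := hp
    have us_mem : ∀ u, u ∈ labelsL us ↔ v + 1 ≤ u ∧ u < v + 1 + (labelsL us).length := fun u => by
      conv_lhs => rw [h₁]
      exact List.mem_range'_1
    have ts_mem : ∀ u, u ∈ labelsL ts ↔ v + 1 + (labelsL us).length ≤ u ∧ u < v + m := fun u => by
      conv_lhs => rw [h₂]
      rw [List.mem_range'_1]; omega
    rw [linkedL_cons]
    refine ⟨?_, (hP v (by omega) (by omega)).trans p₁, ?_, ?_⟩
    · rcases hx with h | ⟨h₄, h₅, h₆, h₇⟩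
      · exact absurd p₁ (h.2 v le_rfl (by omega))
      · by_contra h
        exact h₇ v le_rfl (by omega) p₁
    · refine ih₁ h₁ p₂ (hC v (by omega) (by omega)) (by omega) (by omega) fun u hu₁ hu₂ => ?_
      rcases Nat.lt_or_ge u (v + m) with hu | hu
      · rcases p₃.mem ((ts_mem u).2 ⟨hu₁, hu⟩) with h | h
        · omega
        · have := (ts_mem _).1 h; omega
      · have := hlate u hu hu₂; omega
    · refine ih₂ h₂ p₃ ?_ (by omega) (by omega) fun u hu₁ hu₂ => ?_
      · have := hX v (by omega) (by omega)
        rw [p₁] at this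
        refine this.mono (by omega) fun u hu₁ hu₂ h => ?_
        rcases p₂.mem ((us_mem u).2 ⟨hu₁, hu₂⟩) with h' | h'
        · omega
        · have := (us_mem _).1 h'; omega
      · have := hlate u (by omega) hu₂
        omega

/-! ### Contraction of nodes -/

/-- Delete the nodes in `D`: the forest below a deleted node takes its place. -/
def contractL (D : ℕ → Bool) : List (RTree ℕ) → List (RTree ℕ)
  | [] => []
  | node v us :: ts =>
      if D v then contractL D us ++ contractL D ts else node v (contractL D us) :: contractL D ts

theorem labelsL_contractL (D : ℕ → Bool) (ts : List (RTree ℕ)) :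
    labelsL (contractL D ts) = (labelsL ts).filter (fun v => !D v) := by
  induction ts using forest_induction with
  | nil => simp [contractL]
  | cons a us ts ih₁ ih₂ =>
    by_cases h : D a <;> simp [contractL, h, ih₁, ih₂, labelsL_append]

theorem parL_append {P : ℕ → ℕ} {p : ℕ} {ts us : List (RTree ℕ)} :
    ParL P p (ts ++ us) ↔ ParL P p ts ∧ ParL P p us := by
  induction ts with
  | nil => simp [ParL]
  | cons t ts ih => obtain ⟨v, ws⟩ := t; simp [ParL, ih, and_assoc]

/-- A deleted node has the same representative as its parent, so `rep` leads to the lowest surviving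
ancestor. This ancestor becomes the parent of the children of a deleted node, in accordance with
their place in the contracted forest. -/
theorem ParL.contractL {P Q rep : ℕ → ℕ} {D : ℕ → Bool} {p : ℕ} {ts : List (RTree ℕ)}
    (h : ParL P p ts) (h₁ : ∀ v ∈ labelsL ts, D v = true → rep v = rep (P v))
    (h₂ : ∀ v ∈ labelsL ts, D v = false → Q (rep v) = rep (P v)) :
    ParL Q (rep p) (mapL rep (contractL D ts)) := by
  induction ts using forest_induction generalizing p with
  | nil => simp [TtoG.contractL, ParL]
  | cons v us ts ih₁ ih₂ =>
    rw [ParL] at h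
    simp only [labelsL_cons, List.mem_cons, List.mem_append] at h₁ h₂
    have i₁ := ih₁ h.2.1 (fun v hv => h₁ v (.inr (.inl hv))) (fun v hv => h₂ v (.inr (.inl hv)))
    have i₂ := ih₂ h.2.2 (fun v hv => h₁ v (.inr (.inr hv))) (fun v hv => h₂ v (.inr (.inr hv)))
    by_cases hD : D v
    · rw [h₁ v (.inl rfl) hD, h.1] at i₁
      simp [TtoG.contractL, hD, mapL_append, parL_append, i₁, i₂]
    · simp only [Bool.not_eq_true] at hD
      have := h₂ v (.inl rfl) hD
      rw [h.1] at this
      simp [TtoG.contractL, hD, ParL, i₁, i₂, this]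


/-! ### Rebuilding the pointers -/

/-- Construct the tree with labels `NLAB` and parent pointers `NPAR`. -/
def finish : Cmd :=
  .write CHILD 0 0 ;;
  forUp (.write LABEL (.reg I) (.read NLAB (.reg I)) ;;
    .write PARENT (.reg I) (.read NPAR (.reg I)) ;; .write CHILD (.reg I) 0) ;;
  forDown (.write NEXT (.reg I) (.read CHILD (.read PARENT (.reg I))) ;;
    .write CHILD (.read PARENT (.reg I)) (.reg I)) ;;
  .set ROOT 1

theorem finish_spec {s : State} {us : List (RTree ℕ)} {N : ℕ} (hN : s.reg SIZE = N)
    (hl : labelsL [node 1 us] = List.range' 1 N) (hp : ParL (s.arr NPAR) 0 [node 1 us]) :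
    Tri finish s (60 * (N + 1)) (fun s' => Canon s' us N ∧
      ∀ v, 1 ≤ v → v ≤ N → s'.arr LABEL v = s.arr NLAB v) := by
  -- Parents precede their children in preorder; for the root this reads `0 < 1`.
  have hlt : ∀ v, 1 ≤ v → v ≤ N → s.arr NPAR v < v := by
    intro v h₁ h₂
    have hv : v ∈ labelsL [node 1 us] := by rw [hl, List.mem_range'_1]; omega
    have key : ∀ {p q m : ℕ} {ts : List (RTree ℕ)}, labelsL ts = List.range' q m →
        ParL (s.arr NPAR) p ts → p < q → ∀ v ∈ labelsL ts, s.arr NPAR v < v := by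
      intro p q m ts
      induction ts using forest_induction generalizing p q m with
      | nil => simp
      | cons a us ts ih₁ ih₂ =>
        intro hl hp hpq v hv
        rw [labelsL_cons] at hl
        obtain ⟨rfl, h₁, h₂, h₃⟩ := range'_cons_append hl
        rw [ParL] at hp
        simp only [labelsL_cons, List.mem_cons, List.mem_append] at hv
        rcases hv with rfl | hv | hv
        · rw [hp.1]; exact hpq
        · exact ih₁ h₁ hp.2.1 (by omega) v hv
        · exact ih₂ h₂ hp.2.2 (by omega) v hv
    exact key hl hp (by omega) v hv
  refine Tri.mono (b := 6 + ((N * (20 + 10) + 8) + ((N * (20 + 10) + 8) + 2))) (Tri.seqF (R := fun s' => s'.arr CHILD 0 = 0)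
    (.flat rfl (by decide) (by simp)) fun s₁ h₁ f₁ => ?_) (by omega) fun _ h => h
  have e₁ : s₁.arr NLAB = s.arr NLAB ∧ s₁.arr NPAR = s.arr NPAR ∧ s₁.reg SIZE = N :=
    ⟨f₁.2 _ rfl, f₁.2 _ rfl, (f₁.1 _ rfl).trans hN⟩
  refine Tri.seqF (Tri.forUp (C := 20) (fun i s' =>
    (∀ v, 1 ≤ v → v < i → s'.arr LABEL v = s.arr NLAB v ∧ s'.arr PARENT v = s.arr NPAR v) ∧
      ∀ v, v < i → s'.arr CHILD v = 0) rfl rfl (fun i s x h => h) ?_ e₁.2.2 ?_) ?_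
  · exact ⟨fun v h₁ h₂ => by omega, fun v hv => by obtain rfl : v = 0 := (by omega); exact h₁⟩
  · intro i s₂ hf hi hiN hI hJ
    have e₂ : s₂.arr NLAB = s.arr NLAB := (hf.2 _ rfl).trans e₁.1
    have e₃ : s₂.arr NPAR = s.arr NPAR := (hf.2 _ rfl).trans e₁.2.1
    refine .flat rfl (by decide) ⟨fun v h₁ h₂ => ?_, fun v h₂ => ?_⟩
    · rcases eq_or_ne v i with rfl | hv
      · simp +decide [hI, e₂, e₃]
      · have := hJ.1 v h₁ (by omega)
        simp +decide [hI, hv, this]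
    · rcases eq_or_ne v i with rfl | hv
      · simp +decide [hI]
      · have := hJ.2 v (by omega)
        simp +decide [hI, hv, this]
  intro s₂ ⟨h₂, h₃⟩ f₂
  have e₂ : s₂.reg SIZE = N := (f₂.1 _ rfl).trans e₁.2.2
  -- Going downwards, every node is put in front of the child list of its parent. After the nodes
  -- greater than `i` have been treated, `CHILD p` is the first of them with parent `p`, and `NEXT
  -- v` is the content that `CHILD` had just before `v` was inserted. The case `p = 0` is included
  -- because the root is inserted there.
  refine Tri.seqF (Tri.forDown (C := 20) (fun i s' =>
    (∀ p, p ≤ N → IsFirst (s.arr NPAR) N (i + 1) p (s'.arr CHILD p)) ∧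
      ∀ v, i < v → v ≤ N → IsFirst (s.arr NPAR) N (v + 1) (s.arr NPAR v) (s'.arr NEXT v))
    rfl (fun i s x h => h) ?_ e₂ ?_) ?_
  · exact ⟨fun p hp => .inl ⟨h₃ p (by omega), fun u h₁ h₂ => by omega⟩,
      fun v h₁ h₂ => by omega⟩
  · intro i s₃ hf hi hiN hI hJ
    have hP : s₃.arr PARENT i = s.arr NPAR i := by
      rw [hf.2 PARENT rfl]; exact (h₂ i hi (by omega)).2
    have hlt' := hlt i hi hiN
    have hi1 : i - 1 + 1 = i := by omega
    refine .flat rfl (by decide) ⟨fun p hp => ?_, fun v h₁ h₂ => ?_⟩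
    · rcases eq_or_ne p (s.arr NPAR i) with rfl | hne
      · simp +decide [hI, hP, hi1]
        exact .inr ⟨le_rfl, hiN, rfl, fun u h₁ h₂ => by omega⟩
      · simp +decide [hI, hP, hne, hi1]
        rcases hJ.1 p hp with ⟨h₁, h₂⟩ | ⟨h₁, h₂, h₃, h₄⟩
        · refine .inl ⟨h₁, fun u h₃ h₄ => ?_⟩
          rcases Nat.eq_or_lt_of_le h₃ with rfl | h₃
          · exact hne.symm
          · exact h₂ u h₃ h₄
        · refine .inr ⟨by omega, h₂, h₃, fun u h₅ h₆ => ?_⟩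
          rcases Nat.eq_or_lt_of_le h₅ with rfl | h₅
          · exact hne.symm
          · exact h₄ u h₅ h₆
    · rcases eq_or_ne v i with rfl | hv
      · simp +decide [hI, hP]
        exact hJ.1 _ (by omega)
      · simp +decide [hI, hv]
        exact hJ.2 v (by omega) h₂
  intro s₃ ⟨h₄, h₅⟩ f₃
  refine .flat rfl (by decide) ⟨⟨hl, ?_, by simp, ?_⟩, fun v hv₁ hv₂ => ?_⟩
  · have hP : ∀ v, 1 ≤ v → v ≤ N → s₃.arr PARENT v = s.arr NPAR v := fun v hv₁ hv₂ => by
      rw [f₃.2 PARENT rfl]; exact (h₂ v hv₁ (by omega)).2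
    refine linkedL_congr (s := s₃) (s' := (Cmd.set ROOT 1).run s₃) rfl rfl rfl ?_
    refine linkedL_of_first (P := s.arr NPAR) (N := N) (q := 1) (m := N) hP (fun v hv₁ hv₂ => ?_)
      (fun v hv₁ hv₂ => h₅ v hv₁ hv₂) hl hp ?_ (by omega) (by omega) fun u hu₁ hu₂ => by omega
    · refine (h₄ v hv₂).mono (by omega) fun u hu₁ hu₂ h => ?_
      have := hlt u hu₁ (by omega)
      omega
    · have hNpos : 1 ≤ N := by
        have : 1 ∈ List.range' 1 N := by rw [← hl]; simp
        rw [List.mem_range'_1] at this; omega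
      rw [ParL] at hp
      exact .inr ⟨le_rfl, hNpos, hp.1, fun u h₁ h₂ => by omega⟩
  · simpa +decide [e₂] using f₃.1 SIZE rfl
  · change s₃.arr LABEL v = _
    rw [f₃.2 LABEL rfl]
    exact (h₂ v hv₁ (by omega)).1

/-! ### Deleting nodes -/

/-- Delete the nodes marked in `DEL`, relabel the others according to `NL`. -/
def contractP : Cmd :=
  .write REP 0 0 ;; .set R1 0 ;;
  forUp (.ite (.read DEL (.reg I)) (.write REP (.reg I) (.read REP (.read PARENT (.reg I))))
    (.set R1 (.reg R1 + 1) ;; .write REP (.reg I) (.reg R1) ;;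
      .write NLAB (.reg R1) (.read NL (.reg I)) ;;
      .write NPAR (.reg R1) (.read REP (.read PARENT (.reg I))))) ;;
  .set SIZE (.reg R1) ;; finish

/-- When a node is reached in preorder, the representative of its parent is already known. Surviving
nodes are numbered consecutively in the order of their old addresses, so the new addresses are again
in preorder. The root must survive, since otherwise the contraction could be a forest with several
roots. -/
theorem contractP_spec {s : State} {us : List (RTree ℕ)} {N : ℕ} (hs : Canon s us N)
    {D : ℕ → Bool} (hD : ∀ v, 1 ≤ v → v ≤ N → (D v = true ↔ s.arr DEL v ≠ 0))
    (hD1 : s.arr DEL 1 = 0) :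
    Tri contractP s (200 * N) (fun s' => ∃ us', Canon s' us' (1 + (labelsL (contractL D us)).length) ∧
      mapL (s'.arr LABEL) us' = mapL (s.arr NL) (contractL D us) ∧
      s'.arr LABEL 1 = s.arr NL 1) := by
  have hNpos := hs.pos
  have hD1' : D 1 = false := by
    rw [← Bool.not_eq_true, hD 1 le_rfl hNpos]; simpa using hD1
  -- These are the surviving nodes less than `i`; the register `R1` holds their number.
  set kept : ℕ → List ℕ := fun i => (List.range' 1 (i - 1)).filter (fun v => !D v) with hk
  have kept_succ : ∀ i, 1 ≤ i → kept (i + 1) = kept i ++ if D i then [] else [i] := by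
    intro i hi
    simp only [hk]
    rw [show i + 1 - 1 = (i - 1) + 1 by omega, List.range'_concat, List.filter_append,
      show 1 + 1 * (i - 1) = i by omega]
    cases h : D i <;> simp [h]
  have hkN : (kept (N + 1)) = labelsL (contractL D [node 1 us]) := by
    rw [labelsL_contractL, hs.labels]
    rfl
  have hlen : (kept (N + 1)).length = 1 + (labelsL (contractL D us)).length := by
    rw [hkN]; simp [contractL, hD1']; omega
  have hkle : (kept (N + 1)).length ≤ N :=
    (List.length_filter_le _ _).trans (by simp)
  refine Tri.mono (b := 6 + (2 + ((N * (20 + 10) + 8) + (2 + 60 * (N + 1))))) ?_ (by omega) fun _ h => h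
  refine Tri.seqF (R := fun s' => s'.arr REP 0 = 0) (.flat rfl (by decide) (by simp))
    fun s₁ h₁ f₁ => ?_
  refine Tri.seqF (R := fun s' => s'.reg R1 = 0 ∧ s'.arr REP 0 = 0)
    (.flat rfl (by decide) (by simp [h₁])) fun s₂ h₂ f₂ => ?_
  have hs₂ := (hs.frame f₁ rfl).frame f₂ rfl
  have eP : s₂.arr PARENT = s.arr PARENT := (f₂.2 _ rfl).trans (f₁.2 _ rfl)
  have eL : s₂.arr NL = s.arr NL := (f₂.2 _ rfl).trans (f₁.2 _ rfl)
  have eD : s₂.arr DEL = s.arr DEL := (f₂.2 _ rfl).trans (f₁.2 _ rfl)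
  refine Tri.seqF (Tri.forUp (C := 20) (fun i s' =>
    s'.reg R1 = (kept i).length ∧ s'.arr REP 0 = 0 ∧
    (∀ v, v < i → s'.arr REP v ≤ s'.reg R1) ∧
    (kept i).map (s'.arr REP) = List.range' 1 (s'.reg R1) ∧
    ∀ v, 1 ≤ v → v < i → if D v then s'.arr REP v = s'.arr REP (s.arr PARENT v) else
      s'.arr NLAB (s'.arr REP v) = s.arr NL v ∧
      s'.arr NPAR (s'.arr REP v) = s'.arr REP (s.arr PARENT v)) rfl rfl (fun i s x h => h)
    ?_ hs₂.size ?_) ?_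
  · refine ⟨by simp [h₂.1, hk], h₂.2, fun v hv => ?_, by simp [h₂.1, hk], fun v h₁ h₂ => by omega⟩
    obtain rfl : v = 0 := by omega
    rw [h₂.2]; omega
  · intro i s₃ hf hi hiN hI ⟨j₁, j₂, j₃, j₄, j₅⟩
    have eP' : s₃.arr PARENT = s.arr PARENT := (hf.2 _ rfl).trans eP
    have eL' : s₃.arr NL = s.arr NL := (hf.2 _ rfl).trans eL
    have eD' : s₃.arr DEL = s.arr DEL := (hf.2 _ rfl).trans eD
    have hpl := hs.parent_lt hi hiN
    have hmem : ∀ v ∈ kept i, v < i := fun v hv => by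
      simp [hk] at hv; omega
    by_cases hDi : D i = true
    · have hDi' : s.arr DEL i ≠ 0 := (hD i hi hiN).1 hDi
      refine .flat rfl (by decide) ?_
      simp +decide only [Cmd.run, Expr.eval_read, Expr.eval_reg, hI, eD', hDi', if_false, eP',
        State.setA_reg]
      refine ⟨by rw [kept_succ i hi]; simpa [hDi] using j₁, ?_, fun v hv => ?_, ?_, fun v h₁ h₂ => ?_⟩
      · simp [j₂]; omega
      · rcases eq_or_ne v i with rfl | hv'
        · simp; exact j₃ _ hpl
        · simp [hv']; exact j₃ v (by omega)
      · rw [kept_succ i hi]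
        simp only [hDi, if_true, List.append_nil, ← j₄]
        refine List.map_congr_left fun v hv => ?_
        have := hmem v hv
        simp; omega
      · rcases eq_or_ne v i with rfl | hv'
        · simp [hDi, hpl.ne]
        · have hpv := hs.parent_lt h₁ (show v ≤ N by omega)
          have h4 : s.arr PARENT v ≠ i := by omega
          have := j₅ v h₁ (by omega)
          simpa +decide [hv', h4] using this
    · have hDi' : s.arr DEL i = 0 := by
        by_contra h; exact hDi ((hD i hi hiN).2 h)
      simp only [Bool.not_eq_true] at hDi
      have hne1 : s.arr PARENT i ≠ i := hpl.ne
      refine .flat rfl (by decide) ?_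
      simp +decide only [Cmd.run, Expr.eval_read, Expr.eval_reg, hI, eD', hDi', if_true, eP',
        State.setA_reg, State.setR_reg, State.setR_arr, State.setA_arr, Expr.eval_add,
        Expr.eval_one, if_false, true_and, false_and, eL', hne1]
      refine ⟨by rw [kept_succ i hi]; simp [hDi, j₁], ?_, fun v hv => ?_, ?_, fun v h₁ h₂ => ?_⟩
      · simp [j₂]; omega
      · rcases eq_or_ne v i with rfl | hv'
        · simp
        · simp [hv']; exact (j₃ v (by omega)).trans (by omega)
      · rw [kept_succ i hi, List.range'_concat, ← j₄]
        simp only [hDi, List.map_append]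
        congr 1
        · refine List.map_congr_left fun v hv => ?_
          have := hmem v hv
          simp +decide; omega
        · simp +decide; omega
      · rcases eq_or_ne v i with rfl | hv'
        · simp [hDi, hne1]
        · have hpv := hs.parent_lt h₁ (show v ≤ N by omega)
          have h4 : s.arr PARENT v ≠ i := by omega
          have h5 := j₃ v (by omega)
          -- The newly assigned number is greater than all earlier ones, so the entries of `NLAB`
          -- and `NPAR` for earlier nodes are not overwritten.
          have h6 : s₃.arr REP v ≠ s₃.reg R1 + 1 := by omega
          have := j₅ v h₁ (by omega)
          simpa +decide [hv', h4, h6] using this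
  intro s₃ ⟨j₁, j₂, j₃, j₄, j₅⟩ f₃
  refine Tri.seqF (R := fun s' => s'.reg SIZE = (kept (N + 1)).length)
    (.flat rfl (by decide) (by simp [j₁])) fun s₄ h₄ f₄ => ?_
  have e₁ : s₄.arr NLAB = s₃.arr NLAB := f₄.2 _ rfl
  have e₂ : s₄.arr NPAR = s₃.arr NPAR := f₄.2 _ rfl
  set rep := s₃.arr REP with hrep
  have hlab : labelsL (mapL rep (contractL D [node 1 us])) =
      List.range' 1 (kept (N + 1)).length := by
    rw [labelsL_mapL, ← hkN, j₄, j₁]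
  have hc : contractL D [node 1 us] = [node 1 (contractL D us)] := by simp [contractL, hD1']
  have hrep1 : rep 1 = 1 := by
    rw [hc, hlen, add_comm 1] at hlab
    simp only [mapL_cons, labelsL_cons, List.range'_succ] at hlab
    exact (List.cons.inj hlab).1
  have hpar : ParL (s₄.arr NPAR) 0 (mapL rep (contractL D [node 1 us])) := by
    rw [e₂, ← j₂]
    refine hs.linked.parL.contractL (fun v hv hDv => ?_) fun v hv hDv => ?_
    · have hv' := hs.mem_iff.1 hv
      have := j₅ v hv'.1 (by omega)
      simpa [hDv] using this
    · have hv' := hs.mem_iff.1 hv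
      have := j₅ v hv'.1 (by omega)
      simp only [hDv] at this
      exact this.2
  have hmapc : mapL rep (contractL D [node 1 us]) = [node 1 (mapL rep (contractL D us))] := by
    rw [hc, mapL_cons, hrep1, mapL_nil]
  rw [hmapc] at hlab hpar
  refine (finish_spec h₄ hlab hpar).mono (by omega) fun s' ⟨hs', hL⟩ => ?_
  have hfin : ∀ v ∈ labelsL (contractL D [node 1 us]), s'.arr LABEL (rep v) = s.arr NL v := by
    intro v hv
    have hv1 : 1 ≤ rep v ∧ rep v ≤ (kept (N + 1)).length := by
      have : rep v ∈ (kept (N + 1)).map rep := List.mem_map_of_mem (by rwa [hkN])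
      rw [j₄, List.mem_range'_1] at this
      omega
    rw [hL _ hv1.1 hv1.2, e₁]
    rw [labelsL_contractL, List.mem_filter] at hv
    have hv' := hs.mem_iff.1 hv.1
    have := j₅ v hv'.1 (by omega)
    have hDv : D v = false := by simpa using hv.2
    simp only [hDv] at this
    exact this.1
  rw [hc] at hfin
  refine ⟨mapL rep (contractL D us), ?_, ?_, ?_⟩
  · rw [← hlen]; exact hs'
  · rw [mapL_mapL]
    exact mapL_congr fun v hv => hfin v (by simp [hv])
  · have := hfin 1 (by simp)
    rwa [hrep1] at this


-- Bottom-up induction over the nodes of a forest, and unary nodes in memory.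

theorem nodes_trans {α : Type} {ts : List (RTree α)} {v b : α} {ws xs : List (RTree α)}
    (hv : (v, ws) ∈ nodesL ts) (hb : node b xs ∈ ws) : (b, xs) ∈ nodesL ts := by
  have root : ∀ {ts : List (RTree α)}, node b xs ∈ ts → (b, xs) ∈ nodesL ts := by
    intro ts h
    induction ts with
    | nil => simp at h
    | cons t ts ih =>
      obtain ⟨a, us⟩ := t
      simp only [List.mem_cons, node.injEq] at h
      simp only [nodesL, List.mem_cons, Prod.mk.injEq, List.mem_append]
      rcases h with h | h
      · exact .inl h
      · exact .inr (.inr (ih h))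
  induction ts using forest_induction with
  | nil => simp [nodesL] at hv
  | cons a us ts ih₁ ih₂ =>
    simp only [nodesL, List.mem_cons, Prod.mk.injEq, List.mem_append] at hv ⊢
    rcases hv with ⟨rfl, rfl⟩ | hv | hv
    · exact .inr (.inl (root hb))
    · exact .inr (.inl (ih₁ hv))
    · exact .inr (.inr (ih₂ hv))

/-- Induction over the nodes of a forest, from the leaves to the roots. -/
theorem nodes_induction {α : Type} {ts : List (RTree α)} {P : α → List (RTree α) → Prop}
    (h : ∀ v ws, (v, ws) ∈ nodesL ts → (∀ b xs, node b xs ∈ ws → P b xs) → P v ws) :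
    ∀ v ws, (v, ws) ∈ nodesL ts → P v ws := by
  have key : ∀ us : List (RTree α), (∀ v ws, (v, ws) ∈ nodesL us → (v, ws) ∈ nodesL ts) →
      (∀ v ws, (v, ws) ∈ nodesL us → P v ws) ∧ ∀ v ws, node v ws ∈ us → P v ws := by
    intro us
    induction us using forest_induction with
    | nil => simp [nodesL]
    | cons a us us' ih₁ ih₂ =>
      intro hs
      simp only [nodesL, List.mem_cons, Prod.mk.injEq, List.mem_append] at hs
      have i₁ := ih₁ fun v ws hv => hs v ws (.inr (.inl hv))
      have i₂ := ih₂ fun v ws hv => hs v ws (.inr (.inr hv))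
      have ha : P a us := h a us (hs a us (.inl ⟨rfl, rfl⟩)) i₁.2
      refine ⟨fun v ws hv => ?_, fun v ws hv => ?_⟩
      · simp only [nodesL, List.mem_cons, Prod.mk.injEq, List.mem_append] at hv
        rcases hv with ⟨rfl, rfl⟩ | hv | hv
        · exact ha
        · exact i₁.1 v ws hv
        · exact i₂.1 v ws hv
      · simp only [List.mem_cons, node.injEq] at hv
        rcases hv with ⟨rfl, rfl⟩ | hv
        · exact ha
        · exact i₂.2 v ws hv
  exact (key ts fun _ _ h => h).1

theorem mem_roots {α : Type} {b : α} {ws xs : List (RTree α)} (h : node b xs ∈ ws) :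
    b ∈ roots ws := List.mem_map_of_mem (f := fun | node a _ => a) h

/-- The node `v` is unary. -/
def IsUn (s : State) (v : ℕ) : Prop := s.arr CHILD v ≠ 0 ∧ s.arr NEXT (s.arr CHILD v) = 0

namespace Canon
variable {s : State} {us : List (RTree ℕ)} {N : ℕ}

theorem unary (h : Canon s us N) {v b : ℕ} {xs : List (RTree ℕ)}
    (hv : (v, [node b xs]) ∈ nodesL [node 1 us]) :
    IsUn s v ∧ s.arr CHILD v = b ∧ s.arr PARENT b = v ∧ (b, xs) ∈ nodesL [node 1 us] := by
  obtain ⟨h₁, h₂, h₃, h₄⟩ := h.of_mem hv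
  rw [linkedL_cons, linkedL_nil] at h₃
  have := h₄ b (by simp)
  exact ⟨⟨by omega, by rw [h₃.1]; exact h₃.2.2.2⟩, h₃.1, h₃.2.1, nodes_trans hv (by simp)⟩

theorem isUn_iff (h : Canon s us N) {v : ℕ} {ws : List (RTree ℕ)}
    (hv : (v, ws) ∈ nodesL [node 1 us]) : IsUn s v ↔ ∃ b xs, ws = [node b xs] := by
  refine ⟨fun ⟨hc, hn⟩ => ?_, ?_⟩
  · obtain ⟨h₁, h₂, h₃, h₄⟩ := h.of_mem hv
    match ws, h₃, h₄ with
    | [], h₃, _ => rw [linkedL_nil] at h₃; exact absurd h₃ hc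
    | [node b xs], _, _ => exact ⟨b, xs, rfl⟩
    | node b xs :: node b' xs' :: ws, h₃, h₄ =>
      rw [linkedL_cons, linkedL_cons] at h₃
      rw [h₃.1, h₃.2.2.2.1] at hn
      have := h₄ b' (by simp)
      omega
  · rintro ⟨b, xs, rfl⟩
    exact (h.unary hv).1

theorem parent_of_mem (h : Canon s us N) {v b : ℕ} {ws xs : List (RTree ℕ)}
    (hv : (v, ws) ∈ nodesL [node 1 us]) (hb : node b xs ∈ ws) : s.arr PARENT b = v :=
  parent_of_root (h.of_mem hv).2.2.1 (mem_roots hb)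

theorem root_mem : (1, us) ∈ nodesL [node 1 us] := by simp [nodesL]

end Canon

/-! ### The three compressions as contractions -/

section contraction
variable {s : State} {us : List (RTree ℕ)} {N : ℕ} {nm : Desc → ℕ} {D : ℕ → Bool}
  {lb nl rn : ℕ → ℕ}

/-- The hypothesis `hr` is the recurrence by which a program computes `rn` from the children. It
determines `rn` at all nodes, and `topRun` satisfies it. -/
theorem topRun_eq (h : Canon s us N)
    (hr : ∀ v, 1 ≤ v → v ≤ N → (IsUn s v →
      rn v = if lb (s.arr CHILD v) = lb v then rn (s.arr CHILD v) + 1 else 1) ∧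
      (¬ IsUn s v → rn v = 0)) :
    ∀ v ws, (v, ws) ∈ nodesL [node 1 us] → rn v = topRun (lb v) (node (lb v) (mapL lb ws)) := by
  refine nodes_induction fun v ws hv ih => ?_
  obtain ⟨h₁, h₂, -, -⟩ := h.of_mem hv
  have hr := hr v h₁ h₂
  match ws, hv, ih with
  | [], hv, _ =>
    rw [hr.2 (by rw [h.isUn_iff hv]; simp)]
    simp [topRun]
  | [node b xs], hv, ih =>
    obtain ⟨u₁, u₂, u₃, u₄⟩ := h.unary hv
    rw [hr.1 u₁, u₂]
    have hb := ih b xs (by simp)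
    simp only [mapL_cons, mapL_nil, topRun, if_true]
    split_ifs with hl
    · rw [← hl, hb]
    · cases hx : mapL lb xs with
      | nil => simp [topRun]
      | cons x xs' => cases xs' <;> simp [topRun, hl]
  | node b xs :: node b' xs' :: ws, hv, _ =>
    rw [hr.2 (by rw [h.isUn_iff hv]; simp)]
    simp [topRun]

/-- A node is deleted if it continues the chain of its parent. The recursion gives a new label to
the inner nodes of a chain as well, but each one is discarded when the node above takes over the
children, so only the label chosen at the top survives; accordingly `nl` may be arbitrary
garbage-free data at deleted nodes. -/
theorem chainTree_eq (h : Canon s us N)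
    (hr : ∀ v, 1 ≤ v → v ≤ N → (IsUn s v →
      rn v = if lb (s.arr CHILD v) = lb v then rn (s.arr CHILD v) + 1 else 1) ∧
      (¬ IsUn s v → rn v = 0))
    (hD : ∀ v, 2 ≤ v → v ≤ N → (D v = true ↔ 2 ≤ rn (s.arr PARENT v)))
    (hn : ∀ v, 1 ≤ v → v ≤ N → nl v = if 2 ≤ rn v then nm (.chain (lb v) (rn v)) else lb v) :
    ∀ v ws, (v, ws) ∈ nodesL [node 1 us] →
      chainTree nm (node (lb v) (mapL lb ws)) = node (nl v) (mapL nl (contractL D ws)) := by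
  have ht := topRun_eq h hr
  refine nodes_induction fun v ws hv ih => ?_
  obtain ⟨h₁, h₂, -, h₃⟩ := h.of_mem hv
  have key : rn v < 2 → chainTreeL nm (mapL lb ws) = mapL nl (contractL D ws) := by
    intro hv2
    have : ∀ ys, (∀ t ∈ ys, t ∈ ws) → chainTreeL nm (mapL lb ys) = mapL nl (contractL D ys) := by
      intro ys hys
      induction ys with
      | nil => simp [chainTreeL, contractL]
      | cons t ys ihy =>
        obtain ⟨b, xs⟩ := t
        have hb := hys (node b xs) (by simp)
        have hDb : D b = false := by
          have := h₃ b (roots_subset _ (mem_roots hb))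
          rw [← Bool.not_eq_true, hD b (by omega) this.2, h.parent_of_mem hv hb]
          omega
        rw [mapL_cons, chainTreeL, ih b xs hb, ihy fun t ht => hys t (by simp [ht]), contractL]
        simp [hDb]
    exact this ws fun _ h => h
  have hn := hn v h₁ h₂
  match ws, hv, ih, key, h₃ with
  | [], hv, _, key, _ =>
    have h0 : rn v = 0 := (hr v h₁ h₂).2 (by rw [h.isUn_iff hv]; simp)
    rw [← key (by omega), hn, if_neg (by omega)]
    simp [chainTree]
  | [node b xs], hv, ih, key, h₃ =>
    have hb := ih b xs (by simp)
    have htv := ht v _ hv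
    simp only [mapL_cons, mapL_nil, topRun, if_true] at htv
    simp only [mapL_cons, mapL_nil, chainTree]
    split_ifs with h0
    · rw [hn, if_neg (by omega), ← key (by omega)]
      simp [chainTreeL]
    · have hDb : D b = true := by
        have := h₃ b (by simp)
        rw [hD b (by omega) this.2, (h.unary hv).2.2.1]
        omega
      rw [hb, hn, if_pos (by omega), ← htv]
      simp [contractL, hDb]
  | node b xs :: node b' xs' :: ws, hv, _, key, _ =>
    have h0 : rn v = 0 := (hr v h₁ h₂).2 (by rw [h.isUn_iff hv]; simp)
    rw [← key (by omega), hn, if_neg (by omega)]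
    simp [chainTree]

theorem leafTree_eq (hD : ∀ v ws, (v, ws) ∈ nodesL [node 1 us] → (D v = true ↔ ws = []))
    (hn : ∀ v ws, (v, ws) ∈ nodesL [node 1 us] → nl v =
      if leafList 1 (mapL lb ws) = [] then lb v else nm (.leaf (lb v) (leafList 1 (mapL lb ws)))) :
    ∀ v ws, (v, ws) ∈ nodesL [node 1 us] →
      leafTree nm (node (lb v) (mapL lb ws)) = node (nl v) (mapL nl (contractL D ws)) := by
  refine nodes_induction fun v ws hv ih => ?_
  rw [leafTree, hn v ws hv]
  congr 1
  have : ∀ ys, (∀ t ∈ ys, t ∈ ws) → leafTreeL nm (mapL lb ys) = mapL nl (contractL D ys) := by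
    intro ys hys
    induction ys with
    | nil => simp [leafTreeL, contractL]
    | cons t ys ihy =>
      obtain ⟨b, xs⟩ := t
      have hb := hys (node b xs) (by simp)
      have hDb := hD b xs (nodes_trans hv hb)
      have ihy := ihy fun t ht => hys t (by simp [ht])
      match xs, hb, hDb with
      | [], _, hDb =>
        have : D b = true := by simpa using hDb
        simp [leafTreeL, contractL, this, ihy]
      | node c zs :: xs, hb, hDb =>
        have hDb' : D b = false := by rw [← Bool.not_eq_true, hDb]; simp
        have := ih b _ hb
        simp only [mapL_cons] at this
        simp only [mapL_cons, leafTreeL, this, ihy, contractL, hDb']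
        simp
  exact this ws fun _ h => h

/-- Merging a node with its child makes the recursion jump to the grandchild, so the claim is
carried for the node together with its children. The grandchild itself is not deleted: this would
require the label of the child to be in `up`, but it is in `down`, and the sides are disjoint. -/
theorem pairTree_eq (h : Canon s us N) {up down : List ℕ} (hdis : ∀ a ∈ up, a ∉ down)
    (hD : ∀ v, 2 ≤ v → v ≤ N → (D v = true ↔
      IsUn s v ∧ IsUn s (s.arr PARENT v) ∧ lb (s.arr PARENT v) ∈ up ∧ lb v ∈ down))
    (hn : ∀ v, 1 ≤ v → v ≤ N →
      (IsUn s v ∧ IsUn s (s.arr CHILD v) ∧ lb v ∈ up ∧ lb (s.arr CHILD v) ∈ down →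
        nl v = nm (.pair (lb v) (lb (s.arr CHILD v)))) ∧
      (¬ (IsUn s v ∧ IsUn s (s.arr CHILD v) ∧ lb v ∈ up ∧ lb (s.arr CHILD v) ∈ down) →
        nl v = lb v)) :
    ∀ v ws, (v, ws) ∈ nodesL [node 1 us] →
      pairTree nm up down (node (lb v) (mapL lb ws)) = node (nl v) (mapL nl (contractL D ws)) := by
  suffices H : ∀ v ws, (v, ws) ∈ nodesL [node 1 us] →
      pairTree nm up down (node (lb v) (mapL lb ws)) = node (nl v) (mapL nl (contractL D ws)) ∧
      ∀ b xs, node b xs ∈ ws →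
        pairTree nm up down (node (lb b) (mapL lb xs)) = node (nl b) (mapL nl (contractL D xs)) from
    fun v ws hv => (H v ws hv).1
  refine nodes_induction fun v ws hv ih => ⟨?_, fun b xs hb => (ih b xs hb).1⟩
  obtain ⟨h₁, h₂, -, h₃⟩ := h.of_mem hv
  have key : (∀ b xs, node b xs ∈ ws → D b = false) →
      pairTreeL nm up down (mapL lb ws) = mapL nl (contractL D ws) := by
    intro hDb
    have : ∀ ys, (∀ t ∈ ys, t ∈ ws) →
        pairTreeL nm up down (mapL lb ys) = mapL nl (contractL D ys) := by
      intro ys hys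
      induction ys with
      | nil => simp [pairTreeL, contractL]
      | cons t ys ihy =>
        obtain ⟨b, xs⟩ := t
        have hb := hys (node b xs) (by simp)
        rw [mapL_cons, pairTreeL, (ih b xs hb).1, ihy fun t ht => hys t (by simp [ht]), contractL]
        simp [hDb b xs hb]
    exact this ws fun _ h => h
  have notUn : ¬ IsUn s v → ∀ b xs, node b xs ∈ ws → D b = false := by
    intro hu b xs hb
    have := h₃ b (roots_subset _ (mem_roots hb))
    rw [← Bool.not_eq_true, hD b (by omega) this.2, h.parent_of_mem hv hb]
    exact fun h' => hu h'.2.1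
  have hn := hn v h₁ h₂
  match ws, hv, ih, key, h₃, notUn with
  | [], hv, _, key, _, hu =>
    have hu' : ¬ IsUn s v := by rw [h.isUn_iff hv]; simp
    rw [← key (hu hu'), hn.2 fun h' => hu' h'.1]
    simp [pairTree]
  | node b xs :: node b' xs' :: ws, hv, _, key, _, hu =>
    have hu' : ¬ IsUn s v := by rw [h.isUn_iff hv]; simp
    rw [← key (hu hu'), hn.2 fun h' => hu' h'.1]
    simp [pairTree]
  | [node b xs], hv, ih, key, h₃, _ =>
    obtain ⟨u₁, u₂, u₃, u₄⟩ := h.unary hv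
    have hb3 := h₃ b (by simp)
    have hDb := hD b (by omega) hb3.2
    rw [u₃] at hDb
    rw [u₂] at hn
    have other : ¬ (IsUn s b ∧ lb v ∈ up ∧ lb b ∈ down) →
        node (lb v) [pairTree nm up down (node (lb b) (mapL lb xs))] =
          node (nl v) (mapL nl (contractL D [node b xs])) := by
      intro hc
      rw [← key ?_, hn.2 fun h' => hc ⟨h'.2.1, h'.2.2⟩]
      · simp [pairTreeL]
      · intro b' xs' hb'
        simp only [List.mem_singleton, node.injEq] at hb'
        rw [hb'.1, ← Bool.not_eq_true, hDb]
        exact fun h' => hc ⟨h'.1, h'.2.2⟩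
    match xs, u₄, ih, other, hb3 with
    | [], u₄, _, other, _ =>
      have := other (by rw [h.isUn_iff u₄]; simp)
      simp only [mapL_cons, mapL_nil] at this ⊢
      rw [← this]
      simp [pairTree, pairTreeL]
    | node c ys :: node c' ys' :: xs, u₄, _, other, _ =>
      have := other (by rw [h.isUn_iff u₄]; simp)
      simp only [mapL_cons, mapL_nil] at this ⊢
      rw [← this]
      simp [pairTree, pairTreeL]
    | [node c ys], u₄, ih, other, hb3 =>
      obtain ⟨w₁, w₂, w₃, w₄⟩ := h.unary u₄
      simp only [mapL_cons, mapL_nil] at other ⊢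
      rw [pairTree]
      split_ifs with hc
      · have hb := (ih b [node c ys] (by simp)).2 c ys (by simp)
        have hDb' : D b = true := hDb.2 ⟨w₁, u₁, hc⟩
        have hDc : D c = false := by
          have := (h.of_mem u₄).2.2.2 c (by simp)
          rw [← Bool.not_eq_true, hD c (by omega) this.2, w₃]
          intro h'
          exact hdis _ h'.2.2.1 hc.2
        rw [hb, hn.1 ⟨u₁, w₁, hc⟩]
        simp [contractL, hDb', hDc]
      · exact other fun h' => hc ⟨h'.2.1, h'.2.2⟩

end contraction


/-! ### Stored productions -/

/-- The productions `G` are stored, and all their letters are less than `FR`. -/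
def PS (s : State) (G : Set Production) : Prop :=
  StoresProds s G ∧ ∀ p ∈ G, p.lhs < s.reg FR ∧ ∀ a ∈ p.rhs.letters, a < s.reg FR

theorem PS.congr {s s' : State} {G : Set Production} (h : PS s G) (hL : s'.reg LEN = s.reg LEN)
    (hP : ∀ i, i < s.reg LEN → s'.arr PRODS i = s.arr PRODS i) (hF : s.reg FR ≤ s'.reg FR) :
    PS s' G := by
  obtain ⟨⟨L, h₁, h₂, h₃, h₄⟩, h₅⟩ := h
  exact ⟨⟨L, h₁, h₂, hL.trans h₃, fun i hi => (hP i (by omega)).trans (h₄ i hi)⟩,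
    fun p hp => ⟨by have := (h₅ p hp).1; omega, fun a ha => by have := (h₅ p hp).2 a ha; omega⟩⟩

/-- Append a production with a new left-hand side. -/
theorem PS.emit {s s' : State} {G : Set Production} (h : PS s G) (p : Production)
    (hL : s'.reg LEN = s.reg LEN + p.encode.length)
    (hP : ∀ i, i < s.reg LEN → s'.arr PRODS i = s.arr PRODS i)
    (hE : ∀ (j : ℕ) (hj : j < p.encode.length), s'.arr PRODS (s.reg LEN + j) = p.encode[j])
    (hl : p.lhs = s.reg FR) (hF : s.reg FR < s'.reg FR)
    (hr : ∀ a ∈ p.rhs.letters, a < s'.reg FR) : PS s' (insert p G) := by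
  obtain ⟨⟨L, h₁, h₂, h₃, h₄⟩, h₅⟩ := h
  have hp : p ∉ G := fun hp => by have := (h₅ p hp).1; omega
  refine ⟨⟨L ++ [p], ?_, fun q => ?_, ?_, fun i hi => ?_⟩, ?_⟩
  · exact List.nodup_append.2 ⟨h₁, by simp, fun a ha b hb => by
      rw [List.mem_singleton.1 hb]
      rintro rfl
      exact hp ((h₂ _).1 ha)⟩
  · simp [h₂, or_comm]
  · simp [hL, h₃]
  · simp only [List.flatMap_append, List.flatMap_cons, List.flatMap_nil, List.append_nil,
      List.length_append] at hi ⊢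
    rcases Nat.lt_or_ge i (L.flatMap Production.encode).length with hi' | hi'
    · rw [List.getElem_append_left hi', hP i (by omega), h₄ i hi']
    · rw [List.getElem_append_right hi', ← hE _ (by omega)]
      congr 1
      omega
  · rintro q (rfl | hq)
    · exact ⟨by omega, hr⟩
    · exact ⟨by have := (h₅ q hq).1; omega, fun a ha => by have := (h₅ q hq).2 a ha; omega⟩

/-! ### The dictionary -/

/-- The entries `≥ m` of the table are pairwise different, and all entries are less than `f`. -/
def Dict (T : ℕ → ℕ) (m f : ℕ) : Prop :=
  (∀ k, T k < f) ∧ ∀ k k', m ≤ T k → T k = T k' → k = k'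

/-- With the threshold set to the current value of the counter all old entries count as absent, and
injectivity holds vacuously. This is why the table need not be cleared between compressions. -/
theorem Dict.init {T : ℕ → ℕ} {f : ℕ} (h : ∀ k, T k < f) : Dict T f f :=
  ⟨h, fun k _ hk => by have := h k; omega⟩

/-- The value `f` is greater than all entries so far, so it cannot collide with any of them. -/
theorem Dict.alloc {T T' : ℕ → ℕ} {m f k : ℕ} (h : Dict T m f)
    (hT : ∀ j, T' j = if j = k then f else T j) : Dict T' m (f + 1) := by
  refine ⟨fun j => ?_, fun i j hi hij => ?_⟩
  · have := h.1 j; rw [hT]; split_ifs <;> omega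
  · have h₁ := h.1 i
    have h₂ := h.1 j
    rw [hT] at hi
    rw [hT, hT] at hij
    split_ifs at hi hij with h₃ h₄ h₄
    · rw [h₃, h₄]
    · omega
    · omega
    · exact h.2 i j hi hij

/-- The key of a pair, with a tag. -/
def key (m x y t : ℕ) : ℕ := (x * m + y) * 4 + t

/-- Division by 4 and by `m` recovers the components. Only the second component has to be less than
`m`; the first one is unrestricted, so a key may itself be the first component of another key. -/
theorem key_inj {m x y t x' y' t' : ℕ} (h : key m x y t = key m x' y' t') (hy : y < m)
    (hy' : y' < m) (ht : t < 4) (ht' : t' < 4) : x = x' ∧ y = y' ∧ t = t' := by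
  unfold key at h
  obtain ⟨h₁, rfl⟩ : x * m + y = x' * m + y' ∧ t = t' := by omega
  have hx : x = x' := by
    have := congrArg (· / m) h₁
    simpa [Nat.add_div_of_dvd_right, Nat.div_eq_of_lt hy, Nat.div_eq_of_lt hy',
      Nat.mul_add_div (show 0 < m by omega), mul_comm _ m] using this
  subst hx
  exact ⟨rfl, by omega, rfl⟩

/-! ### The state between two compressions -/

/-- The configuration `X` is stored, with node addresses `1, 2, …` in preorder, and the letters
`≥ FR` have not been used. -/
def Good (s : State) (X : Config) : Prop :=
  ∃ us, Canon s us X.tree.size ∧ X.tree = node (s.arr LABEL 1) (mapL (s.arr LABEL) us) ∧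
    PS s X.prods ∧ (∀ a ∈ X.tree.labels, a < s.reg FR) ∧ X.tree.size < s.reg FR ∧
    ∀ k, s.arr TAB k < s.reg FR

theorem size_node {α : Type} (a : α) (us : List (RTree α)) :
    (node a us).size = 1 + (labelsL us).length := by simp [RTree.size, labels]; omega

theorem Good.stores {s : State} {X : Config} (h : Good s X) : Stores s X := by
  obtain ⟨us, h₁, h₂, h₃, -⟩ := h
  have hl : (node 1 us).labels = List.range' 1 X.tree.size := by
    have := h₁.labels
    simpa [labels] using this
  refine ⟨⟨node 1 us, ?_, fun v hv => ?_, ?_, ?_⟩, h₁.size, h₃.1⟩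
  · rw [hl]; exact List.nodup_range'
  · rw [hl, List.mem_range'_1] at hv; omega
  · rw [h₁.root]; exact h₁.linked
  · rw [map, h₂]

theorem Good.used {s : State} {X : Config} (h : Good s X) : ∀ a ∈ X.used, a < s.reg FR := by
  obtain ⟨us, h₁, h₂, h₃, h₄, -⟩ := h
  rintro a (ha | ⟨p, hp, rfl | ha⟩)
  · exact h₄ a ha
  · exact (h₃.2 p hp).1
  · exact (h₃.2 p hp).2 a ha

theorem contractP_good {s : State} {us : List (RTree ℕ)} {N : ℕ} (hs : Canon s us N)
    {D : ℕ → Bool} (hD : ∀ v, 1 ≤ v → v ≤ N → (D v = true ↔ s.arr DEL v ≠ 0))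
    (hD1 : s.arr DEL 1 = 0) {G : Set Production} (hG : PS s G)
    (hL : ∀ v, 1 ≤ v → v ≤ N → s.arr NL v < s.reg FR) (hN : N < s.reg FR)
    (hT : ∀ k, s.arr TAB k < s.reg FR) :
    Tri contractP s (200 * N)
      (fun s' => Good s' ⟨node (s.arr NL 1) (mapL (s.arr NL) (contractL D us)), G⟩) := by
  refine (contractP_spec hs hD hD1).frame.mono le_rfl fun s' ⟨⟨us', h₁, h₂, h₃⟩, hf⟩ => ?_
  have e₁ : s'.reg FR = s.reg FR := hf.1 _ rfl
  have sub : ∀ v ∈ labelsL (contractL D us), 1 ≤ v ∧ v ≤ N := fun v hv => by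
    rw [labelsL_contractL, List.mem_filter] at hv
    exact hs.mem_iff.1 (by simp [hv.1])
  have hsz : (node (s.arr NL 1) (mapL (s.arr NL) (contractL D us))).size =
      1 + (labelsL (contractL D us)).length := by
    rw [size_node, labelsL_mapL, List.length_map]
  refine ⟨us', ?_, ?_, hG.congr (hf.1 _ rfl) (fun i _ => by rw [hf.2 PRODS rfl]) e₁.ge, ?_, ?_, ?_⟩
  · simp only [hsz]; exact h₁
  · simp only [h₂, h₃]
  · simp only [labels, labelsL_mapL, List.mem_cons, List.mem_map]
    rintro a (rfl | ⟨v, hv, rfl⟩)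
    · rw [e₁]; exact hL 1 le_rfl hs.pos
    · rw [e₁]; exact hL v (sub v hv).1 (sub v hv).2
  · simp only [hsz, e₁]
    have : (labelsL (contractL D us)).length ≤ (labelsL us).length := by
      rw [labelsL_contractL]; exact List.length_filter_le _ _
    have h' := congrArg List.length hs.labels
    simp at h'
    omega
  · rw [e₁, hf.2 TAB rfl]; exact hT

/-- The letters assigned by a naming are pairwise different and have not been used. -/
theorem fresh_of_names {X : Config} {nm : Desc → ℕ} {D : Set (Desc × Rhs)} {m : ℕ}
    (hX : ∀ a ∈ X.used, a < m) (h₁ : ∀ p ∈ D, m ≤ nm p.1)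
    (h₂ : ∀ p ∈ D, ∀ q ∈ D, nm p.1 = nm q.1 → p.1 = q.1) : Fresh X nm D := by
  refine ⟨?_, fun p hp h => ?_⟩
  · rintro _ ⟨p, hp, rfl⟩ _ ⟨q, hq, rfl⟩ h
    exact h₂ p hp q hq h
  · have := hX _ h
    have := h₁ p hp
    omega


/-! ### Preprocessing -/

/-- Take a node from the stack and number it. -/
def popNode : Cmd :=
  .set R3 (.read STK (.reg R1)) ;; .set R1 (.reg R1 - 1) ;; .set R2 (.reg R2 + 1) ;;
  .write REP (.reg R3) (.reg R2) ;; .write NLAB (.reg R2) (.read LABEL (.reg R3)) ;;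
  .write NPAR (.reg R2) (.read REP (.read PARENT (.reg R3))) ;;
  .ite (.op .lt (.reg FR) (.read LABEL (.reg R3) + 1))
    (.set FR (.read LABEL (.reg R3) + 1 + 1)) (.set FR (.reg FR + 1))

/-- Push the node to which the pointer in the array `A` leads. -/
def pushNode (A : ℕ) : Cmd :=
  .ite (.read A (.reg R3)) (.set R1 (.reg R1 + 1) ;; .write STK (.reg R1) (.read A (.reg R3))) .skip

/-- Number the nodes of the input tree in preorder. -/
def initP : Cmd :=
  .set FR 1 ;; .set R1 1 ;; .write STK 1 (.reg ROOT) ;;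
  .while (.reg R1) (popNode ;; pushNode NEXT ;; pushNode CHILD) ;; .set SIZE (.reg R2) ;; finish

/-- The stack of height `r` holds the sibling lists `fs`, whose parents are `0` or in `done`. -/
def Pend (s : State) (done : List ℕ) : ℕ → List (List (RTree ℕ)) → Prop
  | r, [] => r = 0
  | r, f :: fs => f ≠ [] ∧ 1 ≤ r ∧ (∃ p, LinkedL s p (s.arr STK r) f ∧ (p = 0 ∨ p ∈ done)) ∧
      Pend s done (r - 1) fs

theorem Pend.congr {s s' : State} {done done' : List ℕ} (h₁ : s'.arr PARENT = s.arr PARENT)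
    (h₂ : s'.arr CHILD = s.arr CHILD) (h₃ : s'.arr NEXT = s.arr NEXT) (h₅ : done ⊆ done')
    {fs : List (List (RTree ℕ))} {r : ℕ} (h₄ : ∀ i, i ≤ r → s'.arr STK i = s.arr STK i)
    (h : Pend s done r fs) : Pend s' done' r fs := by
  induction fs generalizing r with
  | nil => exact h
  | cons f fs ih =>
    obtain ⟨a, b, ⟨p, c, d⟩, e⟩ := h
    exact ⟨a, b, ⟨p, by rw [h₄ r le_rfl]; exact linkedL_congr h₁ h₂ h₃ c,
      d.imp_right fun h => h₅ h⟩, ih (fun i hi => h₄ i (by omega)) e⟩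

theorem contractL_false (ts : List (RTree ℕ)) : contractL (fun _ => false) ts = ts := by
  induction ts using forest_induction with
  | nil => simp [contractL]
  | cons a us ts ih₁ ih₂ => simp [contractL, ih₁, ih₂]

/-- The invariant of the traversal; `b` is the time left. -/
def InitInv (s₀ : State) (t : RTree ℕ) (b : ℕ) (s : State) : Prop :=
  ∃ done fs, s.arr LABEL = s₀.arr LABEL ∧ s.arr PARENT = s₀.arr PARENT ∧
    s.arr CHILD = s₀.arr CHILD ∧ s.arr NEXT = s₀.arr NEXT ∧
    done ++ fs.flatMap labelsL = labelsL [t] ∧ b = 100 * (fs.flatMap labelsL).length ∧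
    Pend s done (s.reg R1) fs ∧ s.arr REP 0 = 0 ∧ s.reg R2 = done.length ∧
    done.map (s.arr REP) = List.range' 1 done.length ∧ done.length < s.reg FR ∧
    ∀ v ∈ done, s.arr LABEL v < s.reg FR ∧ s.arr NLAB (s.arr REP v) = s.arr LABEL v ∧
      s.arr NPAR (s.arr REP v) = s.arr REP (s.arr PARENT v) ∧
      (s.arr PARENT v = 0 ∨ s.arr PARENT v ∈ done)

theorem pushNode_spec {A : ℕ} {s : State} {done : List ℕ} {p : ℕ}
    {f : List (RTree ℕ)} {fs : List (List (RTree ℕ))} (h : Pend s done (s.reg R1) fs)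
    (hf : LinkedL s p (s.arr A (s.reg R3)) f) (hp : p = 0 ∨ p ∈ done)
    (h0 : ∀ x ∈ labelsL f, 0 < x) :
    Tri (pushNode A) s 20 (fun s' =>
      Pend s' done (s'.reg R1) ((if f = [] then [] else [f]) ++ fs)) := by
  have hz : f = [] ↔ s.arr A (s.reg R3) = 0 := by
    cases f with
    | nil => simpa [linkedL_nil] using hf
    | cons u us =>
      obtain ⟨a, ws⟩ := u
      have := (linkedL_cons.1 hf).1
      have ha := h0 a (by simp)
      simp; omega
  have hF := Cmd.frame_run (p := pushNode A) rfl s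
  refine .flat rfl (by simp +decide [pushNode, Cmd.cst, Expr.cost]) ?_
  by_cases h₁ : f = []
  · have c₁ := hz.1 h₁
    simpa [pushNode, c₁, h₁] using h
  · have c₁ := mt hz.2 h₁
    have e₁ : ((pushNode A).run s).reg R1 = s.reg R1 + 1 := by simp [pushNode, c₁]
    have e₂ : ∀ i, ((pushNode A).run s).arr STK i =
        if i = s.reg R1 + 1 then s.arr A (s.reg R3) else s.arr STK i := by
      simp +decide [pushNode, c₁]
    rw [e₁]
    simp only [h₁, if_false, List.cons_append, List.nil_append]
    refine ⟨h₁, by omega, ⟨p, ?_, hp⟩, ?_⟩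
    · rw [e₂, if_pos rfl]
      exact linkedL_congr (hF.2 _ rfl) (hF.2 _ rfl) (hF.2 _ rfl) hf
    · refine Pend.congr (hF.2 _ rfl) (hF.2 _ rfl) (hF.2 _ rfl) (List.Subset.refl _)
        (fun i hi => ?_) h
      rw [e₂, if_neg (by omega)]

/-- The root of the topmost sibling list is numbered; then its remaining siblings are pushed, and
its children on top of them, so the children come next and the order is preorder. The parent of the
popped node has been numbered before, so its new address can be looked up. -/
theorem initBody_spec {s₀ s : State} {t : RTree ℕ} {b : ℕ} (hnd : (labelsL [t]).Nodup)
    (hpos : ∀ v ∈ labelsL [t], 0 < v) (h : InitInv s₀ t b s) (he : s.reg R1 ≠ 0) :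
    ∃ b', 90 + b' + 2 ≤ b ∧
      Tri (popNode ;; pushNode NEXT ;; pushNode CHILD) s 90 (InitInv s₀ t b') := by
  obtain ⟨done, fs, eL, eP, eC, eX, hsp, rfl, hp, h0, h2, hm, hF, hd⟩ := h
  match fs, hp with
  | [], hp => exact absurd hp he
  | [] :: fs, hp => exact absurd rfl hp.1
  | (node v us :: ts) :: fs, ⟨_, hr, ⟨p, hl, hpd⟩, hp⟩ =>
    rw [linkedL_cons] at hl
    obtain ⟨hv, hpar, hus, hts⟩ := hl
    refine ⟨100 * ((us :: ts :: fs).flatMap labelsL).length, by simp; omega, ?_⟩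
    have hvl : v ∈ labelsL [t] := by rw [← hsp]; simp
    have hv0 : v ≠ 0 := (hpos v hvl).ne'
    have hvd : v ∉ done := by
      rw [← hsp, List.nodup_append] at hnd
      exact fun h => hnd.2.2 v h v (by simp) rfl
    have hpv : p ≠ v := by
      rintro rfl
      rcases hpd with h | h
      · exact hv0 h
      · exact hvd h
    have hRle : ∀ u ∈ done, s.arr REP u ≤ done.length := fun u hu => by
      have : s.arr REP u ∈ done.map (s.arr REP) := List.mem_map_of_mem hu
      rw [hm, List.mem_range'_1] at this
      omega
    -- The counter `FR` grows with every node and exceeds the label of that node. In the end it is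
    -- greater than all labels of the input and greater than the number of nodes.
    have hreg : (popNode.run s).reg R2 = done.length + 1 ∧ (popNode.run s).reg R3 = v ∧
        (popNode.run s).reg R1 = s.reg R1 - 1 ∧
        s.reg FR < (popNode.run s).reg FR ∧ s.arr LABEL v < (popNode.run s).reg FR ∧
        (∀ u, (popNode.run s).arr REP u = if u = v then done.length + 1 else s.arr REP u) ∧
        (∀ u, (popNode.run s).arr NLAB u =
          if u = done.length + 1 then s.arr LABEL v else s.arr NLAB u) ∧
        (∀ u, (popNode.run s).arr NPAR u =
          if u = done.length + 1 then s.arr REP p else s.arr NPAR u) := by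
      simp +decide [popNode, hv, h2, hpar, hpv]
      split_ifs <;> omega
    have f₁ : Frame popNode s (popNode.run s) := Cmd.frame_run rfl s
    refine Tri.mono (b := 50 + (20 + 20)) (Tri.seq (R := fun s' => s' = popNode.run s)
      (.flat rfl (by decide) rfl) fun s₁ h₁ => ?_) (by omega) fun _ h => h
    rw [← h₁] at hreg f₁
    obtain ⟨r₁, r₂, r₃, r₄, r₅, r₆, r₇, r₈⟩ := hreg
    have hus' : LinkedL s₁ v (s₁.arr CHILD (s₁.reg R3)) us := by
      rw [r₂, f₁.2 CHILD rfl]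
      exact linkedL_congr (f₁.2 _ rfl) (f₁.2 _ rfl) (f₁.2 _ rfl) hus
    have hts' : LinkedL s₁ p (s₁.arr NEXT (s₁.reg R3)) ts := by
      rw [r₂, f₁.2 NEXT rfl]
      exact linkedL_congr (f₁.2 _ rfl) (f₁.2 _ rfl) (f₁.2 _ rfl) hts
    have hp' : Pend s₁ (done ++ [v]) (s₁.reg R1) fs := by
      rw [r₃]
      exact Pend.congr (f₁.2 _ rfl) (f₁.2 _ rfl) (f₁.2 _ rfl) (List.subset_append_left _ _)
        (fun i _ => by rw [f₁.2 STK rfl]) hp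
    refine Tri.seqF (pushNode_spec hp' hts' (by simpa using hpd.imp_right Or.inl)
      fun x hx => hpos x (by rw [← hsp]; simp [hx])) fun s₂ h₂ f₂ => ?_
    have hus'' : LinkedL s₂ v (s₂.arr CHILD (s₂.reg R3)) us := by
      rw [f₂.1 R3 rfl, f₂.2 CHILD rfl]
      exact linkedL_congr (f₂.2 _ rfl) (f₂.2 _ rfl) (f₂.2 _ rfl) hus'
    refine (pushNode_spec h₂ hus'' (by simp)
      fun x hx => hpos x (by rw [← hsp]; simp [hx])).frame.mono le_rfl fun s₃ ⟨h₃, f₃⟩ => ?_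
    have arr₃ : ∀ A, A ≠ STK → s₃.arr A = s₁.arr A := fun A hA => by
      have : ∀ B, (pushNode B).modA A = false := fun B => by simp [pushNode, Cmd.modA, hA.symm]
      rw [f₃.2 A (this _), f₂.2 A (this _)]
    have reg₃ : ∀ x, x ≠ R1 → s₃.reg x = s₁.reg x := fun x hx => by
      have : ∀ B, (pushNode B).modR x = false := fun B => by simp [pushNode, Cmd.modR, hx.symm]
      rw [f₃.1 x (this _), f₂.1 x (this _)]
    have e₁ : s₃.arr LABEL = s.arr LABEL := (arr₃ _ (by decide)).trans (f₁.2 _ rfl)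
    have e₂ : s₃.arr PARENT = s.arr PARENT := (arr₃ _ (by decide)).trans (f₁.2 _ rfl)
    have e₃ : s₃.arr CHILD = s.arr CHILD := (arr₃ _ (by decide)).trans (f₁.2 _ rfl)
    have e₄ : s₃.arr NEXT = s.arr NEXT := (arr₃ _ (by decide)).trans (f₁.2 _ rfl)
    have hRd : ∀ u, (u = 0 ∨ u ∈ done) → s₁.arr REP u = s.arr REP u := fun u hu => by
      rw [r₆, if_neg]
      rintro rfl
      rcases hu with h | h
      · exact hv0 h
      · exact hvd h
    refine ⟨done ++ [v], _, e₁.trans eL, e₂.trans eP, e₃.trans eC, e₄.trans eX, ?_, ?_, h₃, ?_⟩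
    · rw [← hsp]; split_ifs <;> simp [*]
    · split_ifs <;> simp [*]
    rw [arr₃ REP (by decide), reg₃ R2 (by decide), reg₃ FR (by decide), e₁, e₂,
      arr₃ NLAB (by decide), arr₃ NPAR (by decide)]
    refine ⟨by rw [hRd 0 (.inl rfl), h0], by simp [r₁], ?_, by simp; omega, fun u hu => ?_⟩
    · rw [List.map_append, List.map_congr_left fun u hu => hRd u (.inr hu), hm]
      simp [r₆, List.range'_concat]; omega
    · rw [List.mem_append, List.mem_singleton] at hu
      rcases hu with hu | rfl
      · obtain ⟨d₁, d₂, d₃, d₄⟩ := hd u hu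
        have hne : s.arr REP u ≠ done.length + 1 := by have := hRle u hu; omega
        rw [hRd u (.inr hu), hRd _ d₄, r₇, r₈, if_neg hne, if_neg hne]
        exact ⟨by omega, d₂, d₃, d₄.imp_right fun h => by simp [h]⟩
      · have : s₁.arr REP u = done.length + 1 := by rw [r₆, if_pos rfl]
        rw [this, hpar, hRd p hpd, r₇, r₈, if_pos rfl, if_pos rfl]
        exact ⟨r₅, rfl, rfl, hpd.imp_right fun h => by simp [h]⟩

theorem initP_spec {s : State} {T : RTree ℕ} (h : IsInput s T) :
    Tri initP s (300 * T.size) (Good · ⟨T, ∅⟩) := by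
  obtain ⟨⟨v, us⟩, ⟨h₁, h₂, h₃, h₄⟩, h₅, h₆, h₇⟩ := h
  have hlab : (node v us).labels = labelsL [node v us] := by simp [labels]
  rw [hlab] at h₁ h₂ h₅
  have hreg : ∀ x, x ≠ ROOT → s.reg x = 0 := h₆
  have harr : ∀ A i, A ∉ [LABEL, PARENT, CHILD, NEXT] → s.arr A i = 0 :=
    fun A i hA => h₇ A i fun h => absurd h hA
  have hsz : T.size = (labelsL [node v us]).length := by
    rw [← h₄, map, size_node, labelsL_mapL]; simp; omega
  have hpos : 1 ≤ T.size := by rw [hsz]; simp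
  refine Tri.mono (b := 2 + (2 + (3 + (100 * T.size + 2 + (2 + 60 * (T.size + 1)))))) ?_ (by omega)
    fun _ h => h
  refine Tri.seqF (R := fun s' => s'.reg FR = 1) (.flat rfl (by decide) (by simp)) fun s₁ g₁ f₁ => ?_
  refine Tri.seqF (R := fun s' => s'.reg R1 = 1) (.flat rfl (by decide) (by simp)) fun s₂ g₂ f₂ => ?_
  refine Tri.seqF (R := fun s' => s'.arr STK 1 = s₂.reg ROOT) (.flat rfl (by decide) (by simp))
    fun s₃ g₃ f₃ => ?_
  have arr₃ : ∀ A, A ≠ STK → s₃.arr A = s.arr A := fun A hA => by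
    rw [f₃.2 A (by simpa [Cmd.modA] using hA.symm), f₂.2 A (by simp [Cmd.modA]),
      f₁.2 A (by simp [Cmd.modA])]
  have reg₃ : ∀ x, x ≠ R1 → x ≠ FR → s₃.reg x = s.reg x := fun x hx hx' => by
    rw [f₃.1 x (by simp [Cmd.modR]), f₂.1 x (by simpa [Cmd.modR] using hx.symm),
      f₁.1 x (by simpa [Cmd.modR] using hx'.symm)]
  have g₄ : s₃.reg R1 = 1 := (f₃.1 _ rfl).trans g₂
  have g₅ : s₃.reg FR = 1 := (f₃.1 _ rfl).trans ((f₂.1 _ rfl).trans g₁)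
  have g₆ : s₃.arr STK 1 = s.reg ROOT := by rw [g₃, f₂.1 _ rfl, f₁.1 _ rfl]
  have hlk : LinkedL s₃ 0 (s.reg ROOT) [node v us] :=
    linkedL_congr (arr₃ _ (by decide)) (arr₃ _ (by decide)) (arr₃ _ (by decide)) h₃
  have hinit : InitInv s₃ (node v us) (100 * T.size) s₃ := by
    refine ⟨[], [[node v us]], rfl, rfl, rfl, rfl, by simp, by simp [hsz], ?_, ?_, ?_, by simp,
      by simp [g₅], by simp⟩
    · refine ⟨by simp, by omega, ⟨0, ?_, .inl rfl⟩, by simp [Pend, g₄]⟩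
      rw [g₄, g₆]; exact hlk
    · rw [arr₃ _ (by decide)]; exact harr _ _ (by decide)
    · rw [reg₃ _ (by decide) (by decide)]; exact hreg _ (by decide)
  refine Tri.seqF (Tri.while (InitInv s₃ (node v us)) (fun b s' hI he => ?_) hinit) ?_
  · obtain ⟨b', hb, hT⟩ := initBody_spec h₁ h₂ hI (by simpa using he)
    exact ⟨90, b', by simp only [Expr.cost]; omega, hT⟩
  rintro s₄ ⟨he, b, done, fs, eL, eP, eC, eX, hsp, -, hp, h0, h2, hm, hF, hd⟩ f₄
  have : fs = [] := by
    cases fs with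
    | nil => rfl
    | cons f fs =>
      have := hp.2.1
      simp at he
      omega
  subst this
  simp only [List.flatMap_nil, List.append_nil] at hsp
  subst hsp
  refine Tri.seqF (R := fun s' => s'.reg SIZE = T.size)
    (.flat rfl (by decide) (by simp [h2, hsz])) fun s₅ g₇ f₅ => ?_
  have arr₅ : ∀ A, s₅.arr A = s₄.arr A := fun A => f₅.2 A (by simp [Cmd.modA])
  have reg₅ : s₅.reg FR = s₄.reg FR := f₅.1 _ rfl
  have hrep : s₄.arr REP v = 1 := by
    simp only [labelsL_cons, List.map_cons, List.length_cons, List.range'_succ] at hm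
    exact (List.cons.inj hm).1
  have hmap : mapL (s₄.arr REP) [node v us] = [node 1 (mapL (s₄.arr REP) us)] := by
    rw [mapL_cons, hrep, mapL_nil]
  refine (finish_spec (us := mapL (s₄.arr REP) us) g₇ ?_ ?_).frame.mono (by omega) ?_
  · rw [← hmap, labelsL_mapL, hm, hsz]
  -- Renumbering the nodes is treated as a contraction that deletes nothing.
  · have := hlk.parL.contractL (Q := s₄.arr NPAR) (rep := s₄.arr REP) (D := fun _ => false)
      (by simp) (fun v hv _ => by rw [(hd v hv).2.2.1, eP])
    rw [contractL_false, hmap, h0] at this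
    rw [arr₅]; exact this
  · rintro s₆ ⟨⟨c₁, c₂⟩, f₆⟩
    have eF : s₆.reg FR = s₄.reg FR := (f₆.1 _ rfl).trans reg₅
    have eT : s₆.arr TAB = s.arr TAB :=
      ((f₆.2 _ rfl).trans (arr₅ _)).trans ((f₄.2 _ rfl).trans (arr₃ _ (by decide)))
    have eN : s₆.reg LEN = s.reg LEN :=
      ((f₆.1 _ rfl).trans (f₅.1 _ rfl)).trans ((f₄.1 _ rfl).trans (reg₃ _ (by decide) (by decide)))
    have hlb : ∀ x ∈ labelsL [node v us], s₆.arr LABEL (s₄.arr REP x) = s.arr LABEL x := by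
      intro x hx
      have hx' : 1 ≤ s₄.arr REP x ∧ s₄.arr REP x ≤ T.size := by
        have : s₄.arr REP x ∈ (labelsL [node v us]).map (s₄.arr REP) := List.mem_map_of_mem hx
        rw [hm, List.mem_range'_1] at this
        omega
      rw [c₂ _ hx'.1 hx'.2, arr₅, (hd x hx).2.1, eL, arr₃ _ (by decide)]
    refine ⟨_, c₁, ?_, ⟨⟨[], by simp, by simp, ?_, by simp⟩, by simp⟩, ?_, ?_, ?_⟩
    · simp only
      rw [mapL_mapL, ← h₄, map]
      congr 1
      · rw [← hlb v (by simp), hrep]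
      · exact mapL_congr fun x hx => (hlb x (by simp [hx])).symm
    · rw [eN, hreg _ (by decide)]; rfl
    · simp only [← h₄, map, labels, labelsL_mapL, List.mem_cons, List.mem_map]
      have : ∀ x ∈ labelsL [node v us], s.arr LABEL x < s₆.reg FR := fun x hx => by
        have := (hd x hx).1
        rw [eL, arr₃ _ (by decide)] at this
        rwa [eF]
      rintro a (rfl | ⟨x, hx, rfl⟩)
      · exact this v (by simp)
      · exact this x (by simp [hx])
    · simp only [eF, hsz]; exact hF
    · intro k
      rw [eT, harr _ _ (by decide)]
      omega


/-! ### Lengths of chains -/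

/-- The numbers `1, …, r` that satisfy `P`. -/
noncomputable def lens (P : ℕ → Prop) (r : ℕ) : List ℕ :=
  open Classical in (List.range' 1 r).filter fun l => decide (P l)

theorem lens_zero (P : ℕ → Prop) : lens P 0 = [] := by simp [lens]

theorem lens_succ_pos {P : ℕ → Prop} {r : ℕ} (h : P (r + 1)) :
    lens P (r + 1) = lens P r ++ [r + 1] := by
  simp [lens, List.range'_concat, List.filter_append, h, add_comm]

theorem lens_succ_neg {P : ℕ → Prop} {r : ℕ} (h : ¬ P (r + 1)) : lens P (r + 1) = lens P r := by
  have h' : ¬ P (1 + r) := by rwa [add_comm]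
  simp [lens, List.range'_concat, List.filter_append, h']

theorem mem_lens {P : ℕ → Prop} {r l : ℕ} : l ∈ lens P r ↔ 1 ≤ l ∧ l ≤ r ∧ P l := by
  have : l < 1 + r ↔ l ≤ r := by omega
  simp only [lens, List.mem_filter, List.mem_range'_1, decide_eq_true_eq, and_assoc, this]

theorem lens_last_le (P : ℕ → Prop) (r : ℕ) : (lens P r).getLastD 0 ≤ r := by
  induction r with
  | zero => simp [lens_zero]
  | succ r ih =>
    by_cases h : P (r + 1)
    · simp [lens_succ_pos h]
    · rw [lens_succ_neg h]; omega

theorem maxDiff_append (ls : List ℕ) (p l : ℕ) :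
    maxDiff p (ls ++ [l]) = max (maxDiff p ls) (l - ls.getLastD p) := by
  induction ls generalizing p with
  | nil => simp [maxDiff]
  | cons x xs ih => simp only [List.cons_append, maxDiff, ih, List.getLastD_cons, max_assoc]

/-- The productions for two consecutive lengths. -/
def diffProd (nm : Desc → ℕ) (a p l : ℕ) : Desc × Rhs :=
  (.diff a l, .word ((l - p).bitIndices.map (powLetter nm a)))

/-- The productions for two consecutive lengths. -/
def chainProd (nm : Desc → ℕ) (a p l : ℕ) : Desc × Rhs :=
  (.chain a l, .word (nm (.diff a l) :: (if p = 0 then [] else [nm (.chain a p)])))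

theorem lengthProds_append (nm : Desc → ℕ) (a : ℕ) (ls : List ℕ) (p l : ℕ) :
    lengthProds nm a p (ls ++ [l]) = lengthProds nm a p ls ++
      [diffProd nm a (ls.getLastD p) l, chainProd nm a (ls.getLastD p) l] := by
  induction ls generalizing p with
  | nil => simp [lengthProds, diffProd, chainProd]
  | cons x xs ih => simp only [List.cons_append, lengthProds, ih, List.getLastD_cons]

/-- The productions for the powers `2, …, 2 ^ e`. -/
def powList (nm : Desc → ℕ) (a e : ℕ) : List (Desc × Rhs) :=
  (List.range e).map fun j => (.pow a (j + 1), .word [powLetter nm a j, powLetter nm a j])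

theorem powList_succ (nm : Desc → ℕ) (a e : ℕ) : powList nm a (e + 1) = powList nm a e ++
    [(.pow a (e + 1), .word [powLetter nm a e, powLetter nm a e])] := by
  simp [powList, List.range_succ]

/-- The largest exponent that is needed if the lengths satisfy `P`, and `r` nodes are known. -/
noncomputable def maxExp (P : ℕ → Prop) (r : ℕ) : ℕ :=
  Nat.log 2 (max (maxDiff 0 (lens P r)) (r - (lens P r).getLastD 0))

/-- When one more node is known, the maximum under the logarithm grows by at most one. Hence the
exponent increases exactly when the gap since the last length hits the next power of two, which is a
test of constant cost. Whether the length `r + 1` itself occurs is irrelevant: its gap only moves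
from the second argument of the maximum into `maxDiff`. -/
theorem maxExp_succ (P : ℕ → Prop) (r : ℕ) :
    maxExp P (r + 1) = if r + 1 - (lens P r).getLastD 0 = 2 ^ maxExp P r + 2 ^ maxExp P r
      then maxExp P r + 1 else maxExp P r := by
  have h₁ : maxExp P (r + 1) =
      Nat.log 2 (max (maxDiff 0 (lens P r)) (r + 1 - (lens P r).getLastD 0)) := by
    unfold maxExp
    by_cases h : P (r + 1)
    · rw [lens_succ_pos h, maxDiff_append]; simp
    · rw [lens_succ_neg h]
  rw [h₁]
  have hl := lens_last_le P r
  set b := (lens P r).getLastD 0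
  have h₂ : maxExp P r = Nat.log 2 (max (maxDiff 0 (lens P r)) (r - b)) := rfl
  rw [h₂]
  set d := maxDiff 0 (lens P r)
  set g := r + 1 - b with hg
  have hg' : r - b + 1 = g := by omega
  clear_value d b g
  clear h₁ h₂ hg hl
  set x := max d (r - b) with hx
  -- The case `x = 0` is separate because `Nat.log 2 0 = 0` is a default value for which `2 ^
  -- Nat.log 2 x ≤ x` fails.
  rcases Nat.eq_zero_or_pos x with h0 | h0
  · have : g ≤ 1 := by omega
    have h' : max d g ≤ 1 := by omega
    have hlog : Nat.log 2 (max d g) = 0 := Nat.log_of_lt (by omega)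
    have hlx : Nat.log 2 x = 0 := Nat.log_of_lt (by omega)
    rw [hlog, hlx, if_neg (by simp; omega)]
  · have k₁ : 2 ^ Nat.log 2 x ≤ x := Nat.pow_log_le_self 2 (by omega)
    have k₂ : x < 2 ^ (Nat.log 2 x + 1) := Nat.lt_pow_succ_log_self (by omega) x
    have k₃ : 2 ^ (Nat.log 2 x + 1) = 2 ^ Nat.log 2 x + 2 ^ Nat.log 2 x := by ring
    split_ifs with hc
    · refine (Nat.log_eq_iff (by omega)).2 ⟨by omega, ?_⟩
      have : 2 ^ (Nat.log 2 x + 1 + 1) = 2 * 2 ^ (Nat.log 2 x + 1) := by ring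
      omega
    · exact (Nat.log_eq_iff (by omega)).2 ⟨by omega, by omega⟩

/-- This ensures that all powers needed for the binary expansion of a difference already have
letters when the expansion is written. -/
theorem log_le_maxExp {P : ℕ → Prop} {r : ℕ} (h : P (r + 1)) :
    Nat.log 2 (r + 1 - (lens P r).getLastD 0) ≤ maxExp P (r + 1) := by
  refine Nat.log_mono_right ?_
  rw [lens_succ_pos h, maxDiff_append]
  omega

theorem bitIndices_lt {n j : ℕ} (h : j ∈ n.bitIndices) : j ≤ Nat.log 2 n := by
  have h₁ : 2 ^ j ≤ n := Nat.two_pow_le_of_mem_bitIndices h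
  exact Nat.le_log_of_pow_le (by omega) h₁

-- Maximal chains in terms of the computed run lengths.

section chains
variable {s : State} {us : List (RTree ℕ)} {N : ℕ} {lb rn : ℕ → ℕ}

/-- A maximal chain starts at a unary node that does not continue the run of its parent, that is,
whose parent has a run shorter than 2. At the root of the subtree the argument `prev` plays the role
of this condition. -/
theorem mem_chainOcc (h : Canon s us N)
    (hr : ∀ v, 1 ≤ v → v ≤ N → (IsUn s v →
      rn v = if lb (s.arr CHILD v) = lb v then rn (s.arr CHILD v) + 1 else 1) ∧
      (¬ IsUn s v → rn v = 0)) (a l : ℕ) :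
    ∀ v ws, (v, ws) ∈ nodesL [node 1 us] → ∀ prev,
      (a, l) ∈ chainOcc prev (node (lb v) (mapL lb ws)) ↔
        (IsUn s v ∧ prev ≠ some (lb v) ∧ a = lb v ∧ l = rn v) ∨
        ∃ u ∈ labelsL ws, IsUn s u ∧ ¬ 2 ≤ rn (s.arr PARENT u) ∧ a = lb u ∧ l = rn u := by
  have ht := topRun_eq h hr
  refine nodes_induction fun v ws hv ih prev => ?_
  obtain ⟨h₁, h₂, -, h₃⟩ := h.of_mem hv
  have hr := hr v h₁ h₂
  have many : ¬ IsUn s v → ((a, l) ∈ chainOccL (mapL lb ws) ↔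
      ∃ u ∈ labelsL ws, IsUn s u ∧ ¬ 2 ≤ rn (s.arr PARENT u) ∧ a = lb u ∧ l = rn u) := by
    intro hu
    have : ∀ ys, (∀ t ∈ ys, t ∈ ws) → ((a, l) ∈ chainOccL (mapL lb ys) ↔
        ∃ u ∈ labelsL ys, IsUn s u ∧ ¬ 2 ≤ rn (s.arr PARENT u) ∧ a = lb u ∧ l = rn u) := by
      intro ys hys
      induction ys with
      | nil => simp [chainOccL]
      | cons t ys ihy =>
        obtain ⟨b, xs⟩ := t
        have hb := hys (node b xs) (by simp)
        have hp : ¬ 2 ≤ rn (s.arr PARENT b) := by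
          rw [h.parent_of_mem hv hb, hr.2 hu]; omega
        rw [mapL_cons, chainOccL, List.mem_append, ih b xs hb,
          ihy fun t ht => hys t (by simp [ht])]
        simp only [labelsL_cons, List.mem_cons, List.mem_append, or_and_right, exists_or,
          exists_eq_left, hp, not_false_eq_true, true_and, ne_eq, reduceCtorEq, or_assoc]
    exact this ws fun _ h => h
  match ws, hv, ih, many with
  | [], hv, _, many =>
    have hu : ¬ IsUn s v := by rw [h.isUn_iff hv]; simp
    simp [chainOcc, chainOccL, hu]
  | node b xs :: node b' xs' :: ws, hv, _, many =>
    have hu : ¬ IsUn s v := by rw [h.isUn_iff hv]; simp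
    rw [← many hu]
    simp [chainOcc, hu]
  | [node b xs], hv, ih, _ =>
    obtain ⟨u₁, u₂, u₃, u₄⟩ := h.unary hv
    have hb := ih b xs (by simp)
    have htv := ht v _ hv
    have hrv := hr.1 u₁
    rw [u₂] at hrv
    obtain ⟨-, hrb⟩ := h.of_mem u₄
    have hrb0 : IsUn s b → 1 ≤ rn b := by
      intro hub
      have h₃ := h₃ b (by simp)
      have := (ht b xs u₄)
      obtain ⟨c, ys, rfl⟩ := (h.isUn_iff u₄).1 hub
      simp only [mapL_cons, mapL_nil, topRun, if_true] at this
      omega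
    -- Two descriptions of "a new chain starts at `b`" agree: as the run at a unary node `b` is at
    -- least 1, the run at `v` is at least 2 exactly if the labels coincide.
    have hbt : (IsUn s b ∧ some (lb v) ≠ some (lb b) ∧ a = lb b ∧ l = rn b) ↔
        (IsUn s b ∧ ¬ 2 ≤ rn (s.arr PARENT b) ∧ a = lb b ∧ l = rn b) := by
      rw [u₃, hrv]
      refine and_congr_right fun hub => and_congr_left fun _ => ?_
      have := hrb0 hub
      by_cases hl : lb b = lb v
      · simp [hl]; omega
      · simp [hl, Ne.symm hl]
    simp only [mapL_cons, mapL_nil, topRun, if_true] at htv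
    simp only [mapL_cons, mapL_nil, chainOcc, labelsL_cons, labelsL_nil, List.append_nil,
      List.mem_cons, or_and_right, exists_or, exists_eq_left]
    by_cases hp : prev = some (lb v)
    · simp only [hp, if_true, ne_eq, not_true_eq_false, false_and, and_false, false_or]
      rw [hb, hbt]
    · simp only [hp, if_false, List.mem_cons, ne_eq, not_false_eq_true, true_and, u₁, hb,
        Prod.mk.injEq, ← htv]
      exact or_congr_right (or_congr_left hbt)

/-- There is an `a`-maximal chain with `l > 1` nodes. -/
def HasLen (s : State) (N : ℕ) (lb rn : ℕ → ℕ) (a l : ℕ) : Prop :=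
  2 ≤ l ∧ ∃ v, 1 ≤ v ∧ v ≤ N ∧ ¬ 2 ≤ rn (s.arr PARENT v) ∧ lb v = a ∧ rn v = l

/-- Both lists are increasing, so it suffices to compare members. The bound `r` may be any upper
bound for the runs of the letter. The address 0 stands for the missing parent of the root, hence the
condition `rn 0 = 0`. -/
theorem chainLengths_eq (h : Canon s us N)
    (hr : ∀ v, 1 ≤ v → v ≤ N → (IsUn s v →
      rn v = if lb (s.arr CHILD v) = lb v then rn (s.arr CHILD v) + 1 else 1) ∧
      (¬ IsUn s v → rn v = 0)) (h0 : rn 0 = 0) {a r : ℕ}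
    (hP : ∀ v, 1 ≤ v → v ≤ N → lb v = a → rn v ≤ r) :
    chainLengths (node (lb 1) (mapL lb us)) a = lens (HasLen s N lb rn a) r := by
  have hnd : (lens (HasLen s N lb rn a) r).Nodup := List.Nodup.filter _ List.nodup_range'
  have hs : (lens (HasLen s N lb rn a) r).Pairwise (· ≤ ·) := by
    refine List.Pairwise.filter _ ?_
    exact (List.pairwise_lt_range' (s := 1) (n := r)).imp fun h => le_of_lt h
  rw [chainLengths, ← (List.toFinset_sort (· ≤ ·) hnd).2 hs]
  congr 1
  ext l
  simp only [List.mem_toFinset, List.mem_map, List.mem_filter, Prod.exists, mem_lens]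
  have key := fun l => mem_chainOcc h hr a l 1 us (by simp [nodesL]) none
  constructor
  · rintro ⟨a', l', ⟨h₁, h₂⟩, rfl⟩
    simp only [decide_eq_true_eq] at h₂
    obtain ⟨rfl, h₂⟩ := h₂
    refine ⟨by omega, ?_, h₂, ?_⟩
    · rcases (key l').1 h₁ with ⟨_, _, h₃, rfl⟩ | ⟨u, hu, _, _, h₃, rfl⟩
      · exact hP 1 le_rfl h.pos h₃.symm
      · have := h.mem_iff.1 (show u ∈ labelsL [node 1 us] by simp [hu])
        exact hP u this.1 this.2 h₃.symm
    · rcases (key l').1 h₁ with ⟨_, _, h₃, rfl⟩ | ⟨u, hu, _, h₄, h₃, rfl⟩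
      · exact ⟨1, le_rfl, h.pos, by rw [h.parent_one, h0]; omega, h₃.symm, rfl⟩
      · have := h.mem_iff.1 (show u ∈ labelsL [node 1 us] by simp [hu])
        exact ⟨u, this.1, this.2, h₄, h₃.symm, rfl⟩
  · rintro ⟨-, -, h₂, v, h₃, h₄, h₅, h₆, rfl⟩
    refine ⟨a, rn v, ⟨(key _).2 ?_, by simp [h₂]⟩, rfl⟩
    have hu : IsUn s v := by
      by_contra hu
      rw [(hr v h₃ h₄).2 hu] at h₂
      omega
    have := h.mem_iff.2 ⟨h₃, h₄⟩
    simp only [labelsL_cons, labelsL_nil, List.append_nil, List.mem_cons] at this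
    rcases this with rfl | hv
    · exact .inl ⟨hu, by simp, h₆.symm, rfl⟩
    · exact .inr ⟨v, hv, hu, h₅, h₆.symm, rfl⟩

end chains


/-! ### Emitting the productions of chain compression -/

/-- The expression for a key. -/
def keyE (x y t : Expr) : Expr := (x * .reg ST + y) * 4 + t

@[simp] theorem eval_keyE (s : State) (x y t : Expr) :
    (keyE x y t).eval s = key (s.reg ST) (x.eval s) (y.eval s) (t.eval s) := rfl

/-- The naming `nm` takes its values from the table `T`. -/
def Agree (nm : Desc → ℕ) (T : ℕ → ℕ) (m : ℕ) : Prop :=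
  ∀ a j, j < m → (m ≤ T (key m a j 0) → nm (.pow a j) = T (key m a j 0)) ∧
    (m ≤ T (key m a j 1) → nm (.diff a j) = T (key m a j 1)) ∧
    (m ≤ T (key m a j 2) → nm (.chain a j) = T (key m a j 2))

/-- The naming can only be read off the completed table. New letters go to cells that count as
empty, so a naming that agrees with a later table agrees with all earlier ones; therefore the
invariant speaks about every naming that agrees with the current table. -/
theorem Agree.of_alloc {nm : Desc → ℕ} {T T' : ℕ → ℕ} {m k f : ℕ} (h : Agree nm T' m)
    (hT : ∀ j, T' j = if j = k then f else T j) (hk : T k < m) : Agree nm T m := by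
  have : ∀ j, m ≤ T j → T' j = T j := fun j hj => by
    rw [hT, if_neg]; rintro rfl; omega
  intro a j hj
  obtain ⟨h₁, h₂, h₃⟩ := h a j hj
  refine ⟨fun h => ?_, fun h => ?_, fun h => ?_⟩
  · rw [← this _ h]; exact h₁ (by rw [this _ h]; exact h)
  · rw [← this _ h]; exact h₂ (by rw [this _ h]; exact h)
  · rw [← this _ h]; exact h₃ (by rw [this _ h]; exact h)

/-- The productions that have been emitted if the powers up to `2 ^ pe a` and the lengths in `L a`
have been treated. -/
def emitted (A : Finset ℕ) (nm : Desc → ℕ) (pe : ℕ → ℕ) (L : ℕ → List ℕ) : Set Production :=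
  {q | ∃ a ∈ A, ∃ p, (p ∈ powList nm a (pe a) ∨ p ∈ lengthProds nm a 0 (L a)) ∧
    q = ⟨nm p.1, p.2⟩}

theorem emitted_pow {A : Finset ℕ} {nm : Desc → ℕ} {pe : ℕ → ℕ} {L : ℕ → List ℕ} {a : ℕ}
    (ha : a ∈ A) : emitted A nm (Function.update pe a (pe a + 1)) L =
      insert ⟨nm (.pow a (pe a + 1)), .word [powLetter nm a (pe a), powLetter nm a (pe a)]⟩
        (emitted A nm pe L) := by
  ext q
  simp only [emitted, Set.mem_ofPred_eq, Set.mem_insert_iff]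
  constructor
  · rintro ⟨b, hb, p, hp, rfl⟩
    rcases eq_or_ne b a with rfl | hne
    · rw [Function.update_self, powList_succ, List.mem_append, List.mem_singleton] at hp
      rcases hp with (hp | rfl) | hp
      · exact .inr ⟨b, hb, p, .inl hp, rfl⟩
      · exact .inl rfl
      · exact .inr ⟨b, hb, p, .inr hp, rfl⟩
    · rw [Function.update_of_ne hne] at hp
      exact .inr ⟨b, hb, p, hp, rfl⟩
  · rintro (rfl | ⟨b, hb, p, hp, rfl⟩)
    · exact ⟨a, ha, (.pow a (pe a + 1), .word [powLetter nm a (pe a), powLetter nm a (pe a)]),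
        .inl (by rw [Function.update_self, powList_succ]; simp), rfl⟩
    · refine ⟨b, hb, p, hp.imp_left fun hp => ?_, rfl⟩
      rcases eq_or_ne b a with rfl | hne
      · rw [Function.update_self, powList_succ]; simp [hp]
      · rwa [Function.update_of_ne hne]

theorem emitted_len {A : Finset ℕ} {nm : Desc → ℕ} {pe : ℕ → ℕ} {L : ℕ → List ℕ} {a r p : ℕ}
    (ha : a ∈ A) (hp : (L a).getLastD 0 = p) :
    emitted A nm pe (Function.update L a (L a ++ [r])) =
      insert ⟨nm (.chain a r), (chainProd nm a p r).2⟩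
        (insert ⟨nm (.diff a r), (diffProd nm a p r).2⟩ (emitted A nm pe L)) := by
  ext q
  simp only [emitted, Set.mem_ofPred_eq, Set.mem_insert_iff]
  constructor
  · rintro ⟨b, hb, x, hx, rfl⟩
    rcases eq_or_ne b a with rfl | hne
    · rw [Function.update_self, lengthProds_append, hp, List.mem_append] at hx
      simp only [List.mem_cons, List.not_mem_nil, or_false] at hx
      rcases hx with hx | hx | rfl | rfl
      · exact .inr (.inr ⟨b, hb, x, .inl hx, rfl⟩)
      · exact .inr (.inr ⟨b, hb, x, .inr hx, rfl⟩)
      · exact .inr (.inl rfl)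
      · exact .inl rfl
    · rw [Function.update_of_ne hne] at hx
      exact .inr (.inr ⟨b, hb, x, hx, rfl⟩)
  · rintro (rfl | rfl | ⟨b, hb, x, hx, rfl⟩)
    · exact ⟨a, ha, chainProd nm a p r, .inr (by
        rw [Function.update_self, lengthProds_append, hp]; simp), rfl⟩
    · exact ⟨a, ha, diffProd nm a p r, .inr (by
        rw [Function.update_self, lengthProds_append, hp]; simp), rfl⟩
    · refine ⟨b, hb, x, hx.imp_right fun hx => ?_, rfl⟩
      rcases eq_or_ne b a with rfl | hne
      · rw [Function.update_self, lengthProds_append]; simp [hx]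
      · rwa [Function.update_of_ne hne]

/-- The invariant of the emission of productions: for the letters in `A`, the powers up to
`2 ^ pe a` and the lengths in `L a` have been treated; the marked lengths are those in `P a`. -/
structure ChInv (m : ℕ) (A : Finset ℕ) (P : ℕ → ℕ → Prop) (G : Set Production) (pe : ℕ → ℕ)
    (L : ℕ → List ℕ) (s : State) : Prop where
  st : s.reg ST = m
  dict : Dict (s.arr TAB) m (s.reg FR)
  le : m ≤ s.reg FR
  mark : ∀ a ∈ A, ∀ l < m, m ≤ s.arr TAB (key m a l 3) ↔ P a l
  pow : ∀ a ∈ A, ∀ j < m, m ≤ s.arr TAB (key m a j 0) ↔ 1 ≤ j ∧ j ≤ pe a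
  diff : ∀ a ∈ A, ∀ l < m, m ≤ s.arr TAB (key m a l 1) ↔ l ∈ L a
  chain : ∀ a ∈ A, ∀ l < m, m ≤ s.arr TAB (key m a l 2) ↔ l ∈ L a
  exp : ∀ a ∈ A, s.arr PE a = pe a ∧ s.arr PW a = 2 ^ pe a ∧ s.arr LAST a = (L a).getLastD 0
  prods : ∀ nm, Agree nm (s.arr TAB) m → (∀ a ∈ A, s.arr PL a = powLetter nm a (pe a)) ∧
    PS s (G ∪ emitted A nm pe L)

/-- Emit the production for the next power of two. -/
def powEmit : Cmd :=
  .write PE (.reg R1) (.read PE (.reg R1) + 1) ;; .write PW (.reg R1) (.reg R3) ;;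
  .write TAB (keyE (.reg R1) (.read PE (.reg R1)) 0) (.reg FR) ;;
  .write PRODS (.reg LEN) (.reg FR) ;; .write PRODS (.reg LEN + 1) 0 ;;
  .write PRODS (.reg LEN + 2) 2 ;; .write PRODS (.reg LEN + 3) (.read PL (.reg R1)) ;;
  .write PRODS (.reg LEN + 4) (.read PL (.reg R1)) ;; .write PL (.reg R1) (.reg FR) ;;
  .set LEN (.reg LEN + 5) ;; .set FR (.reg FR + 1)

section emit
variable {m : ℕ} {A : Finset ℕ} {P : ℕ → ℕ → Prop} {G : Set Production} {pe : ℕ → ℕ}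
  {L : ℕ → List ℕ} {s : State}

theorem powLetter_lt {nm : Desc → ℕ} (h : ChInv m A P G pe L s) (hn : Agree nm (s.arr TAB) m)
    {a j : ℕ} (ha : a ∈ A) (hm : a < m) (hj : j ≤ pe a) (hjm : j < m) :
    powLetter nm a j < s.reg FR := by
  cases j with
  | zero => exact hm.trans_le h.le
  | succ j =>
    rw [powLetter, ((hn a (j + 1) hjm).1) ((h.pow a ha _ hjm).2 ⟨by omega, hj⟩)]
    exact h.dict.1 _

/-- The register `R3` already contains twice the last power, so the power is doubled by copying this
register. Storing a sum of two cells would not be slow in the sense of `Expr.slow`. -/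
theorem powEmit_spec (h : ChInv m A P G pe L s) (hA : ∀ a ∈ A, a < m) {a : ℕ} (ha : a ∈ A)
    (h₁ : s.reg R1 = a) (h₃ : s.reg R3 = 2 ^ pe a + 2 ^ pe a) (hm : pe a + 1 < m) :
    Tri powEmit s 100 (ChInv m A P G (Function.update pe a (pe a + 1)) L) := by
  have e₁ := (h.exp a ha).1
  have hst := h.st
  have hrun : (powEmit.run s).reg LEN = s.reg LEN + 5 ∧ (powEmit.run s).reg FR = s.reg FR + 1 ∧
      (∀ j, (powEmit.run s).arr TAB j =
        if j = key m a (pe a + 1) 0 then s.reg FR else s.arr TAB j) ∧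
      (∀ j, (powEmit.run s).arr PE j = if j = a then pe a + 1 else s.arr PE j) ∧
      (∀ j, (powEmit.run s).arr PW j = if j = a then s.reg R3 else s.arr PW j) ∧
      (∀ j, (powEmit.run s).arr PL j = if j = a then s.reg FR else s.arr PL j) ∧
      (∀ j, (powEmit.run s).arr PRODS j = if j = s.reg LEN + 4 then s.arr PL a else
        if j = s.reg LEN + 3 then s.arr PL a else if j = s.reg LEN + 2 then 2 else
        if j = s.reg LEN + 1 then 0 else if j = s.reg LEN then s.reg FR else s.arr PRODS j) := by
    simp +decide [powEmit, h₁, e₁, hst]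
  refine .flat rfl (by decide) ?_
  have hf : Frame powEmit s (powEmit.run s) := Cmd.frame_run rfl s
  generalize powEmit.run s = s' at *
  obtain ⟨r₁, r₂, r₃, r₄, r₅, r₆, r₇⟩ := hrun
  have hkey : s.arr TAB (key m a (pe a + 1) 0) < m := by
    by_contra hc
    have := (h.pow a ha _ hm).1 (by omega)
    omega
  have htab : ∀ b y t, y < m → t < 4 → (b ≠ a ∨ y ≠ pe a + 1 ∨ t ≠ 0) →
      s'.arr TAB (key m b y t) = s.arr TAB (key m b y t) := by
    intro b y t hy ht hne
    rw [r₃, if_neg]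
    intro hc
    have := key_inj hc hy hm ht (by omega)
    omega
  have hself : s'.arr TAB (key m a (pe a + 1) 0) = s.reg FR := by rw [r₃, if_pos rfl]
  refine ⟨by rw [hf.1 _ rfl, h.st], ?_, ?_, fun b hb l hl => ?_, fun b hb j hj => ?_,
    fun b hb l hl => ?_, fun b hb l hl => ?_, fun b hb => ?_, fun nm hn => ?_⟩
  · rw [r₂]; exact h.dict.alloc r₃
  · rw [r₂]; exact h.le.trans (by omega)
  · rw [htab b l 3 hl (by omega) (by omega)]; exact h.mark b hb l hl
  · by_cases hc : b = a ∧ j = pe a + 1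
    · obtain ⟨rfl, rfl⟩ := hc
      rw [hself, Function.update_self]
      have := h.le
      omega
    · rw [htab b j 0 hj (by omega) (by omega), h.pow b hb j hj]
      rcases eq_or_ne b a with rfl | hne
      · rw [Function.update_self]; omega
      · rw [Function.update_of_ne hne]
  · rw [htab b l 1 hl (by omega) (by omega)]; exact h.diff b hb l hl
  · rw [htab b l 2 hl (by omega) (by omega)]; exact h.chain b hb l hl
  · obtain ⟨x₁, x₂, x₃⟩ := h.exp b hb
    rw [r₄, r₅, hf.2 LAST rfl]
    rcases eq_or_ne b a with rfl | hne
    · simp only [if_true, Function.update_self, true_and]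
      exact ⟨by rw [h₃]; ring, x₃⟩
    · simp only [hne, if_false, Function.update_of_ne hne]
      exact ⟨x₁, x₂, x₃⟩
  · have hn' := hn.of_alloc r₃ hkey
    obtain ⟨p₁, p₂⟩ := h.prods nm hn'
    have hnew : nm (.pow a (pe a + 1)) = s.reg FR := by
      rw [(hn a (pe a + 1) hm).1 (by rw [hself]; exact h.le), hself]
    refine ⟨fun b hb => ?_, ?_⟩
    · rw [r₆]
      rcases eq_or_ne b a with rfl | hne
      · rw [if_pos rfl, Function.update_self, powLetter, hnew]
      · rw [if_neg hne, Function.update_of_ne hne]; exact p₁ b hb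
    · rw [emitted_pow ha, Set.union_insert]
      have hpl := p₁ a ha
      have hlt : powLetter nm a (pe a) < s.reg FR :=
        powLetter_lt h hn' ha (hA a ha) le_rfl (by omega)
      refine p₂.emit _ (by rw [r₁]; rfl) (fun i hi => ?_) (fun j hj => ?_) hnew (by omega) ?_
      · rw [r₇]; repeat rw [if_neg (by omega)]
      · rw [r₇]
        have hj' : j < 5 := hj
        interval_cases j <;> simp [Production.encode, hnew, hpl]
      · intro b hb
        simp only [Rhs.letters, List.mem_cons, List.not_mem_nil, or_false, or_self] at hb
        rw [hb, r₂]; omega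

/-- Write the letters for the binary expansion of `R3` behind the last production. -/
def bitsEmit : Cmd :=
  .set R4 (.reg R3) ;; .set R5 0 ;; .set R6 (.reg LEN + 3) ;;
  .while (.reg R4)
    (.ite (.reg R4 % 2)
      (.ite (.reg R5) (.write PRODS (.reg R6) (.read TAB (keyE (.reg R1) (.reg R5) 0)))
        (.write PRODS (.reg R6) (.reg R1)) ;; .set R6 (.reg R6 + 1)) .skip ;;
    .set R4 (.reg R4 / 2) ;; .set R5 (.reg R5 + 1))

/-- The letter for a power of two that is stored in the table. -/
def powTab (s : State) (a j : ℕ) : ℕ := if j = 0 then a else s.arr TAB (key (s.reg ST) a j 0)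

/-- A bound linear in the number, rather than logarithmic, is enough, since the differences of
consecutive lengths of a letter add up to at most its longest run. The first three cells behind
`LEN` are left free for the left-hand side, the tag and the length of the word. -/
theorem bitsEmit_spec (s : State) :
    Tri bitsEmit s (60 * s.reg R3 + 20) (fun s' =>
      s'.reg R6 = s.reg LEN + 3 + (s.reg R3).bitIndices.length ∧
      (∀ i, i < s.reg LEN + 3 → s'.arr PRODS i = s.arr PRODS i) ∧
      ∀ (j : ℕ) (hj : j < (s.reg R3).bitIndices.length),
        s'.arr PRODS (s.reg LEN + 3 + j) = powTab s (s.reg R1) (s.reg R3).bitIndices[j]) := by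
  refine Tri.mono (b := 2 + (2 + (4 + (60 * s.reg R3 + 1 + 1)))) ?_ (by omega) fun _ h => h
  refine Tri.seqF (R := fun s' => s'.reg R4 = s.reg R3) (.flat rfl (by decide) (by simp))
    fun s₁ g₁ f₁ => ?_
  refine Tri.seqF (R := fun s' => s'.reg R5 = 0) (.flat rfl (by decide) (by simp))
    fun s₂ g₂ f₂ => ?_
  refine Tri.seqF (R := fun s' => s'.reg R6 = s.reg LEN + 3) (.flat rfl (by decide)
    (by simp [f₂.1 LEN rfl, f₁.1 LEN rfl])) fun s₃ g₃ f₃ => ?_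
  have a₁ : s₃.reg R4 = s.reg R3 := (f₃.1 _ rfl).trans ((f₂.1 _ rfl).trans g₁)
  have a₂ : s₃.reg R5 = 0 := (f₃.1 _ rfl).trans g₂
  have a₃ : s₃.arr PRODS = s.arr PRODS := (f₃.2 _ rfl).trans ((f₂.2 _ rfl).trans (f₁.2 _ rfl))
  have a₄ : s₃.arr TAB = s.arr TAB := (f₃.2 _ rfl).trans ((f₂.2 _ rfl).trans (f₁.2 _ rfl))
  have a₅ : s₃.reg ST = s.reg ST := (f₃.1 _ rfl).trans ((f₂.1 _ rfl).trans (f₁.1 _ rfl))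
  have a₆ : s₃.reg R1 = s.reg R1 := (f₃.1 _ rfl).trans ((f₂.1 _ rfl).trans (f₁.1 _ rfl))
  -- Here `D` lists the exponents that have been written, `R4` is the remaining quotient, and `R5`
  -- is the number of halvings by which its bit positions have to be shifted.
  refine (Tri.while (fun b s' => ∃ D : List ℕ, b = 60 * s'.reg R4 ∧
    D ++ (s'.reg R4).bitIndices.map (· + s'.reg R5) = (s.reg R3).bitIndices ∧
    s'.reg R6 = s.reg LEN + 3 + D.length ∧ s'.arr TAB = s.arr TAB ∧ s'.reg ST = s.reg ST ∧
    s'.reg R1 = s.reg R1 ∧ (∀ i, i < s.reg LEN + 3 → s'.arr PRODS i = s.arr PRODS i) ∧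
    ∀ (j : ℕ) (hj : j < D.length), s'.arr PRODS (s.reg LEN + 3 + j) = powTab s (s.reg R1) D[j])
    ?_ ?_).mono le_rfl ?_
  rotate_left
  · exact ⟨[], by rw [a₁], by simp [a₁, a₂], by simp [g₃], a₄, a₅, a₆, by simp [a₃], by simp⟩
  · rintro s' ⟨he, b, D, -, h₂, h₃, -, -, -, h₄, h₅⟩
    simp only [Expr.eval_reg] at he
    rw [he, Nat.bitIndices_zero, List.map_nil, List.append_nil] at h₂
    subst h₂
    exact ⟨h₃, h₄, h₅⟩
  · rintro b s' ⟨D, rfl, h₂, h₃, h₄, h₅, h₆, h₇, h₈⟩ he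
    simp only [Expr.eval_reg] at he
    refine ⟨40, 60 * (s'.reg R4 / 2), by simp only [Expr.cost]; omega, ?_⟩
    rcases Nat.mod_two_eq_zero_or_one (s'.reg R4) with hx | hx
    · have e : s'.reg R4 = 2 * (s'.reg R4 / 2) := by omega
      refine .flat rfl (by decide) ⟨D, ?_⟩
      rw [e, Nat.bitIndices_two_mul, List.map_map] at h₂
      simp +decide [hx, h₃, h₄, h₅, h₆]
      refine ⟨?_, fun i hi => h₇ i hi, h₈⟩
      rw [← h₂]
      congr 1
      refine List.map_congr_left fun x _ => ?_
      simp only [Function.comp_apply]; omega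
    · have e : s'.reg R4 = 2 * (s'.reg R4 / 2) + 1 := by omega
      refine .flat rfl (by decide) ⟨D ++ [s'.reg R5], ?_⟩
      rw [e, Nat.bitIndices_two_mul_add_one, List.map_cons, List.map_map] at h₂
      simp +decide [hx, h₃, h₄, h₅, h₆]
      refine ⟨?_, by omega, by split_ifs <;> (funext i; simp +decide [h₄]), fun i hi => ?_, fun j hj => ?_⟩
      · rw [← h₂]
        congr 2
        · omega
        · refine List.map_congr_left fun x _ => ?_
          simp only [Function.comp_apply]; omega
      · have : i ≠ s.reg LEN + 3 + D.length := by omega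
        simp [this, h₇ i hi]
      · rcases Nat.lt_or_ge j D.length with hj' | hj'
        · have : j ≠ D.length := by omega
          simp [this, List.getElem_append_left hj', h₈ j hj']
        · obtain rfl : j = D.length := by omega
          by_cases h0 : s'.reg R5 = 0 <;> simp [h0, powTab]

end emit


/-- Emit the production for a difference; its right-hand side has already been written. -/
def diffEmit : Cmd :=
  .write TAB (keyE (.reg R1) (.reg R2) 1) (.reg FR) ;; .write PRODS (.reg LEN) (.reg FR) ;;
  .write PRODS (.reg LEN + 1) 0 ;; .write PRODS (.reg LEN + 2) (.reg R6 - (.reg LEN + 3)) ;;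
  .set LEN (.reg R6) ;; .set FR (.reg FR + 1)

/-- Emit the production for a chain. -/
def chainEmit : Cmd :=
  .write PRODS (.reg LEN + 1) 0 ;; .write PRODS (.reg LEN + 3) (.reg FR - 1) ;;
  .ite (.read LAST (.reg R1))
    (.write PRODS (.reg LEN + 2) 2 ;;
      .write PRODS (.reg LEN + 4) (.read TAB (keyE (.reg R1) (.read LAST (.reg R1)) 2)))
    (.write PRODS (.reg LEN + 2) 1) ;;
  .write PRODS (.reg LEN) (.reg FR) ;;
  .write TAB (keyE (.reg R1) (.reg R2) 2) (.reg FR) ;;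
  .ite (.read LAST (.reg R1)) (.set LEN (.reg LEN + 5)) (.set LEN (.reg LEN + 4)) ;;
  .write LAST (.reg R1) (.reg R2) ;; .set FR (.reg FR + 1)

/-- Emit the productions for a length. -/
def lenEmit : Cmd := bitsEmit ;; diffEmit ;; chainEmit

section emit
variable {m : ℕ} {A : Finset ℕ} {P : ℕ → ℕ → Prop} {G : Set Production} {pe : ℕ → ℕ}
  {L : ℕ → List ℕ} {s : State}

theorem diffEmit_run (s : State) (n : ℕ) (h6 : s.reg R6 = s.reg LEN + 3 + n) :
    Tri diffEmit s 60 (fun s' => s'.reg LEN = s.reg LEN + 3 + n ∧ s'.reg FR = s.reg FR + 1 ∧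
      (∀ j, s'.arr TAB j =
        if j = key (s.reg ST) (s.reg R1) (s.reg R2) 1 then s.reg FR else s.arr TAB j) ∧
      ∀ j, s'.arr PRODS j = if j = s.reg LEN + 2 then n else if j = s.reg LEN + 1 then 0 else
        if j = s.reg LEN then s.reg FR else s.arr PRODS j) := by
  refine .flat rfl (by decide) ?_
  simp +decide [diffEmit, h6]

theorem chainEmit_run (s : State) :
    Tri chainEmit s 80 (fun s' => s'.reg FR = s.reg FR + 1 ∧
      s'.reg LEN = s.reg LEN + (if s.arr LAST (s.reg R1) = 0 then 4 else 5) ∧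
      (∀ j, s'.arr TAB j =
        if j = key (s.reg ST) (s.reg R1) (s.reg R2) 2 then s.reg FR else s.arr TAB j) ∧
      (∀ j, s'.arr LAST j = if j = s.reg R1 then s.reg R2 else s.arr LAST j) ∧
      (∀ i, i < s.reg LEN → s'.arr PRODS i = s.arr PRODS i) ∧
      s'.arr PRODS (s.reg LEN) = s.reg FR ∧ s'.arr PRODS (s.reg LEN + 1) = 0 ∧
      s'.arr PRODS (s.reg LEN + 2) = (if s.arr LAST (s.reg R1) = 0 then 1 else 2) ∧
      s'.arr PRODS (s.reg LEN + 3) = s.reg FR - 1 ∧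
      (s.arr LAST (s.reg R1) ≠ 0 → s'.arr PRODS (s.reg LEN + 4) =
        s.arr TAB (key (s.reg ST) (s.reg R1) (s.arr LAST (s.reg R1)) 2))) := by
  refine .flat rfl (by decide) ?_
  by_cases h0 : s.arr LAST (s.reg R1) = 0
  · simp +decide [chainEmit, h0]
    intro i hi
    repeat rw [if_neg (by omega)]
  · simp +decide [chainEmit, h0]
    intro i hi
    repeat rw [if_neg (by omega)]

theorem getLastD_mem {l : List ℕ} (h : l.getLastD 0 ≠ 0) : l.getLastD 0 ∈ l := by
  rcases List.eq_nil_or_concat l with rfl | ⟨l', x, rfl⟩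
  · simp at h
  · simp

/-- By `hlog` the powers in the binary expansion of the difference have letters. The letter for the
difference is the old value of `FR` and the letter for the chain is the next one, which is why the
second production refers to the first letter as `FR - 1`. -/
theorem lenEmit_spec (h : ChInv m A P G pe L s) (hA : ∀ a ∈ A, a < m) {a r : ℕ} (ha : a ∈ A)
    (h₁ : s.reg R1 = a) (h₂ : s.reg R2 = r) (hr : r < m) (hrL : r ∉ L a) (hL : ∀ l ∈ L a, l < m)
    (h₃ : s.reg R3 = r - (L a).getLastD 0)
    (hlog : Nat.log 2 (r - (L a).getLastD 0) ≤ pe a) :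
    Tri lenEmit s (60 * s.reg R3 + 160)
      (ChInv m A P G pe (Function.update L a (L a ++ [r]))) := by
  have hst := h.st
  have hle := h.le
  refine Tri.mono (b := 60 * s.reg R3 + 20 + (60 + 80)) ?_ (by omega) fun _ h => h
  refine Tri.seqF (bitsEmit_spec s) fun s₁ ⟨b₁, b₂, b₃⟩ f₁ => ?_
  have c₁ : s₁.reg LEN = s.reg LEN := f₁.1 _ rfl
  rw [← c₁] at b₁
  refine Tri.seqF (diffEmit_run s₁ _ b₁) fun s₂ ⟨d₁, d₂, d₃, d₄⟩ f₂ => ?_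
  refine (chainEmit_run s₂).frame.mono le_rfl
    fun s₃ ⟨⟨e₁, e₂, e₃, e₄, e₅, e₆, e₇, e₈, e₉, e₁₀⟩, f₃⟩ => ?_
  rw [h₃] at b₁ d₁ d₄
  rw [h₃, h₁] at b₃
  set n := (r - (L a).getLastD 0).bitIndices.length with hn
  have g₁ : s₁.reg R1 = a := (f₁.1 _ rfl).trans h₁
  have g₂ : s₁.reg R2 = r := (f₁.1 _ rfl).trans h₂
  have g₃ : s₁.reg ST = m := (f₁.1 _ rfl).trans hst
  have g₄ : s₁.reg FR = s.reg FR := f₁.1 _ rfl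
  have g₅ : s₁.arr TAB = s.arr TAB := f₁.2 _ rfl
  have g₆ : s₂.arr LAST a = (L a).getLastD 0 := by
    rw [f₂.2 _ rfl, f₁.2 _ rfl]; exact (h.exp a ha).2.2
  have g₇ : s₂.reg R1 = a := (f₂.1 _ rfl).trans g₁
  have g₈ : s₂.reg R2 = r := (f₂.1 _ rfl).trans g₂
  have g₉ : s₂.reg ST = m := (f₂.1 _ rfl).trans g₃
  simp only [g₁, g₂, g₃, g₄, g₅, c₁] at d₁ d₂ d₃ d₄
  simp only [g₆, g₇, g₈, g₉, d₁, d₂] at e₁ e₂ e₃ e₄ e₅ e₆ e₇ e₈ e₉ e₁₀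
  have hk1 : s.arr TAB (key m a r 1) < m := by
    by_contra hc
    exact hrL ((h.diff a ha r hr).1 (by omega))
  have hk2 : s₂.arr TAB (key m a r 2) < m := by
    rw [d₃, if_neg fun hc => by have := key_inj hc hr hr (by omega) (by omega); omega]
    by_contra hc
    exact hrL ((h.chain a ha r hr).1 (by omega))
  have hD₂ : Dict (s₂.arr TAB) m (s.reg FR + 1) := h.dict.alloc d₃
  have htab : ∀ b y t, y < m → t < 4 → (b ≠ a ∨ y ≠ r ∨ (t ≠ 1 ∧ t ≠ 2)) →
      s₃.arr TAB (key m b y t) = s.arr TAB (key m b y t) := by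
    intro b y t hy ht hne
    rw [e₃, if_neg, d₃, if_neg]
    all_goals
      intro hc
      have := key_inj hc hy hr ht (by omega)
      omega
  have hself1 : s₃.arr TAB (key m a r 1) = s.reg FR := by
    rw [e₃, if_neg fun hc => by have := key_inj hc hr hr (by omega) (by omega); omega,
      d₃, if_pos rfl]
  have hself2 : s₃.arr TAB (key m a r 2) = s.reg FR + 1 := by rw [e₃, if_pos rfl]
  have hmem : ∀ b ∈ A, ∀ l < m, ∀ t < 4, (t = 1 ∨ t = 2) →
      (m ≤ s.arr TAB (key m b l t) ↔ l ∈ L b) →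
      (m ≤ s₃.arr TAB (key m b l t) ↔ l ∈ Function.update L a (L a ++ [r]) b) := by
    intro b hb l hl t ht ht' hi
    by_cases hc : b = a ∧ l = r
    · obtain ⟨rfl, rfl⟩ := hc
      rw [Function.update_self]
      rcases ht' with rfl | rfl
      · rw [hself1]; simp; omega
      · rw [hself2]; simp; omega
    · rw [htab b l t hl ht (by omega), hi]
      rcases eq_or_ne b a with rfl | hne
      · rw [Function.update_self]; simp; omega
      · rw [Function.update_of_ne hne]
  refine ⟨(f₃.1 _ rfl).trans g₉, ?_, by omega, fun b hb l hl => ?_, fun b hb j hj => ?_,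
    fun b hb l hl => ?_, fun b hb l hl => ?_, fun b hb => ?_, fun nm hn' => ?_⟩
  · rw [e₁]; exact hD₂.alloc e₃
  · rw [htab b l 3 hl (by omega) (by omega)]; exact h.mark b hb l hl
  · rw [htab b j 0 hj (by omega) (by omega)]; exact h.pow b hb j hj
  · exact hmem b hb l hl 1 (by omega) (.inl rfl) (h.diff b hb l hl)
  · exact hmem b hb l hl 2 (by omega) (.inr rfl) (h.chain b hb l hl)
  · obtain ⟨x₁, x₂, x₃⟩ := h.exp b hb
    rw [f₃.2 PE rfl, f₂.2 PE rfl, f₁.2 PE rfl, f₃.2 PW rfl, f₂.2 PW rfl, f₁.2 PW rfl, e₄]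
    refine ⟨x₁, x₂, ?_⟩
    rcases eq_or_ne b a with rfl | hne
    · simp
    · rw [if_neg hne, Function.update_of_ne hne, f₂.2 LAST rfl, f₁.2 LAST rfl, x₃]
  · have hn₂ := hn'.of_alloc e₃ hk2
    have hn₁ := hn₂.of_alloc d₃ hk1
    obtain ⟨p₁, p₂⟩ := h.prods nm hn₁
    refine ⟨fun b hb => ?_, ?_⟩
    · rw [f₃.2 PL rfl, f₂.2 PL rfl, f₁.2 PL rfl]; exact p₁ b hb
    have n₁ : nm (.diff a r) = s.reg FR := by
      rw [(hn' a r hr).2.1 (by rw [hself1]; exact hle), hself1]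
    have n₂ : nm (.chain a r) = s.reg FR + 1 := by
      rw [(hn' a r hr).2.2 (by rw [hself2]; omega), hself2]
    -- An exponent `j` of the expansion satisfies `j < 2 ^ j ≤ r < m`, so it is an admissible second
    -- component of a key. The exponent 0 needs no table entry, since its letter is `a` itself.
    have hpow : ∀ j ∈ (r - (L a).getLastD 0).bitIndices,
        powTab s a j = powLetter nm a j ∧ powLetter nm a j < s.reg FR := by
      intro j hj
      have hj' := (bitIndices_lt hj).trans hlog
      have hjm : j < m := by
        have h1 := Nat.two_pow_le_of_mem_bitIndices hj
        have h2 : j < 2 ^ j := Nat.lt_two_pow_self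
        omega
      refine ⟨?_, powLetter_lt h hn₁ ha (hA a ha) hj' hjm⟩
      cases j with
      | zero => rfl
      | succ j =>
        rw [powTab, if_neg (by omega), powLetter, hst,
          (hn₁ a (j + 1) hjm).1 ((h.pow a ha _ hjm).2 ⟨by omega, hj'⟩)]
    rw [emitted_len ha rfl, Set.union_insert, Set.union_insert]
    have q₂ : PS s₂ (insert ⟨nm (.diff a r), (diffProd nm a ((L a).getLastD 0) r).2⟩
        (G ∪ emitted A nm pe L)) := by
      refine p₂.emit _ ?_ (fun i hi => ?_) (fun j hj => ?_) n₁ (by omega) ?_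
      · rw [d₁]; simp [diffProd, Production.encode, hn]; omega
      · rw [d₄]; repeat rw [if_neg (by omega)]
        exact b₂ i (by omega)
      · simp only [diffProd, Production.encode] at hj ⊢
        match j, hj with
        | 0, _ => simp [d₄, n₁]
        | 1, _ => simp [d₄]
        | 2, _ => simp [d₄, hn]
        | j + 3, hj =>
          simp only [List.length_cons, List.length_map] at hj
          have hj' : j < n := by omega
          rw [d₄]; repeat rw [if_neg (by omega)]
          simp only [List.getElem_cons_succ, List.getElem_map]
          rw [← (hpow _ (List.getElem_mem hj')).1, ← b₃ j hj']
          congr 1; omega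
      · intro b hb
        simp only [diffProd, Rhs.letters, List.mem_map] at hb
        obtain ⟨j, hj, rfl⟩ := hb
        have := (hpow j hj).2
        omega
    refine q₂.emit _ ?_ (fun i hi => e₅ i (by omega)) (fun j hj => ?_) (by rw [n₂, d₂])
      (by omega) ?_
    · rw [e₂, d₁]
      by_cases hz : (L a).getLastD 0 = 0 <;> simp [chainProd, Production.encode, hz, -List.getLastD_eq_getLast?]
    · have hold : (L a).getLastD 0 ≠ 0 → nm (.chain a ((L a).getLastD 0)) =
          s₂.arr TAB (key m a ((L a).getLastD 0) 2) := fun hz => by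
        have hm := getLastD_mem hz
        have hlt := hL _ hm
        have e : s₂.arr TAB (key m a ((L a).getLastD 0) 2) =
            s.arr TAB (key m a ((L a).getLastD 0) 2) := by
          rw [d₃, if_neg fun hc => by have := key_inj hc hlt hr (by omega) (by omega); omega]
        rw [e]
        exact (hn₁ a _ hlt).2.2 ((h.chain a ha _ hlt).2 hm)
      rw [d₁]
      simp only [chainProd, Production.encode] at hj ⊢
      match j, hj with
      | 0, _ => simp [e₆, n₂]
      | 1, _ => simp [e₇]
      | 2, _ => rw [e₈]; by_cases hz : (L a).getLastD 0 = 0 <;> simp [hz, -List.getLastD_eq_getLast?]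
      | 3, _ => rw [e₉]; simp [n₁]
      | j + 4, hj =>
        by_cases hz : (L a).getLastD 0 = 0
        · simp [hz, -List.getLastD_eq_getLast?] at hj
        · simp [hz, -List.getLastD_eq_getLast?] at hj
          obtain rfl : j = 0 := by omega
          rw [e₁₀ hz]; simp [hz, hold hz, -List.getLastD_eq_getLast?]
    · intro b hb
      simp only [chainProd, Rhs.letters, List.mem_cons] at hb
      rcases hb with rfl | hb
      · omega
      · split_ifs at hb with hz
        · simp at hb
        · simp only [List.mem_singleton] at hb
          have hm := getLastD_mem hz
          have hlt := hL _ hm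
          rw [hb, (hn₁ a _ hlt).2.2 ((h.chain a ha _ hlt).2 hm)]
          have := h.dict.1 (key m a ((L a).getLastD 0) 2)
          omega

end emit


/-! ### Chain compression -/

/-- Compute the length of the chain that starts at a node, and initialise the data of its label. -/
def chainRun : Cmd :=
  .set R1 (.read LABEL (.reg I)) ;; .write CUR (.reg R1) 0 ;; .write LAST (.reg R1) 0 ;;
  .write PW (.reg R1) 1 ;; .write PE (.reg R1) 0 ;; .write PL (.reg R1) (.reg R1) ;;
  .set R2 (.read CHILD (.reg I)) ;;
  .ite (.reg R2)
    (.ite (.read NEXT (.reg R2)) (.write RUN (.reg I) 0)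
      (.ite (.op .eq (.read LABEL (.reg R2)) (.reg R1))
        (.write RUN (.reg I) (.read RUN (.reg R2) + 1)) (.write RUN (.reg I) 1)))
    (.write RUN (.reg I) 0)

/-- Mark the lengths of maximal chains, and the nodes to be deleted. -/
def chainMark : Cmd :=
  .ite (.op .lt 1 (.read RUN (.read PARENT (.reg I)))) (.write DEL (.reg I) 1)
    (.write DEL (.reg I) 0 ;;
      .ite (.op .lt 1 (.read RUN (.reg I)))
        (.write TAB (keyE (.read LABEL (.reg I)) (.read RUN (.reg I)) 3) (.reg FR) ;;
          .set FR (.reg FR + 1)) .skip)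

/-- Emit the productions that are due when a longer chain is found. -/
def chainStep : Cmd :=
  .set R1 (.read LABEL (.reg I)) ;; .set R2 (.read RUN (.reg I)) ;;
  .ite (.op .lt (.read CUR (.reg R1)) (.reg R2))
    (.write CUR (.reg R1) (.reg R2) ;; .set R3 (.reg R2 - .read LAST (.reg R1)) ;;
      .ite (.op .eq (.reg R3) (.read PW (.reg R1) + .read PW (.reg R1))) powEmit .skip ;;
      .ite (.op .lt (.read TAB (keyE (.reg R1) (.reg R2) 3)) (.reg ST)) .skip lenEmit) .skip

/-- The new label of a node. -/
def chainLab : Cmd :=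
  .ite (.op .lt 1 (.read RUN (.reg I)))
    (.write NL (.reg I) (.read TAB (keyE (.read LABEL (.reg I)) (.read RUN (.reg I)) 2)))
    (.write NL (.reg I) (.read LABEL (.reg I)))

/-- Chain compression. -/
def chainP : Cmd :=
  .set ST (.reg FR) ;; .write RUN 0 0 ;; forDown chainRun ;; forUp chainMark ;;
  forDown chainStep ;; forUp chainLab ;; contractP

section chains
variable {s : State} {us : List (RTree ℕ)} {N : ℕ}

/-- `rn v` is the number of nodes of the longest chain starting at `v`. -/
def RunSpec (s : State) (N : ℕ) (rn : ℕ → ℕ) : Prop :=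
  ∀ v, 1 ≤ v → v ≤ N → (IsUn s v →
    rn v = if s.arr LABEL (s.arr CHILD v) = s.arr LABEL v then rn (s.arr CHILD v) + 1 else 1) ∧
    (¬ IsUn s v → rn v = 0)

/-- Children have greater addresses than their parents, so the downward loop finds the run of the
child finished. A run starting at `v` uses only nodes from `v` on, whence the bound `N + 1 - v` in
the invariant. The data of letters are reset only for the labels that occur in the tree, which keeps
the cost linear in its current size. -/
theorem chainRun_spec (h : Canon s us N) (h0 : s.arr RUN 0 = 0) :
    Tri (forDown chainRun) s (N * 110 + 8) (fun s' => s'.arr RUN 0 = 0 ∧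
      RunSpec s N (s'.arr RUN) ∧ ∀ v, 1 ≤ v → v ≤ N → s'.arr RUN v ≤ N ∧
        s'.arr CUR (s.arr LABEL v) = 0 ∧ s'.arr LAST (s.arr LABEL v) = 0 ∧
        s'.arr PW (s.arr LABEL v) = 1 ∧ s'.arr PE (s.arr LABEL v) = 0 ∧
        s'.arr PL (s.arr LABEL v) = s.arr LABEL v) := by
  refine (Tri.forDown (C := 100) (fun i s' => s'.arr RUN 0 = 0 ∧
    ∀ v, i < v → v ≤ N → ((IsUn s v → s'.arr RUN v =
        if s.arr LABEL (s.arr CHILD v) = s.arr LABEL v then s'.arr RUN (s.arr CHILD v) + 1 else 1) ∧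
      (¬ IsUn s v → s'.arr RUN v = 0)) ∧ s'.arr RUN v ≤ N + 1 - v ∧
      s'.arr CUR (s.arr LABEL v) = 0 ∧ s'.arr LAST (s.arr LABEL v) = 0 ∧
      s'.arr PW (s.arr LABEL v) = 1 ∧ s'.arr PE (s.arr LABEL v) = 0 ∧
      s'.arr PL (s.arr LABEL v) = s.arr LABEL v) rfl (fun i s x h => h)
    ⟨h0, fun v h₁ h₂ => by omega⟩ h.size ?_).mono le_rfl ?_
  · intro i s' hf h₁ h₂ hi ⟨hr0, hJ⟩
    have eL : s'.arr LABEL = s.arr LABEL := hf.2 _ rfl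
    have eC : s'.arr CHILD = s.arr CHILD := hf.2 _ rfl
    have eX : s'.arr NEXT = s.arr NEXT := hf.2 _ rfl
    have hrun : (∀ v, (chainRun.run s').arr RUN v = if v = i then
          if s.arr CHILD i = 0 then 0 else if s.arr NEXT (s.arr CHILD i) = 0 then
            if s.arr LABEL (s.arr CHILD i) = s.arr LABEL i then s'.arr RUN (s.arr CHILD i) + 1 else 1
          else 0 else s'.arr RUN v) ∧
        (∀ v, (chainRun.run s').arr CUR v = if v = s.arr LABEL i then 0 else s'.arr CUR v) ∧
        (∀ v, (chainRun.run s').arr LAST v = if v = s.arr LABEL i then 0 else s'.arr LAST v) ∧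
        (∀ v, (chainRun.run s').arr PW v = if v = s.arr LABEL i then 1 else s'.arr PW v) ∧
        (∀ v, (chainRun.run s').arr PE v = if v = s.arr LABEL i then 0 else s'.arr PE v) ∧
        (∀ v, (chainRun.run s').arr PL v =
          if v = s.arr LABEL i then s.arr LABEL i else s'.arr PL v) := by
      by_cases c₁ : s.arr CHILD i = 0
      · simp +decide [chainRun, hi, eL, eC, c₁]
      · by_cases c₂ : s.arr NEXT (s.arr CHILD i) = 0
        · by_cases c₃ : s.arr LABEL (s.arr CHILD i) = s.arr LABEL i <;>
            simp +decide [chainRun, hi, eL, eC, eX, c₁, c₂, c₃]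
        · simp +decide [chainRun, hi, eL, eC, eX, c₁, c₂]
    refine .flat rfl (by decide) ?_
    generalize chainRun.run s' = s'' at *
    obtain ⟨r₁, r₂, r₃, r₄, r₅, r₆⟩ := hrun
    refine ⟨by rw [r₁, if_neg (by omega), hr0], fun v hv hvN => ?_⟩
    have hlab : s''.arr CUR (s.arr LABEL v) = 0 ∧ s''.arr LAST (s.arr LABEL v) = 0 ∧
      s''.arr PW (s.arr LABEL v) = 1 ∧ s''.arr PE (s.arr LABEL v) = 0 ∧
      s''.arr PL (s.arr LABEL v) = s.arr LABEL v := by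
      rw [r₂, r₃, r₄, r₅, r₆]
      rcases eq_or_ne (s.arr LABEL v) (s.arr LABEL i) with hl | hl
      · simp [hl]
      · simp only [hl, if_false]
        have : i < v := by
          rcases Nat.lt_or_ge i v with h | h
          · exact h
          · exact absurd (by congr 1; omega) hl
        exact (hJ v this hvN).2.2
    refine ⟨?_, ?_, hlab⟩
    · have hch : IsUn s v → s''.arr RUN (s.arr CHILD v) = s'.arr RUN (s.arr CHILD v) := fun hu => by
        have := h.child (by omega) hvN hu.1
        rw [r₁, if_neg (by omega)]
      rcases Nat.lt_or_ge i v with hlt | hge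
      · obtain ⟨⟨j₁, j₂⟩, -⟩ := hJ v hlt hvN
        have hne : v ≠ i := by omega
        refine ⟨fun hu => ?_, fun hu => ?_⟩
        · rw [hch hu, r₁, if_neg hne, j₁ hu]
        · rw [r₁, if_neg hne, j₂ hu]
      · obtain rfl : v = i := by omega
        refine ⟨fun hu => ?_, fun hu => ?_⟩
        · rw [hch hu, r₁, if_pos rfl, if_neg hu.1, if_pos hu.2]
        · rw [r₁, if_pos rfl]
          by_cases c : s.arr CHILD v = 0
          · rw [if_pos c]
          · rw [if_neg c, if_neg fun c' => hu ⟨c, c'⟩]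
    · rcases Nat.lt_or_ge i v with hlt | hge
      · rw [r₁, if_neg (by omega)]
        exact (hJ v hlt hvN).2.1
      · obtain rfl : v = i := by omega
        rw [r₁, if_pos rfl]
        split_ifs with c₁ c₂ c₃
        · omega
        · have hc := h.child (by omega) hvN c₁
          have := (hJ _ hc.1 hc.2.1).2.1
          omega
        · omega
        · omega
  · intro s' ⟨hr0, hJ⟩
    exact ⟨hr0, fun v h₁ h₂ => (hJ v h₁ h₂).1, fun v h₁ h₂ =>
      ⟨(hJ v h₁ h₂).2.1.trans (by omega), (hJ v h₁ h₂).2.2⟩⟩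

/-- The tag 3 serves only for marks: whether a length occurs for a letter can afterwards be tested
in constant time. Values of `FR` consumed for marks never become letters. Run lengths are at most `N
< m`, so they are admissible in keys. -/
theorem chainMark_spec (h : Canon s us N) {m : ℕ} (hst : s.reg ST = m) (hfr : s.reg FR = m)
    (hT : ∀ k, s.arr TAB k < m) (hr : ∀ v, 1 ≤ v → v ≤ N → s.arr RUN v ≤ N) (hN : N < m) :
    Tri (forUp chainMark) s (N * 110 + 8) (fun s' => Dict (s'.arr TAB) m (s'.reg FR) ∧
      m ≤ s'.reg FR ∧
      (∀ a l, l < m →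
        (m ≤ s'.arr TAB (key m a l 3) ↔ HasLen s N (s.arr LABEL) (s.arr RUN) a l)) ∧
      (∀ a l t, l < m → t < 3 → s'.arr TAB (key m a l t) < m) ∧
      ∀ v, 1 ≤ v → v ≤ N → (s'.arr DEL v ≠ 0 ↔ 2 ≤ s.arr RUN (s.arr PARENT v))) := by
  refine (Tri.forUp (C := 100) (fun i s' => Dict (s'.arr TAB) m (s'.reg FR) ∧ m ≤ s'.reg FR ∧
      (∀ a l, l < m → (m ≤ s'.arr TAB (key m a l 3) ↔ 2 ≤ l ∧ ∃ v, 1 ≤ v ∧ v < i ∧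
        ¬ 2 ≤ s.arr RUN (s.arr PARENT v) ∧ s.arr LABEL v = a ∧ s.arr RUN v = l)) ∧
      (∀ a l t, l < m → t < 3 → s'.arr TAB (key m a l t) < m) ∧
      ∀ v, 1 ≤ v → v < i → (s'.arr DEL v ≠ 0 ↔ 2 ≤ s.arr RUN (s.arr PARENT v)))
    rfl rfl (fun i s x h => h) ?_ h.size ?_).mono le_rfl ?_
  · refine ⟨hfr ▸ Dict.init (hfr ▸ hT), hfr.ge, fun a l _ => ?_, fun a l t _ _ => hT _,
      fun v _ _ => by omega⟩
    have := hT (key m a l 3)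
    constructor
    · intro; omega
    · rintro ⟨_, v, _, _, _⟩; omega
  · intro i s' hf h₁ h₂ hi ⟨j₁, j₂, j₃, j₄, j₅⟩
    have eL : s'.arr LABEL = s.arr LABEL := hf.2 _ rfl
    have eP : s'.arr PARENT = s.arr PARENT := hf.2 _ rfl
    have eR : s'.arr RUN = s.arr RUN := hf.2 _ rfl
    have eS : s'.reg ST = m := (hf.1 _ rfl).trans hst
    refine .flat rfl (by decide) ?_
    have hf' : Frame chainMark s' (chainMark.run s') := Cmd.frame_run rfl s'
    by_cases c₁ : 2 ≤ s.arr RUN (s.arr PARENT i)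
    · have hrun : (chainMark.run s').reg FR = s'.reg FR ∧
          (chainMark.run s').arr TAB = s'.arr TAB ∧
          ∀ v, (chainMark.run s').arr DEL v = if v = i then 1 else s'.arr DEL v := by
        have c₁' : 1 < s.arr RUN (s.arr PARENT i) := c₁
        refine ⟨?_, funext fun k => ?_, fun v => ?_⟩ <;>
          simp +decide [chainMark, hi, eP, eR, c₁']
      generalize chainMark.run s' = s'' at *
      obtain ⟨r₁, r₂, r₃⟩ := hrun
      rw [r₁, r₂]
      refine ⟨j₁, j₂, fun a l hl => ?_, j₄, fun v hv hvi => ?_⟩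
      · rw [j₃ a l hl]
        refine and_congr_right fun _ => ⟨?_, ?_⟩
        · rintro ⟨v, x, y, z⟩; exact ⟨v, x, by omega, z⟩
        · rintro ⟨v, x, y, z⟩
          refine ⟨v, x, ?_, z⟩
          have : v ≠ i := by rintro rfl; exact z.1 c₁
          omega
      · rw [r₃]
        rcases eq_or_ne v i with rfl | hne
        · simp [c₁]
        · rw [if_neg hne]; exact j₅ v hv (by omega)
    · have c₁' : ¬ 1 < s.arr RUN (s.arr PARENT i) := c₁
      by_cases c₂ : 1 < s.arr RUN i
      · have hrun : (chainMark.run s').reg FR = s'.reg FR + 1 ∧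
            (∀ k, (chainMark.run s').arr TAB k =
              if k = key m (s.arr LABEL i) (s.arr RUN i) 3 then s'.reg FR else s'.arr TAB k) ∧
            ∀ v, (chainMark.run s').arr DEL v = if v = i then 0 else s'.arr DEL v := by
          refine ⟨?_, fun k => ?_, fun v => ?_⟩ <;>
            simp +decide [chainMark, hi, eP, eR, c₁', c₂, eL, eS]
        generalize chainMark.run s' = s'' at *
        obtain ⟨r₁, r₂, r₃⟩ := hrun
        rw [r₁]
        have hri := (hr i h₁ h₂).trans_lt hN
        refine ⟨j₁.alloc r₂, by omega, fun a l hl => ?_, fun a l t hl ht => ?_, fun v hv hvi => ?_⟩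
        · rw [r₂]
          split_ifs with hk
          · obtain ⟨rfl, rfl, -⟩ := key_inj hk hl hri (by omega) (by omega)
            exact ⟨fun _ => ⟨c₂, i, h₁, by omega, c₁, rfl, rfl⟩, fun _ => j₂⟩
          · rw [j₃ a l hl]
            refine and_congr_right fun _ => ⟨?_, ?_⟩
            · rintro ⟨v, x, y, z⟩; exact ⟨v, x, by omega, z⟩
            · rintro ⟨v, x, y, z⟩
              refine ⟨v, x, ?_, z⟩
              have : v ≠ i := by rintro rfl; exact hk (by rw [z.2.1, z.2.2])
              omega
        · rw [r₂, if_neg fun hk => by have := key_inj hk hl hri (by omega) (by omega); omega]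
          exact j₄ a l t hl ht
        · rw [r₃]
          rcases eq_or_ne v i with rfl | hne
          · simp [c₁]
          · rw [if_neg hne]; exact j₅ v hv (by omega)
      · have hrun : (chainMark.run s').reg FR = s'.reg FR ∧
            (chainMark.run s').arr TAB = s'.arr TAB ∧
            ∀ v, (chainMark.run s').arr DEL v = if v = i then 0 else s'.arr DEL v := by
          refine ⟨?_, funext fun k => ?_, fun v => ?_⟩ <;>
            simp +decide [chainMark, hi, eP, eR, c₁', c₂]
        generalize chainMark.run s' = s'' at *
        obtain ⟨r₁, r₂, r₃⟩ := hrun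
        rw [r₁, r₂]
        refine ⟨j₁, j₂, fun a l hl => ?_, j₄, fun v hv hvi => ?_⟩
        · rw [j₃ a l hl]
          refine and_congr_right fun hl2 => ⟨?_, ?_⟩
          · rintro ⟨v, x, y, z⟩; exact ⟨v, x, by omega, z⟩
          · rintro ⟨v, x, y, z⟩
            refine ⟨v, x, ?_, z⟩
            have : v ≠ i := by rintro rfl; omega
            omega
        · rw [r₃]
          rcases eq_or_ne v i with rfl | hne
          · simp [c₁]
          · rw [if_neg hne]; exact j₅ v hv (by omega)
  · intro s' ⟨j₁, j₂, j₃, j₄, j₅⟩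
    refine ⟨j₁, j₂, fun a l hl => ?_, j₄, fun v h₁ h₂ => j₅ v h₁ (by omega)⟩
    rw [j₃ a l hl, HasLen]
    refine and_congr_right fun _ => exists_congr fun v => and_congr_right fun _ => and_congr_left' ?_
    omega

theorem chainLab_spec (h : Canon s us N) :
    Tri (forUp chainLab) s (N * 60 + 8) (fun s' => ∀ v, 1 ≤ v → v ≤ N → s'.arr NL v =
      if 2 ≤ s.arr RUN v then s.arr TAB (key (s.reg ST) (s.arr LABEL v) (s.arr RUN v) 2)
      else s.arr LABEL v) := by
  refine (Tri.forUp (C := 50) (fun i s' => ∀ v, 1 ≤ v → v < i → s'.arr NL v =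
      if 2 ≤ s.arr RUN v then s.arr TAB (key (s.reg ST) (s.arr LABEL v) (s.arr RUN v) 2)
      else s.arr LABEL v) rfl rfl (fun i s x h => h) (fun v _ _ => by omega) h.size ?_).mono le_rfl
    fun s' h v h₁ h₂ => h v h₁ (by omega)
  intro i s' hf h₁ h₂ hi hJ
  have eL : s'.arr LABEL = s.arr LABEL := hf.2 _ rfl
  have eR : s'.arr RUN = s.arr RUN := hf.2 _ rfl
  have eT : s'.arr TAB = s.arr TAB := hf.2 _ rfl
  have eS : s'.reg ST = s.reg ST := hf.1 _ rfl
  have hrun : ∀ v, (chainLab.run s').arr NL v = if v = i then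
      (if 2 ≤ s.arr RUN v then s.arr TAB (key (s.reg ST) (s.arr LABEL v) (s.arr RUN v) 2)
      else s.arr LABEL v) else s'.arr NL v := by
    intro v
    by_cases c : 1 < s.arr RUN i
    · rcases eq_or_ne v i with rfl | hne
      · have c' : 2 ≤ s.arr RUN v := c
        simp +decide [chainLab, hi, eL, eR, eT, eS, c, c']
      · simp +decide [chainLab, hi, eL, eR, eT, eS, c, hne]
    · rcases eq_or_ne v i with rfl | hne
      · have c' : ¬ 2 ≤ s.arr RUN v := c
        simp +decide [chainLab, hi, eL, eR, c, c']
      · simp +decide [chainLab, hi, eL, eR, c, hne]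
  refine .flat rfl (by decide) fun v hv hvi => ?_
  rw [hrun]
  rcases eq_or_ne v i with rfl | hne
  · rw [if_pos rfl]
  · rw [if_neg hne]; exact hJ v hv (by omega)

end chains


-- Meeting the lengths of every letter in increasing order, at amortised constant cost.

section chains
variable {m : ℕ} {A : Finset ℕ} {P : ℕ → ℕ → Prop} {G : Set Production} {pe : ℕ → ℕ}
  {L : ℕ → List ℕ} {s : State} {us : List (RTree ℕ)} {N : ℕ}

theorem ChInv.congr (h : ChInv m A P G pe L s) {s' : State} (h₁ : s'.reg ST = s.reg ST)
    (h₂ : s'.reg FR = s.reg FR) (h₃ : s'.reg LEN = s.reg LEN) (h₄ : s'.arr TAB = s.arr TAB)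
    (h₅ : s'.arr PE = s.arr PE) (h₆ : s'.arr PW = s.arr PW) (h₇ : s'.arr PL = s.arr PL)
    (h₈ : s'.arr LAST = s.arr LAST) (h₉ : s'.arr PRODS = s.arr PRODS) :
    ChInv m A P G pe L s' := by
  refine ⟨h₁.trans h.st, by rw [h₄, h₂]; exact h.dict, by rw [h₂]; exact h.le,
    by rw [h₄]; exact h.mark, by rw [h₄]; exact h.pow, by rw [h₄]; exact h.diff,
    by rw [h₄]; exact h.chain, by rw [h₅, h₆, h₈]; exact h.exp, fun nm hn => ?_⟩
  rw [h₄] at hn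
  obtain ⟨p₁, p₂⟩ := h.prods nm hn
  exact ⟨by rw [h₇]; exact p₁, p₂.congr h₃ (fun i _ => by rw [h₉]) h₂.ge⟩

/-- The potential that pays for writing binary expansions. -/
noncomputable def chainPot (A : Finset ℕ) (P : ℕ → ℕ → Prop) (cur : ℕ → ℕ) : ℕ :=
  ∑ a ∈ A, 60 * (cur a - (lens (P a) (cur a)).getLastD 0)

theorem chainPot_update {cur : ℕ → ℕ} {a x : ℕ} (ha : a ∈ A) :
    chainPot A P (Function.update cur a x) + 60 * (cur a - (lens (P a) (cur a)).getLastD 0) =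
      chainPot A P cur + 60 * (x - (lens (P a) x).getLastD 0) := by
  unfold chainPot
  rw [← Finset.add_sum_erase A _ ha, ← Finset.add_sum_erase A
    (fun a => 60 * (cur a - (lens (P a) (cur a)).getLastD 0)) ha]
  have : ∑ b ∈ A.erase a, 60 * (Function.update cur a x b -
      (lens (P b) (Function.update cur a x b)).getLastD 0) =
      ∑ b ∈ A.erase a, 60 * (cur b - (lens (P b) (cur b)).getLastD 0) :=
    Finset.sum_congr rfl fun b hb => by rw [Function.update_of_ne (Finset.ne_of_mem_erase hb)]
  rw [this, Function.update_self]
  ring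

/-- The state of the emission after chains of lengths up to `cur a` have been found. -/
def StepInv (m : ℕ) (A : Finset ℕ) (P : ℕ → ℕ → Prop) (G : Set Production) (N : ℕ)
    (lb rn : ℕ → ℕ) (i p : ℕ) (s : State) : Prop :=
  ∃ cur : ℕ → ℕ, p = chainPot A P cur ∧ (∀ a ∈ A, s.arr CUR a = cur a) ∧
    (∀ v, i < v → v ≤ N → rn v ≤ cur (lb v)) ∧
    (∀ a ∈ A, cur a = 0 ∨ ∃ v, i < v ∧ v ≤ N ∧ lb v = a ∧ rn v = cur a) ∧
    ChInv m A P G (fun a => maxExp (P a) (cur a)) (fun a => lens (P a) (cur a)) s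

/-- By `hstep` a run of length at least 2 extends a run of the same letter at an already visited
node. So the record `cur a` of a letter can only be beaten by one: every length up to the longest
run is met in increasing order, which takes the place of sorting. -/
theorem chainStep_spec {lb rn : ℕ → ℕ} {i p : ℕ} (hA : ∀ a ∈ A, a < m)
    (hlb : lb i ∈ A) (hN : N < m) (hrn : rn i ≤ N) (h₁ : 1 ≤ i) (h₂ : i ≤ N)
    (hi : s.reg I = i) (eL : s.arr LABEL = lb) (eR : s.arr RUN = rn)
    (hstep : rn i ≤ 1 ∨ ∃ v, i < v ∧ v ≤ N ∧ lb v = lb i ∧ rn i = rn v + 1)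
    (h : StepInv m A P G N lb rn i p s) :
    ∃ c p', c + p' ≤ 500 + p ∧ Tri chainStep s c (StepInv m A P G N lb rn (i - 1) p') := by
  classical
  obtain ⟨cur, rfl, c₁, c₂, c₃, c₄⟩ := h
  set a := lb i with ha
  set r := rn i with hr
  -- the first two instructions
  have start : ∀ c Q, (∀ s', s'.reg R1 = a → s'.reg R2 = r →
      Frame (.set R1 (.read LABEL (.reg I)) ;; .set R2 (.read RUN (.reg I))) s s' →
      Tri (.ite (.op .lt (.read CUR (.reg R1)) (.reg R2))
        (.write CUR (.reg R1) (.reg R2) ;; .set R3 (.reg R2 - .read LAST (.reg R1)) ;;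
          .ite (.op .eq (.reg R3) (.read PW (.reg R1) + .read PW (.reg R1))) powEmit .skip ;;
          .ite (.op .lt (.read TAB (keyE (.reg R1) (.reg R2) 3)) (.reg ST)) .skip lenEmit) .skip)
        s' c Q) → Tri chainStep s (3 + (3 + c)) Q := by
    intro c Q hQ
    refine Tri.seqF (R := fun s' => s'.reg R1 = a) (.flat rfl (by decide) (by simp [hi, eL, ha]))
      fun s₁ g₁ f₁ => ?_
    refine Tri.seqF (R := fun s' => s'.reg R2 = r) (.flat rfl (by decide)
      (by simp [f₁.1 I rfl, hi, f₁.2 RUN rfl, eR, hr])) fun s₂ g₂ f₂ => ?_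
    refine hQ s₂ ((f₂.1 _ rfl).trans g₁) g₂ ⟨fun x hx => ?_, fun x hx => ?_⟩
    · simp only [Cmd.modR, Bool.or_eq_false_iff] at hx
      rw [f₂.1 x hx.2, f₁.1 x hx.1]
    · rw [f₂.2 x rfl, f₁.2 x rfl]
  by_cases hc : cur a < r
  · -- a longer chain
    have hra : r = cur a + 1 := by
      rcases hstep with h | ⟨v, x, y, z, w⟩
      · omega
      · have := c₂ v x y; rw [z] at this; omega
    set b := (lens (P a) (cur a)).getLastD 0 with hb
    have hble : b ≤ cur a := lens_last_le _ _
    set cur' := Function.update cur a r with hcur'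
    have hpe : (fun a => maxExp (P a) (cur' a)) = Function.update (fun a => maxExp (P a) (cur a)) a
        (if r - b = 2 ^ maxExp (P a) (cur a) + 2 ^ maxExp (P a) (cur a)
          then maxExp (P a) (cur a) + 1 else maxExp (P a) (cur a)) := by
      funext x
      rcases eq_or_ne x a with rfl | hne
      · simp only [hcur', Function.update_self]
        rw [hra, maxExp_succ]
      · simp only [hcur', Function.update_of_ne hne]
    have hpot := chainPot_update (P := P) (cur := cur) (x := r) hlb
    rw [← hcur', ← hb] at hpot
    have hPl : ¬ P a r → lens (P a) r = lens (P a) (cur a) := fun hn => by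
      rw [hra] at hn ⊢; exact lens_succ_neg hn
    have hPl' : P a r → lens (P a) r = lens (P a) (cur a) ++ [r] := fun hn => by
      rw [hra] at hn ⊢; exact lens_succ_pos hn
    -- the cost
    have hcost : ∃ c₀, (c₀ = if P a r then 60 * (r - b) + 160 else 1) ∧
        6 + (7 + (4 + (5 + (10 + (120 + (20 + c₀)))))) + chainPot A P cur' ≤
          500 + chainPot A P cur := by
      refine ⟨_, rfl, ?_⟩
      split_ifs with hP
      · rw [hPl' hP] at hpot
        simp only [List.getLastD_concat] at hpot
        omega
      · rw [hPl hP, ← hb] at hpot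
        omega
    obtain ⟨c₀, hc₀, hcost⟩ := hcost
    refine ⟨_, chainPot A P cur', hcost, ?_⟩
    have fin : ∀ s', (∀ x ∈ A, s'.arr CUR x = cur' x) →
        ChInv m A P G (fun a => maxExp (P a) (cur' a)) (fun a => lens (P a) (cur' a)) s' →
        StepInv m A P G N lb rn (i - 1) (chainPot A P cur') s' := by
      intro s' q₁ q₂
      refine ⟨cur', rfl, q₁, fun v hv hvN => ?_, fun x hx => ?_, q₂⟩
      · rcases eq_or_ne v i with rfl | hne
        · rw [← ha, ← hr, hcur', Function.update_self]
        · have := c₂ v (by omega) hvN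
          rcases eq_or_ne (lb v) a with hl | hl
          · rw [hl] at this ⊢
            rw [hcur', Function.update_self]; omega
          · rwa [hcur', Function.update_of_ne hl]
      · rcases eq_or_ne x a with rfl | hl
        · refine .inr ⟨i, by omega, h₂, rfl, ?_⟩
          rw [hcur', Function.update_self]
        · rw [hcur', Function.update_of_ne hl]
          exact (c₃ x hx).imp_right fun ⟨v, x, y, z⟩ => ⟨v, by omega, y, z⟩
    have := start (7 + (4 + (5 + (10 + (120 + (20 + c₀)))))) (StepInv m A P G N lb rn (i - 1)
      (chainPot A P cur')) fun s₂ g₁ g₂ f₂ => ?_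
    · exact this.mono (by omega) fun _ h => h
    have e₁ : s₂.arr CUR = s.arr CUR := f₂.2 _ rfl
    have k₂ : ChInv m A P G (fun a => maxExp (P a) (cur a)) (fun a => lens (P a) (cur a)) s₂ :=
      c₄.congr (f₂.1 _ rfl) (f₂.1 _ rfl) (f₂.1 _ rfl) (f₂.2 _ rfl) (f₂.2 _ rfl) (f₂.2 _ rfl)
        (f₂.2 _ rfl) (f₂.2 _ rfl) (f₂.2 _ rfl)
    refine Tri.mono (Tri.ite (b := 4 + (5 + (10 + (120 + (20 + c₀))))) (fun _ => ?_) fun he => ?_)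
      (by simp only [Expr.cost]; omega) fun _ h => h
    swap
    · simp [g₁, g₂, e₁, c₁ a hlb] at he
      omega
    refine Tri.mono (b := 3 + (5 + ((9 + 1 + 101) + (20 + c₀)))) ?_ (by omega) fun _ h => h
    refine Tri.seqF (R := fun s' => ∀ x ∈ A, s'.arr CUR x = cur' x) (.flat rfl (by decide) ?_)
      fun s₃ g₃ f₃ => ?_
    · intro x hx
      have := c₁ x hx
      rcases eq_or_ne x a with rfl | hne
      · simp [g₁, g₂, hcur']
      · simp [g₁, g₂, hcur', hne, e₁, this]
    have k₃ := k₂.congr (s' := s₃) (f₃.1 _ rfl) (f₃.1 _ rfl) (f₃.1 _ rfl) (f₃.2 _ rfl) (f₃.2 _ rfl)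
      (f₃.2 _ rfl) (f₃.2 _ rfl) (f₃.2 _ rfl) (f₃.2 _ rfl)
    have g₁' : s₃.reg R1 = a := (f₃.1 _ rfl).trans g₁
    have g₂' : s₃.reg R2 = r := (f₃.1 _ rfl).trans g₂
    refine Tri.seqF (R := fun s' => s'.reg R3 = r - b) (.flat rfl (by decide)
      (by simp only [Cmd.run, State.setR, Expr.eval_sub, Expr.eval_reg, Expr.eval_read, g₁', g₂',
            (k₃.exp a hlb).2.2, Function.update_self, hb])) fun s₄ g₄ f₄ => ?_
    have k₄ := k₃.congr (s' := s₄) (f₄.1 _ rfl) (f₄.1 _ rfl) (f₄.1 _ rfl) (f₄.2 _ rfl) (f₄.2 _ rfl)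
      (f₄.2 _ rfl) (f₄.2 _ rfl) (f₄.2 _ rfl) (f₄.2 _ rfl)
    have g₁₄ : s₄.reg R1 = a := (f₄.1 _ rfl).trans g₁'
    have g₂₄ : s₄.reg R2 = r := (f₄.1 _ rfl).trans g₂'
    have g₃₄ : ∀ x ∈ A, s₄.arr CUR x = cur' x := fun x hx => by rw [f₄.2 _ rfl, g₃ x hx]
    have hpw := (k₄.exp a hlb).2.1
    refine Tri.seqF (R := ChInv m A P G (fun a => maxExp (P a) (cur' a))
      (fun a => lens (P a) (cur a))) (Tri.mono (Tri.ite (b := 100) (fun he => ?_) fun he => ?_)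
        (by simp only [Expr.cost]; omega) fun _ h => h) fun s₅ k₅ f₅ => ?_
    · have hx : r - b = 2 ^ maxExp (P a) (cur a) + 2 ^ maxExp (P a) (cur a) := by
        simp only [Expr.eval_eq, Expr.eval_reg, Expr.eval_add, Expr.eval_read, g₁₄, g₄, hpw] at he
        by_contra hne
        simp [hne] at he
      rw [hpe, if_pos hx]
      refine powEmit_spec k₄ hA hlb g₁₄ (by rw [g₄, hx]) ?_
      have : maxExp (P a) (cur a) < 2 ^ maxExp (P a) (cur a) := Nat.lt_two_pow_self
      omega
    · have hx : ¬ r - b = 2 ^ maxExp (P a) (cur a) + 2 ^ maxExp (P a) (cur a) := by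
        simp only [Expr.eval_eq, Expr.eval_reg, Expr.eval_add, Expr.eval_read, g₁₄, g₄, hpw] at he
        intro hne
        simp [hne] at he
      rw [hpe, if_neg hx]
      refine .flat rfl (by decide) ?_
      rw [show Function.update (fun a => maxExp (P a) (cur a)) a (maxExp (P a) (cur a)) =
        fun a => maxExp (P a) (cur a) from Function.update_eq_self a _]
      exact k₄
    have f₅R : ∀ x, x ≠ LEN → x ≠ FR → s₅.reg x = s₄.reg x := fun x hx hx' => f₅.1 x (by
      simp [Cmd.modR, powEmit, hx.symm, hx'.symm])
    have g₁₅ : s₅.reg R1 = a := (f₅.1 _ rfl).trans g₁₄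
    have g₂₅ : s₅.reg R2 = r := (f₅.1 _ rfl).trans g₂₄
    have g₃₅ : ∀ x ∈ A, s₅.arr CUR x = cur' x := fun x hx => by rw [f₅.2 _ rfl, g₃₄ x hx]
    have g₄₅ : s₅.reg R3 = r - b := (f₅.1 _ rfl).trans g₄
    have hrm : r < m := by omega
    have hmark := k₅.mark a hlb r hrm
    have hst := k₅.st
    refine Tri.mono (Tri.ite (b := c₀) (fun he => ?_) fun he => ?_)
        (Nat.add_le_add_right (by decide) c₀) fun _ h => h
    · have hx : ¬ P a r := by
        simp [g₁₅, g₂₅, hst] at he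
        rw [← hmark]; omega
      refine .flat rfl (by rw [hc₀, if_neg hx]; decide) (fin _ g₃₅ ?_)
      have : (fun a => lens (P a) (cur' a)) = fun a => lens (P a) (cur a) := by
        funext x
        rcases eq_or_ne x a with rfl | hne
        · simp only [hcur', Function.update_self]; exact hPl hx
        · simp only [hcur', Function.update_of_ne hne]
      rw [this]
      exact k₅
    · have hx : P a r := by
        simp [g₁₅, g₂₅, hst] at he
        rw [← hmark]; omega
      have : (fun a => lens (P a) (cur' a)) =
          Function.update (fun a => lens (P a) (cur a)) a (lens (P a) (cur a) ++ [r]) := by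
        funext x
        rcases eq_or_ne x a with rfl | hne
        · simp only [hcur', Function.update_self]; exact hPl' hx
        · simp only [hcur', Function.update_of_ne hne]
      have hlog : Nat.log 2 (r - b) ≤ maxExp (P a) (cur' a) := by
        rw [hcur', Function.update_self]
        rw [hra] at hx ⊢
        exact log_le_maxExp hx
      refine Tri.mono (lenEmit_spec k₅ hA hlb g₁₅ g₂₅ hrm (fun h => ?_) (fun l hl => ?_) g₄₅
        hlog).frame (by rw [hc₀, if_pos hx, g₄₅]) fun s₆ ⟨k₆, f₆⟩ => fin _ (fun x hx => ?_) ?_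
      · have := (mem_lens.1 h).2.1; omega
      · have := (mem_lens.1 hl).2.1; omega
      · rw [f₆.2 _ rfl, g₃₅ x hx]
      · rw [this]; exact k₆
  · refine ⟨50, chainPot A P cur, by omega, ?_⟩
    have := start 40 (StepInv m A P G N lb rn (i - 1) (chainPot A P cur)) fun s₂ g₁ g₂ f₂ => ?_
    · exact this.mono (by omega) fun _ h => h
    have e₁ : s₂.arr CUR = s.arr CUR := f₂.2 _ rfl
    refine Tri.mono (Tri.ite (b := 1) (fun he => ?_) fun he => ?_)
      (by simp only [Expr.cost]; omega) fun _ h => h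
    · simp [g₁, g₂, e₁, c₁ a hlb] at he
      omega
    · refine .flat rfl le_rfl ⟨cur, rfl, fun x hx => ?_, fun v hv hvN => ?_, fun x hx => ?_, ?_⟩
      · exact (congrFun e₁ x).trans (c₁ x hx)
      · rcases eq_or_ne v i with rfl | hne
        · rw [← ha, ← hr]; omega
        · exact c₂ v (by omega) hvN
      · exact (c₃ x hx).imp_right fun ⟨v, x, y, z⟩ => ⟨v, by omega, y, z⟩
      · exact c₄.congr (f₂.1 _ rfl) (f₂.1 _ rfl) (f₂.1 _ rfl) (f₂.2 _ rfl) (f₂.2 _ rfl)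
          (f₂.2 _ rfl) (f₂.2 _ rfl) (f₂.2 _ rfl) (f₂.2 _ rfl)

end chains


-- Correctness and cost of chain compression.

theorem lengthProds_fst {nm : Desc → ℕ} {a q : ℕ} {ls : List ℕ} {p : Desc × Rhs}
    (h : p ∈ lengthProds nm a q ls) : ∃ l ∈ ls, p.1 = .diff a l ∨ p.1 = .chain a l := by
  induction ls generalizing q with
  | nil => simp [lengthProds] at h
  | cons l ls ih =>
    simp only [lengthProds, List.mem_cons] at h
    rcases h with rfl | rfl | h
    · exact ⟨l, by simp, .inl rfl⟩
    · exact ⟨l, by simp, .inr rfl⟩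
    · obtain ⟨l', h₁, h₂⟩ := ih h
      exact ⟨l', by simp [h₁], h₂⟩

/-- The names of the letters of a chain compression, taken from the table `T`. -/
def chainName (T : ℕ → ℕ) (m : ℕ) : Desc → ℕ
  | .pow a j => T (key m a j 0)
  | .diff a l => T (key m a l 1)
  | .chain a l => T (key m a l 2)
  | _ => 0

section chains
variable {s s' : State} {us : List (RTree ℕ)} {N m : ℕ} {G : Set Production}

/-- After all chains have been treated, exactly the required productions are stored. -/
theorem StepInv.result {A : Finset ℕ} {lb rn : ℕ → ℕ} {p : ℕ} (h : Canon s us N)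
    (hlb : s.arr LABEL = lb) (hr : RunSpec s N rn) (h0 : rn 0 = 0)
    (hrN : ∀ v, 1 ≤ v → v ≤ N → rn v ≤ N) (hN : N < m)
    (hA : ∀ a, a ∈ A ↔ ∃ v, 1 ≤ v ∧ v ≤ N ∧ lb v = a)
    (hI : StepInv m A (HasLen s N lb rn) G N lb rn 0 p s') :
    PS s' (addProds G (chainName (s'.arr TAB) m)
      (chainProds (chainName (s'.arr TAB) m) (node (lb 1) (mapL lb us)))) ∧
    (∀ p ∈ chainProds (chainName (s'.arr TAB) m) (node (lb 1) (mapL lb us)),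
      m ≤ chainName (s'.arr TAB) m p.1) ∧
    ∀ p ∈ chainProds (chainName (s'.arr TAB) m) (node (lb 1) (mapL lb us)),
    ∀ q ∈ chainProds (chainName (s'.arr TAB) m) (node (lb 1) (mapL lb us)),
      chainName (s'.arr TAB) m p.1 = chainName (s'.arr TAB) m q.1 → p.1 = q.1 := by
  obtain ⟨cur, -, -, c₂, c₃, c₄⟩ := hI
  subst hlb
  set lb := s.arr LABEL with hlb
  set nm := chainName (s'.arr TAB) m with hnm
  set P := HasLen s N lb rn with hP
  have hls : ∀ a ∈ A, chainLengths (node (lb 1) (mapL lb us)) a = lens (P a) (cur a) :=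
    fun a ha => chainLengths_eq h hr h0 fun v h₁ h₂ h₃ => h₃ ▸ c₂ v (by omega) h₂
  have hnl : ∀ a, a ∉ A → chainLengths (node (lb 1) (mapL lb us)) a = [] := fun a ha => by
    rw [chainLengths_eq h hr h0 (r := 0) fun v h₁ h₂ h₃ => absurd ((hA a).2 ⟨v, h₁, h₂, h₃⟩) ha,
      lens_zero]
  have hcurN : ∀ a ∈ A, cur a ≤ N := fun a ha => by
    rcases c₃ a ha with h | ⟨v, h₁, h₂, -, h₃⟩
    · omega
    · rw [← h₃]; exact hrN v (by omega) h₂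
  -- In the end a record of at least 2 is itself the length of a maximal chain: a parent continuing
  -- the run would have given a longer one. Hence the open gap is 0, and no power beyond the
  -- logarithm of the maximal difference has been emitted.
  have hpow : ∀ a ∈ A, powProds nm a (chainLengths (node (lb 1) (mapL lb us)) a) =
      powList nm a (maxExp (P a) (cur a)) := fun a ha => by
    rw [hls a ha, powProds, powList]
    congr 2
    unfold maxExp
    by_cases h2 : 2 ≤ cur a
    · have hPa : P a (cur a) := by
        rcases c₃ a ha with h' | ⟨v, h₁, h₂, h₃, h₄⟩
        · omega
        · refine ⟨h2, v, h₁, h₂, fun hpar => ?_, h₃, h₄⟩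
          have hp0 : s.arr PARENT v ≠ 0 := fun h' => by rw [h', h0] at hpar; omega
          have hv2 : 2 ≤ v := by
            by_contra hv
            obtain rfl : v = 1 := by omega
            exact hp0 h.parent_one
          obtain ⟨p₁, p₂, -, -⟩ := h.parent hv2 h₂
          obtain ⟨r₁, r₂⟩ := hr _ p₁ (by omega)
          by_cases hu : IsUn s (s.arr PARENT v)
          · have r₁ := r₁ hu
            rw [h.only_child (by omega) h₂ hp0 hu.2] at r₁
            split_ifs at r₁ with hl
            · have := c₂ _ p₁ (by omega)
              rw [← hlb] at hl
              rw [← hl, h₃, r₁, h₄] at this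
              omega
            · omega
          · have := r₂ hu; omega
      obtain ⟨r, hr'⟩ : ∃ r, cur a = r + 1 := ⟨cur a - 1, by omega⟩
      rw [hr'] at hPa ⊢
      rw [lens_succ_pos hPa]
      simp
    · have : lens (P a) (cur a) = [] := by
        refine List.eq_nil_iff_forall_not_mem.2 fun l hl => ?_
        obtain ⟨-, h₁, h₂, -⟩ := mem_lens.1 hl
        omega
      rw [this]
      simp only [maxDiff, List.getLastD_nil]
      rw [Nat.log_of_lt (by omega), Nat.log_of_lt (by omega)]
  have hset : addProds G nm (chainProds nm (node (lb 1) (mapL lb us))) =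
      G ∪ emitted A nm (fun a => maxExp (P a) (cur a)) (fun a => lens (P a) (cur a)) := by
    unfold addProds
    congr 1
    ext q
    simp only [emitted, chainProds, Set.mem_image, Set.mem_ofPred_eq]
    constructor
    · rintro ⟨p, ⟨a, hp⟩, rfl⟩
      by_cases ha : a ∈ A
      · refine ⟨a, ha, p, ?_, rfl⟩
        rwa [hpow a ha, hls a ha] at hp
      · rw [hnl a ha] at hp
        simp [powProds, maxDiff, lengthProds] at hp
    · rintro ⟨a, ha, p, hp, rfl⟩
      refine ⟨p, ⟨a, ?_⟩, rfl⟩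
      rwa [hpow a ha, hls a ha]
  have hagree : Agree nm (s'.arr TAB) m := fun a j _ => ⟨fun _ => rfl, fun _ => rfl, fun _ => rfl⟩
  have hkeys : ∀ p ∈ chainProds nm (node (lb 1) (mapL lb us)), m ≤ nm p.1 ∧ ∃ a ∈ A, ∃ j < m,
      p.1 = .pow a j ∨ p.1 = .diff a j ∨ p.1 = .chain a j := by
    rintro p ⟨a, hp⟩
    have ha : a ∈ A := by
      by_contra ha
      rw [hnl a ha] at hp
      simp [powProds, maxDiff, lengthProds] at hp
    rw [hpow a ha, hls a ha] at hp
    rcases hp with hp | hp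
    · simp only [powList, List.mem_map, List.mem_range] at hp
      obtain ⟨j, hj, rfl⟩ := hp
      -- The exponent is less than the power, and the power is at most a difference of lengths,
      -- hence at most `N`.
      have hjm : j + 1 < m := by
        have h₁ : 2 ^ (j + 1) ≤ max (maxDiff 0 (lens (P a) (cur a)))
            (cur a - (lens (P a) (cur a)).getLastD 0) := by
          have : j + 1 ≤ maxExp (P a) (cur a) := hj
          refine Nat.pow_le_of_le_log ?_ this
          intro h0
          unfold maxExp at this
          rw [h0, Nat.log_zero_right] at this
          omega
        have h₂ : ∀ ls q, (∀ l ∈ ls, l ≤ N) → maxDiff q ls ≤ N := by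
          intro ls
          induction ls with
          | nil => intro q _; exact Nat.zero_le _
          | cons l ls ih =>
            intro q hq
            have e₁ := ih l fun x hx => hq x (by simp [hx])
            have e₂ := hq l (by simp)
            simp only [maxDiff]; omega
        have h₃ := h₂ (lens (P a) (cur a)) 0 fun l hl =>
          (mem_lens.1 hl).2.1.trans (hcurN a ha)
        have h₄ := hcurN a ha
        have h₅ : j + 1 < 2 ^ (j + 1) := Nat.lt_two_pow_self
        omega
      exact ⟨(c₄.pow a ha _ hjm).2 ⟨by omega, hj⟩, a, ha, j + 1, hjm, .inl rfl⟩
    · obtain ⟨l, hl, h'⟩ := lengthProds_fst hp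
      have hlm : l < m := by
        have := (mem_lens.1 hl).2.1
        have := hcurN a ha
        omega
      rcases h' with h' | h'
      · exact ⟨by rw [h']; exact (c₄.diff a ha l hlm).2 hl, a, ha, l, hlm, .inr (.inl h')⟩
      · exact ⟨by rw [h']; exact (c₄.chain a ha l hlm).2 hl, a, ha, l, hlm, .inr (.inr h')⟩
  refine ⟨?_, fun p hp => (hkeys p hp).1, fun p hp q hq hpq => ?_⟩
  · rw [hset]; exact (c₄.prods nm hagree).2
  · obtain ⟨m₁, a, -, j, hj, hp'⟩ := hkeys p hp
    obtain ⟨-, b, -, l, hl, hq'⟩ := hkeys q hq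
    -- Entries from the threshold on are injective in the key, and the key determines the letter,
    -- the number and the tag, so equal names come from equal descriptions.
    have key : ∀ t t', t < 4 → t' < 4 → nm p.1 = s'.arr TAB (key m a j t) →
        nm q.1 = s'.arr TAB (key m b l t') → a = b ∧ j = l ∧ t = t' := by
      intro t t' ht ht' e₁ e₂
      exact key_inj (c₄.dict.2 _ _ (e₁ ▸ m₁) (by rw [← e₁, ← e₂, hpq])) hj hl ht ht'
    rcases hp' with hp' | hp' | hp' <;> rcases hq' with hq' | hq' | hq' <;>
      (have := key _ _ (by omega) (by omega) (congrArg nm hp') (congrArg nm hq')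
       obtain ⟨rfl, rfl, ht⟩ := this
       first
       | exact absurd ht (by decide)
       | rw [hp', hq'])

theorem chainP_spec {X : Config} (hX : Good s X) :
    Tri chainP s (2000 * X.tree.size) (fun s' => ∃ Y, ChainComp X Y ∧ Good s' Y) := by
  have hused := hX.used
  obtain ⟨us, hc, ht, hps, hlab, hsz, hT⟩ := hX
  set N := X.tree.size with hNdef
  have hN := hc.pos
  refine Tri.mono (b := 2 + (3 + ((N * 110 + 8) + ((N * 110 + 8) + ((N * (500 + 10) + 0 + 8) +
    ((N * 60 + 8) + 200 * N)))))) ?_ (by omega) fun _ h => h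
  set m := s.reg FR with hm
  set lb := s.arr LABEL with hlb
  refine Tri.seqF (R := fun s' => s'.reg ST = m) (.flat rfl (by decide) (by simp [hm]))
    fun s₁ g₁ f₁ => ?_
  refine Tri.seqF (R := fun s' => s'.arr RUN 0 = 0) (.flat rfl (by decide) (by simp))
    fun s₂ g₂ f₂ => ?_
  have cn₂ := (hc.frame f₁ rfl).frame f₂ rfl
  have eL₂ : s₂.arr LABEL = lb := (f₂.2 _ rfl).trans (f₁.2 _ rfl)
  have eT₂ : s₂.arr TAB = s.arr TAB := (f₂.2 _ rfl).trans (f₁.2 _ rfl)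
  have eF₂ : s₂.reg FR = m := (f₂.1 _ rfl).trans (f₁.1 _ rfl)
  have eS₂ : s₂.reg ST = m := (f₂.1 _ rfl).trans g₁
  refine Tri.seqF (chainRun_spec cn₂ g₂) fun s₃ ⟨r₁, r₂, r₃⟩ f₃ => ?_
  rw [eL₂] at r₃
  set rn := s₃.arr RUN with hrn
  have cn₃ := cn₂.frame f₃ rfl
  have eL₃ : s₃.arr LABEL = lb := (f₃.2 _ rfl).trans eL₂
  have eT₃ : s₃.arr TAB = s.arr TAB := (f₃.2 _ rfl).trans eT₂
  have eF₃ : s₃.reg FR = m := (f₃.1 _ rfl).trans eF₂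
  have eS₃ : s₃.reg ST = m := (f₃.1 _ rfl).trans eS₂
  have hrs : RunSpec s₃ N rn := by
    intro v h₁ h₂
    have := r₂ v h₁ h₂
    rwa [IsUn, ← f₃.2 CHILD rfl, ← f₃.2 NEXT rfl, ← f₃.2 LABEL rfl] at this
  refine Tri.seqF (chainMark_spec cn₃ eS₃ eF₃ (by rw [eT₃]; exact hT)
    (fun v h₁ h₂ => (r₃ v h₁ h₂).1) hsz) fun s₄ ⟨k₁, k₂, k₃, k₄, k₅⟩ f₄ => ?_
  rw [eL₃, ← hrn] at k₃
  have cn₄ := cn₃.frame f₄ rfl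
  have eL₄ : s₄.arr LABEL = lb := (f₄.2 _ rfl).trans eL₃
  have eR₄ : s₄.arr RUN = rn := f₄.2 _ rfl
  have eS₄ : s₄.reg ST = m := (f₄.1 _ rfl).trans eS₃
  set A : Finset ℕ := (Finset.Icc 1 N).image lb with hAdef
  have hA : ∀ a, a ∈ A ↔ ∃ v, 1 ≤ v ∧ v ≤ N ∧ lb v = a := fun a => by
    simp [hAdef, and_assoc]
  have hAm : ∀ a ∈ A, a < m := fun a ha => by
    obtain ⟨v, h₁, h₂, rfl⟩ := (hA a).1 ha
    refine hlab _ ?_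
    have hv := hc.mem_iff.2 ⟨h₁, h₂⟩
    rw [ht]
    simp only [labels, labelsL_mapL, List.mem_cons, List.mem_map]
    simp only [labelsL_cons, labelsL_nil, List.append_nil, List.mem_cons] at hv
    exact hv.imp (fun h => by rw [h]) fun h => ⟨v, h, rfl⟩
  have hps₄ : PS s₄ X.prods := by
    refine hps.congr ((f₄.1 _ rfl).trans ((f₃.1 _ rfl).trans ((f₂.1 _ rfl).trans (f₁.1 _ rfl))))
      (fun i _ => by rw [f₄.2 PRODS rfl, f₃.2 PRODS rfl, f₂.2 PRODS rfl, f₁.2 PRODS rfl]) k₂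
  -- Before any chain has been met all records are 0, and the only power available is `2 ^ 0`,
  -- represented by the letter itself.
  have init : StepInv m A (HasLen s₃ N lb rn) X.prods N lb rn N 0 s₄ := by
    have hl0 : ∀ a, lens (HasLen s₃ N lb rn a) 0 = [] := fun a => lens_zero _
    have hd : ∀ a ∈ A, s₃.arr CUR a = 0 ∧ s₃.arr LAST a = 0 ∧ s₃.arr PW a = 1 ∧ s₃.arr PE a = 0 ∧
        s₃.arr PL a = a := fun a ha => by
      obtain ⟨v, h₁, h₂, rfl⟩ := (hA a).1 ha
      exact (r₃ v h₁ h₂).2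
    refine ⟨fun _ => 0, by simp [chainPot], fun a ha => ?_, fun v _ _ => by omega,
      fun a _ => .inl rfl, eS₄, k₁, k₂, fun a _ l hl => k₃ a l hl, fun a _ j hj => ?_,
      fun a _ l hl => ?_, fun a _ l hl => ?_, fun a ha => ?_, fun nm _ => ⟨fun a ha => ?_, ?_⟩⟩
    · rw [f₄.2 CUR rfl]; exact (hd a ha).1
    · have := k₄ a j 0 hj (by omega)
      simp [maxExp, hl0, maxDiff]; omega
    · have := k₄ a l 1 hl (by omega)
      simp [hl0]; omega
    · have := k₄ a l 2 hl (by omega)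
      simp [hl0]; omega
    · rw [f₄.2 PE rfl, f₄.2 PW rfl, f₄.2 LAST rfl]
      obtain ⟨-, d₁, d₂, d₃, -⟩ := hd a ha
      simp [maxExp, hl0, maxDiff, d₁, d₂, d₃]
    · rw [f₄.2 PL rfl, (hd a ha).2.2.2.2]
      simp [maxExp, hl0, maxDiff, powLetter]
    · have : emitted A nm (fun a => maxExp (HasLen s₃ N lb rn a) 0)
          (fun a => lens (HasLen s₃ N lb rn a) 0) = ∅ := by
        ext q
        simp [emitted, hl0, maxExp, maxDiff, powList, lengthProds]
      rw [this, Set.union_empty]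
      exact hps₄
  refine Tri.seqF (Tri.forDownP (N := N) (C := 500) (p := 0) (StepInv m A (HasLen s₃ N lb rn) X.prods N lb rn) rfl ?_ init
    cn₄.size ?_) fun s₅ ⟨p, hI⟩ f₅ => ?_
  · rintro i p s' x ⟨cur, q₁, q₂, q₃, q₄, q₅⟩
    exact ⟨cur, q₁, q₂, q₃, q₄, q₅.congr rfl rfl rfl rfl rfl rfl rfl rfl rfl⟩
  · intro i p s' hf h₁ h₂ hi hJ
    refine chainStep_spec hAm ((hA _).2 ⟨i, h₁, h₂, rfl⟩) hsz (r₃ i h₁ h₂).1 h₁ h₂ hi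
      ((hf.2 _ rfl).trans eL₄) ((hf.2 _ rfl).trans eR₄) ?_ hJ
    obtain ⟨u₁, u₂⟩ := hrs i h₁ h₂
    rw [eL₃] at u₁
    by_cases hu : IsUn s₃ i
    · rw [u₁ hu]
      have hch := cn₃.child h₁ h₂ hu.1
      split_ifs with hl
      · exact .inr ⟨_, hch.1, hch.2.1, hl, rfl⟩
      · exact .inl le_rfl
    · rw [u₂ hu]; exact .inl (by omega)
  obtain ⟨q₁, q₂, q₃⟩ := hI.result cn₃ eL₃ hrs r₁ (fun v h₁ h₂ => (r₃ v h₁ h₂).1) hsz hA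
  have hdict : Dict (s₅.arr TAB) m (s₅.reg FR) ∧ m ≤ s₅.reg FR := by
    obtain ⟨cur, -, -, -, -, h⟩ := hI
    exact ⟨h.dict, h.le⟩
  have cn₅ := cn₄.frame f₅ rfl
  have eL₅ : s₅.arr LABEL = lb := (f₅.2 _ rfl).trans eL₄
  have eR₅ : s₅.arr RUN = rn := (f₅.2 _ rfl).trans eR₄
  have eS₅ : s₅.reg ST = m := (f₅.1 _ rfl).trans eS₄
  refine Tri.seqF (chainLab_spec cn₅) fun s₆ hnl f₆ => ?_
  rw [eL₅, eR₅, eS₅] at hnl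
  set T := s₅.arr TAB with hTdef
  have cn₆ := cn₅.frame f₆ rfl
  have eP : s₆.arr PARENT = s₃.arr PARENT := (f₆.2 _ rfl).trans ((f₅.2 _ rfl).trans (f₄.2 _ rfl))
  have eD : s₆.arr DEL = s₄.arr DEL := (f₆.2 _ rfl).trans (f₅.2 _ rfl)
  have eF₆ : s₆.reg FR = s₅.reg FR := f₆.1 _ rfl
  have hD : ∀ v, 1 ≤ v → v ≤ N → (s₆.arr DEL v ≠ 0 ↔ 2 ≤ rn (s₃.arr PARENT v)) := fun v h₁ h₂ => by
    rw [eD, k₅ v h₁ h₂]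
  have htree : chainTree (chainName T m) X.tree = node (s₆.arr NL 1) (mapL (s₆.arr NL)
      (contractL (fun v => decide (2 ≤ rn (s₃.arr PARENT v))) us)) := by
    rw [ht]
    refine chainTree_eq cn₃ (lb := lb) (rn := rn) (nl := s₆.arr NL) (nm := chainName T m)
      (by rw [← eL₃]; exact hrs) (by simp) hnl 1 us (by simp [nodesL])
  refine (contractP_good cn₆ (D := fun v => decide (2 ≤ rn (s₃.arr PARENT v)))
    (fun v h₁ h₂ => by rw [hD v h₁ h₂]; simp) ?_
    (q₁.congr (f₆.1 _ rfl) (fun i _ => by rw [f₆.2 PRODS rfl]) eF₆.ge) ?_ ?_ ?_).mono le_rfl ?_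
  · by_contra h'
    have := (hD 1 le_rfl hN).1 h'
    rw [cn₃.parent_one, r₁] at this
    omega
  · intro v h₁ h₂
    rw [hnl v h₁ h₂, eF₆]
    split_ifs
    · exact hdict.1.1 _
    · exact (hAm _ ((hA _).2 ⟨v, h₁, h₂, rfl⟩)).trans_le hdict.2
  · rw [eF₆]; exact hsz.trans_le hdict.2
  · rw [eF₆, f₆.2 TAB rfl]; exact hdict.1.1
  · intro s' hs'
    refine ⟨_, ⟨chainName T m, ?_, htree.symm, ?_⟩, hs'⟩
    · rw [ht]; exact fresh_of_names hused q₂ q₃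
    · rw [ht]

end chains


/-! ### Two-chains -/

section pairs
variable {s : State} {us : List (RTree ℕ)} {N : ℕ} {U : ℕ → Bool} {lb : ℕ → ℕ}

theorem unaryLabels_eq (h : Canon s us N) (hU : ∀ v, 1 ≤ v → v ≤ N → (U v = true ↔ IsUn s v)) :
    ∀ v ws, (v, ws) ∈ nodesL [node 1 us] →
      unaryLabels (node (lb v) (mapL lb ws)) = ((v :: labelsL ws).filter U).map lb := by
  refine nodes_induction fun v ws hv ih => ?_
  obtain ⟨h₁, h₂, -, -⟩ := h.of_mem hv
  have hu := (hU v h₁ h₂).trans (h.isUn_iff hv)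
  have many : unaryLabelsL (mapL lb ws) = ((labelsL ws).filter U).map lb := by
    have : ∀ ys, (∀ t ∈ ys, t ∈ ws) →
        unaryLabelsL (mapL lb ys) = ((labelsL ys).filter U).map lb := by
      intro ys hys
      induction ys with
      | nil => simp [unaryLabelsL]
      | cons t ys ihy =>
        obtain ⟨b, xs⟩ := t
        rw [mapL_cons, unaryLabelsL, ih b xs (hys _ (by simp)), ihy fun t ht => hys t (by simp [ht]),
          labelsL_cons, ← List.cons_append, List.filter_append, List.map_append]
    exact this ws fun _ h => h
  match ws, hv, hu, many, ih with
  | [], _, hu, many, _ =>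
    have : U v = false := by simpa using hu
    simp [unaryLabels, unaryLabelsL, this]
  | [node b xs], _, hu, _, ih =>
    have : U v = true := by simpa using hu
    rw [mapL_cons, mapL_nil, unaryLabels, ih b xs (by simp)]
    simp [List.filter_cons, this]
  | node b xs :: node b' xs' :: ws, _, hu, many, _ =>
    have : U v = false := by simpa using hu
    rw [List.filter_cons_of_neg (by simp [this]), ← many]
    simp [unaryLabels]

theorem pairOcc_eq (h : Canon s us N) (hU : ∀ v, 1 ≤ v → v ≤ N → (U v = true ↔ IsUn s v)) :
    ∀ v ws, (v, ws) ∈ nodesL [node 1 us] → pairOcc (node (lb v) (mapL lb ws)) =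
      ((v :: labelsL ws).filter fun v => U v && U (s.arr CHILD v)).map
        fun v => (lb v, lb (s.arr CHILD v)) := by
  refine nodes_induction fun v ws hv ih => ?_
  obtain ⟨h₁, h₂, -, -⟩ := h.of_mem hv
  have hu := (hU v h₁ h₂).trans (h.isUn_iff hv)
  have many : pairOccL (mapL lb ws) = ((labelsL ws).filter fun v => U v && U (s.arr CHILD v)).map
        fun v => (lb v, lb (s.arr CHILD v)) := by
    have : ∀ ys, (∀ t ∈ ys, t ∈ ws) →
        pairOccL (mapL lb ys) = ((labelsL ys).filter fun v => U v && U (s.arr CHILD v)).map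
        fun v => (lb v, lb (s.arr CHILD v)) := by
      intro ys hys
      induction ys with
      | nil => simp [pairOccL]
      | cons t ys ihy =>
        obtain ⟨b, xs⟩ := t
        rw [mapL_cons, pairOccL, ih b xs (hys _ (by simp)), ihy fun t ht => hys t (by simp [ht]),
          labelsL_cons, ← List.cons_append, List.filter_append, List.map_append]
    exact this ws fun _ h => h
  match ws, hv, hu, many, ih with
  | [], _, hu, many, _ =>
    have : U v = false := by simpa using hu
    simp [pairOcc, pairOccL, this]
  | node b xs :: node b' xs' :: ws, _, hu, many, _ =>
    have : U v = false := by simpa using hu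
    rw [List.filter_cons_of_neg (by simp [this]), ← many]
    simp [pairOcc]
  | [node b xs], hv, hu, many, ih =>
    have hv' : U v = true := by simpa using hu
    obtain ⟨-, hc, -, hb⟩ := h.unary hv
    obtain ⟨hb₁, hb₂, -, -⟩ := h.of_mem hb
    have hub := (hU b hb₁ hb₂).trans (h.isUn_iff hb)
    match xs, hub, many, ih with
    | [], hub, many, _ =>
      have : U b = false := by simpa using hub
      rw [List.filter_cons_of_neg (by simp [hc, this]), ← many]
      simp [pairOcc]
    | node c ys :: node c' ys' :: xs, hub, many, _ =>
      have : U b = false := by simpa using hub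
      rw [List.filter_cons_of_neg (by simp [hc, this]), ← many]
      simp [pairOcc]
    | [node c ys], hub, many, ih =>
      have : U b = true := by simpa using hub
      rw [List.filter_cons_of_pos (by simp [hc, this, hv']), List.map_cons, ← many, hc]
      simp [pairOcc, pairOccL]

theorem countP_range' (N : ℕ) (p : ℕ → Bool) :
    (List.range' 1 N).countP p = ((Finset.Icc 1 N).filter fun v => p v = true).card := by
  rw [List.countP_eq_length_filter, ← List.toFinset_card_of_nodup
    (List.Nodup.filter _ List.nodup_range')]
  congr 1
  ext v
  simp
  omega

theorem countP_or {α : Type} (l : List α) (p q : α → Bool) (h : ∀ x, p x = true → q x = false) :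
    l.countP (fun x => p x || q x) = l.countP p + l.countP q := by
  induction l with
  | nil => rfl
  | cons x l ih =>
    simp only [List.countP_cons, ih]
    have := h x
    cases hp : p x <;> cases hq : q x <;> simp_all <;> omega

/-- A 2-chain between `a` and `S` is counted at its node labelled `a`: through the child if this is
the upper node, through the parent if it is the lower one. As `a ∉ S`, the two cases exclude each
other. In the second case `CHILD` and `PARENT` are inverse bijections between the upper and the
lower nodes. By `h0` the missing parent of the root does not count as unary. -/
theorem touching_eq (h : Canon s us N) (hU : ∀ v, 1 ≤ v → v ≤ N → (U v = true ↔ IsUn s v))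
    (h0 : U 0 = false) {a : ℕ} {S : List ℕ} (ha : a ∉ S) :
    touching (pairOcc (node (lb 1) (mapL lb us))) a S =
      ((List.range' 1 N).filter fun v => U v && decide (lb v = a)).countP
        (fun v => U (s.arr CHILD v) && decide (lb (s.arr CHILD v) ∈ S)) +
      ((List.range' 1 N).filter fun v => U v && decide (lb v = a)).countP
        (fun v => U (s.arr PARENT v) && decide (lb (s.arr PARENT v) ∈ S)) := by
  have hl : 1 :: labelsL us = List.range' 1 N := by have := h.labels; simpa using this
  rw [touching, pairOcc_eq h hU 1 us (by simp [nodesL]), hl, List.countP_map, List.countP_filter,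
    List.countP_filter, List.countP_filter]
  have e : (List.range' 1 N).countP (fun v => ((fun p : ℕ × ℕ => decide ((p.1 = a ∧ p.2 ∈ S) ∨
      (p.2 = a ∧ p.1 ∈ S))) ∘ fun v => (lb v, lb (s.arr CHILD v))) v &&
        (U v && U (s.arr CHILD v))) = (List.range' 1 N).countP (fun v =>
      (U (s.arr CHILD v) && decide (lb (s.arr CHILD v) ∈ S) && (U v && decide (lb v = a))) ||
      (U (s.arr CHILD v) && decide (lb v ∈ S) && (U v && decide (lb (s.arr CHILD v) = a)))) := by
    congr 1
    funext v
    rw [Bool.eq_iff_iff]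
    simp only [Function.comp_apply, Bool.and_eq_true, Bool.or_eq_true, decide_eq_true_eq]
    tauto
  rw [e, countP_or _ _ _ (by
    intro x hx
    simp only [Bool.and_eq_true, decide_eq_true_eq] at hx
    have : lb x ∉ S := by rw [hx.2.2]; exact ha
    simp [this])]
  congr 1
  rw [countP_range', countP_range']
  refine Finset.card_bij' (fun v _ => s.arr CHILD v) (fun v _ => s.arr PARENT v) ?_ ?_ ?_ ?_
  · intro v hv
    simp only [Finset.mem_filter, Finset.mem_Icc, Bool.and_eq_true, decide_eq_true_eq] at hv ⊢
    obtain ⟨⟨h₁, h₂⟩, ⟨h₃, h₄⟩, h₅, h₆⟩ := hv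
    have := h.child h₁ h₂ ((hU v h₁ h₂).1 h₅).1
    rw [this.2.2]
    exact ⟨⟨by omega, this.2.1⟩, ⟨h₅, h₄⟩, h₃, h₆⟩
  · intro v hv
    simp only [Finset.mem_filter, Finset.mem_Icc, Bool.and_eq_true, decide_eq_true_eq] at hv ⊢
    obtain ⟨⟨h₁, h₂⟩, ⟨h₃, h₄⟩, h₅, h₆⟩ := hv
    have hp0 : s.arr PARENT v ≠ 0 := fun h' => by rw [h', h0] at h₃; simp at h₃
    have hlt := h.parent_lt h₁ h₂
    have := h.only_child h₁ h₂ hp0 ((hU _ (by omega) (by omega)).1 h₃).2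
    rw [this]
    exact ⟨⟨by omega, by omega⟩, ⟨h₅, h₄⟩, h₃, h₆⟩
  · intro v hv
    simp only [Finset.mem_filter, Finset.mem_Icc, Bool.and_eq_true, decide_eq_true_eq] at hv
    obtain ⟨⟨h₁, h₂⟩, ⟨h₃, h₄⟩, h₅, h₆⟩ := hv
    exact (h.child h₁ h₂ ((hU v h₁ h₂).1 h₅).1).2.2
  · intro v hv
    simp only [Finset.mem_filter, Finset.mem_Icc, Bool.and_eq_true, decide_eq_true_eq] at hv
    obtain ⟨⟨h₁, h₂⟩, ⟨h₃, h₄⟩, h₅, h₆⟩ := hv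
    have hp0 : s.arr PARENT v ≠ 0 := fun h' => by rw [h', h0] at h₃; simp at h₃
    have hlt := h.parent_lt h₁ h₂
    exact h.only_child h₁ h₂ hp0 ((hU _ (by omega) (by omega)).1 h₃).2

theorem covered_eq (h : Canon s us N) (hU : ∀ v, 1 ≤ v → v ≤ N → (U v = true ↔ IsUn s v))
    (S R : List ℕ) : covered (pairOcc (node (lb 1) (mapL lb us))) S R =
      (List.range' 1 N).countP fun v => U v && U (s.arr CHILD v) && decide (lb v ∈ S) &&
        decide (lb (s.arr CHILD v) ∈ R) := by
  have hl : 1 :: labelsL us = List.range' 1 N := by have := h.labels; simpa using this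
  rw [covered, pairOcc_eq h hU 1 us (by simp [nodesL]), hl, List.countP_map, List.countP_filter]
  congr 1
  funext v
  rw [Bool.eq_iff_iff]
  simp only [Function.comp_apply, Bool.and_eq_true, decide_eq_true_eq]
  tauto

theorem greedyLoop_append (occ : List (ℕ × ℕ)) (as : List ℕ) (a : ℕ) (P : List ℕ × List ℕ) :
    greedyLoop occ (as ++ [a]) P =
      if touching occ a (greedyLoop occ as P).1 ≤ touching occ a (greedyLoop occ as P).2
      then (a :: (greedyLoop occ as P).1, (greedyLoop occ as P).2)
      else ((greedyLoop occ as P).1, a :: (greedyLoop occ as P).2) := by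
  induction as generalizing P with
  | nil => rfl
  | cons b as ih =>
    simp only [List.cons_append, greedyLoop]
    split_ifs <;> simp_all

end pairs


/-! ### The greedy partition -/

/-- Find out whether a node is unary, and initialise the data of its label. -/
def pairInit : Cmd :=
  .write HEAD (.read LABEL (.reg I)) 0 ;; .write SIDE (.read LABEL (.reg I)) 0 ;;
  .ite (.read CHILD (.reg I))
    (.ite (.read NEXT (.read CHILD (.reg I))) (.write UN (.reg I) 0) (.write UN (.reg I) 1))
    (.write UN (.reg I) 0)

/-- Put a unary node into the list of its label. -/
def pairList : Cmd :=
  .ite (.read UN (.reg I))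
    (.write LNX (.reg I) (.read HEAD (.read LABEL (.reg I))) ;;
      .write HEAD (.read LABEL (.reg I)) (.reg I)) .skip

/-- Count the node `R5` if it is unary, depending on the side of its label. -/
def touch : Cmd :=
  .ite (.read UN (.reg R5))
    (.ite (.op .eq (.read SIDE (.read LABEL (.reg R5))) 1) (.set R3 (.reg R3 + 1))
      (.ite (.op .eq (.read SIDE (.read LABEL (.reg R5))) 2) (.set R4 (.reg R4 + 1)) .skip)) .skip

/-- Count the neighbours of the unary nodes labelled `R1`. -/
def walk : Cmd :=
  .set R3 0 ;; .set R4 0 ;; .set R2 (.read HEAD (.reg R1)) ;;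
  .while (.reg R2)
    (.set R5 (.read CHILD (.reg R2)) ;; touch ;; .set R5 (.read PARENT (.reg R2)) ;; touch ;;
      .set R2 (.read LNX (.reg R2)))

/-- Choose the side of a new letter. -/
def greedyStep : Cmd :=
  .set R1 (.read LABEL (.reg I)) ;;
  .ite (.read UN (.reg I))
    (.ite (.read SIDE (.reg R1)) .skip
      (walk ;; .ite (.op .lt (.reg R4) (.reg R3)) (.write SIDE (.reg R1) 2)
        (.write SIDE (.reg R1) 1))) .skip

/-- Count the covered 2-chains. -/
def coverStep : Cmd :=
  .set R2 (.read CHILD (.reg I)) ;;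
  .ite (.read UN (.reg I))
    (.ite (.read UN (.reg R2))
      (.set R1 (.read SIDE (.read LABEL (.reg I))) ;; .set R2 (.read SIDE (.read LABEL (.reg R2))) ;;
        .ite (.op .eq (.reg R1) 1) (.ite (.op .eq (.reg R2) 2) (.set R3 (.reg R3 + 1)) .skip)
          (.ite (.op .eq (.reg R1) 2) (.ite (.op .eq (.reg R2) 1) (.set R4 (.reg R4 + 1)) .skip)
            .skip)) .skip) .skip

/-- Count the covered 2-chains, and switch the sides if necessary. -/
def coverP : Cmd :=
  .set R3 0 ;; .set R4 0 ;; forUp coverStep ;;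
  .ite (.op .lt (.reg R3) (.reg R4)) (.set R5 2 ;; .set R6 1) (.set R5 1 ;; .set R6 2)

/-- The linked list starting at `p` consists of the members of a list. -/
def Chn (nx : ℕ → ℕ) : ℕ → List ℕ → Prop
  | p, [] => p = 0
  | p, v :: l => p = v ∧ v ≠ 0 ∧ Chn nx (nx v) l

theorem Chn.congr {nx nx' : ℕ → ℕ} {l : List ℕ} (h : ∀ v ∈ l, nx' v = nx v) {p : ℕ}
    (hl : Chn nx p l) : Chn nx' p l := by
  induction l generalizing p with
  | nil => exact hl
  | cons v l ih =>
    obtain ⟨h₁, h₂, h₃⟩ := hl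
    exact ⟨h₁, h₂, by rw [h v (by simp)]; exact ih (fun u hu => h u (by simp [hu])) h₃⟩

/-- Whether a node has been found to be unary. -/
def unB (s : State) (v : ℕ) : Bool := decide (s.arr UN v ≠ 0)

/-- The unary nodes in `{i + 1, …, N}` with label `a`. -/
def unList (s : State) (N i a : ℕ) : List ℕ :=
  (List.range' (i + 1) (N - i)).filter fun v => unB s v && decide (s.arr LABEL v = a)

section pairs
variable {s : State} {us : List (RTree ℕ)} {N : ℕ}

theorem pairInit_spec (h : Canon s us N) (h0 : s.arr UN 0 = 0) :
    Tri (forUp pairInit) s (N * 60 + 8) (fun s' => s'.arr UN 0 = 0 ∧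
      ∀ v, 1 ≤ v → v ≤ N → (unB s' v = true ↔ IsUn s v) ∧ s'.arr HEAD (s.arr LABEL v) = 0 ∧
        s'.arr SIDE (s.arr LABEL v) = 0) := by
  refine (Tri.forUp (C := 50) (fun i s' => s'.arr UN 0 = 0 ∧
      ∀ v, 1 ≤ v → v < i → (unB s' v = true ↔ IsUn s v) ∧ s'.arr HEAD (s.arr LABEL v) = 0 ∧
        s'.arr SIDE (s.arr LABEL v) = 0) rfl rfl (fun i s x h => h) ⟨h0, fun v _ _ => by omega⟩
    h.size ?_).mono le_rfl fun s' h => ⟨h.1, fun v h₁ h₂ => h.2 v h₁ (by omega)⟩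
  intro i s' hf h₁ h₂ hi ⟨j₀, hJ⟩
  have eL : s'.arr LABEL = s.arr LABEL := hf.2 _ rfl
  have eC : s'.arr CHILD = s.arr CHILD := hf.2 _ rfl
  have eX : s'.arr NEXT = s.arr NEXT := hf.2 _ rfl
  have hrun : (∀ v, (pairInit.run s').arr UN v = if v = i then
        if s.arr CHILD i = 0 then 0 else if s.arr NEXT (s.arr CHILD i) = 0 then 1 else 0
        else s'.arr UN v) ∧
      (∀ v, (pairInit.run s').arr HEAD v = if v = s.arr LABEL i then 0 else s'.arr HEAD v) ∧
      (∀ v, (pairInit.run s').arr SIDE v = if v = s.arr LABEL i then 0 else s'.arr SIDE v) := by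
    by_cases c₁ : s.arr CHILD i = 0
    · simp +decide [pairInit, hi, eL, eC, c₁]
    · by_cases c₂ : s.arr NEXT (s.arr CHILD i) = 0 <;>
        simp +decide [pairInit, hi, eL, eC, eX, c₁, c₂]
  refine .flat rfl (by decide) ?_
  generalize pairInit.run s' = s'' at *
  obtain ⟨r₁, r₂, r₃⟩ := hrun
  refine ⟨by rw [r₁, if_neg (by omega), j₀], fun v hv hvi => ?_⟩
  rw [unB, r₁, r₂, r₃]
  rcases eq_or_ne v i with rfl | hne
  · refine ⟨?_, if_pos rfl, if_pos rfl⟩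
    unfold IsUn
    by_cases c₁ : s.arr CHILD v = 0
    · simp [c₁]
    · by_cases c₂ : s.arr NEXT (s.arr CHILD v) = 0 <;> simp [c₁, c₂]
  · rw [if_neg hne]
    obtain ⟨q₁, q₂, q₃⟩ := hJ v hv (by omega)
    rw [q₂, q₃]
    exact ⟨q₁, by simp, by simp⟩

theorem pairList_spec (h : Canon s us N)
    (hd : ∀ v, 1 ≤ v → v ≤ N → s.arr HEAD (s.arr LABEL v) = 0) :
    Tri (forDown pairList) s (N * 50 + 8) (fun s' => ∀ v, 1 ≤ v → v ≤ N →
      Chn (s'.arr LNX) (s'.arr HEAD (s.arr LABEL v)) (unList s N 0 (s.arr LABEL v))) := by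
  refine Tri.forDown (C := 40) (fun i s' => i ≤ N ∧ ∀ v, 1 ≤ v → v ≤ N →
      Chn (s'.arr LNX) (s'.arr HEAD (s.arr LABEL v)) (unList s N i (s.arr LABEL v)))
    rfl (fun i s x h => h) ⟨le_rfl, fun v h₁ h₂ => ?_⟩ h.size ?_ |>.mono le_rfl fun s' h => h.2
  · simpa [unList, Chn] using hd v h₁ h₂
  intro i s' hf h₁ h₂ hi ⟨_, hJ⟩
  have eL : s'.arr LABEL = s.arr LABEL := hf.2 _ rfl
  have eU : s'.arr UN = s.arr UN := hf.2 _ rfl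
  refine .flat rfl (by decide) ⟨by omega, fun v hv hvN => ?_⟩
  have hl : ∀ a, unList s N (i - 1) a =
      if unB s i && decide (s.arr LABEL i = a) then i :: unList s N i a else unList s N i a := by
    intro a
    have : N - (i - 1) = N - i + 1 := by omega
    rw [unList, this, show i - 1 + 1 = i by omega, List.range'_succ, List.filter_cons]
    rfl
  rw [hl]
  by_cases c : s.arr UN i = 0
  · have hb : unB s i = false := by simp [unB, c]
    have hrun : (pairList.run s').arr LNX = s'.arr LNX ∧
        (pairList.run s').arr HEAD = s'.arr HEAD := by simp [pairList, hi, eU, c]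
    rw [hrun.1, hrun.2, hb]
    exact hJ v hv hvN
  · have hb : unB s i = true := by simp [unB, c]
    have hrun : (∀ u, (pairList.run s').arr LNX u =
          if u = i then s'.arr HEAD (s.arr LABEL i) else s'.arr LNX u) ∧
        ∀ a, (pairList.run s').arr HEAD a = if a = s.arr LABEL i then i else s'.arr HEAD a := by
      simp +decide [pairList, hi, eU, eL, c]
    generalize pairList.run s' = s'' at *
    obtain ⟨r₁, r₂⟩ := hrun
    have hcon : ∀ p a, Chn (s'.arr LNX) p (unList s N i a) →
        Chn (s''.arr LNX) p (unList s N i a) := fun p a => Chn.congr fun u hu => by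
      have := (List.mem_range'_1.1 (List.mem_filter.1 hu).1).1
      rw [r₁, if_neg (by omega)]
    rw [hb, r₂]
    by_cases hla : s.arr LABEL v = s.arr LABEL i
    · rw [if_pos hla, hla]
      simp only [decide_true, Bool.and_true, if_true]
      refine ⟨rfl, by omega, ?_⟩
      rw [r₁, if_pos rfl]
      exact hcon _ _ (hJ i h₁ h₂)
    · rw [if_neg hla]
      simp only [Ne.symm hla, decide_false, Bool.and_false, Bool.false_eq_true, if_false]
      exact hcon _ _ (hJ v hv hvN)

/-- A node is unary, and its label is on a given side. -/
def sideB (s : State) (k v : ℕ) : Bool := unB s v && decide (s.arr SIDE (s.arr LABEL v) = k)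

theorem sideB_congr {s s' : State} (h : s'.arr = s.arr) : sideB s' = sideB s := by
  funext k v
  simp only [sideB, unB, h]

/-- The neighbour of a node is unary, and its label is on a given side. -/
def onSide (s : State) (A k v : ℕ) : Bool := sideB s k (s.arr A v)

theorem countP_singleton' (p : ℕ → Bool) (a : ℕ) : [a].countP p = (p a).toNat := by
  cases h : p a <;> simp [h]

theorem touch_run (s : State) : (touch.run s).arr = s.arr ∧
    (∀ x, x ≠ R3 → x ≠ R4 → (touch.run s).reg x = s.reg x) ∧
    (touch.run s).reg R3 = s.reg R3 +
      (sideB s 1 (s.reg R5)).toNat ∧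
    (touch.run s).reg R4 = s.reg R4 +
      (sideB s 2 (s.reg R5)).toNat := by
  have hf : Frame touch s (touch.run s) := Cmd.frame_run rfl s
  refine ⟨funext fun A => hf.2 A (by simp [touch, Cmd.modA]), fun x h₁ h₂ => hf.1 x (by
    simp [touch, Cmd.modR, h₁.symm, h₂.symm]), ?_⟩
  clear hf
  by_cases c₁ : s.arr UN (s.reg R5) = 0
  · simp [touch, sideB, unB, c₁]
  · by_cases c₂ : s.arr SIDE (s.arr LABEL (s.reg R5)) = 1
    · simp +decide [touch, sideB, unB, c₁, c₂]
    · by_cases c₃ : s.arr SIDE (s.arr LABEL (s.reg R5)) = 2 <;>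
        simp +decide [touch, sideB, unB, c₁, c₂, c₃]

theorem walk_spec {l : List ℕ} (h : Chn (s.arr LNX) (s.arr HEAD (s.reg R1)) l) :
    Tri walk s (90 * l.length + 20) (fun s' =>
      s'.reg R3 = l.countP (onSide s CHILD 1) + l.countP (onSide s PARENT 1) ∧
      s'.reg R4 = l.countP (onSide s CHILD 2) + l.countP (onSide s PARENT 2)) := by
  refine Tri.mono (b := 2 + (2 + (3 + (90 * l.length + 1 + 1)))) ?_ (by omega) fun _ h => h
  refine Tri.seqF (R := fun s' => s'.reg R3 = 0) (.flat rfl (by decide) (by simp)) fun s₁ g₁ f₁ => ?_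
  refine Tri.seqF (R := fun s' => s'.reg R4 = 0) (.flat rfl (by decide) (by simp)) fun s₂ g₂ f₂ => ?_
  refine Tri.seqF (R := fun s' => s'.reg R2 = s.arr HEAD (s.reg R1)) (.flat rfl (by decide)
    (by simp [f₂.1 R1 rfl, f₁.1 R1 rfl, f₂.2 HEAD rfl, f₁.2 HEAD rfl])) fun s₃ g₃ f₃ => ?_
  have ea : s₃.arr = s.arr := funext fun A => (f₃.2 A rfl).trans ((f₂.2 A rfl).trans (f₁.2 A rfl))
  refine (Tri.while (fun b s' => s'.arr = s.arr ∧ ∃ d r, d ++ r = l ∧ b = 90 * r.length ∧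
    Chn (s.arr LNX) (s'.reg R2) r ∧
    s'.reg R3 = d.countP (onSide s CHILD 1) + d.countP (onSide s PARENT 1) ∧
    s'.reg R4 = d.countP (onSide s CHILD 2) + d.countP (onSide s PARENT 2)) ?_ ?_).mono le_rfl ?_
  rotate_left
  · refine ⟨ea, [], l, rfl, rfl, by rw [g₃]; exact h, ?_, ?_⟩
    · simpa using (f₃.1 _ rfl).trans ((f₂.1 _ rfl).trans g₁)
    · simpa using (f₃.1 _ rfl).trans g₂
  · rintro s' ⟨he, b, -, d, r, rfl, -, hr, h₃, h₄⟩
    simp only [Expr.eval_reg] at he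
    match r, hr with
    | [], _ => simpa using ⟨h₃, h₄⟩
    | v :: r, hr => exact absurd (hr.1.symm.trans he) hr.2.1
  · rintro b s' ⟨ha, d, r, rfl, rfl, hr, h₃, h₄⟩ he
    simp only [Expr.eval_reg] at he
    match r, hr with
    | [], hr => exact absurd hr he
    | v :: r, ⟨hv, hv0, hr⟩ =>
      refine ⟨3 + (20 + (3 + (20 + 3))), 90 * r.length, by simp [Expr.cost]; omega, ?_⟩
      have hc : touch.cst ≤ 20 := by decide
      refine Tri.seqF (R := fun t => t.reg R5 = s.arr CHILD v) (.flat rfl (by decide)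
        (by simp [ha, hv])) fun t₁ k₁ q₁ => ?_
      refine Tri.seq (R := fun t => t = touch.run t₁) (.flat rfl hc rfl) fun t₂ k₂ => ?_
      obtain ⟨w₁, w₂, w₃, w₄⟩ := touch_run t₁
      rw [← k₂] at w₁ w₂ w₃ w₄
      have a₂ : t₂.arr = s.arr := w₁.trans ((funext fun A => q₁.2 A rfl).trans ha)
      refine Tri.seqF (R := fun t => t.reg R5 = s.arr PARENT v) (.flat rfl (by decide)
        (by simp [a₂, w₂ R2 (by decide) (by decide), q₁.1 R2 rfl, hv])) fun t₃ k₃ q₃ => ?_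
      refine Tri.seq (R := fun t => t = touch.run t₃) (.flat rfl hc rfl) fun t₄ k₄ => ?_
      obtain ⟨z₁, z₂, z₃, z₄⟩ := touch_run t₃
      rw [← k₄] at z₁ z₂ z₃ z₄
      have a₃ : t₃.arr = s.arr := (funext fun A => q₃.2 A rfl).trans a₂
      have a₄ : t₄.arr = s.arr := z₁.trans a₃
      have a₁ : t₁.arr = s.arr := (funext fun A => q₁.2 A rfl).trans ha
      have hR2 : t₄.reg R2 = v := by
        rw [z₂ R2 (by decide) (by decide), q₃.1 R2 rfl, w₂ R2 (by decide) (by decide), q₁.1 R2 rfl, hv]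
      refine .flat rfl (by decide) ⟨by simpa using a₄, d ++ [v], r, by simp, rfl, ?_, ?_, ?_⟩
      · simpa [a₄, hR2] using hr
      · rw [sideB_congr a₁, k₁, q₁.1 R3 rfl, h₃] at w₃
        rw [sideB_congr a₃, k₃, q₃.1 R3 rfl, w₃] at z₃
        simp +decide only [Cmd.run, State.setR_reg, if_false, z₃, List.countP_append,
          countP_singleton', onSide]
        omega
      · rw [sideB_congr a₁, k₁, q₁.1 R4 rfl, h₄] at w₄
        rw [sideB_congr a₃, k₃, q₃.1 R4 rfl, w₄] at z₄
        simp +decide only [Cmd.run, State.setR_reg, if_false, z₄, List.countP_append,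
          countP_singleton', onSide]
        omega

end pairs


-- The greedy choice, with an amortised analysis of the walks through the occurrences.

section pairs
variable {s : State} {us : List (RTree ℕ)} {N : ℕ}

/-- The sides stored in memory are those of the partition `P`. -/
def Sides (s : State) (N : ℕ) (P : List ℕ × List ℕ) : Prop :=
  (∀ a ∈ P.1, a ∉ P.2) ∧ ∀ v, 1 ≤ v → v ≤ N → s.arr SIDE (s.arr LABEL v) =
    if s.arr LABEL v ∈ P.1 then 1 else if s.arr LABEL v ∈ P.2 then 2 else 0

theorem Sides.one {P : List ℕ × List ℕ} (h : Sides s N P) {v : ℕ} (h₁ : 1 ≤ v) (h₂ : v ≤ N) :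
    s.arr SIDE (s.arr LABEL v) = 1 ↔ s.arr LABEL v ∈ P.1 := by
  rw [h.2 v h₁ h₂]; split_ifs <;> simp_all

theorem Sides.two {P : List ℕ × List ℕ} (h : Sides s N P) {v : ℕ} (h₁ : 1 ≤ v) (h₂ : v ≤ N) :
    s.arr SIDE (s.arr LABEL v) = 2 ↔ s.arr LABEL v ∈ P.2 := by
  have := h.1 (s.arr LABEL v)
  rw [h.2 v h₁ h₂]; split_ifs <;> simp_all

theorem mem_unList {v a : ℕ} : v ∈ unList s N 0 a ↔
    1 ≤ v ∧ v ≤ N ∧ unB s v = true ∧ s.arr LABEL v = a := by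
  have : (0 + 1 ≤ v ∧ v < 0 + 1 + (N - 0)) ↔ (1 ≤ v ∧ v ≤ N) := by omega
  simp only [unList, List.mem_filter, List.mem_range'_1, Bool.and_eq_true, decide_eq_true_eq, this,
    and_assoc]

theorem touching_side (h : Canon s us N) (hU : ∀ v, 1 ≤ v → v ≤ N → (unB s v = true ↔ IsUn s v))
    (h0 : unB s 0 = false) {a k : ℕ} {S : List ℕ} (ha : a ∉ S)
    (hk : ∀ v, 1 ≤ v → v ≤ N → (s.arr SIDE (s.arr LABEL v) = k ↔ s.arr LABEL v ∈ S)) :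
    touching (pairOcc (node (s.arr LABEL 1) (mapL (s.arr LABEL) us))) a S =
      (unList s N 0 a).countP (onSide s CHILD k) + (unList s N 0 a).countP (onSide s PARENT k) := by
  rw [touching_eq h hU h0 ha]
  change (unList s N 0 a).countP _ + (unList s N 0 a).countP _ = _
  congr 1
  · refine List.countP_congr fun v hv => ?_
    obtain ⟨h₁, h₂, h₃, h₄⟩ := mem_unList.1 hv
    have hc := h.child h₁ h₂ ((hU v h₁ h₂).1 h₃).1
    simp only [onSide, sideB, Bool.and_eq_true, decide_eq_true_eq]
    rw [hk _ (by omega) hc.2.1]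
  · refine List.countP_congr fun v hv => ?_
    obtain ⟨h₁, h₂, h₃, h₄⟩ := mem_unList.1 hv
    have hc := h.parent_lt h₁ h₂
    simp only [onSide, sideB, Bool.and_eq_true, decide_eq_true_eq]
    refine and_congr_right fun hu => ?_
    have : s.arr PARENT v ≠ 0 := fun h' => by rw [h', h0] at hu; simp at hu
    rw [hk _ (by omega) (by omega)]

/-- The state of the greedy algorithm when the labels of the nodes less than `i` have been
considered. -/
def GreedyInv (s₀ : State) (N : ℕ) (occ : List (ℕ × ℕ)) (i p : ℕ) (s : State) : Prop :=
  ∃ order : List ℕ, order.Nodup ∧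
    (∀ a, a ∈ order ↔ ∃ v, 1 ≤ v ∧ v < i ∧ unB s₀ v = true ∧ s₀.arr LABEL v = a) ∧
    (∀ a, a ∈ order ↔ a ∈ (greedyLoop occ order ([], [])).1 ∨
      a ∈ (greedyLoop occ order ([], [])).2) ∧
    s.arr LABEL = s₀.arr LABEL ∧ Sides s N (greedyLoop occ order ([], [])) ∧
    p = 90 * (List.range' 1 N).countP fun v => unB s₀ v && decide (s₀.arr LABEL v ∉ order)

/-- A letter is decided when its first unary node in preorder is met; the side 0 means that it is
undecided, so later occurrences cost a constant. The potential is 90 for each unary node with an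
undecided label, and the walk through the occurrences of a letter uses up exactly the part belonging
to them. -/
theorem greedyStep_spec (h : Canon s us N) (hU : ∀ v, 1 ≤ v → v ≤ N → (unB s v = true ↔ IsUn s v))
    (h0 : unB s 0 = false) (hch : ∀ v, 1 ≤ v → v ≤ N →
      Chn (s.arr LNX) (s.arr HEAD (s.arr LABEL v)) (unList s N 0 (s.arr LABEL v)))
    {occ : List (ℕ × ℕ)} (hocc : occ = pairOcc (node (s.arr LABEL 1) (mapL (s.arr LABEL) us)))
    {i p : ℕ} {s' : State} (hf : Frame (forUp greedyStep) s s') (h₁ : 1 ≤ i) (h₂ : i ≤ N)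
    (hi : s'.reg I = i) (hJ : GreedyInv s N occ i p s') :
    ∃ c p', c + p' ≤ 100 + p ∧ Tri greedyStep s' c (GreedyInv s N occ (i + 1) p') := by
  obtain ⟨order, o₁, o₂, o₃, o₄, o₅, rfl⟩ := hJ
  set a := s.arr LABEL i with ha
  have eU : s'.arr UN = s.arr UN := hf.2 _ rfl
  have eb : unB s' = unB s := funext fun v => by simp [unB, eU]
  have old : (unB s i = false ∨ a ∈ order) → ∀ t : State, t.arr LABEL = s.arr LABEL →
      t.arr SIDE = s'.arr SIDE → GreedyInv s N occ (i + 1) (90 * (List.range' 1 N).countP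
        fun v => unB s v && decide (s.arr LABEL v ∉ order)) t := by
    intro hold t ht ht'
    refine ⟨order, o₁, fun b => (o₂ b).trans ⟨?_, ?_⟩, o₃, ht, ?_, rfl⟩
    · rintro ⟨v, x, y, z⟩; exact ⟨v, x, by omega, z⟩
    · rintro ⟨v, x, y, z, w⟩
      rcases eq_or_ne v i with rfl | hne
      · rcases hold with hold | hold
        · rw [hold] at z; simp at z
        · exact (o₂ b).1 (w ▸ hold)
      · exact ⟨v, x, by omega, z, w⟩
    · refine ⟨o₅.1, fun v x y => ?_⟩
      rw [ht, ht', ← o₄]; exact o₅.2 v x y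
  have start : ∀ c Q, (∀ t, t.reg R1 = a → t.reg I = i → t.arr = s'.arr →
      Tri (.ite (.read UN (.reg I)) (.ite (.read SIDE (.reg R1)) .skip
        (walk ;; .ite (.op .lt (.reg R4) (.reg R3)) (.write SIDE (.reg R1) 2)
          (.write SIDE (.reg R1) 1))) .skip) t c Q) → Tri greedyStep s' (3 + c) Q := by
    intro c Q hQ
    exact Tri.seqF (R := fun t => t.reg R1 = a) (.flat rfl (by decide) (by simp [hi, o₄, ha]))
      fun t k q => hQ t k ((q.1 _ rfl).trans hi) (funext fun A => q.2 A rfl)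
  by_cases c₁ : s.arr UN i = 0
  · refine ⟨3 + (2 + 1 + 1), 90 * (List.range' 1 N).countP fun v =>
      unB s v && decide (s.arr LABEL v ∉ order), by omega, start _ _ fun t k₁ k₂ k₃ => ?_⟩
    refine Tri.ite (fun he => ?_) fun _ => .flat rfl le_rfl
      (old (.inl (by simp [unB, c₁])) _ (by rw [← o₄]; exact congrFun k₃ _) (congrFun k₃ _))
    simp [k₂, k₃, eU, c₁] at he
  have hui : unB s i = true := by simp [unB, c₁]
  by_cases c₂ : a ∈ order
  · refine ⟨3 + (2 + 1 + (2 + 1 + 1)), 90 * (List.range' 1 N).countP fun v =>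
      unB s v && decide (s.arr LABEL v ∉ order), by omega, start _ _ fun t k₁ k₂ k₃ => ?_⟩
    refine Tri.ite (fun _ => Tri.ite (fun _ => .flat rfl le_rfl
      (old (.inr c₂) _ (by rw [← o₄]; exact congrFun k₃ _) (congrFun k₃ _))) fun he => ?_)
      fun he => ?_
    · have := o₅.2 i h₁ h₂
      simp only [Expr.eval_read, Expr.eval_reg, k₁, k₃] at he
      rw [o₄, ← ha, he] at this
      have h' := (o₃ a).1 c₂
      exfalso
      rcases h' with h' | h'
      · rw [if_pos h'] at this; omega
      · split_ifs at this
    · simp [k₂, k₃, eU, c₁] at he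
  set P := greedyLoop occ order ([], []) with hP
  have n₁ : a ∉ P.1 := fun h => c₂ ((o₃ a).2 (.inl h))
  have n₂ : a ∉ P.2 := fun h => c₂ ((o₃ a).2 (.inr h))
  have hs0 : s'.arr SIDE a = 0 := by
    have := o₅.2 i h₁ h₂
    rw [o₄, ← ha] at this
    rw [this, if_neg n₁, if_neg n₂]
  -- Deciding `a` releases the potential of exactly the nodes in its list of occurrences.
  have hcount : (List.range' 1 N).countP (fun v => unB s v && decide (s.arr LABEL v ∉ order)) =
      (List.range' 1 N).countP (fun v => unB s v && decide (s.arr LABEL v ∉ order ++ [a])) +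
        (unList s N 0 a).length := by
    have e : (unList s N 0 a).length =
        (List.range' 1 N).countP fun v => unB s v && decide (s.arr LABEL v = a) := by
      rw [List.countP_eq_length_filter]; rfl
    rw [e, ← countP_or _ _ _ (fun x hx => by simp at hx; simp [hx.2.2])]
    refine List.countP_congr fun v _ => ?_
    simp only [Bool.and_eq_true, Bool.or_eq_true, decide_eq_true_eq, List.mem_append,
      List.mem_singleton, not_or]
    by_cases hv : s.arr LABEL v = a
    · simp [hv, c₂]
    · simp [hv]
  have cn' := h.frame hf rfl
  have hT : ∀ k S, a ∉ S → (∀ v, 1 ≤ v → v ≤ N →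
      (s'.arr SIDE (s'.arr LABEL v) = k ↔ s'.arr LABEL v ∈ S)) →
      touching occ a S = (unList s N 0 a).countP (onSide s' CHILD k) +
        (unList s N 0 a).countP (onSide s' PARENT k) := by
    intro k S hS hk
    have := touching_side cn' (a := a) (k := k) (fun v x y => by
      rw [eb, hU v x y, IsUn, IsUn, hf.2 CHILD rfl, hf.2 NEXT rfl]) (by rw [eb]; exact h0) hS hk
    rwa [o₄, ← hocc, show unList s' N 0 a = unList s N 0 a by simp only [unList, eb, o₄]] at this
  have t₁ := hT 1 P.1 n₁ fun v x y => o₅.one x y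
  have t₂ := hT 2 P.2 n₂ fun v x y => o₅.two x y
  refine ⟨3 + (2 + 1 + (2 + 1 + (90 * (unList s N 0 a).length + 20 + 10))),
    90 * (List.range' 1 N).countP fun v => unB s v && decide (s.arr LABEL v ∉ order ++ [a]),
    by rw [hcount]; omega, start _ _ fun t k₁ k₂ k₃ => ?_⟩
  refine Tri.ite (fun _ => Tri.ite (fun he => ?_) fun _ => ?_) fun he => ?_
  · simp [k₁, k₃, hs0] at he
  · have hwalk := walk_spec (s := t) (l := unList s N 0 a) (by
      rw [k₁, k₃, hf.2 LNX rfl, hf.2 HEAD rfl]; exact hch i h₁ h₂)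
    refine Tri.seqF hwalk fun t' ⟨w₁, w₂⟩ q => ?_
    have hon : ∀ A k, onSide t A k = onSide s' A k := fun A k => by
      funext v; simp only [onSide, sideB_congr k₃, k₃]
    rw [hon, hon, ← t₁] at w₁
    rw [hon, hon, ← t₂] at w₂
    have ea : t'.arr = s'.arr := (funext fun A => q.2 A rfl).trans k₃
    have eR : t'.reg R1 = a := (q.1 _ rfl).trans k₁
    have hgl := greedyLoop_append occ order a ([], [])
    rw [← hP] at hgl
    have fin : ∀ (u : State) (x : ℕ), u.arr LABEL = s.arr LABEL →
        (∀ b, u.arr SIDE b = if b = a then x else s'.arr SIDE b) →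
        (x = if touching occ a P.1 ≤ touching occ a P.2 then 1 else 2) →
        GreedyInv s N occ (i + 1) (90 * (List.range' 1 N).countP fun v =>
          unB s v && decide (s.arr LABEL v ∉ order ++ [a])) u := by
      intro u x hu hx hxe
      refine ⟨order ++ [a], ?_, fun b => ?_, fun b => ?_, hu, ?_, rfl⟩
      · rw [List.nodup_append]
        exact ⟨o₁, by simp, fun b hb c hc => by
          rw [List.mem_singleton.1 hc]; rintro rfl; exact c₂ hb⟩
      · rw [List.mem_append, List.mem_singleton, o₂]
        constructor
        · rintro (⟨v, x, y, z⟩ | rfl)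
          · exact ⟨v, x, by omega, z⟩
          · exact ⟨i, h₁, by omega, hui, rfl⟩
        · rintro ⟨v, x, y, z, w⟩
          rcases eq_or_ne v i with rfl | hne
          · exact .inr w.symm
          · exact .inl ⟨v, x, by omega, z, w⟩
      · rw [hgl, List.mem_append, List.mem_singleton, o₃]
        split_ifs <;> simp only [List.mem_cons] <;> tauto
      · rw [hgl]
        refine ⟨?_, fun v y z => ?_⟩
        · split_ifs
          · intro b hb
            rcases List.mem_cons.1 hb with rfl | hb
            · exact n₂
            · exact o₅.1 b hb
          · intro b hb hb'
            rcases List.mem_cons.1 hb' with rfl | hb'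
            · exact n₁ hb
            · exact o₅.1 b hb hb'
        · have := o₅.2 v y z
          rw [o₄] at this
          rw [hu, hx, hxe]
          by_cases hv : s.arr LABEL v = a
          · rw [if_pos hv, hv]
            by_cases hle : touching occ a P.1 ≤ touching occ a P.2
            · simp only [if_pos hle, List.mem_cons, true_or, if_true]
            · simp only [if_neg hle, List.mem_cons, true_or, if_true, if_neg n₁]
          · rw [if_neg hv, this]
            by_cases hle : touching occ a P.1 ≤ touching occ a P.2
            · simp only [if_pos hle, List.mem_cons, hv, false_or]
            · simp only [if_neg hle, List.mem_cons, hv, false_or]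
    refine Tri.mono (b := 3 + 1 + 3) (Tri.ite (fun he => ?_) fun he => ?_) (by omega) fun _ h => h
    · have hlt : ¬ touching occ a P.1 ≤ touching occ a P.2 := by
        simp [w₁, w₂] at he; omega
      refine .flat rfl (by decide) (fin _ 2 (by funext b; simp +decide [ea, o₄]) (fun b => ?_)
        (by rw [if_neg hlt]))
      simp [ea, eR]
    · have hle : touching occ a P.1 ≤ touching occ a P.2 := by
        simp [w₁, w₂] at he; omega
      refine .flat rfl (by decide) (fin _ 1 (by funext b; simp +decide [ea, o₄]) (fun b => ?_)
        (by rw [if_pos hle]))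
      simp [ea, eR]
  · simp [k₂, k₃, eU, c₁] at he

theorem greedyLoop_spec (h : Canon s us N) (hU : ∀ v, 1 ≤ v → v ≤ N → (unB s v = true ↔ IsUn s v))
    (h0 : unB s 0 = false) (hch : ∀ v, 1 ≤ v → v ≤ N →
      Chn (s.arr LNX) (s.arr HEAD (s.arr LABEL v)) (unList s N 0 (s.arr LABEL v)))
    (hsd : ∀ v, 1 ≤ v → v ≤ N → s.arr SIDE (s.arr LABEL v) = 0)
    {occ : List (ℕ × ℕ)} (hocc : occ = pairOcc (node (s.arr LABEL 1) (mapL (s.arr LABEL) us))) :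
    Tri (forUp greedyStep) s (N * 200 + 8) (fun s' => ∃ p, GreedyInv s N occ (N + 1) p s') := by
  set p := 90 * (List.range' 1 N).countP fun v => unB s v && decide (s.arr LABEL v ∉ ([] : List ℕ))
    with hp
  have hpN : p ≤ 90 * N := by
    have : (List.range' 1 N).countP (fun v => unB s v && decide (s.arr LABEL v ∉ ([] : List ℕ))) ≤ N :=
      List.countP_le_length.trans (by simp)
    omega
  refine Tri.mono (Tri.forUpP (N := N) (C := 100) (p := p) (GreedyInv s N occ) rfl rfl
    (fun i p s x h => h) ?_ h.size ?_) (by omega) fun _ h => h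
  · refine ⟨[], by simp, fun a => ?_, by simp [greedyLoop], rfl, ⟨by simp [greedyLoop], ?_⟩, rfl⟩
    · constructor
      · simp
      · rintro ⟨v, x, y, _⟩; omega
    · intro v h₁ h₂; simp [greedyLoop, hsd v h₁ h₂]
  · intro i p s' hf h₁ h₂ hi hJ
    exact greedyStep_spec h hU h0 hch hocc hf h₁ h₂ hi hJ

end pairs


/-! ### Unary pair compression -/

/-- Mark a node that is to be deleted. -/
def pairDel : Cmd :=
  .write DEL (.reg I) 0 ;; .set R3 (.read PARENT (.reg I)) ;;
  .ite (.read UN (.reg I)) (.ite (.read UN (.reg R3))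
    (.ite (.op .eq (.read SIDE (.read LABEL (.reg R3))) (.reg R5))
      (.ite (.op .eq (.read SIDE (.read LABEL (.reg I))) (.reg R6))
        (.write DEL (.reg I) 1) .skip) .skip) .skip) .skip

/-- Emit the production for a pair. -/
def pairEmit : Cmd :=
  .write TAB (keyE (.reg R1) (.reg R4) 0) (.reg FR) ;;
  .write PRODS (.reg LEN) (.reg FR) ;; .write PRODS (.reg LEN + 1) 0 ;;
  .write PRODS (.reg LEN + 2) 2 ;; .write PRODS (.reg LEN + 3) (.reg R1) ;;
  .write PRODS (.reg LEN + 4) (.reg R4) ;; .set LEN (.reg LEN + 5) ;; .set FR (.reg FR + 1)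

/-- Find the new label of a node. -/
def pairLab : Cmd :=
  .set R1 (.read LABEL (.reg I)) ;; .write NL (.reg I) (.reg R1) ;;
  .set R2 (.read CHILD (.reg I)) ;; .set R4 (.read LABEL (.reg R2)) ;;
  .ite (.read UN (.reg I)) (.ite (.read UN (.reg R2))
    (.ite (.op .eq (.read SIDE (.reg R1)) (.reg R5))
      (.ite (.op .eq (.read SIDE (.reg R4)) (.reg R6))
        (.ite (.op .lt (.read TAB (keyE (.reg R1) (.reg R4) 0)) (.reg ST)) pairEmit .skip ;;
          .write NL (.reg I) (.read TAB (keyE (.reg R1) (.reg R4) 0))) .skip) .skip) .skip) .skip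

/-- Unary pair compression. -/
def pairP : Cmd :=
  .set ST (.reg FR) ;; .write UN 0 0 ;; forUp pairInit ;; forDown pairList ;; forUp greedyStep ;;
  coverP ;; forUp pairDel ;; forUp pairLab ;; contractP

section pairs
variable {s : State} {us : List (RTree ℕ)} {N : ℕ}

/-- A node and its child form a 2-chain with labels on the sides `x` and `y`. -/
def Cov (s : State) (x y v : ℕ) : Prop :=
  unB s v = true ∧ unB s (s.arr CHILD v) = true ∧ s.arr SIDE (s.arr LABEL v) = x ∧
    s.arr SIDE (s.arr LABEL (s.arr CHILD v)) = y

instance (s : State) (x y v : ℕ) : Decidable (Cov s x y v) := by unfold Cov; infer_instance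

theorem Cov.congr {s s' : State} (hU : s'.arr UN = s.arr UN) (hC : s'.arr CHILD = s.arr CHILD)
    (hL : s'.arr LABEL = s.arr LABEL) (hS : s'.arr SIDE = s.arr SIDE) : Cov s' = Cov s := by
  funext x y v
  simp only [Cov, unB, hU, hC, hL, hS]

theorem coverStep_run (s : State) {i : ℕ} (hi : s.reg I = i) :
    (coverStep.run s).reg R3 = s.reg R3 + (decide (Cov s 1 2 i)).toNat ∧
    (coverStep.run s).reg R4 = s.reg R4 + (decide (Cov s 2 1 i)).toNat := by
  by_cases c₁ : s.arr UN i = 0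
  · simp +decide [coverStep, Cov, unB, hi, c₁]
  by_cases c₂ : s.arr UN (s.arr CHILD i) = 0
  · simp +decide [coverStep, Cov, unB, hi, c₁, c₂]
  by_cases c₃ : s.arr SIDE (s.arr LABEL i) = 1
  · by_cases c₄ : s.arr SIDE (s.arr LABEL (s.arr CHILD i)) = 2 <;>
      simp +decide [coverStep, Cov, unB, hi, c₁, c₂, c₃, c₄]
  by_cases c₄ : s.arr SIDE (s.arr LABEL i) = 2
  · by_cases c₅ : s.arr SIDE (s.arr LABEL (s.arr CHILD i)) = 1 <;>
      simp +decide [coverStep, Cov, unB, hi, c₁, c₂, c₄, c₅]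
  · simp +decide [coverStep, Cov, unB, hi, c₁, c₂, c₃, c₄]

/-- Switching the two sides does not touch `SIDE`: the registers `R5` and `R6` record which of the
numbers 1 and 2 means up and which means down. -/
theorem coverP_spec (hN : s.reg SIZE = N) :
    Tri coverP s (N * 90 + 30) (fun s' => (s'.reg R5, s'.reg R6) =
      if (List.range' 1 N).countP (fun v => decide (Cov s 1 2 v)) <
        (List.range' 1 N).countP (fun v => decide (Cov s 2 1 v)) then (2, 1) else (1, 2)) := by
  refine Tri.mono (b := 2 + (2 + ((N * (80 + 10) + 8) + 18))) ?_ (by omega) fun _ h => h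
  refine Tri.seqF (R := fun s' => s'.reg R3 = 0) (.flat rfl (by decide) (by simp)) fun s₁ g₁ f₁ => ?_
  refine Tri.seqF (R := fun s' => s'.reg R4 = 0) (.flat rfl (by decide) (by simp)) fun s₂ g₂ f₂ => ?_
  have e₂ : s₂.arr = s.arr := funext fun A => (f₂.2 A rfl).trans (f₁.2 A rfl)
  refine Tri.seqF (Tri.forUp (C := 80) (fun i s' =>
    s'.reg R3 = (List.range' 1 (i - 1)).countP (fun v => decide (Cov s 1 2 v)) ∧
    s'.reg R4 = (List.range' 1 (i - 1)).countP (fun v => decide (Cov s 2 1 v))) rfl rfl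
    (fun i s x h => h) ?_ (N := N) ((f₂.1 SIZE rfl).trans ((f₁.1 SIZE rfl).trans hN)) ?_)
    fun s₃ ⟨j₁, j₂⟩ _ => ?_
  · simp [(f₂.1 R3 rfl).trans g₁, g₂]
  · intro i s' hf h₁ h₂ hi ⟨j₁, j₂⟩
    obtain ⟨r₁, r₂⟩ := coverStep_run s' hi
    have ea : s'.arr = s.arr := (funext fun A => hf.2 A rfl).trans e₂
    simp only [Cov.congr (congrFun ea _) (congrFun ea _) (congrFun ea _) (congrFun ea _)] at r₁ r₂
    refine .flat rfl (by decide) ?_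
    rw [r₁, r₂, j₁, j₂]
    obtain ⟨k, rfl⟩ : ∃ k, i = k + 1 := ⟨i - 1, by omega⟩
    simp only [Nat.add_sub_cancel, List.range'_concat, List.countP_append, countP_singleton',
      one_mul, Nat.add_comm 1 k, and_self]
  · simp only [Nat.add_sub_cancel] at j₁ j₂
    refine .flat rfl (by decide) ?_
    rw [← j₁, ← j₂]
    by_cases c : s₃.reg R3 < s₃.reg R4 <;> simp +decide [c]

theorem pairDel_spec (hN : s.reg SIZE = N) :
    Tri (forUp pairDel) s (N * 70 + 8) (fun s' => ∀ v, 1 ≤ v → v ≤ N → (s'.arr DEL v ≠ 0 ↔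
      unB s v = true ∧ unB s (s.arr PARENT v) = true ∧
      s.arr SIDE (s.arr LABEL (s.arr PARENT v)) = s.reg R5 ∧
      s.arr SIDE (s.arr LABEL v) = s.reg R6)) := by
  refine (Tri.forUp (C := 60) (fun i s' => ∀ v, 1 ≤ v → v < i → (s'.arr DEL v ≠ 0 ↔
      unB s v = true ∧ unB s (s.arr PARENT v) = true ∧
      s.arr SIDE (s.arr LABEL (s.arr PARENT v)) = s.reg R5 ∧
      s.arr SIDE (s.arr LABEL v) = s.reg R6)) rfl rfl (fun i s x h => h) (fun v _ _ => by omega)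
    hN ?_).mono le_rfl fun s' h v h₁ h₂ => h v h₁ (by omega)
  intro i s' hf h₁ h₂ hi hJ
  have eL : s'.arr LABEL = s.arr LABEL := hf.2 _ rfl
  have eP : s'.arr PARENT = s.arr PARENT := hf.2 _ rfl
  have eU : s'.arr UN = s.arr UN := hf.2 _ rfl
  have eS : s'.arr SIDE = s.arr SIDE := hf.2 _ rfl
  have e5 : s'.reg R5 = s.reg R5 := hf.1 _ rfl
  have e6 : s'.reg R6 = s.reg R6 := hf.1 _ rfl
  refine .flat rfl (by decide) fun v hv hvi => ?_
  by_cases hne : v = i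
  · subst hne
    by_cases c₁ : s.arr UN v = 0
    · simp +decide [pairDel, unB, hi, eP, eU, c₁]
    by_cases c₂ : s.arr UN (s.arr PARENT v) = 0
    · simp +decide [pairDel, unB, hi, eP, eU, c₁, c₂]
    by_cases c₃ : s.arr SIDE (s.arr LABEL (s.arr PARENT v)) = s.reg R5
    · by_cases c₄ : s.arr SIDE (s.arr LABEL v) = s.reg R6 <;>
        simp +decide [pairDel, unB, hi, eP, eU, eL, eS, e5, e6, c₁, c₂, c₃, c₄]
    · simp +decide [pairDel, unB, hi, eP, eU, eL, eS, e5, c₁, c₂, c₃]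
  · rw [← hJ v hv (by omega)]
    have : (pairDel.run s').arr DEL v = s'.arr DEL v := by
      simp +decide [pairDel, hi, hne]
    rw [this]

/-- The productions for the pairs at the nodes that satisfy `C`. -/
def pairSet (T : ℕ → ℕ) (m : ℕ) (lb ch : ℕ → ℕ) (C : ℕ → Prop) : Set Production :=
  {q | ∃ v, C v ∧ q = ⟨T (key m (lb v) (lb (ch v)) 0), .word [lb v, lb (ch v)]⟩}

/-- The state of the relabelling when the nodes less than `i` have been treated. -/
structure LabInv (m : ℕ) (lb ch : ℕ → ℕ) (C : ℕ → Prop) (G : Set Production) (i : ℕ) (s : State) :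
    Prop where
  dict : Dict (s.arr TAB) m (s.reg FR)
  le : m ≤ s.reg FR
  dom : ∀ a b, b < m → (m ≤ s.arr TAB (key m a b 0) ↔
    ∃ v, (1 ≤ v ∧ v < i ∧ C v) ∧ lb v = a ∧ lb (ch v) = b)
  lab : ∀ v, 1 ≤ v → v < i → (C v → s.arr NL v = s.arr TAB (key m (lb v) (lb (ch v)) 0)) ∧
    (¬ C v → s.arr NL v = lb v)
  prods : PS s (G ∪ pairSet (s.arr TAB) m lb ch fun v => 1 ≤ v ∧ v < i ∧ C v)

/-- All occurrences of a pair of labels share one cell of the table. The first one fills it and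
emits the production, the others only read it; the field `dom` of the invariant says that the filled
cells are those of the pairs met so far. -/
theorem pairLab_spec (hN : s.reg SIZE = N) {m : ℕ} {G : Set Production} (hst : s.reg ST = m)
    (hfr : s.reg FR = m) (hT : ∀ k, s.arr TAB k < m)
    (hlb : ∀ v, 1 ≤ v → v ≤ N → s.arr LABEL v < m ∧
      (Cov s (s.reg R5) (s.reg R6) v → s.arr LABEL (s.arr CHILD v) < m)) (hG : PS s G) :
    Tri (forUp pairLab) s (N * 210 + 8)
      (LabInv m (s.arr LABEL) (s.arr CHILD) (Cov s (s.reg R5) (s.reg R6)) G (N + 1)) := by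
  set C := Cov s (s.reg R5) (s.reg R6) with hC
  refine (Tri.forUp (C := 200) (LabInv m (s.arr LABEL) (s.arr CHILD) C G) rfl rfl
    (fun i s x h => ⟨h.dict, h.le, h.dom, h.lab, h.prods⟩)
    ⟨hfr ▸ Dict.init (hfr ▸ hT), hfr.ge, fun a b _ => ?_, fun v _ _ => by omega, ?_⟩ hN ?_)
  · have := hT (key m a b 0)
    constructor
    · intro; omega
    · rintro ⟨v, ⟨_, _, _⟩, _⟩; omega
  · have : (pairSet (s.arr TAB) m (s.arr LABEL) (s.arr CHILD) fun v => 1 ≤ v ∧ v < 1 ∧ C v) = ∅ := by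
      ext q; simp [pairSet]
    rw [this, Set.union_empty]; exact hG
  intro i s' hf h₁ h₂ hi hJ
  have eL : s'.arr LABEL = s.arr LABEL := hf.2 _ rfl
  have eC : s'.arr CHILD = s.arr CHILD := hf.2 _ rfl
  have eU : s'.arr UN = s.arr UN := hf.2 _ rfl
  have eS : s'.arr SIDE = s.arr SIDE := hf.2 _ rfl
  have e5 : s'.reg R5 = s.reg R5 := hf.1 _ rfl
  have e6 : s'.reg R6 = s.reg R6 := hf.1 _ rfl
  have eT : s'.reg ST = m := (hf.1 _ rfl).trans hst
  obtain ⟨j₁, j₂, j₃, j₄, j₅⟩ := hJ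
  set lb := s.arr LABEL
  set ch := s.arr CHILD
  refine .flat rfl (by decide) ?_
  have hp₀ : ∀ v, v ≠ i → (pairLab.run s').arr NL v = s'.arr NL v := fun v hne => by
    simp +decide [pairLab, pairEmit, hi, hne]
  have split : ∀ v, (1 ≤ v ∧ v < i + 1 ∧ C v) ↔ (1 ≤ v ∧ v < i ∧ C v) ∨ (v = i ∧ C i) := by
    intro v
    constructor
    · rintro ⟨x, y, z⟩
      rcases eq_or_ne v i with rfl | hne
      · exact .inr ⟨rfl, z⟩
      · exact .inl ⟨x, by omega, z⟩
    · rintro (⟨x, y, z⟩ | ⟨rfl, z⟩)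
      · exact ⟨x, by omega, z⟩
      · exact ⟨h₁, by omega, z⟩
  by_cases c : C i
  · have c' := c
    obtain ⟨c₁, c₂, c₃, c₄⟩ := c'
    replace c₁ : s.arr UN i ≠ 0 := by simpa [unB] using c₁
    replace c₂ : s.arr UN (ch i) ≠ 0 := by simpa [unB] using c₂
    replace c₃ : s.arr SIDE (lb i) = s.reg R5 := c₃
    replace c₄ : s.arr SIDE (lb (ch i)) = s.reg R6 := c₄
    have hbm := (hlb i h₁ h₂).2 c
    have ham := (hlb i h₁ h₂).1
    by_cases c₅ : s'.arr TAB (key m (lb i) (lb (ch i)) 0) < m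
    · have hrun : (pairLab.run s').reg FR = s'.reg FR + 1 ∧
          (∀ k, (pairLab.run s').arr TAB k = if k = key m (lb i) (lb (ch i)) 0 then s'.reg FR
            else s'.arr TAB k) ∧ (pairLab.run s').arr NL i = s'.reg FR ∧
          (pairLab.run s').reg LEN = s'.reg LEN + 5 ∧
          (∀ j, (pairLab.run s').arr PRODS j = if j = s'.reg LEN + 4 then lb (ch i) else
            if j = s'.reg LEN + 3 then lb i else if j = s'.reg LEN + 2 then 2 else
            if j = s'.reg LEN + 1 then 0 else if j = s'.reg LEN then s'.reg FR
            else s'.arr PRODS j) := by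
        refine ⟨?_, fun k => ?_, ?_, ?_, fun j => ?_⟩ <;>
          simp +decide [pairLab, pairEmit, hi, eL, eC, eU, eS, e5, e6, eT, c₁, c₂, c₃, c₄, c₅]
      generalize pairLab.run s' = s'' at *
      obtain ⟨r₁, r₂, r₃, r₄, r₅⟩ := hrun
      have hself : s''.arr TAB (key m (lb i) (lb (ch i)) 0) = s'.reg FR := by rw [r₂, if_pos rfl]
      -- The cells of the pairs met before are filled, so none of them is the empty cell that is
      -- filled now.
      have hold : ∀ v, (1 ≤ v ∧ v < i ∧ C v) → s''.arr TAB (key m (lb v) (lb (ch v)) 0) =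
          s'.arr TAB (key m (lb v) (lb (ch v)) 0) := by
        intro v hv
        rw [r₂, if_neg]
        intro hk
        have hvm := (hlb v hv.1 (by omega)).2 hv.2.2
        have := (j₃ (lb v) (lb (ch v)) hvm).2 ⟨v, hv, rfl, rfl⟩
        rw [hk] at this
        omega
      refine ⟨by rw [r₁]; exact j₁.alloc r₂, by omega, fun a b hb => ?_, fun v hv hvi => ?_, ?_⟩
      · simp only [split]
        by_cases hab : a = lb i ∧ b = lb (ch i)
        · obtain ⟨rfl, rfl⟩ := hab
          rw [hself]
          exact ⟨fun _ => ⟨i, .inr ⟨rfl, c⟩, rfl, rfl⟩, fun _ => j₂⟩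
        · rw [r₂, if_neg fun hk => hab (by
            have := key_inj hk hb hbm (by omega) (by omega); exact ⟨this.1, this.2.1⟩), j₃ a b hb]
          constructor
          · rintro ⟨v, hv, h'⟩; exact ⟨v, .inl hv, h'⟩
          · rintro ⟨v, hv | ⟨rfl, -⟩, h'⟩
            · exact ⟨v, hv, h'⟩
            · exact absurd ⟨h'.1.symm, h'.2.symm⟩ hab
      · rcases eq_or_ne v i with rfl | hne
        · exact ⟨fun _ => by rw [r₃, hself], fun h => absurd c h⟩
        · obtain ⟨q₁, q₂⟩ := j₄ v hv (by omega)
          rw [hp₀ v hne]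
          exact ⟨fun hc => by rw [hold v ⟨hv, by omega, hc⟩, q₁ hc], q₂⟩
      · have hset : (pairSet (s''.arr TAB) m lb ch fun v => 1 ≤ v ∧ v < i + 1 ∧ C v) =
            insert ⟨s'.reg FR, .word [lb i, lb (ch i)]⟩
              (pairSet (s'.arr TAB) m lb ch fun v => 1 ≤ v ∧ v < i ∧ C v) := by
          ext q
          simp only [pairSet, Set.mem_ofPred_eq, Set.mem_insert_iff, split]
          constructor
          · rintro ⟨v, hv | ⟨rfl, -⟩, rfl⟩
            · exact .inr ⟨v, hv, by rw [hold v hv]⟩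
            · exact .inl (by rw [hself])
          · rintro (rfl | ⟨v, hv, rfl⟩)
            · exact ⟨i, .inr ⟨rfl, c⟩, by rw [hself]⟩
            · exact ⟨v, .inl hv, by rw [hold v hv]⟩
        rw [hset, Set.union_insert]
        refine j₅.emit _ (by rw [r₄]; rfl) (fun k hk => ?_) (fun j hj => ?_) rfl (by omega) ?_
        · rw [r₅]; repeat rw [if_neg (by omega)]
        · rw [r₅]
          have hj' : j < 5 := hj
          interval_cases j <;> simp [Production.encode]
        · intro b hb
          simp only [Rhs.letters, List.mem_cons, List.not_mem_nil, or_false] at hb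
          rcases hb with rfl | rfl <;> omega
    · have hrun : (pairLab.run s').reg FR = s'.reg FR ∧
          (pairLab.run s').arr TAB = s'.arr TAB ∧
          (pairLab.run s').arr NL i = s'.arr TAB (key m (lb i) (lb (ch i)) 0) ∧
          (pairLab.run s').reg LEN = s'.reg LEN ∧
          (pairLab.run s').arr PRODS = s'.arr PRODS := by
        refine ⟨?_, funext fun k => ?_, ?_, ?_, funext fun j => ?_⟩ <;>
          simp +decide [pairLab, pairEmit, hi, eL, eC, eU, eS, e5, e6, eT, c₁, c₂, c₃, c₄, c₅]
      generalize pairLab.run s' = s'' at *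
      obtain ⟨r₁, r₂, r₃, r₄, r₅⟩ := hrun
      -- A filled cell stems from an earlier node `u` with the same pair, whose production has
      -- already been stored.
      obtain ⟨u, hu, hua, hub⟩ := (j₃ (lb i) (lb (ch i)) hbm).1 (by omega)
      refine ⟨by rw [r₁, r₂]; exact j₁, by omega, fun a b hb => ?_, fun v hv hvi => ?_, ?_⟩
      · rw [r₂, j₃ a b hb]
        simp only [split]
        constructor
        · rintro ⟨v, hv, h'⟩; exact ⟨v, .inl hv, h'⟩
        · rintro ⟨v, hv | ⟨rfl, -⟩, h'⟩
          · exact ⟨v, hv, h'⟩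
          · exact ⟨u, hu, hua.trans h'.1, hub.trans h'.2⟩
      · rw [r₂]
        rcases eq_or_ne v i with rfl | hne
        · exact ⟨fun _ => r₃, fun h => absurd c h⟩
        · rw [hp₀ v hne]; exact j₄ v hv (by omega)
      · have hset : (pairSet (s''.arr TAB) m lb ch fun v => 1 ≤ v ∧ v < i + 1 ∧ C v) =
            pairSet (s'.arr TAB) m lb ch fun v => 1 ≤ v ∧ v < i ∧ C v := by
          ext q
          simp only [pairSet, Set.mem_ofPred_eq, split, r₂]
          constructor
          · rintro ⟨v, hv | ⟨rfl, -⟩, rfl⟩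
            · exact ⟨v, hv, rfl⟩
            · exact ⟨u, hu, by rw [hua, hub]⟩
          · rintro ⟨v, hv, rfl⟩; exact ⟨v, .inl hv, rfl⟩
        rw [hset]
        exact j₅.congr r₄ (fun i _ => by rw [r₅]) r₁.ge
  · have hrun : (pairLab.run s').reg FR = s'.reg FR ∧
        (pairLab.run s').arr TAB = s'.arr TAB ∧
        (pairLab.run s').arr NL i = lb i ∧
        (pairLab.run s').reg LEN = s'.reg LEN ∧
        (pairLab.run s').arr PRODS = s'.arr PRODS := by
      by_cases c₁ : s.arr UN i = 0
      · refine ⟨?_, funext fun k => ?_, ?_, ?_, funext fun j => ?_⟩ <;>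
          simp +decide [pairLab, hi, eL, eC, eU, c₁]
      by_cases c₂ : s.arr UN (ch i) = 0
      · refine ⟨?_, funext fun k => ?_, ?_, ?_, funext fun j => ?_⟩ <;>
          simp +decide [pairLab, hi, eL, eC, eU, c₁, c₂]
      by_cases c₃ : s.arr SIDE (lb i) = s.reg R5
      · by_cases c₄ : s.arr SIDE (lb (ch i)) = s.reg R6
        · exact absurd ⟨by simp [unB, c₁], by simp only [unB]; simpa using c₂, c₃, c₄⟩ c
        · refine ⟨?_, funext fun k => ?_, ?_, ?_, funext fun j => ?_⟩ <;>
            simp +decide [pairLab, hi, eL, eC, eU, eS, e5, e6, c₁, c₂, c₃, c₄]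
      · refine ⟨?_, funext fun k => ?_, ?_, ?_, funext fun j => ?_⟩ <;>
          simp +decide [pairLab, hi, eL, eC, eU, eS, e5, c₁, c₂, c₃]
    generalize pairLab.run s' = s'' at *
    obtain ⟨r₁, r₂, r₃, r₄, r₅⟩ := hrun
    have split' : ∀ v, (1 ≤ v ∧ v < i + 1 ∧ C v) ↔ (1 ≤ v ∧ v < i ∧ C v) := fun v => by
      rw [split]; simp [c]
    refine ⟨by rw [r₁, r₂]; exact j₁, by omega, fun a b hb => ?_, fun v hv hvi => ?_, ?_⟩
    · rw [r₂, j₃ a b hb]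
      simp only [split']
    · rw [r₂]
      rcases eq_or_ne v i with rfl | hne
      · exact ⟨fun h => absurd h c, fun _ => r₃⟩
      · rw [hp₀ v hne]; exact j₄ v hv (by omega)
    · simp only [split', r₂]
      exact j₅.congr r₄ (fun i _ => by rw [r₅]) r₁.ge

end pairs


-- Correctness and cost of unary pair compression.

theorem Good.labels_lt {s : State} {us : List (RTree ℕ)} {N m : ℕ} {X : Config}
    (h : Canon s us N) (ht : X.tree = node (s.arr LABEL 1) (mapL (s.arr LABEL) us))
    (hlab : ∀ a ∈ X.tree.labels, a < m) {v : ℕ} (h₁ : 1 ≤ v) (h₂ : v ≤ N) : s.arr LABEL v < m := by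
  refine hlab _ ?_
  have hv := h.mem_iff.2 ⟨h₁, h₂⟩
  rw [ht]
  simp only [labels, labelsL_mapL, List.mem_cons, List.mem_map]
  simp only [labelsL_cons, labelsL_nil, List.append_nil, List.mem_cons] at hv
  exact hv.imp (fun h => by rw [h]) fun h => ⟨v, h, rfl⟩

/-- The names of the letters of a pair compression, taken from the table `T`. -/
def pairName (T : ℕ → ℕ) (m : ℕ) : Desc → ℕ
  | .pair a b => T (key m a b 0)
  | _ => 0

section pairs
variable {s : State} {us : List (RTree ℕ)} {N : ℕ}

theorem IsUn.congr {s s' : State} (hC : s'.arr CHILD = s.arr CHILD)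
    (hN : s'.arr NEXT = s.arr NEXT) : IsUn s' = IsUn s := by
  funext v
  simp only [IsUn, hC, hN]

theorem unB_congr {s s' : State} (h : s'.arr UN = s.arr UN) : unB s' = unB s := by
  funext v; simp only [unB, h]

/-- The relabelling of the nodes and the contraction, for a given greedy partition. -/
theorem pairLab_contract {X : Config} {m : ℕ} {up down : List ℕ} (h : Canon s us N)
    (ht : X.tree = node (s.arr LABEL 1) (mapL (s.arr LABEL) us)) (hused : ∀ a ∈ X.used, a < m)
    (hU : ∀ v, 1 ≤ v → v ≤ N → (unB s v = true ↔ IsUn s v)) (h0 : unB s 0 = false)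
    (hgr : GreedyPartition X.tree up down) (hdis : ∀ a ∈ up, a ∉ down)
    (h5 : ∀ v, 1 ≤ v → v ≤ N → (s.arr SIDE (s.arr LABEL v) = s.reg R5 ↔ s.arr LABEL v ∈ up))
    (h6 : ∀ v, 1 ≤ v → v ≤ N → (s.arr SIDE (s.arr LABEL v) = s.reg R6 ↔ s.arr LABEL v ∈ down))
    (hst : s.reg ST = m) (hfr : s.reg FR = m) (hT : ∀ k, s.arr TAB k < m) (hG : PS s X.prods)
    (hN : N < m) :
    Tri (forUp pairDel ;; forUp pairLab ;; contractP) s (600 * N)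
      (fun s' => ∃ Y, PairComp X Y ∧ Good s' Y) := by
  have hN1 := h.pos
  set lb := s.arr LABEL with hlb
  set ch := s.arr CHILD with hch
  have hlab : ∀ v, 1 ≤ v → v ≤ N → lb v < m := fun v h₁ h₂ =>
    Good.labels_lt h ht (fun a ha => hused a (.inl ha)) h₁ h₂
  have hC : ∀ v, 1 ≤ v → v ≤ N → (Cov s (s.reg R5) (s.reg R6) v ↔
      IsUn s v ∧ IsUn s (ch v) ∧ lb v ∈ up ∧ lb (ch v) ∈ down) := by
    intro v h₁ h₂
    rw [Cov, hU v h₁ h₂]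
    refine and_congr_right fun hu => ?_
    have hc := h.child h₁ h₂ hu.1
    rw [hU _ (by omega) hc.2.1, h5 v h₁ h₂, h6 _ (by omega) hc.2.1]
  refine Tri.mono (b := (N * 70 + 8) + ((N * 210 + 8) + 200 * N)) ?_ (by omega) fun _ h => h
  refine Tri.seqF (pairDel_spec h.size) fun s₁ hD f₁ => ?_
  have eL : s₁.arr LABEL = lb := f₁.2 _ rfl
  have eC : s₁.arr CHILD = ch := f₁.2 _ rfl
  have eCov : Cov s₁ (s₁.reg R5) (s₁.reg R6) = Cov s (s.reg R5) (s.reg R6) := by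
    rw [Cov.congr (f₁.2 UN rfl) (f₁.2 CHILD rfl) (f₁.2 LABEL rfl) (f₁.2 SIDE rfl), f₁.1 R5 rfl,
      f₁.1 R6 rfl]
  have cn₁ := h.frame f₁ rfl
  refine Tri.seqF (pairLab_spec cn₁.size ((f₁.1 _ rfl).trans hst) ((f₁.1 _ rfl).trans hfr)
    (by rw [f₁.2 TAB rfl]; exact hT) (G := X.prods) ?_ ?_) fun s₂ hI f₂ => ?_
  · intro v h₁ h₂
    rw [eCov, eL, eC]
    refine ⟨hlab v h₁ h₂, fun hc => ?_⟩
    have := h.child h₁ h₂ ((hC v h₁ h₂).1 hc).1.1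
    exact hlab _ ((Nat.zero_le _).trans_lt this.1) this.2.1
  · exact hG.congr (f₁.1 _ rfl) (fun i _ => by rw [f₁.2 PRODS rfl]) (f₁.1 FR rfl).ge
  rw [eCov, eL, eC] at hI
  obtain ⟨j₁, j₂, j₃, j₄, j₅⟩ := hI
  set T := s₂.arr TAB with hTd
  have cn₂ := cn₁.frame f₂ rfl
  have eD : s₂.arr DEL = s₁.arr DEL := f₂.2 _ rfl
  have htree : pairTree (pairName T m) up down X.tree = node (s₂.arr NL 1) (mapL (s₂.arr NL)
      (contractL (fun v => decide (s₂.arr DEL v ≠ 0)) us)) := by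
    rw [ht]
    refine pairTree_eq h (lb := lb) (nl := s₂.arr NL) (nm := pairName T m) hdis ?_ ?_ 1 us
      (by simp [nodesL])
    · intro v h₁ h₂
      obtain ⟨p₁, p₂, -, -⟩ := h.parent h₁ h₂
      rw [decide_eq_true_iff, eD, hD v (by omega) h₂, hU v (by omega) h₂, hU _ p₁ (by omega),
        h5 _ p₁ (by omega), h6 v (by omega) h₂]
    · intro v h₁ h₂
      have := j₄ v h₁ (by omega)
      rw [hC v h₁ h₂] at this
      exact this
  have hocc : ∀ a b, (a, b) ∈ pairOcc X.tree ↔ ∃ v, 1 ≤ v ∧ v ≤ N ∧ IsUn s v ∧ IsUn s (ch v) ∧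
      lb v = a ∧ lb (ch v) = b := by
    intro a b
    have hl : 1 :: labelsL us = List.range' 1 N := by have := h.labels; simpa using this
    rw [ht, pairOcc_eq h hU 1 us (by simp [nodesL]), hl]
    simp only [List.mem_map, List.mem_filter, List.mem_range'_1, Bool.and_eq_true, Prod.mk.injEq]
    refine exists_congr fun v => ⟨?_, ?_⟩
    · rintro ⟨⟨⟨x, y⟩, z, w⟩, q⟩
      have z' := (hU v x (by omega)).1 z
      have hc := h.child x (by omega) z'.1
      exact ⟨x, by omega, z', (hU _ (by omega) hc.2.1).1 w, q⟩
    · rintro ⟨x, y, z, w, q⟩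
      have hc := h.child x y z.1
      exact ⟨⟨⟨x, by omega⟩, (hU v x y).2 z, (hU _ (by omega) hc.2.1).2 w⟩, q⟩
  have hprods : ∀ p, p ∈ pairProds up down X.tree ↔ ∃ v, (1 ≤ v ∧ v < N + 1 ∧
      Cov s (s.reg R5) (s.reg R6) v) ∧ p = (.pair (lb v) (lb (ch v)), .word [lb v, lb (ch v)]) := by
    intro p
    simp only [pairProds, Set.mem_ofPred_eq, hocc]
    constructor
    · rintro ⟨a, ha, b, hb, ⟨v, x, y, z, w, rfl, rfl⟩, rfl⟩
      exact ⟨v, ⟨x, by omega, (hC v x y).2 ⟨z, w, ha, hb⟩⟩, rfl⟩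
    · rintro ⟨v, ⟨x, y, z⟩, rfl⟩
      obtain ⟨z₁, z₂, z₃, z₄⟩ := (hC v x (by omega)).1 z
      exact ⟨_, z₃, _, z₄, ⟨v, x, by omega, z₁, z₂, rfl, rfl⟩, rfl⟩
  have hset : addProds X.prods (pairName T m) (pairProds up down X.tree) =
      X.prods ∪ pairSet T m lb ch fun v => 1 ≤ v ∧ v < N + 1 ∧ Cov s (s.reg R5) (s.reg R6) v := by
    unfold addProds
    congr 1
    ext q
    simp only [Set.mem_image, hprods, pairSet, Set.mem_ofPred_eq]
    constructor
    · rintro ⟨p, ⟨v, hv, rfl⟩, rfl⟩; exact ⟨v, hv, rfl⟩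
    · rintro ⟨v, hv, rfl⟩; exact ⟨_, ⟨v, hv, rfl⟩, rfl⟩
  have hbm : ∀ v, (1 ≤ v ∧ v < N + 1 ∧ Cov s (s.reg R5) (s.reg R6) v) → lb (ch v) < m := by
    rintro v ⟨h₁, h₂, hc⟩
    have := h.child h₁ (by omega) ((hC v h₁ (by omega)).1 hc).1.1
    exact hlab _ ((Nat.zero_le _).trans_lt this.1) this.2.1
  rw [← hset] at j₅
  refine (contractP_good cn₂ (D := fun v => decide (s₂.arr DEL v ≠ 0))
    (fun v h₁ h₂ => by simp) ?_ j₅ ?_ (by omega) j₁.1).mono le_rfl ?_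
  -- The root is not deleted, since the address 0 of its missing parent is not marked as unary.
  · by_contra h'
    rw [eD, ← ne_eq, hD 1 le_rfl hN1, h.parent_one, h0] at h'
    simp at h'
  · intro v h₁ h₂
    obtain ⟨q₁, q₂⟩ := j₄ v h₁ (by omega)
    by_cases hc : Cov s (s.reg R5) (s.reg R6) v
    · rw [q₁ hc]; exact j₁.1 _
    · rw [q₂ hc]; exact (hlab v h₁ h₂).trans_le j₂
  · intro s' hs'
    refine ⟨_, ⟨up, down, pairName T m, hgr, ?_, htree.symm, rfl⟩, hs'⟩
    refine fresh_of_names hused (fun p hp => ?_) fun p hp q hq hpq => ?_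
    · obtain ⟨v, hv, rfl⟩ := (hprods p).1 hp
      exact (j₃ _ _ (hbm v hv)).2 ⟨v, hv, rfl, rfl⟩
    · obtain ⟨v, hv, rfl⟩ := (hprods p).1 hp
      obtain ⟨u, hu, rfl⟩ := (hprods q).1 hq
      have := key_inj (j₁.2 _ _ ((j₃ _ _ (hbm v hv)).2 ⟨v, hv, rfl, rfl⟩) hpq) (hbm v hv) (hbm u hu)
        (by omega) (by omega)
      simp only [this.1, this.2.1]

theorem pairP_spec {X : Config} (hX : Good s X) :
    Tri pairP s (2000 * X.tree.size) (fun s' => ∃ Y, PairComp X Y ∧ Good s' Y) := by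
  have hused := hX.used
  obtain ⟨us, hc, ht, hps, hlab, hsz, hT⟩ := hX
  set N := X.tree.size with hNdef
  have hN := hc.pos
  refine Tri.mono (b := 2 + (3 + ((N * 60 + 8) + ((N * 50 + 8) + ((N * 200 + 8) +
    ((N * 90 + 30) + 600 * N)))))) ?_ (by omega) fun _ h => h
  set m := s.reg FR with hm
  set lb := s.arr LABEL with hlb
  refine Tri.seqF (R := fun s' => s'.reg ST = m) (.flat rfl (by decide) (by simp [hm]))
    fun s₁ g₁ f₁ => ?_
  refine Tri.seqF (R := fun s' => s'.arr UN 0 = 0) (.flat rfl (by decide) (by simp))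
    fun s₂ g₂ f₂ => ?_
  have cn₂ := (hc.frame f₁ rfl).frame f₂ rfl
  have eL₂ : s₂.arr LABEL = lb := (f₂.2 _ rfl).trans (f₁.2 _ rfl)
  refine Tri.seqF (pairInit_spec cn₂ g₂) fun s₃ ⟨i₀, i₁⟩ f₃ => ?_
  have cn₃ := cn₂.frame f₃ rfl
  have eL₃ : s₃.arr LABEL = lb := (f₃.2 _ rfl).trans eL₂
  rw [eL₂] at i₁
  refine Tri.seqF (pairList_spec cn₃ (by rw [eL₃]; exact fun v h₁ h₂ => (i₁ v h₁ h₂).2.1))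
    fun s₄ k₁ f₄ => ?_
  have cn₄ := cn₃.frame f₄ rfl
  have eL₄ : s₄.arr LABEL = lb := (f₄.2 _ rfl).trans eL₃
  have eu₄ : unB s₄ = unB s₃ := unB_congr (f₄.2 _ rfl)
  have hU₄ : ∀ v, 1 ≤ v → v ≤ N → (unB s₄ v = true ↔ IsUn s₄ v) := fun v h₁ h₂ => by
    rw [eu₄, (i₁ v h₁ h₂).1, IsUn.congr (f₄.2 CHILD rfl) (f₄.2 NEXT rfl),
      IsUn.congr (f₃.2 CHILD rfl) (f₃.2 NEXT rfl)]
  have h0₄ : unB s₄ 0 = false := by rw [eu₄]; simp [unB, i₀]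
  have hocc : pairOcc X.tree = pairOcc (node (s₄.arr LABEL 1) (mapL (s₄.arr LABEL) us)) := by
    rw [ht, eL₄]
  refine Tri.seqF (greedyLoop_spec cn₄ hU₄ h0₄ (fun v h₁ h₂ => ?_)
    (fun v h₁ h₂ => by rw [eL₄, f₄.2 SIDE rfl]; exact (i₁ v h₁ h₂).2.2) hocc)
    fun s₅ ⟨p, order, o₁, o₂, o₃, o₄, o₅, _⟩ f₅ => ?_
  · have := k₁ v h₁ h₂
    rw [eL₃] at this
    have e : unList s₄ N 0 (lb v) = unList s₃ N 0 (lb v) := by simp only [unList, eu₄, eL₄, eL₃]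
    rw [eL₄, e]; exact this
  have cn₅ := cn₄.frame f₅ rfl
  have eL₅ : s₅.arr LABEL = lb := (f₅.2 _ rfl).trans eL₄
  have eu₅ : unB s₅ = unB s₄ := unB_congr (f₅.2 _ rfl)
  have hU₅ : ∀ v, 1 ≤ v → v ≤ N → (unB s₅ v = true ↔ IsUn s₅ v) := fun v h₁ h₂ => by
    rw [eu₅, hU₄ v h₁ h₂, IsUn.congr (f₅.2 CHILD rfl) (f₅.2 NEXT rfl)]
  set P := greedyLoop (pairOcc X.tree) order ([], []) with hP
  have hcov : ∀ (S R : List ℕ) (x y : ℕ),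
      (∀ v, 1 ≤ v → v ≤ N → (s₅.arr SIDE (s₅.arr LABEL v) = x ↔ s₅.arr LABEL v ∈ S)) →
      (∀ v, 1 ≤ v → v ≤ N → (s₅.arr SIDE (s₅.arr LABEL v) = y ↔ s₅.arr LABEL v ∈ R)) →
      covered (pairOcc X.tree) S R = (List.range' 1 N).countP fun v => decide (Cov s₅ x y v) := by
    intro S R x y hS hR
    rw [ht, ← eL₅, covered_eq cn₅ hU₅]
    refine List.countP_congr fun v hv => ?_
    rw [List.mem_range'_1] at hv
    rw [decide_eq_true_iff]
    simp only [Bool.and_eq_true, decide_eq_true_eq, Cov, and_assoc]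
    refine and_congr_right fun hu => and_congr_right fun hu' => ?_
    have hch := cn₅.child hv.1 (by omega) ((hU₅ v hv.1 (by omega)).1 hu).1
    rw [hS v hv.1 (by omega), hR _ (by omega) hch.2.1]
  have hc₁ := hcov P.1 P.2 1 2 (fun v x y => o₅.one x y) fun v x y => o₅.two x y
  have hc₂ := hcov P.2 P.1 2 1 (fun v x y => o₅.two x y) fun v x y => o₅.one x y
  have hcp := coverP_spec cn₅.size
  rw [← hc₁, ← hc₂] at hcp
  refine Tri.seqF hcp fun s₆ hR f₆ => ?_
  have cn₆ := cn₅.frame f₆ rfl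
  have eL₆ : s₆.arr LABEL = lb := (f₆.2 _ rfl).trans eL₅
  have eu₆ : unB s₆ = unB s₅ := unB_congr (f₆.2 _ rfl)
  have hU₆ : ∀ v, 1 ≤ v → v ≤ N → (unB s₆ v = true ↔ IsUn s₆ v) := fun v h₁ h₂ => by
    rw [eu₆, hU₅ v h₁ h₂, IsUn.congr (f₆.2 CHILD rfl) (f₆.2 NEXT rfl)]
  have e6 : ∀ v, s₆.arr SIDE (s₆.arr LABEL v) = s₅.arr SIDE (s₅.arr LABEL v) := fun v => by
    rw [f₆.2 SIDE rfl, f₆.2 LABEL rfl]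
  have e6' : s₆.arr LABEL = s₅.arr LABEL := f₆.2 _ rfl
  have hord : ∀ a, a ∈ order ↔ a ∈ unaryLabels X.tree := by
    intro a
    have hl : 1 :: labelsL us = List.range' 1 N := by have := hc.labels; simpa using this
    rw [o₂, ht, ← eL₄, unaryLabels_eq cn₄ hU₄ 1 us (by simp [nodesL]), hl]
    simp only [List.mem_map, List.mem_filter, List.mem_range'_1]
    refine exists_congr fun v => ?_
    have : v < 1 + N ↔ v < N + 1 := by omega
    simp only [this, and_assoc]
  have hgr : GreedyPartition X.tree (greedy (pairOcc X.tree) order).1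
      (greedy (pairOcc X.tree) order).2 := ⟨order, o₁, hord, rfl⟩
  have hsides : (∀ a ∈ (greedy (pairOcc X.tree) order).1, a ∉ (greedy (pairOcc X.tree) order).2) ∧
      (∀ v, 1 ≤ v → v ≤ N → (s₆.arr SIDE (s₆.arr LABEL v) = s₆.reg R5 ↔
        s₆.arr LABEL v ∈ (greedy (pairOcc X.tree) order).1)) ∧
      ∀ v, 1 ≤ v → v ≤ N → (s₆.arr SIDE (s₆.arr LABEL v) = s₆.reg R6 ↔
        s₆.arr LABEL v ∈ (greedy (pairOcc X.tree) order).2) := by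
    have e : greedy (pairOcc X.tree) order =
      if covered (pairOcc X.tree) P.1 P.2 < covered (pairOcc X.tree) P.2 P.1 then (P.2, P.1)
      else P := rfl
    rw [e]
    by_cases hlt : covered (pairOcc X.tree) P.1 P.2 < covered (pairOcc X.tree) P.2 P.1
    · rw [if_pos hlt] at hR ⊢
      obtain ⟨r₁, r₂⟩ := Prod.mk.inj hR
      refine ⟨fun a ha ha' => o₅.1 a ha' ha, fun v x y => ?_, fun v x y => ?_⟩
      · rw [e6, r₁, e6']; exact o₅.two x y
      · rw [e6, r₂, e6']; exact o₅.one x y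
    · rw [if_neg hlt] at hR ⊢
      obtain ⟨r₁, r₂⟩ := Prod.mk.inj hR
      refine ⟨o₅.1, fun v x y => ?_, fun v x y => ?_⟩
      · rw [e6, r₁, e6']; exact o₅.one x y
      · rw [e6, r₂, e6']; exact o₅.two x y
  have arr₆ : ∀ A, A ∈ [TAB, PRODS] → s₆.arr A = s.arr A := by
    intro A hA
    simp only [List.mem_cons, List.not_mem_nil, or_false] at hA
    rcases hA with rfl | rfl <;>
      exact (f₆.2 _ rfl).trans ((f₅.2 _ rfl).trans ((f₄.2 _ rfl).trans ((f₃.2 _ rfl).trans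
        ((f₂.2 _ rfl).trans (f₁.2 _ rfl)))))
  have reg₆ : ∀ x, x ∈ [FR, LEN] → s₆.reg x = s.reg x := by
    intro x hx
    simp only [List.mem_cons, List.not_mem_nil, or_false] at hx
    rcases hx with rfl | rfl <;>
      exact (f₆.1 _ rfl).trans ((f₅.1 _ rfl).trans ((f₄.1 _ rfl).trans ((f₃.1 _ rfl).trans
        ((f₂.1 _ rfl).trans (f₁.1 _ rfl)))))
  refine pairLab_contract cn₆ (by rw [ht, eL₆]) hused hU₆ (by rw [eu₆, eu₅]; exact h0₄) hgr
    hsides.1 hsides.2.1 hsides.2.2 ?_ (reg₆ FR (by simp)) (fun k => ?_) ?_ hsz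
  · exact (f₆.1 _ rfl).trans ((f₅.1 _ rfl).trans ((f₄.1 _ rfl).trans ((f₃.1 _ rfl).trans
      ((f₂.1 _ rfl).trans g₁))))
  · rw [arr₆ TAB (by simp)]; exact hT k
  · exact hps.congr (reg₆ LEN (by simp)) (fun i _ => by rw [arr₆ PRODS (by simp)])
      (reg₆ FR (by simp)).ge

end pairs


/-! ### Leaf compression: the trie of leaf lists -/

/-- The key of the transition of the trie for the pair `(i, a)`. -/
def trK (m st i a : ℕ) : ℕ := key m (key m st a 0) i 1

/-- The key of the letter for a state of the trie. -/
def finK (m st : ℕ) : ℕ := key m st 0 0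

theorem trK_inj {m st i a st' i' a' : ℕ} (h : trK m st i a = trK m st' i' a') (hi : i < m)
    (hi' : i' < m) (ha : a < m) (ha' : a' < m) : st = st' ∧ i = i' ∧ a = a' := by
  have h₁ := key_inj h hi hi' (by omega) (by omega)
  have h₂ := key_inj h₁.1 ha ha' (by omega) (by omega)
  exact ⟨h₂.1, h₁.2.1, h₂.2.1⟩

theorem finK_inj {m st st' : ℕ} (h : finK m st = finK m st') (hm : 0 < m) : st = st' :=
  (key_inj h hm hm (by omega) (by omega)).1

/-- The tags differ, so adding transitions to the trie never disturbs the cells that hold letters.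
-/
theorem trK_ne_finK {m st i a st' : ℕ} : trK m st i a ≠ finK m st' := by
  unfold trK finK key; omega

/-- The state of the trie reached from the state `st`. -/
def wk (T : ℕ → ℕ) (m : ℕ) : ℕ → List (ℕ × ℕ) → ℕ
  | st, [] => st
  | st, q :: l => wk T m (T (trK m st q.1 q.2)) l

/-- All transitions exist, and the pairs are small. -/
def Val (T : ℕ → ℕ) (m : ℕ) : ℕ → List (ℕ × ℕ) → Prop
  | _, [] => True
  | st, q :: l => m ≤ T (trK m st q.1 q.2) ∧ q.1 < m ∧ q.2 < m ∧ Val T m (T (trK m st q.1 q.2)) l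

theorem wk_concat (T : ℕ → ℕ) (m st : ℕ) (l : List (ℕ × ℕ)) (q : ℕ × ℕ) :
    wk T m st (l ++ [q]) = T (trK m (wk T m st l) q.1 q.2) := by
  induction l generalizing st with
  | nil => rfl
  | cons p l ih => exact ih _

theorem val_concat {T : ℕ → ℕ} {m st : ℕ} {l : List (ℕ × ℕ)} {q : ℕ × ℕ} :
    Val T m st (l ++ [q]) ↔
      Val T m st l ∧ m ≤ T (trK m (wk T m st l) q.1 q.2) ∧ q.1 < m ∧ q.2 < m := by
  induction l generalizing st with
  | nil => simp [Val, wk]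
  | cons p l ih => simp only [List.cons_append, Val, wk, ih, and_assoc]

/-- Allocation changes only cells that count as empty, while an existing walk reads only filled
ones. -/
theorem wk_congr {T T' : ℕ → ℕ} {m : ℕ} (hT : ∀ k, m ≤ T k → T' k = T k) {st : ℕ}
    {l : List (ℕ × ℕ)} (h : Val T m st l) : wk T' m st l = wk T m st l ∧ Val T' m st l := by
  induction l generalizing st with
  | nil => exact ⟨rfl, trivial⟩
  | cons p l ih =>
    obtain ⟨h₁, h₂, h₃, h₄⟩ := h
    have := ih h₄
    simp only [wk, Val, hT _ h₁]
    exact ⟨this.1, h₁, h₂, h₃, this.2⟩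

/-- The walk is traced back from its end. A state reached by a transition is a table entry from the
threshold on, and such an entry occurs only once, so it determines the last transition and the state
before it. The starting states are labels below the threshold and cannot be confused with the
others. Thus a single number encodes a label and a list of any length. -/
theorem wk_inj {T : ℕ → ℕ} {m f : ℕ} (hT : Dict T m f) {st st' : ℕ} (hs : st < m) (hs' : st' < m)
    {l l' : List (ℕ × ℕ)} (h : Val T m st l) (h' : Val T m st' l')
    (he : wk T m st l = wk T m st' l') : st = st' ∧ l = l' := by
  induction l using List.reverseRecOn generalizing l' with
  | nil =>
    rcases List.eq_nil_or_concat l' with rfl | ⟨l', q', rfl⟩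
    · exact ⟨he, rfl⟩
    · rw [List.concat_eq_append] at *
      rw [val_concat] at h'
      rw [wk_concat, wk] at he
      omega
  | append_singleton l q ih =>
    rw [val_concat] at h
    rw [wk_concat] at he
    rcases List.eq_nil_or_concat l' with rfl | ⟨l', q', rfl⟩
    · rw [wk] at he
      omega
    · rw [List.concat_eq_append] at *
      rw [val_concat] at h'
      rw [wk_concat] at he
      obtain ⟨k₁, k₂, k₃⟩ := trK_inj (hT.2 _ _ h.2.1 he) h.2.2.1 h'.2.2.1 h.2.2.2 h'.2.2.2
      obtain ⟨rfl, rfl⟩ := ih h.1 h'.1 k₁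
      exact ⟨rfl, by rw [Prod.ext k₂ k₃]⟩

/-! ### The children of a node -/

theorem exists_eq_map_of_nodup {α β : Type} [Inhabited β] (l : List (α × β))
    (h : (l.map Prod.fst).Nodup) :
    ∃ f : α → β, l = (l.map Prod.fst).map fun a => (a, f a) := by
  classical
  induction l with
  | nil => exact ⟨fun _ => default, rfl⟩
  | cons q l ih =>
    simp only [List.map_cons, List.nodup_cons] at h
    obtain ⟨f, hf⟩ := ih h.2
    refine ⟨Function.update f q.1 q.2, ?_⟩
    simp only [List.map_cons, Function.update_self, Prod.mk.eta, List.cons.injEq, true_and]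
    refine hf.trans (List.map_congr_left fun a ha => ?_)
    rw [Function.update_of_ne]
    rintro rfl
    exact h.1 ha

theorem sum_children {α : Type} (ts : List (RTree α)) :
    ((nodesL ts).map fun q => q.2.length).sum + ts.length = (labelsL ts).length := by
  induction ts using forest_induction with
  | nil => simp [nodesL]
  | cons a us ts ih₁ ih₂ => simp [nodesL] at *; omega

/-- Each node other than the root is a child of exactly one node. The bound on the sum of the
numbers of children bounds the total length of all walks through child lists. -/
theorem Canon.children {s : State} {us : List (RTree ℕ)} {N : ℕ} (h : Canon s us N) :
    ∃ kids : ℕ → List (RTree ℕ), (∀ v ws, (v, ws) ∈ nodesL [node 1 us] ↔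
      (1 ≤ v ∧ v ≤ N) ∧ ws = kids v) ∧ ((List.range' 1 N).map fun v => (kids v).length).sum ≤ N := by
  have hn : ((nodesL [node 1 us]).map Prod.fst) = List.range' 1 N := by rw [nodesL_fst, h.labels]
  obtain ⟨f, hf⟩ := exists_eq_map_of_nodup (nodesL [node 1 us]) (by rw [hn]; exact List.nodup_range')
  rw [hn] at hf
  refine ⟨f, fun v ws => ?_, ?_⟩
  · rw [hf]
    simp only [List.mem_map, List.mem_range'_1, Prod.mk.injEq]
    constructor
    · rintro ⟨a, ha, rfl, rfl⟩; exact ⟨by omega, rfl⟩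
    · rintro ⟨ha, rfl⟩; exact ⟨v, by omega, rfl, rfl⟩
  · have := sum_children [node 1 us]
    rw [hf, h.labels] at this
    simp only [List.map_map, List.length_range'] at this
    have e : (fun v => (f v).length) = (fun q : ℕ × List (RTree ℕ) => q.2.length) ∘
      fun a => (a, f a) := rfl
    rw [e]
    omega

theorem leafList_append (i : ℕ) (xs ys : List (RTree ℕ)) :
    leafList i (xs ++ ys) = leafList i xs ++ leafList (i + xs.length) ys := by
  induction xs generalizing i with
  | nil => simp [leafList]
  | cons t xs ih =>
    obtain ⟨a, _ | ⟨u, us⟩⟩ := t <;> simp [leafList, ih, Nat.add_assoc, Nat.add_comm 1]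

/-! ### Leaf compression: the programs -/

/-- Treat a child. -/
def leafStep : Cmd :=
  .set R5 (.read LABEL (.reg R1)) ;;
  .ite (.read CHILD (.reg R1)) .skip
    (.ite (.op .lt (.read TAB (keyE (keyE (.reg R3) (.reg R5) 0) (.reg R2) 1)) (.reg ST))
      (.write TAB (keyE (keyE (.reg R3) (.reg R5) 0) (.reg R2) 1) (.reg FR) ;;
        .set FR (.reg FR + 1)) .skip ;;
      .set R3 (.read TAB (keyE (keyE (.reg R3) (.reg R5) 0) (.reg R2) 1)) ;;
      .write PRODS (.reg R4) (.reg R2) ;; .write PRODS (.reg R4 + 1) (.reg R5) ;;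
      .set R4 (.reg R4 + 2) ;; .set R6 (.reg R6 + 1)) ;;
  .set R1 (.read NEXT (.reg R1)) ;; .set R2 (.reg R2 + 1)

/-- Treat all children. -/
def leafWalk : Cmd := .while (.reg R1) leafStep

/-- The state when the children in the list `ds` of a node labelled `f` have been treated. -/
structure WalkInv (m f : ℕ) (lb : ℕ → ℕ) (T₀ P₀ : ℕ → ℕ) (f₀ len : ℕ) (ds : List (RTree ℕ))
    (s : State) : Prop where
  dict : Dict (s.arr TAB) m (s.reg FR)
  le : f₀ ≤ s.reg FR
  ext : ∀ k, m ≤ T₀ k → s.arr TAB k = T₀ k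
  fin : ∀ st, s.arr TAB (finK m st) = T₀ (finK m st)
  pos : s.reg R2 = ds.length + 1
  val : Val (s.arr TAB) m f (leafList 1 (mapL lb ds))
  st : s.reg R3 = wk (s.arr TAB) m f (leafList 1 (mapL lb ds))
  num : s.reg R6 = (leafList 1 (mapL lb ds)).length
  ptr : s.reg R4 = len + 4 + ((leafList 1 (mapL lb ds)).flatMap fun q => [q.1, q.2]).length
  old : ∀ j, j < len + 4 → s.arr PRODS j = P₀ j
  new : ∀ (j : ℕ) (h : j < ((leafList 1 (mapL lb ds)).flatMap fun q => [q.1, q.2]).length),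
    s.arr PRODS (len + 4 + j) = ((leafList 1 (mapL lb ds)).flatMap fun q => [q.1, q.2])[j]

/-- The pairs of the right-hand side are written behind `LEN + 4` during the walk, before it is
known whether the production is new. If it is not, `LEN` is left unchanged and these cells lie
outside the stored list. -/
theorem leafStep_spec {s : State} {m f f₀ len u : ℕ} {lb T₀ P₀ : ℕ → ℕ} {ds ys : List (RTree ℕ)}
    (hu : s.reg R1 = u) (hst : s.reg ST = m) (hm : m ≤ f₀) (hC : s.arr CHILD u = 0 ↔ ys = [])
    (hlb : s.arr LABEL u = lb u) (hlm : lb u < m) (hd : ds.length + 1 < m)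
    (h : WalkInv m f lb T₀ P₀ f₀ len ds s) :
    Tri leafStep s 150 (fun s' => WalkInv m f lb T₀ P₀ f₀ len (ds ++ [node u ys]) s' ∧
      s'.reg R1 = s.arr NEXT u) := by
  refine .flat rfl (by decide) ?_
  obtain ⟨h₁, h₂, h₃, h₄, h₅, h₆, h₇, h₈, h₉, h₁₀, h₁₁⟩ := h
  have hR1 : (leafStep.run s).reg R1 = s.arr NEXT u := by
    by_cases c : s.arr CHILD u = 0 <;> simp +decide [leafStep, hu, c]
  have hR2 : (leafStep.run s).reg R2 = s.reg R2 + 1 := by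
    by_cases c : s.arr CHILD u = 0 <;> simp +decide [leafStep, hu, c]
  refine ⟨?_, hR1⟩
  cases ys with
  | cons y ys =>
    have hl : leafList 1 (mapL lb (ds ++ [node u (y :: ys)])) = leafList 1 (mapL lb ds) := by
      rw [mapL_append, leafList_append]
      obtain ⟨y, zs⟩ := y
      simp [mapL, leafList, map]
    have c : s.arr CHILD u ≠ 0 := by rw [ne_eq, hC]; simp
    have hrun : (leafStep.run s).arr TAB = s.arr TAB ∧ (leafStep.run s).arr PRODS = s.arr PRODS ∧
        (leafStep.run s).reg FR = s.reg FR ∧ (leafStep.run s).reg R3 = s.reg R3 ∧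
        (leafStep.run s).reg R4 = s.reg R4 ∧ (leafStep.run s).reg R6 = s.reg R6 := by
      refine ⟨?_, ?_, ?_, ?_, ?_, ?_⟩ <;> simp +decide [leafStep, hu, c]
    generalize leafStep.run s = s' at *
    obtain ⟨r₁, r₂, r₃, r₄, r₅, r₆⟩ := hrun
    constructor <;> simp only [hl, r₁, r₂, r₃, r₄, r₅, r₆, hR2] <;> first | assumption | skip
    simp [h₅]
  | nil =>
    have c : s.arr CHILD u = 0 := hC.2 rfl
    set l := leafList 1 (mapL lb ds) with hldef
    have hl : leafList 1 (mapL lb (ds ++ [node u []])) = l ++ [(ds.length + 1, lb u)] := by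
      rw [mapL_append, leafList_append, length_mapL]
      simp [mapL, leafList, map, Nat.add_comm, hldef]
    set k₀ := trK m (s.reg R3) (ds.length + 1) (lb u) with hk
    have hrun : (∀ k, (leafStep.run s).arr TAB k = if k = k₀ ∧ s.arr TAB k₀ < m then s.reg FR
          else s.arr TAB k) ∧
        (∀ j, (leafStep.run s).arr PRODS j = if j = s.reg R4 + 1 then lb u else
          if j = s.reg R4 then ds.length + 1 else s.arr PRODS j) ∧
        (leafStep.run s).reg FR = (if s.arr TAB k₀ < m then s.reg FR + 1 else s.reg FR) ∧
        (leafStep.run s).reg R3 = (if s.arr TAB k₀ < m then s.reg FR else s.arr TAB k₀) ∧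
        (leafStep.run s).reg R4 = s.reg R4 + 2 ∧ (leafStep.run s).reg R6 = s.reg R6 + 1 := by
      have hk' : key m (key m (s.reg R3) (lb u) 0) (ds.length + 1) 1 = k₀ := rfl
      by_cases c' : s.arr TAB k₀ < m <;> refine ⟨fun k => ?_, fun j => ?_, ?_, ?_, ?_, ?_⟩ <;>
        simp +decide [leafStep, hu, c, hlb, h₅, hst, hk', c']
    generalize leafStep.run s = s' at *
    obtain ⟨r₁, r₂, r₃, r₄, r₅, r₆⟩ := hrun
    have hself : s'.arr TAB k₀ = s'.reg R3 ∧ m ≤ s'.reg R3 := by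
      rw [r₁, r₄]; split_ifs <;> simp_all <;> omega
    have hext : ∀ k, m ≤ s.arr TAB k → s'.arr TAB k = s.arr TAB k := fun k hk => by
      rw [r₁, if_neg]; rintro ⟨rfl, h⟩; omega
    obtain ⟨w₁, w₂⟩ := wk_congr hext h₆
    have hf : ((l ++ [(ds.length + 1, lb u)]).flatMap fun q => [q.1, q.2]) =
      (l.flatMap fun q => [q.1, q.2]) ++ [ds.length + 1, lb u] := by simp
    constructor
    · by_cases c' : s.arr TAB k₀ < m
      · rw [r₃, if_pos c']; exact h₁.alloc (k := k₀) (by simpa [c'] using r₁)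
      · have : s'.arr TAB = s.arr TAB := funext fun k => by simp [r₁, c']
        rw [r₃, if_neg c', this]; exact h₁
    · rw [r₃]; split_ifs <;> omega
    · intro k hk; rw [hext k (by rw [h₃ k hk]; exact hk), h₃ k hk]
    · intro st; rw [r₁, if_neg (fun h => trK_ne_finK h.1.symm), h₄]
    · rw [hR2, h₅]; simp
    · rw [hl, val_concat]
      refine ⟨w₂, ?_, hd, hlm⟩
      rw [w₁, ← h₇, hself.1]; exact hself.2
    · rw [hl, wk_concat, w₁, ← h₇]; exact hself.1.symm
    · rw [hl, r₆, h₈]; simp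
    · rw [hl, hf, r₅, h₉, List.length_append]; rfl
    · intro j hj
      rw [r₂, if_neg (by omega), if_neg (by omega), h₁₀ j hj]
    · simp only [hl, hf]
      intro j hj
      simp only [List.length_append, List.length_cons, List.length_nil] at hj
      rw [r₂]
      by_cases hj' : j < (l.flatMap fun q => [q.1, q.2]).length
      · rw [List.getElem_append_left hj', if_neg (by omega), if_neg (by omega), h₁₁ j hj']
      · rw [List.getElem_append_right (by omega)]
        obtain hj'' | hj'' : j = (l.flatMap fun q => [q.1, q.2]).length ∨
          j = (l.flatMap fun q => [q.1, q.2]).length + 1 := by omega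
        · subst hj''; rw [if_neg (by omega), if_pos (by omega)]; simp
        · subst hj''; rw [if_pos (by omega)]; simp

theorem leafWalk_spec {s : State} {m f f₀ len v : ℕ} {lb T₀ P₀ : ℕ → ℕ} {ws : List (RTree ℕ)}
    (hst : s.reg ST = m) (hm : m ≤ f₀) (hlink : LinkedL s v (s.reg R1) ws)
    (hws : ∀ u ys, node u ys ∈ ws → 0 < u ∧ (s.arr CHILD u = 0 ↔ ys = []) ∧
      s.arr LABEL u = lb u ∧ lb u < m) (hd : ws.length < m)
    (h : WalkInv m f lb T₀ P₀ f₀ len [] s) :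
    Tri leafWalk s (ws.length * 160 + 2) (WalkInv m f lb T₀ P₀ f₀ len ws) := by
  refine (Tri.while (b := ws.length * 160) (fun b s' => ∃ ds ys, ws = ds ++ ys ∧
    LinkedL s v (s'.reg R1) ys ∧ WalkInv m f lb T₀ P₀ f₀ len ds s' ∧ Frame leafStep s s' ∧
    b = ys.length * 160) ?_ ⟨[], ws, rfl, hlink, h, Frame.refl _ _, rfl⟩).mono ?_ ?_
  · rintro b s' ⟨ds, ys, hw, hl, hJ, hf, rfl⟩ he
    obtain _ | ⟨⟨u, us⟩, ys⟩ := ys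
    · rw [linkedL_nil] at hl; simp [hl] at he
    · rw [linkedL_cons] at hl
      obtain ⟨q₁, q₂, q₃, q₄⟩ := hws u us (by simp [hw])
      have e₁ : s'.arr CHILD = s.arr CHILD := hf.2 _ rfl
      have e₂ : s'.arr LABEL = s.arr LABEL := hf.2 _ rfl
      have e₃ : s'.arr NEXT = s.arr NEXT := hf.2 _ rfl
      refine ⟨150, ys.length * 160, by simp [Expr.cost]; omega,
        (leafStep_spec (ys := us) hl.1 ((hf.1 ST rfl).trans hst) hm (by rw [e₁]; exact q₂)
          (by rw [e₂]; exact q₃) q₄ (by simp [hw] at hd; omega) hJ).frame.mono le_rfl ?_⟩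
      rintro s'' ⟨⟨i₁, i₂⟩, i₃⟩
      exact ⟨ds ++ [node u us], ys, by simp [hw], by rw [i₂, e₃]; exact hl.2.2.2, i₁,
        hf.trans i₃ (fun _ h => h) (fun _ h => h), rfl⟩
  · simp [Expr.cost]
  · rintro s' ⟨he, b', ds, ys, hw, hl, hJ, -⟩
    obtain _ | ⟨⟨u, us⟩, ys⟩ := ys
    · rw [hw, List.append_nil]; exact hJ
    · rw [linkedL_cons] at hl
      have := (hws u us (by simp [hw])).1
      simp at he
      omega


/-- Emit the production for a node with leaf children. -/
def leafEmit : Cmd :=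
  .write TAB (keyE (.reg R3) 0 0) (.reg FR) ;; .write PRODS (.reg LEN) (.reg FR) ;;
  .write PRODS (.reg LEN + 1) 1 ;; .write PRODS (.reg LEN + 2) (.read LABEL (.reg I)) ;;
  .write PRODS (.reg LEN + 3) (.reg R6) ;; .set LEN (.reg R4) ;; .set FR (.reg FR + 1)

/-- Find the new label of a node with leaf children. -/
def leafFin : Cmd :=
  .ite (.reg R6) (.ite (.op .lt (.read TAB (keyE (.reg R3) 0 0)) (.reg ST)) leafEmit .skip ;;
    .write NL (.reg I) (.read TAB (keyE (.reg R3) 0 0))) .skip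

/-- Prepare the treatment of the children of a node. -/
def leafPrep : Cmd :=
  .set R1 (.read CHILD (.reg I)) ;; .set R2 1 ;; .set R3 (.read LABEL (.reg I)) ;;
  .set R4 (.reg LEN + 4) ;; .set R6 0 ;; .write NL (.reg I) (.reg R3) ;;
  .write DEL (.reg I) (.op .eq (.reg R1) 0)

/-- Treat a node. -/
def leafNode : Cmd := leafPrep ;; leafWalk ;; leafFin

/-- Leaf compression. -/
def leafP : Cmd := .set ST (.reg FR) ;; forUp leafNode ;; contractP

/-- The productions for the leaf lists of the nodes that satisfy `C`. -/
def leafSet (T : ℕ → ℕ) (m : ℕ) (lb : ℕ → ℕ) (lf : ℕ → List (ℕ × ℕ)) (C : ℕ → Prop) :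
    Set Production :=
  {q | ∃ v, C v ∧ q = ⟨T (finK m (wk T m (lb v) (lf v))), .absorb (lb v) (lf v)⟩}

/-- The state of the relabelling when the nodes less than `i` have been treated. -/
structure LeafInv (m : ℕ) (lb ch : ℕ → ℕ) (lf : ℕ → List (ℕ × ℕ)) (G : Set Production) (i : ℕ)
    (s : State) : Prop where
  dict : Dict (s.arr TAB) m (s.reg FR)
  le : m ≤ s.reg FR
  val : ∀ v, 1 ≤ v → v < i → Val (s.arr TAB) m (lb v) (lf v)
  dom : ∀ st, m ≤ s.arr TAB (finK m st) ↔
    ∃ v, (1 ≤ v ∧ v < i ∧ lf v ≠ []) ∧ wk (s.arr TAB) m (lb v) (lf v) = st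
  lab : ∀ v, 1 ≤ v → v < i → s.arr NL v = if lf v = [] then lb v else
    s.arr TAB (finK m (wk (s.arr TAB) m (lb v) (lf v)))
  del : ∀ v, 1 ≤ v → v < i → (s.arr DEL v ≠ 0 ↔ ch v = 0)
  prods : PS s (G ∪ leafSet (s.arr TAB) m lb lf fun v => 1 ≤ v ∧ v < i ∧ lf v ≠ [])

/-- The state between the treatment of the children of a node `i` and its relabelling. -/
structure LeafMid (m : ℕ) (lb ch : ℕ → ℕ) (lf : ℕ → List (ℕ × ℕ)) (G : Set Production) (i : ℕ)
    (s : State) : Prop extends LeafInv m lb ch lf G i s where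
  vali : Val (s.arr TAB) m (lb i) (lf i)
  labi : s.arr NL i = lb i
  deli : s.arr DEL i ≠ 0 ↔ ch i = 0
  st : s.reg R3 = wk (s.arr TAB) m (lb i) (lf i)
  num : s.reg R6 = (lf i).length
  ptr : s.reg R4 = s.reg LEN + 4 + ((lf i).flatMap fun q => [q.1, q.2]).length
  new : ∀ (j : ℕ) (h : j < ((lf i).flatMap fun q => [q.1, q.2]).length),
    s.arr PRODS (s.reg LEN + 4 + j) = ((lf i).flatMap fun q => [q.1, q.2])[j]

theorem Val.lt {T : ℕ → ℕ} {m st : ℕ} {l : List (ℕ × ℕ)} (h : Val T m st l) :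
    ∀ q ∈ l, q.2 < m := by
  induction l generalizing st with
  | nil => simp
  | cons p l ih =>
    obtain ⟨-, -, h₃, h₄⟩ := h
    rintro q (_ | ⟨_, hq⟩)
    · exact h₃
    · exact ih h₄ q hq

/-- The walk may add transitions, but it keeps all filled cells and all letter cells, and it writes
only behind the stored productions. So the statements about earlier nodes persist. -/
theorem LeafInv.mid {s s' : State} {m i : ℕ} {lb ch : ℕ → ℕ} {lf : ℕ → List (ℕ × ℕ)}
    {G : Set Production} {ws : List (RTree ℕ)} (h : LeafInv m lb ch lf G i s)
    (hlf : lf i = leafList 1 (mapL lb ws))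
    (hw : WalkInv m (lb i) lb (s.arr TAB) (s.arr PRODS) (s.reg FR) (s.reg LEN) ws s')
    (hNL : ∀ v, s'.arr NL v = if v = i then lb i else s.arr NL v)
    (hDEL : ∀ v, s'.arr DEL v = if v = i then (if ch i = 0 then 1 else 0) else s.arr DEL v)
    (hLEN : s'.reg LEN = s.reg LEN) : LeafMid m lb ch lf G i s' := by
  obtain ⟨w₁, w₂, w₃, w₄, -, w₆, w₇, w₈, w₉, w₁₀, w₁₁⟩ := hw
  obtain ⟨j₁, j₂, j₃, j₄, j₅, j₆, j₇⟩ := h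
  have hwk : ∀ v, 1 ≤ v → v < i → wk (s'.arr TAB) m (lb v) (lf v) = wk (s.arr TAB) m (lb v) (lf v) ∧
      Val (s'.arr TAB) m (lb v) (lf v) := fun v h₁ h₂ => wk_congr w₃ (j₃ v h₁ h₂)
  have hset : (leafSet (s'.arr TAB) m lb lf fun v => 1 ≤ v ∧ v < i ∧ lf v ≠ []) =
      leafSet (s.arr TAB) m lb lf fun v => 1 ≤ v ∧ v < i ∧ lf v ≠ [] := by
    ext q
    simp only [leafSet, Set.mem_ofPred_eq]
    refine exists_congr fun v => and_congr_right fun hv => ?_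
    rw [(hwk v hv.1 hv.2.1).1, w₄]
  refine ⟨⟨w₁, j₂.trans w₂, fun v h₁ h₂ => (hwk v h₁ h₂).2, fun st => ?_, fun v h₁ h₂ => ?_,
    fun v h₁ h₂ => ?_, ?_⟩, ?_, ?_, ?_, ?_, ?_, ?_, ?_⟩
  · rw [w₄, j₄]
    refine exists_congr fun v => and_congr_right fun hv => ?_
    rw [(hwk v hv.1 hv.2.1).1]
  · rw [hNL, if_neg (by omega), j₅ v h₁ h₂, (hwk v h₁ h₂).1, w₄]
  · rw [hDEL, if_neg (by omega), j₆ v h₁ h₂]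
  · rw [hset]
    exact j₇.congr hLEN (fun j hj => w₁₀ j (by omega)) w₂
  · rw [hlf]; exact w₆
  · rw [hNL, if_pos rfl]
  · rw [hDEL, if_pos rfl]; split_ifs <;> simp_all
  · rw [hlf]; exact w₇
  · rw [hlf]; exact w₈
  · rw [hlf, hLEN]; exact w₉
  · simp only [hlf, hLEN]; exact w₁₁

theorem LeafMid.fin {s : State} {m i : ℕ} {lb ch : ℕ → ℕ} {lf : ℕ → List (ℕ × ℕ)}
    {G : Set Production} (h : LeafMid m lb ch lf G i s) (hI : s.reg I = i) (hst : s.reg ST = m)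
    (hi : 1 ≤ i) (hlab : ∀ v, 1 ≤ v → v ≤ i → lb v < m) (hL : s.arr LABEL i = lb i) :
    LeafInv m lb ch lf G (i + 1) (leafFin.run s) := by
  obtain ⟨⟨j₁, j₂, j₃, j₄, j₅, j₆, j₇⟩, j₈, j₉, j₁₀, j₁₁, j₁₂, j₁₃, j₁₄⟩ := h
  have hm : 0 < m := (Nat.zero_le _).trans_lt (hlab i hi le_rfl)
  have hp₀ : ∀ v, v ≠ i → (leafFin.run s).arr NL v = s.arr NL v := fun v hne => by
    simp +decide [leafFin, leafEmit, hI, hne]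
  have hDEL : (leafFin.run s).arr DEL = s.arr DEL := (Cmd.frame_run rfl s).2 _ rfl
  have hdel : ∀ v, 1 ≤ v → v < i + 1 → ((leafFin.run s).arr DEL v ≠ 0 ↔ ch v = 0) := by
    intro v h₁ h₂
    rw [hDEL]
    rcases eq_or_ne v i with rfl | hne
    · exact j₁₀
    · exact j₆ v h₁ (by omega)
  have hval : ∀ v, 1 ≤ v → v < i + 1 → Val (s.arr TAB) m (lb v) (lf v) := fun v h₁ h₂ => by
    rcases eq_or_ne v i with rfl | hne
    · exact j₈
    · exact j₃ v h₁ (by omega)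
  have split : ∀ v, (1 ≤ v ∧ v < i + 1 ∧ lf v ≠ []) ↔ (1 ≤ v ∧ v < i ∧ lf v ≠ []) ∨
      (v = i ∧ lf i ≠ []) := by
    intro v
    constructor
    · rintro ⟨x, y, z⟩
      rcases eq_or_ne v i with rfl | hne
      · exact .inr ⟨rfl, z⟩
      · exact .inl ⟨x, by omega, z⟩
    · rintro (⟨x, y, z⟩ | ⟨rfl, z⟩)
      · exact ⟨x, by omega, z⟩
      · exact ⟨hi, by omega, z⟩
  by_cases c : lf i = []
  · have h6 : s.reg R6 = 0 := by rw [j₁₂, c]; rfl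
    have e : leafFin.run s = s := by simp [leafFin, h6]
    rw [e] at hdel ⊢
    have split' : ∀ v, (1 ≤ v ∧ v < i + 1 ∧ lf v ≠ []) ↔ (1 ≤ v ∧ v < i ∧ lf v ≠ []) := fun v => by
      rw [split]; simp [c]
    refine ⟨j₁, j₂, hval, fun st => ?_, fun v h₁ h₂ => ?_, hdel, ?_⟩
    · simp only [j₄, split']
    · rcases eq_or_ne v i with rfl | hne
      · rw [j₉, if_pos c]
      · exact j₅ v h₁ (by omega)
    · simp only [split']; exact j₇
  have h6 : s.reg R6 ≠ 0 := by rw [j₁₂]; simpa using c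
  set k₀ := finK m (s.reg R3) with hk
  have hk' : key m (s.reg R3) 0 0 = k₀ := rfl
  by_cases c' : s.arr TAB k₀ < m
  · have hrun : (∀ k, (leafFin.run s).arr TAB k = if k = k₀ then s.reg FR else s.arr TAB k) ∧
        (leafFin.run s).reg FR = s.reg FR + 1 ∧ (leafFin.run s).reg LEN = s.reg R4 ∧
        (leafFin.run s).arr NL i = s.reg FR ∧
        (∀ j, (leafFin.run s).arr PRODS j = if j = s.reg LEN + 3 then s.reg R6 else
          if j = s.reg LEN + 2 then lb i else if j = s.reg LEN + 1 then 1 else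
          if j = s.reg LEN then s.reg FR else s.arr PRODS j) := by
      refine ⟨fun k => ?_, ?_, ?_, ?_, fun j => ?_⟩ <;>
        simp +decide [leafFin, leafEmit, h6, hst, hI, hL, hk', c']
    generalize leafFin.run s = s' at *
    obtain ⟨r₁, r₂, r₃, r₄, r₅⟩ := hrun
    have hext : ∀ k, m ≤ s.arr TAB k → s'.arr TAB k = s.arr TAB k := fun k hk => by
      rw [r₁, if_neg]; rintro rfl; omega
    have hwk := fun v h₁ h₂ => wk_congr hext (hval v h₁ h₂)
    have hself : s'.arr TAB (finK m (wk (s'.arr TAB) m (lb i) (lf i))) = s.reg FR := by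
      rw [(hwk i hi (by omega)).1, ← j₁₁, r₁, if_pos rfl]
    have hold : ∀ v, (1 ≤ v ∧ v < i ∧ lf v ≠ []) →
        s'.arr TAB (finK m (wk (s'.arr TAB) m (lb v) (lf v))) =
          s.arr TAB (finK m (wk (s.arr TAB) m (lb v) (lf v))) := fun v hv => by
      rw [(hwk v hv.1 (by omega)).1]
      exact hext _ ((j₄ _).2 ⟨v, hv, rfl⟩)
    refine ⟨by rw [r₂]; exact j₁.alloc r₁, by omega, fun v h₁ h₂ => (hwk v h₁ h₂).2, fun st => ?_,
      fun v h₁ h₂ => ?_, hdel, ?_⟩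
    · simp only [split]
      by_cases hs : st = s.reg R3
      · subst hs
        rw [r₁, if_pos rfl]
        exact ⟨fun _ => ⟨i, .inr ⟨rfl, c⟩, by rw [(hwk i hi (by omega)).1, j₁₁]⟩, fun _ => j₂⟩
      · rw [r₁, if_neg (fun hk => hs (finK_inj hk hm)), j₄]
        constructor
        · rintro ⟨v, hv, h'⟩; exact ⟨v, .inl hv, by rw [(hwk v hv.1 (by omega)).1, h']⟩
        · rintro ⟨v, hv | ⟨rfl, -⟩, h'⟩
          · exact ⟨v, hv, by rw [← h', (hwk v hv.1 (by omega)).1]⟩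
          · exact absurd (by rw [← h', (hwk v hi (by omega)).1, j₁₁]) hs
    · rcases eq_or_ne v i with rfl | hne
      · rw [r₄, if_neg c, hself]
      · rw [hp₀ v hne, j₅ v h₁ (by omega)]
        split_ifs with hv
        · rfl
        · rw [hold v ⟨h₁, by omega, hv⟩]
    · have hset : (leafSet (s'.arr TAB) m lb lf fun v => 1 ≤ v ∧ v < i + 1 ∧ lf v ≠ []) =
          insert ⟨s.reg FR, .absorb (lb i) (lf i)⟩
            (leafSet (s.arr TAB) m lb lf fun v => 1 ≤ v ∧ v < i ∧ lf v ≠ []) := by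
        ext q
        simp only [leafSet, Set.mem_ofPred_eq, Set.mem_insert_iff, split]
        constructor
        · rintro ⟨v, hv | ⟨rfl, -⟩, rfl⟩
          · exact .inr ⟨v, hv, by rw [hold v hv]⟩
          · exact .inl (by rw [hself])
        · rintro (rfl | ⟨v, hv, rfl⟩)
          · exact ⟨i, .inr ⟨rfl, c⟩, by rw [hself]⟩
          · exact ⟨v, .inl hv, by rw [hold v hv]⟩
      rw [hset, Set.union_insert]
      refine j₇.emit _ ?_ (fun k hk => ?_) (fun j hj => ?_) rfl (by omega) ?_
      · rw [r₃, j₁₃]; simp only [Production.encode, List.length_cons]; omega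
      · rw [r₅]; repeat rw [if_neg (by omega)]
      · rw [r₅]
        match j, hj with
        | 0, _ => simp [Production.encode]
        | 1, _ => simp [Production.encode]
        | 2, _ => simp [Production.encode]
        | 3, _ => simp [Production.encode, j₁₂]
        | j + 4, hj =>
          repeat rw [if_neg (by omega)]
          simp only [Production.encode, List.length_cons] at hj
          have := j₁₄ j (by omega)
          simp only [Production.encode, List.getElem_cons_succ]
          rw [← this]; congr 1; omega
      · intro b hb
        simp only [Rhs.letters, List.mem_cons, List.mem_map] at hb
        rcases hb with rfl | ⟨q, hq, rfl⟩
        · have := hlab i hi le_rfl; omega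
        · have := j₈.lt q hq; omega
  · have hrun : (leafFin.run s).arr TAB = s.arr TAB ∧
        (leafFin.run s).reg FR = s.reg FR ∧ (leafFin.run s).reg LEN = s.reg LEN ∧
        (leafFin.run s).arr NL i = s.arr TAB k₀ ∧ (leafFin.run s).arr PRODS = s.arr PRODS := by
      refine ⟨funext fun k => ?_, ?_, ?_, ?_, funext fun k => ?_⟩ <;>
        simp +decide [leafFin, h6, hst, hI, hk', c']
    generalize leafFin.run s = s' at *
    obtain ⟨r₁, r₂, r₃, r₄, r₅⟩ := hrun
    obtain ⟨u, hu, hst'⟩ := (j₄ (s.reg R3)).1 (not_lt.1 c')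
    rw [j₁₁] at hst'
    -- If the state already has a letter, injectivity of the trie shows that the earlier node `u`
    -- has the same label and the same leaf list, so the production is already stored.
    obtain ⟨hlu, hlfu⟩ := wk_inj j₁ (hlab u hu.1 (by omega)) (hlab i hi le_rfl)
      (hval u hu.1 (by omega)) j₈ hst'
    refine ⟨by rw [r₁, r₂]; exact j₁, by omega, by rw [r₁]; exact hval, fun st => ?_,
      fun v h₁ h₂ => ?_, hdel, ?_⟩
    · rw [r₁, j₄]
      simp only [split]
      constructor
      · rintro ⟨v, hv, h'⟩; exact ⟨v, .inl hv, h'⟩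
      · rintro ⟨v, hv | ⟨rfl, -⟩, h'⟩
        · exact ⟨v, hv, h'⟩
        · exact ⟨u, hu, by rw [hst', h']⟩
    · rw [r₁]
      rcases eq_or_ne v i with rfl | hne
      · rw [r₄, if_neg c, hk, j₁₁]
      · rw [hp₀ v hne, j₅ v h₁ (by omega)]
    · have hset : (leafSet (s'.arr TAB) m lb lf fun v => 1 ≤ v ∧ v < i + 1 ∧ lf v ≠ []) =
          leafSet (s.arr TAB) m lb lf fun v => 1 ≤ v ∧ v < i ∧ lf v ≠ [] := by
        ext q
        simp only [leafSet, Set.mem_ofPred_eq, split, r₁]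
        constructor
        · rintro ⟨v, hv | ⟨rfl, -⟩, rfl⟩
          · exact ⟨v, hv, rfl⟩
          · exact ⟨u, hu, by rw [hlu, hlfu]⟩
        · rintro ⟨v, hv, rfl⟩; exact ⟨v, .inl hv, rfl⟩
      rw [hset]
      exact j₇.congr r₃ (fun i _ => by rw [r₅]) r₂.ge


-- Correctness and cost of leaf compression.

theorem leafPrep_run (s : State) {i : ℕ} (hI : s.reg I = i) :
    (leafPrep.run s).reg R1 = s.arr CHILD i ∧ (leafPrep.run s).reg R2 = 1 ∧
    (leafPrep.run s).reg R3 = s.arr LABEL i ∧ (leafPrep.run s).reg R4 = s.reg LEN + 4 ∧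
    (leafPrep.run s).reg R6 = 0 ∧
    (∀ v, (leafPrep.run s).arr NL v = if v = i then s.arr LABEL i else s.arr NL v) ∧
    ∀ v, (leafPrep.run s).arr DEL v =
      if v = i then (if s.arr CHILD i = 0 then 1 else 0) else s.arr DEL v := by
  refine ⟨?_, ?_, ?_, ?_, ?_, fun v => ?_, fun v => ?_⟩ <;> simp +decide [leafPrep, hI]

section node
variable {s : State} {us : List (RTree ℕ)} {N : ℕ}

theorem leafNode_spec (h : Canon s us N) {m i : ℕ} {lf : ℕ → List (ℕ × ℕ)}
    {G : Set Production} {ws : List (RTree ℕ)} (hi : (i, ws) ∈ nodesL [node 1 us])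
    (hlf : lf i = leafList 1 (mapL (s.arr LABEL) ws)) (hI : s.reg I = i) (hst : s.reg ST = m)
    (hN : N < m) (hlab : ∀ v, 1 ≤ v → v ≤ N → s.arr LABEL v < m)
    (hJ : LeafInv m (s.arr LABEL) (s.arr CHILD) lf G i s) :
    Tri leafNode s (150 + ws.length * 160)
      (LeafInv m (s.arr LABEL) (s.arr CHILD) lf G (i + 1)) := by
  obtain ⟨i₁, i₂, i₃, i₄⟩ := h.of_mem hi
  refine Tri.mono (b := 40 + ((ws.length * 160 + 2) + 100)) ?_ (by omega) fun _ h => h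
  refine Tri.seqF (R := fun s' => s' = leafPrep.run s) (.flat rfl (by decide) rfl)
    fun s₁ g₁ f₁ => ?_
  obtain ⟨r₁, r₂, r₃, r₄, r₅, r₆, r₇⟩ := leafPrep_run s hI
  rw [← g₁] at r₁ r₂ r₃ r₄ r₅ r₆ r₇
  clear g₁
  have cn₁ := h.frame f₁ rfl
  have eL₁ : s₁.arr LABEL = s.arr LABEL := f₁.2 _ rfl
  have eC₁ : s₁.arr CHILD = s.arr CHILD := f₁.2 _ rfl
  have eT₁ : s₁.arr TAB = s.arr TAB := f₁.2 _ rfl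
  have eP₁ : s₁.arr PRODS = s.arr PRODS := f₁.2 _ rfl
  have eF₁ : s₁.reg FR = s.reg FR := f₁.1 _ rfl
  have eN₁ : s₁.reg LEN = s.reg LEN := f₁.1 _ rfl
  -- The positions of the children occur in keys, so they have to be less than `m`.
  have hlen : ws.length ≤ N := by
    have hnd : (labelsL ws).Nodup := by
      have := labelsL_of_mem h.labels hi
      obtain ⟨-, m', h₂, -⟩ := this
      rw [h₂]; exact List.nodup_range'
    have h₁ : (labelsL ws).length ≤ (List.range' 1 N).length :=
      (List.subperm_of_subset hnd fun u hu => by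
        rw [List.mem_range'_1]; have := i₄ u hu; omega).length_le
    have h₂ := sum_children ws
    simp at h₁
    omega
  refine Tri.seqF (leafWalk_spec (m := m) (f := s.arr LABEL i) (f₀ := s.reg FR) (len := s.reg LEN)
    (v := i) (lb := s.arr LABEL) (T₀ := s.arr TAB) (P₀ := s.arr PRODS) ((f₁.1 ST rfl).trans hst)
    hJ.le ?_ (fun u ys hu => ?_) (by omega) ?_) fun s₂ hW f₂ => ?_
  · rw [r₁]
    exact linkedL_congr (f₁.2 _ rfl) (f₁.2 _ rfl) (f₁.2 _ rfl) i₃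
  · have hu' : (u, ys) ∈ nodesL [node 1 us] := nodes_trans hi hu
    have hb := h.of_mem hu'
    exact ⟨by omega, cn₁.child_eq_zero hu', by rw [eL₁], hlab u hb.1 hb.2.1⟩
  · refine ⟨by rw [eT₁, eF₁]; exact hJ.dict, eF₁.ge, fun k _ => by rw [eT₁], fun k => by rw [eT₁],
      by simp [r₂], trivial, ?_, ?_, ?_, fun j _ => by rw [eP₁], ?_⟩
    · rw [r₃]; rfl
    · rw [r₅]; rfl
    · rw [r₄]; rfl
    · intro j hj
      exact absurd hj (Nat.not_lt_zero j)
  · have eNL : s₂.arr NL = s₁.arr NL := f₂.2 _ rfl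
    have eDL : s₂.arr DEL = s₁.arr DEL := f₂.2 _ rfl
    have hM := hJ.mid hlf hW (by rw [eNL]; exact r₆) (by rw [eDL]; exact r₇)
      ((f₂.1 _ rfl).trans eN₁)
    refine .flat rfl (by decide) (hM.fin ?_ ?_ i₁ (fun v a b => hlab v a (by omega)) ?_)
    · exact (f₂.1 _ rfl).trans ((f₁.1 _ rfl).trans hI)
    · exact (f₂.1 _ rfl).trans ((f₁.1 _ rfl).trans hst)
    · rw [f₂.2 LABEL rfl, eL₁]

/-- The cost of a node is proportional to its number of children, which is not bounded. The
potential is 160 for each child of a node that is still to be treated. -/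
theorem leafLoop_spec (h : Canon s us N) {m : ℕ} {kids : ℕ → List (RTree ℕ)}
    {G : Set Production} (hk : ∀ v ws, (v, ws) ∈ nodesL [node 1 us] ↔
      (1 ≤ v ∧ v ≤ N) ∧ ws = kids v)
    (hsum : ((List.range' 1 N).map fun v => (kids v).length).sum ≤ N)
    (hst : s.reg ST = m) (hfr : s.reg FR = m) (hT : ∀ k, s.arr TAB k < m)
    (hN : N < m) (hlab : ∀ v, 1 ≤ v → v ≤ N → s.arr LABEL v < m) (hG : PS s G) :
    Tri (forUp leafNode) s (N * 320 + 8) (LeafInv m (s.arr LABEL) (s.arr CHILD)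
      (fun v => leafList 1 (mapL (s.arr LABEL) (kids v))) G (N + 1)) := by
  set lf := fun v => leafList 1 (mapL (s.arr LABEL) (kids v)) with hlf
  set pot := fun i => 160 * ((List.range' i (N + 1 - i)).map fun v => (kids v).length).sum with hpot
  have hp1 : pot 1 ≤ 160 * N := by simp only [hpot, Nat.add_sub_cancel]; omega
  refine (Tri.forUpP (C := 150) (p := pot 1)
    (fun i p s' => LeafInv m (s.arr LABEL) (s.arr CHILD) lf G i s' ∧ p = pot i) rfl rfl
    (fun i p s x h => ⟨⟨h.1.1, h.1.2, h.1.3, h.1.4, h.1.5, h.1.6, h.1.7⟩, h.2⟩)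
    ⟨⟨hfr ▸ Dict.init (hfr ▸ hT), hfr.ge, fun v _ _ => by omega, fun st => ?_,
      fun v _ _ => by omega, fun v _ _ => by omega, ?_⟩, rfl⟩ h.size ?_).mono (by omega)
    fun s' ⟨p, h⟩ => h.1
  · have := hT (finK m st)
    constructor
    · intro; omega
    · rintro ⟨v, ⟨_, _, _⟩, _⟩; omega
  · have : (leafSet (s.arr TAB) m (s.arr LABEL) lf fun v => 1 ≤ v ∧ v < 1 ∧ lf v ≠ []) = ∅ := by
      ext q; simp only [leafSet, Set.mem_ofPred_eq, Set.mem_empty_iff_false, iff_false]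
      rintro ⟨v, hv, -⟩; omega
    rw [this, Set.union_empty]; exact hG
  · rintro i p s' hf h₁ h₂ hi ⟨hJ, rfl⟩
    have eL : s'.arr LABEL = s.arr LABEL := hf.2 _ rfl
    have eC : s'.arr CHILD = s.arr CHILD := hf.2 _ rfl
    have hp : pot i = 160 * (kids i).length + pot (i + 1) := by
      obtain ⟨n, hn⟩ : ∃ n, N + 1 - i = n + 1 := ⟨N - i, by omega⟩
      have hn' : N + 1 - (i + 1) = n := by omega
      simp only [hpot, hn, hn', List.range'_succ, List.map_cons, List.sum_cons]
      ring
    refine ⟨150 + (kids i).length * 160, pot (i + 1), ?_, ?_⟩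
    · have : pot (i + 1) + 150 + (kids i).length * 160 = 150 + pot i := by omega
      have hle : pot i ≤ pot 1 := by
        simp only [hpot]
        refine Nat.mul_le_mul_left _ (List.Sublist.sum_le_sum ?_ fun _ _ => Nat.zero_le _)
        refine List.Sublist.map _ ?_
        obtain ⟨n, rfl⟩ : ∃ n, i = n + 1 := ⟨i - 1, by omega⟩
        have := List.range'_append (s := 1) (m := n) (n := N - n) (step := 1)
        rw [show N + 1 - (n + 1) = N - n by omega, show N + 1 - 1 = n + (N - n) by omega, ← this,
          Nat.one_mul, Nat.add_comm 1 n]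
        exact List.sublist_append_right _ _
      omega
    · have := leafNode_spec (h.frame hf rfl) (lf := lf) (G := G) ((hk i _).2 ⟨⟨h₁, h₂⟩, rfl⟩)
        (by rw [eL]) hi ((hf.1 ST rfl).trans hst) hN (by rw [eL]; exact hlab) (by rwa [eL, eC])
      rw [eL, eC] at this
      exact this.mono le_rfl fun _ h => ⟨h, rfl⟩

end node

/-- The letters of a leaf compression that are read off the table. -/
def leafName (T : ℕ → ℕ) (m : ℕ) : Desc → ℕ
  | .leaf f l => T (finK m (wk T m f l))
  | _ => 0

theorem mem_leafOccL {q : ℕ × List (ℕ × ℕ)} (lb : ℕ → ℕ) (ts : List (RTree ℕ)) :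
    q ∈ leafOccL (mapL lb ts) ↔ ∃ v ws, (v, ws) ∈ nodesL ts ∧ leafList 1 (mapL lb ws) ≠ [] ∧
      q = (lb v, leafList 1 (mapL lb ws)) := by
  induction ts using forest_induction with
  | nil => simp [mapL, leafOccL, nodesL]
  | cons a us ts ih₁ ih₂ =>
    simp only [mapL_cons, leafOccL, leafOcc, List.mem_append, ih₁, ih₂, nodesL, List.mem_cons,
      Prod.mk.injEq]
    constructor
    · rintro ((h | ⟨v, ws, h₁, h₂⟩) | ⟨v, ws, h₁, h₂⟩)
      · split_ifs at h with c
        · simp at h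
        · exact ⟨a, us, .inl ⟨rfl, rfl⟩, c, by simpa using h⟩
      · exact ⟨v, ws, .inr (.inl h₁), h₂⟩
      · exact ⟨v, ws, .inr (.inr h₁), h₂⟩
    · rintro ⟨v, ws, ⟨rfl, rfl⟩ | h₁ | h₁, h₂, h₃⟩
      · rw [if_neg h₂]; exact .inl (.inl (by simpa using h₃))
      · exact .inl (.inr ⟨v, ws, h₁, h₂, h₃⟩)
      · exact .inr ⟨v, ws, h₁, h₂, h₃⟩

theorem leafP_spec {s : State} {X : Config} (hX : Good s X) (h2 : 1 < X.tree.size) :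
    Tri leafP s (1000 * X.tree.size) (fun s' => ∃ Y, LeafComp X Y ∧ Good s' Y) := by
  have hused := hX.used
  obtain ⟨us, hc, ht, hps, hlab, hsz, hT⟩ := hX
  set N := X.tree.size with hNdef
  set m := s.reg FR with hm
  set lb := s.arr LABEL with hlb
  set ch := s.arr CHILD with hch
  have hlm : ∀ v, 1 ≤ v → v ≤ N → lb v < m := fun v h₁ h₂ =>
    Good.labels_lt hc ht hlab h₁ h₂
  obtain ⟨kids, hk, hsum⟩ := hc.children
  refine Tri.mono (b := 2 + ((N * 320 + 8) + 200 * N)) ?_ (by omega) fun _ h => h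
  refine Tri.seqF (R := fun s' => s'.reg ST = m) (.flat rfl (by decide) (by simp [hm]))
    fun s₁ g₁ f₁ => ?_
  have cn₁ := hc.frame f₁ rfl
  have eL₁ : s₁.arr LABEL = lb := f₁.2 _ rfl
  have eC₁ : s₁.arr CHILD = ch := f₁.2 _ rfl
  refine Tri.seqF (leafLoop_spec cn₁ hk hsum g₁ (f₁.1 _ rfl) (by rw [f₁.2 TAB rfl]; exact hT) hsz
    (by rw [eL₁]; exact hlm)
    (hps.congr (f₁.1 _ rfl) (fun i _ => by rw [f₁.2 PRODS rfl]) (f₁.1 FR rfl).ge))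
    fun s₂ hI f₂ => ?_
  rw [eL₁, eC₁] at hI
  set lf := fun v => leafList 1 (mapL lb (kids v)) with hlf
  have cn₂ := cn₁.frame f₂ rfl
  obtain ⟨j₁, j₂, j₃, j₄, j₅, j₆, j₇⟩ := hI
  set T := s₂.arr TAB with hTd
  have htree : leafTree (leafName T m) X.tree = node (s₂.arr NL 1) (mapL (s₂.arr NL)
      (contractL (fun v => decide (s₂.arr DEL v ≠ 0)) us)) := by
    rw [ht]
    refine leafTree_eq (us := us) (lb := lb) (nl := s₂.arr NL) (nm := leafName T m) ?_ ?_ 1 us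
      (by simp [nodesL])
    · intro v ws hv
      have hv' := hc.of_mem hv
      rw [decide_eq_true_iff, j₆ v hv'.1 (by omega)]
      exact hc.child_eq_zero hv
    · intro v ws hv
      obtain ⟨hv', rfl⟩ := (hk v ws).1 hv
      exact j₅ v hv'.1 (by omega)
  have hprods : ∀ p, p ∈ leafProds X.tree ↔ ∃ v, (1 ≤ v ∧ v < N + 1 ∧ lf v ≠ []) ∧
      p = (.leaf (lb v) (lf v), .absorb (lb v) (lf v)) := by
    intro p
    have e : leafOcc X.tree = leafOccL (mapL lb [node 1 us]) := by
      rw [ht]; simp [leafOccL, mapL, map]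
    simp only [leafProds, Set.mem_ofPred_eq, e, mem_leafOccL]
    constructor
    · rintro ⟨q, ⟨v, ws, h₁, h₂, rfl⟩, rfl⟩
      obtain ⟨h₃, rfl⟩ := (hk _ _).1 h₁
      exact ⟨v, ⟨h₃.1, by omega, h₂⟩, rfl⟩
    · rintro ⟨v, ⟨h₁, h₂, h₃⟩, rfl⟩
      exact ⟨_, ⟨v, kids v, (hk _ _).2 ⟨⟨h₁, by omega⟩, rfl⟩, h₃, rfl⟩, rfl⟩
  have hset : addProds X.prods (leafName T m) (leafProds X.tree) =
      X.prods ∪ leafSet T m lb lf fun v => 1 ≤ v ∧ v < N + 1 ∧ lf v ≠ [] := by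
    unfold addProds
    congr 1
    ext q
    simp only [Set.mem_image, hprods, leafSet, Set.mem_ofPred_eq]
    constructor
    · rintro ⟨p, ⟨v, hv, rfl⟩, rfl⟩; exact ⟨v, hv, rfl⟩
    · rintro ⟨v, hv, rfl⟩; exact ⟨_, ⟨v, hv, rfl⟩, rfl⟩
  rw [← hset] at j₇
  refine (contractP_good cn₂ (D := fun v => decide (s₂.arr DEL v ≠ 0))
    (fun v h₁ h₂ => by simp) ?_ j₇ ?_ (by omega) j₁.1).mono le_rfl ?_
  -- The nodes to be deleted are the leaves. If the root were one, the tree would have a single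
  -- node, contrary to `h2`.
  · by_contra h'
    rw [← ne_eq, j₆ 1 le_rfl (by omega), hch, hc.child_eq_zero Canon.root_mem] at h'
    rw [h'] at ht
    rw [hNdef, ht] at h2
    simp [RTree.size, labels] at h2
  · intro v h₁ h₂
    rw [j₅ v h₁ (by omega)]
    split_ifs
    · exact (hlm v h₁ h₂).trans_le j₂
    · exact j₁.1 _
  · intro s' hs'
    refine ⟨_, ⟨leafName T m, ?_, htree.symm, rfl⟩, hs'⟩
    refine fresh_of_names hused (fun p hp => ?_) fun p hp q hq hpq => ?_
    · obtain ⟨v, hv, rfl⟩ := (hprods p).1 hp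
      exact (j₄ _).2 ⟨v, hv, rfl⟩
    · obtain ⟨v, hv, rfl⟩ := (hprods p).1 hp
      obtain ⟨u, hu, rfl⟩ := (hprods q).1 hq
      have h₁ := finK_inj (j₁.2 _ _ ((j₄ _).2 ⟨v, hv, rfl⟩) hpq) (by omega)
      obtain ⟨h₂, h₃⟩ := wk_inj j₁ (hlm v hv.1 (by omega)) (hlm u hu.1 (by omega))
        (j₃ v hv.1 hv.2.1) (j₃ u hu.1 hu.2.1) h₁
      simp only [h₂, h₃]


/-! ### The size of the tree after a phase -/

theorem tree_induction {α : Type} {P : RTree α → Prop}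
    (h : ∀ a us, (∀ u ∈ us, P u) → P (node a us)) (t : RTree α) : P t := by
  have : ∀ ts : List (RTree α), ∀ t ∈ ts, P t := fun ts => by
    induction ts using forest_induction with
    | nil => simp
    | cons a us ts ih₁ ih₂ =>
      rintro t (_ | ⟨_, ht⟩)
      · exact h a us ih₁
      · exact ih₂ t ht
  exact this [t] t (by simp)

/-- The number of leaves of a forest. -/
def leavesL {α : Type} : List (RTree α) → ℕ
  | [] => 0
  | node _ us :: ts => (if us = [] then 1 else leavesL us) + leavesL ts

/-- The sizes of the trees of a forest, with a surplus that depends on whether the root is unary. -/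
def surplus {α : Type} (ts : List (RTree α)) : ℕ :=
  (ts.map fun | node _ us => if us.length = 1 then 2 else 3).sum

theorem two_mul_length_le_surplus {α : Type} (ts : List (RTree α)) :
    2 * ts.length ≤ surplus ts := by
  induction ts with
  | nil => simp [surplus]
  | cons t ts ih =>
    obtain ⟨a, us⟩ := t
    simp only [surplus, List.map_cons, List.sum_cons, List.length_cons] at *
    split_ifs <;> omega

/-- The surplus of 3 per tree, or 2 if the root is unary, makes the induction work. A leaf gives `1
+ 3 = 4`. A unary node above a tree with a non-unary root is paid for by lowering the surplus from 3
to 2, and above one with a unary root by a new 2-chain. A branching node has at least two subtrees,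
whose surpluses of at least 4 in total pay for the node and its own surplus of 3. -/
theorem size_add_surplus_le (ts : List (RTree ℕ)) :
    (labelsL ts).length + surplus ts ≤ (pairOccL ts).length + 4 * leavesL ts := by
  induction ts using forest_induction with
  | nil => simp [surplus, pairOccL, leavesL]
  | cons a us ts ih₁ ih₂ =>
    have h2 := two_mul_length_le_surplus us
    match us, ih₁, h2 with
    | [], _, _ =>
      simp [surplus, pairOccL, pairOcc, leavesL] at *
      omega
    | [node b []], ih₁, _ =>
      simp [surplus, pairOccL, pairOcc, leavesL] at *
      omega
    | [node b [v]], ih₁, _ =>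
      simp [surplus, pairOccL, pairOcc, leavesL] at *
      omega
    | [node b (v :: w :: vs)], ih₁, _ =>
      simp [surplus, pairOccL, pairOcc, leavesL] at *
      omega
    | u :: v :: vs, ih₁, h2 =>
      simp [surplus, pairOccL, pairOcc, leavesL] at *
      omega

theorem size_le_pairs_add_leaves (t : RTree ℕ) :
    t.size ≤ (pairOcc t).length + 4 * leavesL [t] := by
  have := size_add_surplus_le [t]
  simp only [pairOccL, List.append_nil, labelsL, RTree.size] at *
  omega

theorem size_cons {α : Type} (a : α) (us : List (RTree α)) :
    (node a us).size = 1 + (us.map RTree.size).sum := by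
  rw [size_node]
  congr 1
  induction us with
  | nil => simp
  | cons t us ih => simp [labelsL, RTree.size, ih]

theorem one_le_size {α : Type} (t : RTree α) : 1 ≤ t.size := by
  obtain ⟨a, us⟩ := t
  rw [size_cons]; omega

theorem leavesL_eq {α : Type} (ts : List (RTree α)) :
    leavesL ts = (ts.map fun t => leavesL [t]).sum := by
  induction ts with
  | nil => simp [leavesL]
  | cons t ts ih =>
    obtain ⟨a, us⟩ := t
    simp only [leavesL, List.map_cons, List.sum_cons, ih, Nat.add_zero]

theorem leaf_size (nm : Desc → ℕ) (ts : List (RTree ℕ)) :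
    (labelsL (leafTreeL nm ts)).length + leavesL ts = (labelsL ts).length := by
  induction ts using forest_induction with
  | nil => simp [leafTreeL, leavesL]
  | cons a us ts ih₁ ih₂ =>
    cases us with
    | nil => simp [leafTreeL, leavesL]; omega
    | cons u us => simp [leafTreeL, leavesL, leafTree] at *; omega

theorem leafTree_size (nm : Desc → ℕ) (t : RTree ℕ) (h : 1 < t.size) :
    (leafTree nm t).size + leavesL [t] = t.size := by
  obtain ⟨a, us⟩ := t
  cases us with
  | nil => simp [RTree.size, labels] at h
  | cons u us =>
    have := leaf_size nm [node a (u :: us)]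
    simpa [leafTreeL, RTree.size, labelsL] using this

/-! #### The greedy partition -/

/-- Since no pair `aa` occurs, a pair that becomes settled by adding `a` joins `a` to a letter in
`U` or `D`. -/
theorem greedy_inside (occ : List (ℕ × ℕ)) (hd : ∀ p ∈ occ, p.1 ≠ p.2) (a : ℕ) (U D : List ℕ) :
    occ.countP (fun p => (p.1 = a ∨ p.1 ∈ U ∨ p.1 ∈ D) ∧ (p.2 = a ∨ p.2 ∈ U ∨ p.2 ∈ D)) ≤
      occ.countP (fun p => (p.1 ∈ U ∨ p.1 ∈ D) ∧ (p.2 ∈ U ∨ p.2 ∈ D)) +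
        (touching occ a U + touching occ a D) := by
  induction occ with
  | nil => simp
  | cons p occ ih =>
    have ih := ih fun q hq => hd q (by simp [hq])
    have hp := hd p (by simp)
    simp only [touching, List.countP_cons, decide_eq_true_eq] at *
    generalize List.countP _ occ = x₁ at *
    generalize List.countP _ occ = x₂ at *
    generalize List.countP _ occ = x₃ at *
    generalize List.countP _ occ = x₄ at *
    by_cases c₁ : p.1 = a
    · have c₂ : p.2 ≠ a := fun h => hp (c₁.trans h.symm)
      by_cases c₃ : p.2 ∈ U <;> by_cases c₄ : p.2 ∈ D <;> simp [c₁, c₂, c₃, c₄] <;> grind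
    · by_cases c₂ : p.2 = a
      · by_cases c₃ : p.1 ∈ U <;> by_cases c₄ : p.1 ∈ D <;> simp [c₁, c₂, c₃, c₄] <;> grind
      · simp only [c₁, c₂, false_or, false_and, or_self, if_false]; omega

/-- Pairs cut before do not involve `a`, which is on neither side, and putting `a` next to `U` cuts
all pairs joining `a` to `D`. -/
theorem greedy_cut (occ : List (ℕ × ℕ)) (a : ℕ) {U D : List ℕ} (hU : a ∉ U) (hD : a ∉ D) :
    covered occ U D + covered occ D U + touching occ a D ≤
      covered occ (a :: U) D + covered occ D (a :: U) := by
  induction occ with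
  | nil => simp [touching, covered]
  | cons p occ ih =>
    simp only [touching, covered, List.countP_cons, decide_eq_true_eq, List.mem_cons] at *
    generalize List.countP _ occ = x₁ at *
    generalize List.countP _ occ = x₂ at *
    generalize List.countP _ occ = x₃ at *
    generalize List.countP _ occ = x₄ at *
    generalize List.countP _ occ = x₅ at *
    by_cases c₁ : p.1 = a
    · rw [c₁]; simp [hU, hD]; split_ifs <;> omega
    · by_cases c₂ : p.2 = a
      · rw [c₂]; simp [hU, hD, c₁]; split_ifs <;> omega
      · simp only [c₁, c₂, false_or, false_and, or_self, if_false]; omega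

/-- At least half of the pairs of letters that have been put on a side are between the sides. -/
def Half (occ : List (ℕ × ℕ)) (P : List ℕ × List ℕ) : Prop :=
  occ.countP (fun p => (p.1 ∈ P.1 ∨ p.1 ∈ P.2) ∧ (p.2 ∈ P.1 ∨ p.2 ∈ P.2)) ≤
    2 * (covered occ P.1 P.2 + covered occ P.2 P.1)

/-- When a letter is added, the number of settled pairs grows by at most the sum of its two touching
numbers, and the number of cut pairs by at least the larger of them, because the letter goes to the
side that it touches less. -/
theorem greedyLoop_half (occ : List (ℕ × ℕ)) (hd : ∀ p ∈ occ, p.1 ≠ p.2) (order : List ℕ)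
    (P : List ℕ × List ℕ) (hn : order.Nodup) (hP : ∀ a ∈ order, a ∉ P.1 ∧ a ∉ P.2)
    (hdis : ∀ a, a ∈ P.1 → a ∉ P.2) (h : Half occ P) :
    Half occ (greedyLoop occ order P) ∧
      (∀ a, a ∈ (greedyLoop occ order P).1 → a ∉ (greedyLoop occ order P).2) ∧
      ∀ a, a ∈ (greedyLoop occ order P).1 ∨ a ∈ (greedyLoop occ order P).2 ↔
        a ∈ order ∨ a ∈ P.1 ∨ a ∈ P.2 := by
  induction order generalizing P with
  | nil => exact ⟨h, hdis, by simp [greedyLoop]⟩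
  | cons a order ih =>
    obtain ⟨ha₁, ha₂⟩ := hP a (by simp)
    obtain ⟨hn₁, hn₂⟩ := List.nodup_cons.1 hn
    have hin := greedy_inside occ hd a P.1 P.2
    have hc₁ := greedy_cut occ a ha₁ ha₂
    have hc₂ := greedy_cut occ a ha₂ ha₁
    unfold Half at h
    rw [greedyLoop]
    split_ifs with c
    · suffices hs : (∀ b ∈ order, b ∉ a :: P.1 ∧ b ∉ P.2) ∧ (∀ b, b ∈ a :: P.1 → b ∉ P.2) ∧
          Half occ (a :: P.1, P.2) by
        obtain ⟨h₁, h₂, h₃⟩ := ih _ hn₂ hs.1 hs.2.1 hs.2.2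
        exact ⟨h₁, h₂, fun b => (h₃ b).trans (by simp; tauto)⟩
      refine ⟨?_, ?_, ?_⟩
      · intro b hb
        have := hP b (by simp [hb])
        refine ⟨?_, this.2⟩
        rw [List.mem_cons, not_or]
        exact ⟨fun h => hn₁ (h ▸ hb), this.1⟩
      · rintro b (_ | ⟨_, hb⟩)
        · exact ha₂
        · exact hdis b hb
      · unfold Half
        simp only [List.mem_cons, or_assoc] at *
        omega
    · suffices hs : (∀ b ∈ order, b ∉ P.1 ∧ b ∉ a :: P.2) ∧ (∀ b, b ∈ P.1 → b ∉ a :: P.2) ∧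
          Half occ (P.1, a :: P.2) by
        obtain ⟨h₁, h₂, h₃⟩ := ih _ hn₂ hs.1 hs.2.1 hs.2.2
        exact ⟨h₁, h₂, fun b => (h₃ b).trans (by simp; tauto)⟩
      refine ⟨?_, ?_, ?_⟩
      · intro b hb
        have := hP b (by simp [hb])
        refine ⟨this.1, ?_⟩
        rw [List.mem_cons, not_or]
        exact ⟨fun h => hn₁ (h ▸ hb), this.2⟩
      · intro b hb
        rw [List.mem_cons, not_or]
        exact ⟨fun h => ha₁ (h ▸ hb), hdis b hb⟩
      · unfold Half
        simp only [List.mem_cons, or_left_comm (b := _ = a)] at *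
        omega

theorem mem_unaryLabels_of_pairOcc (t : RTree ℕ) :
    ∀ p ∈ pairOcc t, p.1 ∈ unaryLabels t ∧ p.2 ∈ unaryLabels t := by
  induction t using tree_induction with
  | h a us ih =>
    have hL : ∀ ws, (∀ u ∈ ws, u ∈ us) → ∀ p ∈ pairOccL ws, p.1 ∈ unaryLabelsL ws ∧
        p.2 ∈ unaryLabelsL ws := by
      intro ws hws
      induction ws with
      | nil => simp [pairOccL]
      | cons w ws ihw =>
        intro p hp
        rw [pairOccL, List.mem_append] at hp
        simp only [unaryLabelsL, List.mem_append]
        rcases hp with hp | hp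
        · have := ih w (hws w (by simp)) p hp
          exact ⟨.inl this.1, .inl this.2⟩
        · have := ihw (fun u hu => hws u (by simp [hu])) p hp
          exact ⟨.inr this.1, .inr this.2⟩
    match us, ih, hL with
    | [], _, _ => simp [pairOcc, pairOccL]
    | [node b [u]], ih, _ =>
      intro p hp
      rw [pairOcc, List.mem_cons] at hp
      rw [unaryLabels, List.mem_cons, List.mem_cons]
      rcases hp with rfl | hp
      · simp [unaryLabels]
      · have := ih _ (by simp) p hp
        exact ⟨.inr this.1, .inr this.2⟩
    | [node b []], _, _ => simp [pairOcc, pairOccL]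
    | [node b (v :: w :: vs)], _, hL =>
      intro p hp
      have := hL _ (fun _ h => h) p (by simpa [pairOcc] using hp)
      simp only [unaryLabelsL, List.append_nil] at this
      rw [unaryLabels, List.mem_cons, List.mem_cons]
      exact ⟨.inr this.1, .inr this.2⟩
    | u :: v :: vs, _, hL =>
      intro p hp
      have := hL _ (fun _ h => h) p (by simpa [pairOcc] using hp)
      simpa [unaryLabels] using this

/-- In the end all 2-chains are settled, so at least half of them are cut. The final switch selects
the direction with at least half of the cut ones, which explains the factor 4. -/
theorem GreedyPartition.disjoint_and_half {t : RTree ℕ} {up down : List ℕ}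
    (h : GreedyPartition t up down) (hd : ∀ p ∈ pairOcc t, p.1 ≠ p.2) :
    (∀ a, a ∈ up → a ∉ down) ∧ (pairOcc t).length ≤ 4 * covered (pairOcc t) up down := by
  obtain ⟨order, h₁, h₂, h₃⟩ := h
  obtain ⟨g₁, g₂, g₃⟩ := greedyLoop_half (pairOcc t) hd order ([], []) h₁ (by simp) (by simp)
    (by simp [Half])
  unfold Half at g₁
  rw [List.countP_eq_length.2] at g₁
  · rw [greedy] at h₃
    split_ifs at h₃ with c
    · obtain ⟨rfl, rfl⟩ := Prod.mk.inj h₃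
      exact ⟨fun a ha hb => g₂ a hb ha, by omega⟩
    · obtain ⟨rfl, rfl⟩ := Prod.mk.inj (h₃.trans Prod.mk.eta.symm)
      exact ⟨g₂, by omega⟩
  · intro p hp
    have := mem_unaryLabels_of_pairOcc t p hp
    simp [g₃, h₂, this]


/-! #### Chain compression -/

theorem exists_lengthProds (nm : Desc → ℕ) (a : ℕ) {l : ℕ} {ls : List ℕ} (h : l ∈ ls) (prev : ℕ) :
    ∃ r, (Desc.chain a l, r) ∈ lengthProds nm a prev ls := by
  induction ls generalizing prev with
  | nil => simp at h
  | cons k ls ih =>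
    rcases List.mem_cons.1 h with rfl | h
    · exact ⟨_, .tail _ (.head _)⟩
    · obtain ⟨r, hr⟩ := ih h k
      exact ⟨r, .tail _ (.tail _ hr)⟩

theorem chain_mem_chainProds (nm : Desc → ℕ) {t : RTree ℕ} {a l : ℕ} (h : (a, l) ∈ chainOcc none t)
    (hl : 2 ≤ l) : Desc.chain a l ∈ Prod.fst '' chainProds nm t := by
  have : l ∈ chainLengths t a := by
    simp only [chainLengths, Finset.mem_sort, List.mem_toFinset, List.mem_map, List.mem_filter,
      decide_eq_true_eq]
    exact ⟨(a, l), ⟨h, rfl, hl⟩, rfl⟩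
  obtain ⟨r, hr⟩ := exists_lengthProds nm a this 0
  exact ⟨_, ⟨a, .inr hr⟩, rfl⟩

theorem chainTreeL_eq_map (nm : Desc → ℕ) (ts : List (RTree ℕ)) :
    chainTreeL nm ts = ts.map (chainTree nm) := by
  induction ts with
  | nil => rfl
  | cons t ts ih => simp [chainTreeL, ih]

theorem pairTreeL_eq_map (nm : Desc → ℕ) (up down : List ℕ) (ts : List (RTree ℕ)) :
    pairTreeL nm up down ts = ts.map (pairTree nm up down) := by
  induction ts with
  | nil => rfl
  | cons t ts ih => simp [pairTreeL, ih]

theorem pairOccL_eq_flatMap (ts : List (RTree ℕ)) : pairOccL ts = ts.flatMap pairOcc := by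
  induction ts with
  | nil => rfl
  | cons t ts ih => simp [pairOccL, ih]

theorem mem_chainOccL {ts : List (RTree ℕ)} {t : RTree ℕ} (h : t ∈ ts) :
    chainOcc none t ⊆ chainOccL ts := by
  induction ts with
  | nil => simp at h
  | cons u ts ih =>
    rw [chainOccL]
    rcases List.mem_cons.1 h with rfl | h
    · exact List.subset_append_left _ _
    · exact fun x hx => List.subset_append_right _ _ (ih h hx)

theorem labels_subset {ts : List (RTree ℕ)} {t : RTree ℕ} (h : t ∈ ts) :
    t.labels ⊆ labelsL ts := by
  induction ts with
  | nil => simp at h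
  | cons u ts ih =>
    rw [labelsL]
    rcases List.mem_cons.1 h with rfl | h
    · exact List.subset_append_left _ _
    · exact fun x hx => List.subset_append_right _ _ (ih h hx)

theorem pairOcc_node_nonunary {a : ℕ} {us : List (RTree ℕ)} (h : us.length ≠ 1) :
    pairOcc (node a us) = pairOccL us := by
  match us, h with
  | [], _ => rw [pairOcc]; simp
  | [u], h => simp at h
  | u :: v :: us, _ => rw [pairOcc]; simp

theorem pairOcc_node_child {a b : ℕ} {us : List (RTree ℕ)} (h : us.length ≠ 1) :
    pairOcc (node a [node b us]) = pairOcc (node b us) := by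
  match us, h with
  | [], _ => simp [pairOcc, pairOccL]
  | [u], h => simp at h
  | u :: v :: us, _ => simp [pairOcc, pairOccL]

theorem chainTree_nonunary {nm : Desc → ℕ} {a : ℕ} {us : List (RTree ℕ)} (h : us.length ≠ 1) :
    chainTree nm (node a us) = node a (us.map (chainTree nm)) := by
  match us, h with
  | [], _ => simp [chainTree, chainTreeL]
  | [u], h => simp at h
  | u :: v :: us, _ => simp [chainTree, chainTreeL, chainTreeL_eq_map]

theorem chainOcc_nonunary {a : ℕ} {us : List (RTree ℕ)} (h : us.length ≠ 1) (p : Option ℕ) :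
    chainOcc p (node a us) = chainOccL us := by
  match us, h with
  | [], _ => simp [chainOcc]
  | [u], h => simp at h
  | u :: v :: us, _ => simp [chainOcc]

theorem topRun_eq_zero {a b : ℕ} {us : List (RTree ℕ)} (h : us.length ≠ 1 ∨ b ≠ a) :
    topRun a (node b us) = 0 := by
  match us, h with
  | [], _ => simp [topRun]
  | [u], h => simp at h; simp [topRun, h]
  | u :: v :: us, _ => simp [topRun]

section chain
variable {nm : Desc → ℕ} {H : List (ℕ × ℕ)} {S : List ℕ}

/-- The labels that chain compression may give to the top of a chain of nodes labelled `a`. -/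
def Kind (nm : Desc → ℕ) (H : List (ℕ × ℕ)) (a c : ℕ) : Prop :=
  c = a ∨ ∃ l, 2 ≤ l ∧ (a, l) ∈ H ∧ c = nm (.chain a l)

/-- An old letter differs from a new one by freshness, and two new letters for chains of different
letters differ by injectivity of the naming. -/
theorem Kind.ne (hi : ∀ a l b k, (a, l) ∈ H → (b, k) ∈ H → 2 ≤ l → 2 ≤ k →
      nm (.chain a l) = nm (.chain b k) → a = b)
    (hf : ∀ a l, (a, l) ∈ H → 2 ≤ l → nm (.chain a l) ∉ S) {a b c d : ℕ} (hab : a ≠ b)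
    (ha : a ∈ S) (hb : b ∈ S) (hc : Kind nm H a c) (hd : Kind nm H b d) : c ≠ d := by
  rintro rfl
  rcases hc with rfl | ⟨l, hl, hl', rfl⟩ <;> rcases hd with h | ⟨k, hk, hk', h⟩
  · exact hab h
  · exact hf _ _ hk' hk (h ▸ ha)
  · exact hf _ _ hl' hl (h ▸ hb)
  · exact hab (hi _ _ _ _ hl' hk' hl hk h)

/-- What chain compression does to a tree. -/
theorem chainTree_spec (hi : ∀ a l b k, (a, l) ∈ H → (b, k) ∈ H → 2 ≤ l → 2 ≤ k →
      nm (.chain a l) = nm (.chain b k) → a = b)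
    (hf : ∀ a l, (a, l) ∈ H → 2 ≤ l → nm (.chain a l) ∉ S) (t : RTree ℕ) :
    ∀ prev, chainOcc prev t ⊆ H → t.labels ⊆ S →
      (∀ a u, t = node a [u] → ∃ v, chainTree nm t =
          node (if topRun a u = 0 then a else nm (.chain a (topRun a u + 1))) [v] ∧
        ∀ c, Kind nm H a c → ∀ p ∈ pairOcc (node c [v]), p.1 ≠ p.2) ∧
      (∀ a us, t = node a us → us.length ≠ 1 → ∀ p ∈ pairOcc (chainTree nm t), p.1 ≠ p.2) := by
  -- For a unary root the claim allows every label `c` of the right kind at the top of the result,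
  -- because the label produced for a subtree is replaced when the chain continues above it.
  induction t using tree_induction with
  | h a us ih =>
    have top : ∀ u ∈ us, ∀ prev, (∀ b w, u = node b [w] → prev ≠ some b) →
        chainOcc prev u ⊆ H → u.labels ⊆ S →
        ∀ p ∈ pairOcc (chainTree nm u), p.1 ≠ p.2 := by
      intro u hu prev hprev h₁ h₂
      obtain ⟨i₁, i₂⟩ := ih u hu prev h₁ h₂
      obtain ⟨b, ws⟩ := u
      by_cases hws : ws.length = 1
      · obtain ⟨w, rfl⟩ := List.length_eq_one_iff.1 hws
        obtain ⟨v, hv, hk⟩ := i₁ b w rfl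
        rw [hv]
        refine hk _ ?_
        split_ifs with h0
        · exact .inl rfl
        · refine .inr ⟨_, by omega, h₁ ?_, rfl⟩
          rw [chainOcc, if_neg (hprev b w rfl)]
          exact .head _
      · exact i₂ b ws rfl hws
    intro prev h₁ h₂
    have hS : ∀ u ∈ us, u.labels ⊆ S := fun u hu x hx => h₂ (by
      rw [labels]; exact .tail _ (labels_subset hu hx))
    have haS : a ∈ S := h₂ (by rw [labels]; exact .head _)
    refine ⟨?_, ?_⟩
    · rintro a' u h
      obtain ⟨rfl, rfl⟩ := (RTree.node.injEq _ _ _ _).mp h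
      have hsub : chainOcc (some a) u ⊆ H := by
        refine fun x hx => h₁ ?_
        rw [chainOcc]
        split_ifs
        · exact hx
        · exact .tail _ hx
      have hSu := hS u (by simp)
      obtain ⟨b, ws⟩ := u
      by_cases hws : ws.length = 1
      · obtain ⟨w, rfl⟩ := List.length_eq_one_iff.1 hws
        obtain ⟨v, hv, hk⟩ := (ih _ (by simp) _ hsub hSu).1 b w rfl
        by_cases hab : b = a
        · subst hab
          have h0 : topRun b (node b [w]) ≠ 0 := by simp [topRun]
          refine ⟨v, ?_, hk⟩
          rw [chainTree, if_neg h0, if_neg h0, hv]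
        · have h0 : topRun a (node b [w]) = 0 := topRun_eq_zero (.inr hab)
          refine ⟨chainTree nm (node b [w]), by rw [chainTree, if_pos h0, if_pos h0], ?_⟩
          have hkind : Kind nm H b
              (if topRun b w = 0 then b else nm (.chain b (topRun b w + 1))) := by
            split_ifs with h0
            · exact .inl rfl
            · refine .inr ⟨_, by omega, hsub ?_, rfl⟩
              rw [chainOcc, if_neg (by simpa using Ne.symm hab)]
              exact .head _
          intro c hc p hp
          rw [hv, pairOcc, List.mem_cons] at hp
          rcases hp with rfl | hp
          · exact Kind.ne hi hf (Ne.symm hab) haS (hSu (by rw [labels]; exact .head _)) hc hkind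
          · exact hk _ hkind p hp
      · have h0 : topRun a (node b ws) = 0 := topRun_eq_zero (.inl hws)
        refine ⟨chainTree nm (node b ws), by rw [chainTree, if_pos h0, if_pos h0], ?_⟩
        intro c _ p hp
        refine (ih _ (by simp) _ hsub hSu).2 b ws rfl hws p ?_
        rw [chainTree_nonunary hws] at hp ⊢
        rwa [pairOcc_node_child (by simpa using hws)] at hp
    · rintro a' us' h hus p hp
      obtain ⟨rfl, rfl⟩ := (RTree.node.injEq _ _ _ _).mp h
      rw [chainTree_nonunary hus, pairOcc_node_nonunary (by simpa using hus), pairOccL_eq_flatMap,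
        List.mem_flatMap] at hp
      obtain ⟨t, ht, hp⟩ := hp
      obtain ⟨u, hu, rfl⟩ := List.mem_map.1 ht
      rw [chainOcc_nonunary hus] at h₁
      exact top u hu none (by simp) (fun x hx => h₁ (mem_chainOccL hu hx)) (hS u hu) p hp

end chain

theorem ChainComp.pairOcc_ne {X Y : Config} (h : ChainComp X Y) :
    ∀ p ∈ pairOcc Y.tree, p.1 ≠ p.2 := by
  obtain ⟨nm, ⟨hinj, hfr⟩, ht, -⟩ := h
  have hi : ∀ a l b k, (a, l) ∈ chainOcc none X.tree → (b, k) ∈ chainOcc none X.tree → 2 ≤ l →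
      2 ≤ k → nm (.chain a l) = nm (.chain b k) → a = b := fun a l b k h₁ h₂ h₃ h₄ he => by
    have := hinj (chain_mem_chainProds nm h₁ h₃) (chain_mem_chainProds nm h₂ h₄) he
    simp only [Desc.chain.injEq] at this
    exact this.1
  have hf : ∀ a l, (a, l) ∈ chainOcc none X.tree → 2 ≤ l →
      nm (.chain a l) ∉ X.tree.labels := fun a l h₁ h₂ h₃ => by
    obtain ⟨p, hp, he⟩ := chain_mem_chainProds nm h₁ h₂
    exact hfr p hp (.inl (he ▸ h₃))
  obtain ⟨i₁, i₂⟩ := chainTree_spec hi hf X.tree none (fun _ h => h) (fun _ h => h)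
  rw [ht]
  generalize X.tree = t at *
  obtain ⟨a, us⟩ := t
  by_cases hus : us.length = 1
  · obtain ⟨u, rfl⟩ := List.length_eq_one_iff.1 hus
    obtain ⟨v, hv, hk⟩ := i₁ a u rfl
    rw [hv]
    refine hk _ ?_
    split_ifs with h0
    · exact .inl rfl
    · exact .inr ⟨_, by omega, by rw [chainOcc, if_neg (by simp)]; exact .head _, rfl⟩
  · exact i₂ a us rfl hus

theorem chainTree_size_le (nm : Desc → ℕ) (t : RTree ℕ) : (chainTree nm t).size ≤ t.size := by
  induction t using tree_induction with
  | h a us ih =>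
    by_cases hus : us.length = 1
    · obtain ⟨u, rfl⟩ := List.length_eq_one_iff.1 hus
      have := ih u (by simp)
      rw [chainTree]
      split_ifs
      · simp [size_cons]; exact this
      · generalize chainTree nm u = t at *
        obtain ⟨b, vs⟩ := t
        simp [size_cons] at this ⊢
        omega
    · rw [chainTree_nonunary hus, size_cons, size_cons, List.map_map]
      exact Nat.add_le_add_left (List.sum_le_sum fun u hu => ih u hu) _

/-- The last node of a chain is unary, so its child is not part of the chain and remains below the
new node. -/
theorem chainTree_one_lt_size (nm : Desc → ℕ) (t : RTree ℕ) (h : 1 < t.size) :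
    1 < (chainTree nm t).size := by
  induction t using tree_induction with
  | h a us ih =>
    by_cases hus : us.length = 1
    · obtain ⟨u, rfl⟩ := List.length_eq_one_iff.1 hus
      rw [chainTree]
      split_ifs with h0
      · have := one_le_size (chainTree nm u)
        simp [size_cons]; omega
      · have hu : 1 < u.size := by
          obtain ⟨b, ws⟩ := u
          have : ws.length = 1 := by
            by_contra h'
            exact h0 (topRun_eq_zero (.inl h'))
          obtain ⟨w, rfl⟩ := List.length_eq_one_iff.1 this
          have := one_le_size w
          simp [size_cons]; omega
        have := ih u (by simp) hu
        generalize chainTree nm u = t at *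
        obtain ⟨b, vs⟩ := t
        simpa [size_cons] using this
    · rw [chainTree_nonunary hus]
      cases us with
      | nil => simp [size_cons] at h
      | cons u us =>
        have := one_le_size (chainTree nm u)
        simp [size_cons]; omega

/-! #### Pair compression -/

theorem pairTree_nonunary {nm : Desc → ℕ} {up down : List ℕ} {a : ℕ} {us : List (RTree ℕ)}
    (h : us.length ≠ 1) :
    pairTree nm up down (node a us) = node a (us.map (pairTree nm up down)) := by
  match us, h with
  | [], _ => simp [pairTree, pairTreeL]
  | [u], h => simp at h
  | u :: v :: us, _ => simp [pairTree, pairTreeL, pairTreeL_eq_map]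

theorem pairTree_child {nm : Desc → ℕ} {up down : List ℕ} {a b : ℕ} {us : List (RTree ℕ)}
    (h : us.length ≠ 1) :
    pairTree nm up down (node a [node b us]) = node a [pairTree nm up down (node b us)] := by
  match us, h with
  | [], _ => simp [pairTree, pairTreeL]
  | [u], h => simp at h
  | u :: v :: us, _ => simp [pairTree, pairTreeL]

theorem leavesL_cons_ne {α : Type} {a : α} {us : List (RTree α)} (h : us ≠ []) :
    leavesL [node a us] = (us.map fun t => leavesL [t]).sum := by
  rw [leavesL, if_neg h, leavesL_eq us, leavesL, Nat.add_zero]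

/-- The lower label of a replaced 2-chain is in `down` and hence not in `up`, so replaced 2-chains
do not overlap and each one accounts for exactly one lost node. Only unary nodes are merged, so the
leaves stay. As the recursion skips the lower node of a replaced 2-chain, the claim is proved for a
tree together with the subtrees at its children. -/
theorem pairTree_size_leaves {nm : Desc → ℕ} {up down : List ℕ} (hdis : ∀ a, a ∈ up → a ∉ down)
    (t : RTree ℕ) : (pairTree nm up down t).size + covered (pairOcc t) up down = t.size ∧
      leavesL [pairTree nm up down t] = leavesL [t] := by
  suffices h : ∀ t : RTree ℕ, (∀ u, (u = t ∨ ∃ a us, t = node a us ∧ u ∈ us) →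
      (pairTree nm up down u).size + covered (pairOcc u) up down = u.size ∧
      leavesL [pairTree nm up down u] = leavesL [u]) from h t t (.inl rfl)
  intro t
  induction t using tree_induction with
  | h a us ih =>
    suffices h : (pairTree nm up down (node a us)).size + covered (pairOcc (node a us)) up down =
        (node a us).size ∧ leavesL [pairTree nm up down (node a us)] = leavesL [node a us] by
      rintro u (rfl | ⟨b, ws, h', hu⟩)
      · exact h
      · obtain ⟨rfl, rfl⟩ := (RTree.node.injEq _ _ _ _).mp h'
        exact ih u hu u (.inl rfl)
    by_cases hus : us.length = 1
    · obtain ⟨⟨b, ws⟩, rfl⟩ := List.length_eq_one_iff.1 hus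
      obtain ⟨i₁, i₂⟩ := ih (node b ws) (by simp) (node b ws) (.inl rfl)
      by_cases hws : ws.length = 1
      · obtain ⟨u, rfl⟩ := List.length_eq_one_iff.1 hws
        obtain ⟨k₁, k₂⟩ := ih _ (by simp) u (.inr ⟨b, [u], rfl, by simp⟩)
        rw [pairTree, pairOcc]
        split_ifs with c
        · have hcov : covered (pairOcc (node b [u])) up down = covered (pairOcc u) up down := by
            obtain ⟨d, xs⟩ := u
            by_cases hxs : xs.length = 1
            · obtain ⟨x, rfl⟩ := List.length_eq_one_iff.1 hxs
              have hb : b ∉ up := fun h => hdis b h c.2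
              rw [pairOcc, covered, List.countP_cons, covered]
              simp [hb]
            · rw [pairOcc_node_child hxs]
          rw [covered, List.countP_cons, ← covered, hcov]
          simp only [c, and_self, decide_true, if_true, size_cons, List.map_cons, List.map_nil,
            List.sum_cons, List.sum_nil]
          refine ⟨by omega, ?_⟩
          rw [leavesL_cons_ne (by simp), leavesL_cons_ne (by simp)]
          simp only [List.map_cons, List.map_nil, List.sum_cons, List.sum_nil, k₂]
          rw [leavesL_cons_ne (by simp)]
          simp
        · rw [covered, List.countP_cons, ← covered]
          simp only [c, decide_false, Bool.false_eq_true, if_false, Nat.add_zero]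
          rw [size_cons, size_cons a]
          refine ⟨by simp only [List.map_cons, List.map_nil, List.sum_cons, List.sum_nil]; omega, ?_⟩
          rw [leavesL_cons_ne (by simp), leavesL_cons_ne (by simp)]
          simp only [List.map_cons, List.map_nil, i₂]
      · rw [pairTree_child hws, pairOcc_node_child hws, size_cons, size_cons a]
        refine ⟨by simp only [List.map_cons, List.map_nil, List.sum_cons, List.sum_nil]; omega, ?_⟩
        rw [leavesL_cons_ne (by simp), leavesL_cons_ne (by simp)]
        simp only [List.map_cons, List.map_nil, i₂]
    · rw [pairTree_nonunary hus, pairOcc_node_nonunary hus, size_cons, size_cons, List.map_map,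
        pairOccL_eq_flatMap, covered, List.countP_flatMap]
      have e : ∀ ws : List (RTree ℕ), (∀ w ∈ ws, w ∈ us) →
          (ws.map (RTree.size ∘ pairTree nm up down)).sum +
            (ws.map ((List.countP fun p => decide (p.1 ∈ up ∧ p.2 ∈ down)) ∘ pairOcc)).sum =
            (ws.map RTree.size).sum := by
        intro ws hws
        induction ws with
        | nil => rfl
        | cons w ws ihw =>
          have h₁ := ihw fun w h => hws w (by simp [h])
          have h₂ := (ih w (hws w (by simp)) w (.inl rfl)).1
          rw [covered] at h₂
          simp only [List.map_cons, List.sum_cons, Function.comp_apply] at *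
          omega
      have := e us fun _ h => h
      refine ⟨by omega, ?_⟩
      cases us with
      | nil => rfl
      | cons u us =>
        rw [leavesL_cons_ne (by simp), leavesL_cons_ne (by simp), List.map_map]
        congr 1
        exact List.map_congr_left fun w hw => (ih w hw w (.inl rfl)).2

theorem pairTree_one_lt_size (nm : Desc → ℕ) (up down : List ℕ) (t : RTree ℕ) (h : 1 < t.size) :
    1 < (pairTree nm up down t).size := by
  obtain ⟨a, us⟩ := t
  by_cases hus : us.length = 1
  · obtain ⟨⟨b, ws⟩, rfl⟩ := List.length_eq_one_iff.1 hus
    by_cases hws : ws.length = 1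
    · obtain ⟨u, rfl⟩ := List.length_eq_one_iff.1 hws
      rw [pairTree]
      split_ifs
      · have := one_le_size (pairTree nm up down u); simp [size_cons]; omega
      · have := one_le_size (pairTree nm up down (node b [u])); rw [size_cons]; simp; omega
    · rw [pairTree_child hws, size_cons]
      have := one_le_size (pairTree nm up down (node b ws)); simp; omega
  · rw [pairTree_nonunary hus]
    cases us with
    | nil => simp [size_cons] at h
    | cons u us =>
      have := one_le_size (pairTree nm up down u)
      simp [size_cons]; omega

-- The factor 3/4 for a whole phase.

theorem ChainComp.size {X Y : Config} (h : ChainComp X Y) :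
    Y.tree.size ≤ X.tree.size ∧ (1 < X.tree.size → 1 < Y.tree.size) := by
  obtain ⟨nm, -, ht, -⟩ := h
  rw [ht]
  exact ⟨chainTree_size_le nm _, chainTree_one_lt_size nm _⟩

theorem PairComp.one_lt_size {X Y : Config} (h : PairComp X Y) (h₁ : 1 < X.tree.size) :
    1 < Y.tree.size := by
  obtain ⟨up, down, nm, -, -, ht, -⟩ := h
  rw [ht]
  exact pairTree_one_lt_size nm up down _ h₁

theorem PairComp.size {X Y : Config} (h : PairComp X Y) (hd : ∀ p ∈ pairOcc X.tree, p.1 ≠ p.2) :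
    4 * Y.tree.size + (pairOcc X.tree).length ≤ 4 * X.tree.size ∧
      leavesL [Y.tree] = leavesL [X.tree] := by
  obtain ⟨up, down, nm, hg, -, ht, -⟩ := h
  obtain ⟨h₁, h₂⟩ := hg.disjoint_and_half hd
  obtain ⟨h₃, h₄⟩ := pairTree_size_leaves (nm := nm) h₁ X.tree
  rw [ht]
  exact ⟨by omega, h₄⟩

theorem LeafComp.size {X Y : Config} (h : LeafComp X Y) (h₁ : 1 < X.tree.size) :
    Y.tree.size + leavesL [X.tree] = X.tree.size := by
  obtain ⟨nm, -, ht, -⟩ := h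
  rw [ht]
  exact leafTree_size nm _ h₁

/-- With `P` 2-chains and `L` leaves in `X'`, four times the final size is at most `4|X'| - P - 4L`,
and this is at most `3|X'|` by `size_le_pairs_add_leaves`. Sizes above 1 persist up to leaf
compression, which is needed for all leaves to be removed. -/
theorem Phase.size {X Y : Config} (h₁ : 1 < X.tree.size) (h : Phase X Y) :
    4 * Y.tree.size ≤ 3 * X.tree.size := by
  obtain ⟨X', X'', hc, hp, hl⟩ := h
  obtain ⟨c₁, c₂⟩ := hc.size
  obtain ⟨p₁, p₂⟩ := hp.size hc.pairOcc_ne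
  have h₂ := hl.size (hp.one_lt_size (c₂ h₁))
  have h₃ := size_le_pairs_add_leaves X'.tree
  omega


/-! ### All phases -/

/-- The main loop. -/
def loopP : Cmd :=
  .while (.op .lt (.const 1) (.reg SIZE)) (.seq chainP (.seq pairP leafP))

section phases
variable {B w : ℕ}

/-- The numbers 8 and 10 bound the growth per assignment, and the constants and degrees, in all
programs. Degree 10 is attained by the comparison of a table cell, addressed by a nested key of
degree 9, with `ST`. -/
theorem Tri.exec {p : Cmd} {s : State} {k b : ℕ} {Q : State → Prop} (h : Tri p s k Q)
    (hs : p.slow 8 = true) (hp : p.small 10 10 = true) (hB : 10 ≤ B) (hw : B ^ 10 < 2 ^ w)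
    (hb : Bd s b) (hk : b + 8 * k ≤ B) :
    ∃ l s', Exec w p s l s' ∧ l ≤ k ∧ Q s' ∧ Bd s' (b + 8 * l) := by
  obtain ⟨l, s', h₁, h₂, h₃⟩ := h
  obtain ⟨h₄, h₅⟩ := h₁.exec hs hp hB (by omega) hw b hb (by omega)
  exact ⟨l, s', h₄, h₂, h₃, h₅⟩

theorem phase_exec {s : State} {X : Config} {b : ℕ} (hB : 10 ≤ B) (hw : B ^ 10 < 2 ^ w)
    (hX : Good s X) (h1 : 1 < X.tree.size) (hb : Bd s b) (hk : b + 8 * (5000 * X.tree.size) ≤ B) :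
    ∃ X' X'' Y S' S'' s' k₁ k₂ k₃, ChainComp X X' ∧ Good S' X' ∧ PairComp X' X'' ∧ Good S'' X'' ∧
      LeafComp X'' Y ∧ Good s' Y ∧ Exec w chainP s k₁ S' ∧ Exec w pairP S' k₂ S'' ∧
      Exec w leafP S'' k₃ s' ∧ k₁ + k₂ + k₃ ≤ 5000 * X.tree.size ∧
      4 * Y.tree.size ≤ 3 * X.tree.size ∧ Bd s' (b + 8 * (k₁ + k₂ + k₃)) := by
  obtain ⟨k₁, S', e₁, l₁, ⟨X', c₁, g₁⟩, b₁⟩ :=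
    (chainP_spec hX).exec (by decide) (by decide) hB hw hb (by omega)
  obtain ⟨z₁, z₂⟩ := c₁.size
  obtain ⟨k₂, S'', e₂, l₂, ⟨X'', c₂, g₂⟩, b₂⟩ :=
    (pairP_spec g₁).exec (by decide) (by decide) hB hw b₁ (by omega)
  have z₃ := (c₂.size c₁.pairOcc_ne).1
  obtain ⟨k₃, s', e₃, l₃, ⟨Y, c₃, g₃⟩, b₃⟩ :=
    (leafP_spec g₂ (c₂.one_lt_size (z₂ h1))).exec (by decide) (by decide) hB hw b₂ (by omega)
  exact ⟨X', X'', Y, S', S'', s', k₁, k₂, k₃, c₁, g₁, c₂, g₂, c₃, g₃, e₁, e₂, e₃, by omega,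
    Phase.size h1 ⟨X', X'', c₁, c₂, c₃⟩, b₃.mono (by omega)⟩

/-- The constant comes from the geometric series: a phase takes at most `5000|X|` steps and a test
of the loop condition 4 steps, while the rest of the run starts with at most `3/4` of the size, and
`5000 + 4 + 20016 · 3/4 = 20016`. The same bound on the time keeps the memory contents below `B`
throughout. -/
theorem loop_exec (hB : 10 ≤ B) (hw : B ^ 10 < 2 ^ w) (n : ℕ) :
    ∀ (s : State) (X : Config) (b : ℕ), X.tree.size ≤ n → Good s X → Bd s b →
      b + 8 * (20016 * X.tree.size) ≤ B →
      ∃ (m k : ℕ) (Xs X' X'' : ℕ → Config) (S S' S'' : ℕ → State), S 0 = s ∧ Xs 0 = X ∧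
        (∀ i ≤ m, Stores (S i) (Xs i)) ∧
        (∀ i < m, 1 < (Xs i).tree.size ∧
          ChainComp (Xs i) (X' i) ∧ Stores (S' i) (X' i) ∧
          PairComp (X' i) (X'' i) ∧ Stores (S'' i) (X'' i) ∧
          LeafComp (X'' i) (Xs (i + 1)) ∧
          ∃ k₁ k₂ k₃ : ℕ, Exec w chainP (S i) k₁ (S' i) ∧ Exec w pairP (S' i) k₂ (S'' i) ∧
            Exec w leafP (S'' i) k₃ (S (i + 1)) ∧ k₁ + k₂ + k₃ ≤ 5000 * (Xs i).tree.size) ∧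
        (Xs m).tree.size = 1 ∧ Exec w loopP s k (S m) ∧ k ≤ 20016 * X.tree.size := by
  have hw2 : B < 2 ^ w := (Nat.le_self_pow (by omega) B).trans_lt hw
  induction n using Nat.strong_induction_on with
  | _ n ih =>
    intro s X b hn hX hb hk
    have hst := hX.stores
    have hsz : s.reg SIZE = X.tree.size := hst.2.1
    have hp := one_le_size X.tree
    have hfit : (Expr.op .lt (.const 1) (.reg SIZE)).Fits w s := by
      refine ⟨?_, ?_, ?_⟩
      · show 1 < 2 ^ w; omega
      · show s.reg SIZE < 2 ^ w; omega
      · have : (Op.lt.eval ((Expr.const 1).eval s) ((Expr.reg SIZE).eval s)) ≤ 1 := by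
          simp only [Op.eval]; split_ifs <;> omega
        omega
    by_cases h1 : 1 < X.tree.size
    · obtain ⟨X', X'', Y, S', S'', s', k₁, k₂, k₃, c₁, g₁, c₂, g₂, c₃, g₃, e₁, e₂, e₃, hkk, hY, hb'⟩ :=
        phase_exec hB hw hX h1 hb (by omega)
      obtain ⟨m, k, Xs, Xs', Xs'', S, Ss', Ss'', r₁, r₂, r₃, r₄, r₅, r₆, r₇⟩ :=
        ih Y.tree.size (by omega) s' Y _ le_rfl g₃ hb' (by omega)
      rw [← r₁] at e₃
      rw [← r₂] at c₃
      refine ⟨m + 1, _, fun | 0 => X | i + 1 => Xs i, fun | 0 => X' | i + 1 => Xs' i,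
        fun | 0 => X'' | i + 1 => Xs'' i, fun | 0 => s | i + 1 => S i,
        fun | 0 => S' | i + 1 => Ss' i, fun | 0 => S'' | i + 1 => Ss'' i, rfl, rfl, ?_, ?_, r₅,
        .whileTrue hfit ?_ (.seq e₁ (.seq e₂ e₃)) (r₁ ▸ r₆), ?_⟩
      · rintro (_ | i) hi
        · exact hst
        · exact r₃ i (by omega)
      · rintro (_ | i) hi
        · exact ⟨h1, c₁, g₁.stores, c₂, g₂.stores, c₃, k₁, k₂, k₃, e₁, e₂,
            e₃, hkk⟩
        · exact r₄ i (by omega)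
      · simp [Expr.eval, Op.eval, hsz, h1]
      · simp only [Expr.cost]; omega
    · refine ⟨0, _, fun _ => X, fun _ => X, fun _ => X, fun _ => s, fun _ => s, fun _ => s, rfl, rfl,
        fun _ _ => hst, fun i hi => by omega, by simp only; omega, .whileFalse hfit ?_, ?_⟩
      · simp [Expr.eval, Op.eval, hsz, h1]
      · simp only [Expr.cost]; omega

end phases

/-! ### The input -/

theorem linkedL_bound {s : State} {n p q : ℕ} {ts : List (RTree ℕ)} (h : LinkedL s p q ts)
    (hp : p ≤ n) (hts : ∀ v ∈ labelsL ts, v ≤ n) :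
    q ≤ n ∧ ∀ v ∈ labelsL ts, s.arr PARENT v ≤ n ∧ s.arr CHILD v ≤ n ∧ s.arr NEXT v ≤ n := by
  induction ts using forest_induction generalizing p q with
  | nil => rw [linkedL_nil] at h; simp [h]
  | cons a us ts ih₁ ih₂ =>
    rw [linkedL_cons] at h
    obtain ⟨rfl, h₂, h₃, h₄⟩ := h
    have ha : q ≤ n := hts q (by simp)
    obtain ⟨i₁, i₂⟩ := ih₁ h₃ ha fun v hv => hts v (by simp [hv])
    obtain ⟨i₃, i₄⟩ := ih₂ h₄ hp fun v hv => hts v (by simp [hv])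
    refine ⟨ha, fun v hv => ?_⟩
    simp only [labelsL_cons, List.mem_cons, List.mem_append] at hv
    rcases hv with rfl | hv | hv
    · exact ⟨by omega, i₁, i₃⟩
    · exact i₂ v hv
    · exact i₄ v hv

theorem IsInput.bd {s : State} {T : RTree ℕ} (h : IsInput s T) {b : ℕ} (hT : T.size ≤ b)
    (hl : ∀ a ∈ T.labels, a ≤ b) : Bd s b := by
  obtain ⟨⟨v, us⟩, ⟨-, -, h₃, h₄⟩, h₅, h₆, h₇⟩ := h
  have hlab : (node v us).labels = labelsL [node v us] := by simp [labels]
  rw [hlab] at h₅ h₇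
  obtain ⟨i₁, i₂⟩ := linkedL_bound (n := T.size) h₃ (Nat.zero_le _) h₅
  refine ⟨fun x => ?_, fun A i => ?_⟩
  · by_cases hx : x = ROOT
    · rw [hx]; omega
    · rw [h₆ x hx]; omega
  · by_cases hA : A ∈ [LABEL, PARENT, CHILD, NEXT] → i ∉ labelsL [node v us]
    · rw [h₇ A i hA]; omega
    · push Not at hA
      have hi := i₂ i hA.2
      have hA1 := hA.1
      simp only [List.mem_cons, List.not_mem_nil, or_false] at hA1
      rcases hA1 with rfl | rfl | rfl | rfl
      · refine hl _ ?_
        have e : T.labels = (labelsL [node v us]).map (s.arr LABEL) := by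
          rw [← h₄, map, labels, labelsL_mapL]; simp
        rw [e]
        exact List.mem_map_of_mem hA.2
      · omega
      · omega
      · omega

/-- Put `m = 2 ^ (Nat.log 2 n + 1)`, so `m ≥ 2` and `n < m`. In the exponent `c + 30`, the part `c`
covers the labels, 20 absorbs the numerical constants by `2 ^ 20 ≤ m ^ 20`, and 10 covers the factor
`n`. Expressions of degree 10 give the exponent `E * 10`, and one more factor `m` makes the
inequality strict. -/
theorem word_bound (c n : ℕ) (hn : 1 ≤ n) {E : ℕ} (hE : E = c + 30) :
    n ^ c + n + 8 * (20400 * n) ≤ (2 ^ (Nat.log 2 n + 1)) ^ E ∧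
      10 ≤ (2 ^ (Nat.log 2 n + 1)) ^ E ∧
      ((2 ^ (Nat.log 2 n + 1)) ^ E) ^ 10 < 2 ^ ((E * 10 + 1) * (Nat.log 2 n + 1)) := by
  have hm : n < 2 ^ (Nat.log 2 n + 1) := Nat.lt_pow_succ_log_self (by omega) n
  have h2 : 2 ≤ 2 ^ (Nat.log 2 n + 1) := by rw [pow_succ]; have := Nat.one_le_two_pow (n := Nat.log 2 n); omega
  have hw : 2 ^ ((E * 10 + 1) * (Nat.log 2 n + 1)) = (2 ^ (Nat.log 2 n + 1)) ^ (E * 10 + 1) := by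
    rw [← pow_mul, Nat.mul_comm]
  rw [hw]
  generalize 2 ^ (Nat.log 2 n + 1) = m at *
  have h20 : 2 ^ 20 ≤ m ^ 20 := Nat.pow_le_pow_left h2 20
  have hc : n ^ c ≤ m ^ c := Nat.pow_le_pow_left hm.le c
  have hc1 : 1 ≤ m ^ c := Nat.one_le_pow _ _ (by omega)
  have e : m ^ E = m ^ c * (m ^ 20 * m ^ 10) := by rw [hE, ← pow_add, ← pow_add]
  have h10 : m ≤ m ^ 10 := Nat.le_self_pow (n := 10) (by omega) m
  have h₁ : 2 ^ 20 * m ≤ m ^ 20 * m ^ 10 := Nat.mul_le_mul h20 h10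
  have h₂ : m ^ c * (2 ^ 20 * m) ≤ m ^ E := by rw [e]; exact Nat.mul_le_mul_left _ h₁
  refine ⟨?_, ?_, by
    rw [← pow_mul]; exact Nat.pow_lt_pow_right (by omega) (by omega)⟩
  · nlinarith
  · nlinarith

end TtoG

theorem mainTheorem3 :
    (∀ X Y : TtoG.Config, 1 < X.tree.size → TtoG.Phase X Y →
      4 * Y.tree.size ≤ 3 * X.tree.size) ∧
    ∃ init chainP pairP leafP : TtoG.Cmd, ∀ c : ℕ, ∃ K d : ℕ,
      ∀ (rk : ℕ → ℕ) (T : TtoG.RTree ℕ) (s : TtoG.State) (w : ℕ),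
        T.WellRanked rk →
        (∀ a ∈ T.labels, 1 ≤ a ∧ a ≤ T.size ^ c) →
        TtoG.IsInput s T →
        w = d * (Nat.log 2 T.size + 1) →
        ∃ (m k₀ k : ℕ) (X X' X'' : ℕ → TtoG.Config) (S S' S'' : ℕ → TtoG.State),
          TtoG.Exec w init s k₀ (S 0) ∧ k₀ ≤ K * T.size ∧
          X 0 = ⟨T, ∅⟩ ∧
          (∀ i ≤ m, TtoG.Stores (S i) (X i)) ∧
          (∀ i < m, 1 < (X i).tree.size ∧
            TtoG.ChainComp (X i) (X' i) ∧ TtoG.Stores (S' i) (X' i) ∧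
            TtoG.PairComp (X' i) (X'' i) ∧ TtoG.Stores (S'' i) (X'' i) ∧
            TtoG.LeafComp (X'' i) (X (i + 1)) ∧
            ∃ k₁ k₂ k₃ : ℕ,
              TtoG.Exec w chainP (S i) k₁ (S' i) ∧
              TtoG.Exec w pairP (S' i) k₂ (S'' i) ∧
              TtoG.Exec w leafP (S'' i) k₃ (S (i + 1)) ∧
              k₁ + k₂ + k₃ ≤ K * (X i).tree.size) ∧
          (X m).tree.size = 1 ∧
          TtoG.Exec w (TtoG.main init chainP pairP leafP) s k (S m) ∧
          k ≤ K * T.size := by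
  refine ⟨fun X Y h₁ h => h.size h₁, TtoG.initP, TtoG.chainP, TtoG.pairP, TtoG.leafP, fun c =>
    -- The first constant has room for the 300 steps per node of the preprocessing and the 20016 of
    -- the main loop. The second is the word length required by `word_bound`.
    ⟨20400, (c + 30) * 10 + 1, fun rk T s w _ hl hs hw => ?_⟩⟩
  obtain ⟨w₁, w₂, w₃⟩ := TtoG.word_bound c T.size (TtoG.one_le_size T) rfl
  rw [← hw] at w₃
  have hb : TtoG.Bd s (T.size ^ c + T.size) :=
    hs.bd (by omega) fun a ha => ((hl a ha).2).trans (by omega)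
  obtain ⟨k₀, s₀, e₀, l₀, g₀, b₀⟩ :=
    (TtoG.initP_spec hs).exec (by decide) (by decide) w₂ w₃ hb (by omega)
  obtain ⟨m, k, X, X', X'', S, S', S'', h₁, h₂, h₃, h₄, h₅, h₆, h₇⟩ :=
    TtoG.loop_exec w₂ w₃ T.size s₀ ⟨T, ∅⟩ _ le_rfl g₀ b₀ (by simp only; omega)
  simp only at h₇
  refine ⟨m, k₀, k₀ + k, X, X', X'', S, S', S'', by rw [h₁]; exact e₀, by omega, h₂, h₃,
    fun i hi => ?_, h₅, .seq e₀ h₆, by omega⟩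
  obtain ⟨q₁, q₂, q₃, q₄, q₅, q₆, k₁, k₂, k₃, q₇, q₈, q₉, q₁₀⟩ := h₄ i hi
  exact ⟨q₁, q₂, q₃, q₄, q₅, q₆, k₁, k₂, k₃, q₇, q₈, q₉, by omega⟩
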